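/- Let $\Lambda\in\mathbb R^{2\times2}$ be invertible, $\Lambda^*=2\pi(\Lambda^\top)^{-1}$, and let $W=\{\Lambda z: -1/2<z_1,z_2\le 1/2\}$, $W^*=\{\Lambda^* z: -1/2<z_1,z_2\le 1/2\}$. For $\phi\in C_0^\infty(\mathbb R^2)$ the Bloch transform is $$\mathcal J\phi(\alpha,x)=\frac{|\det\Lambda|^{1/2}}{2\pi}\sum_{j\in\mathbb Z^2}\phi(x+\Lambda j)\,e^{-i\alpha\cdot\Lambda j},\qquad \alpha,x\in\mathbb R^2 .$$ **Spaces.** With $\hat\phi(z)=\frac1{2\pi}\int_{\mathbb R^2} e^{-iz\cdot x}\phi(x)\,dx$, for $s,r\in\mathbb R$ the space $H^s_r(\mathbb R^2)$ consists of the tempered distributions $\phi$ with $\|\phi\|_{H^s_r}=\|(1+|z|^2)^{s/2}\,[(1+|x|^2)^{r/2}\phi]^{\wedge}(z)\|_{L^2(\mathbb R^2)}<\infty$. Let $\mathcal D'_\Lambda$ be the space of distributions $\psi(\alpha,x)$ on $\mathbb R^2\times\mathbb R^2$ that are $\Lambda^*$-periodic in $\alpha$ and satisfy $\psi(\alpha,x+\Lambda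 j)=e^{i\alpha\cdot\Lambda j}\psi(\alpha,x)$ for $j\in\mathbb Z^2$ (such distributions are tempered), and let $C^\infty_\Lambda$ be the space of smooth functions with these two properties. For $\psi\in\mathcal D'_\Lambda$ and $j\in\mathbb Z^2$ let $$\hat\psi(\alpha,j)=|\det\Lambda|^{-1/2}\int_W\psi(\alpha,x)e^{-i(\Lambda^*j+\alpha)\cdot x}\,dx ,$$ a distribution in $\alpha\in\mathbb R^2$ (the integral being the pairing of $\Lambda$-periodic distributions over one cell). The spaces $H^r_0(W^*;H^s_\alpha(W))\subset\mathcal D'_\Lambda$, $s,r\in\mathbb R$, are defined as follows. * If $r=m\ge0$ is an integer, $\psi$ belongs to the space if all weak derivatives $\partial_\alpha^\gamma\hat\psi(\cdot,j)$, $|\gamma|\le m$, are locally integrable functions on $\mathbb R^2$ and $\|\psi\|^2=\sum_{|\gamma|\le m}\sum_{j\in\mathbb Z^2}(1+|j|^2)^s\int_{W^*}|\partial^\gamma_\alpha\hat\psi(\alpha,j)|^2\,d\alpha<\infty$. * If $r=m+\theta$ with an integer $m\ge0$ and $0<\theta<1$, it is the interpolation space of exponent $\theta$ between the spaces of orders $m$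 and $m+1$, with $\|\psi\|^2=\int_0^\infty t^{-2\theta}\inf_{\psi=\psi_0+\psi_1}\big(\|\psi_0\|_{(m)}^2+t^2\|\psi_1\|_{(m+1)}^2\big)\frac{dt}t$. * If $r<0$, it is the dual of $H^{-r}_0(W^*;H^s_\alpha(W))$ with respect to the inner product $(\psi,\chi)_s=\sum_{j}\int_{W^*}(1+|\Lambda^*j+\alpha|^2)^s\,\hat\psi(\alpha,j)\overline{\hat\chi(\alpha,j)}\,d\alpha$ of $L^2(W^*;H^s_\alpha(W))$ (in an equivalent norm), i.e. the space of the $\psi\in\mathcal D'_\Lambda$ with $\|\psi\|=\sup\{|(\psi,\chi)_s|:\chi\in C^\infty_\Lambda,\ \|\chi\|_{H^{-r}_0(W^*;H^s_\alpha(W))}\le1\}<\infty$. **Theorem.** (a) $\mathcal J$ extends from $C_0^\infty(\mathbb R^2)$ to an isometric isomorphism from $L^2(\mathbb R^2)$ onto $L^2(W^*;L^2(W))$, with inverse $$\mathcal J^{-1}\psi(x+\Lambda j)=\frac{|\det\Lambda|^{1/2}}{2\pi}\int_{W^*}\psi(\alpha,x)\,e^{i\alpha\cdot\Lambda j}\,d\alpha,\qquad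 x\in W,\ j\in\mathbb Z^2, \tag{1}$$ for almost every $x\in W$, the integral being that of an $L^2(W)$-valued function of $\alpha$. (b) For all $s,r\in\mathbb R$, $C_0^\infty(\mathbb R^2)\subset H^s_r(\mathbb R^2)$ and $\mathcal J$ extends from $C_0^\infty(\mathbb R^2)$ to an isomorphism (a linear bijection that is bounded with bounded inverse) from $H^s_r(\mathbb R^2)$ onto $H^r_0(W^*;H^s_\alpha(W))$. Its inverse is given by (1) in the sense of the norm of $H^s_r(\mathbb R^2)$: formula (1) holds for every $\psi\in H^r_0(W^*;H^s_\alpha(W))$ that is given by a function in $C^\infty_\Lambda$, and every $\psi\in H^r_0(W^*;H^s_\alpha(W))$ can be approximated by such $\psi'$ so that $\psi'\to\psi$ in $H^r_0(W^*;H^s_\alpha(W))$ and $\mathcal J^{-1}\psi'\to\mathcal J^{-1}\psi$ in $H^s_r(\mathbb R^2)$. -/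

import Mathlib

open MeasureTheory Matrix
open scoped ENNReal NNReal ContDiff LineDeriv FourierTransform ComplexConjugate

noncomputable section

namespace Bloch

/-! ### Lattices, cells and the Bloch transform of test functions -/

/-- The Euclidean plane. -/
abbrev Plane : Type := EuclideanSpace ℝ (Fin 2)

/-- The index set `ℤ²`. -/
abbrev Idx : Type := Fin 2 → ℤ

/-- The vector `A z` of the Euclidean plane. -/
def matVec (A : Matrix (Fin 2) (Fin 2) ℝ) (z : Fin 2 → ℝ) : Plane :=
  WithLp.toLp 2 (A *ᵥ z)

/-- The lattice point `A j`, `j ∈ ℤ²`. -/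
def lat (A : Matrix (Fin 2) (Fin 2) ℝ) (j : Idx) : Plane :=
  matVec A (fun i => (j i : ℝ))

/-- The dual periodicity matrix `Λ* = 2π (Λᵀ)⁻¹`. -/
def dualMat (L : Matrix (Fin 2) (Fin 2) ℝ) : Matrix (Fin 2) (Fin 2) ℝ :=
  (2 * Real.pi) • (Lᵀ)⁻¹

/-- The fundamental cell `{A z : -1/2 < z₁, z₂ ≤ 1/2}`. It is `W` for `A = Λ` and `W*` for
`A = Λ*`. -/
def cell (A : Matrix (Fin 2) (Fin 2) ℝ) : Set Plane :=
  {x | ∃ z : Fin 2 → ℝ, (∀ i, -(1 / 2) < z i ∧ z i ≤ 1 / 2) ∧ x = matVec A z}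

/-- Lebesgue measure on the cell. -/
abbrev cellMeasure (A : Matrix (Fin 2) (Fin 2) ℝ) : Measure Plane :=
  volume.restrict (cell A)

/-- `exp (i t)` for real `t`. -/
def expI (t : ℝ) : ℂ := Complex.exp (Complex.I * (t : ℂ))

/-- The normalizing constant `|det Λ|^(1/2) / (2π)`. -/
def normConst (L : Matrix (Fin 2) (Fin 2) ℝ) : ℝ := √|L.det| / (2 * Real.pi)

/-- The Bloch transform of a function `φ` (a finite sum if `φ` has compact support):
`|det Λ|^(1/2) / (2π) * ∑ⱼ φ(x + Λ j) exp(-i α · Λ j)`. -/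
def bloch (L : Matrix (Fin 2) (Fin 2) ℝ) (φ : Plane → ℂ) (α x : Plane) : ℂ :=
  (normConst L : ℂ) * ∑' j : Idx, φ (x + lat L j) * expI (-(inner ℝ α (lat L j)))

/-! ### Weighted Bessel potential spaces on the plane -/

/-- The weight `(1 + |x|²)^p`. -/
def wt (p : ℝ) (x : Plane) : ℝ := (1 + ‖x‖ ^ 2) ^ p

/-- The weight `(1 + |j|²)^p` on `ℤ²`. -/
def idxWt (p : ℝ) (j : Idx) : ℝ := (1 + ∑ i, (j i : ℝ) ^ 2) ^ p

/-- The tempered distribution `(1 + |z|²)^(s/2) (F ((1 + |x|²)^(r/2) f))(z)`, where the frequency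
variable is `z = 2π ξ` because `𝓕` has the kernel `exp(-2π i ξ · x)`. -/
def besselSymbol (s r : ℝ) (f : TemperedDistribution Plane ℂ) : TemperedDistribution Plane ℂ :=
  TemperedDistribution.smulLeftCLM ℂ (fun ξ : Plane => ((wt (s / 2) ((2 * Real.pi) • ξ) : ℝ) : ℂ))
    (𝓕 (TemperedDistribution.smulLeftCLM ℂ (fun x : Plane => ((wt (r / 2) x : ℝ) : ℂ)) f))

/-- The norm of `H^s_r(ℝ²)`, with value `⊤` outside the space. The infimum is over the at most one
`L²` function that represents the weighted Fourier transform. -/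
def besselNorm (s r : ℝ) (f : TemperedDistribution Plane ℂ) : ℝ≥0∞ :=
  ⨅ (g : Lp ℂ 2 (volume : Measure Plane))
    (_ : besselSymbol s r f = MeasureTheory.Lp.toTemperedDistribution g), ‖g‖ₑ

theorem besselNorm_lt_top_iff {s r : ℝ} {f : TemperedDistribution Plane ℂ} :
    besselNorm s r f < ⊤ ↔ ∃ g : Lp ℂ 2 (volume : Measure Plane),
      besselSymbol s r f = MeasureTheory.Lp.toTemperedDistribution g := by
  simp [besselNorm, iInf_lt_iff]

/-- The weighted Bessel potential space `H^s_r(ℝ²)`. -/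
def besselSpace (s r : ℝ) : Submodule ℂ (TemperedDistribution Plane ℂ) where
  carrier := {f | besselNorm s r f < ⊤}
  zero_mem' := by
    simp only [Set.mem_ofPred_eq, besselNorm_lt_top_iff]
    refine ⟨0, ?_⟩
    rw [← MeasureTheory.Lp.toTemperedDistributionCLM_apply, map_zero]
    have h0 : 𝓕 (0 : TemperedDistribution Plane ℂ) = 0 := by ext; rfl
    simp [besselSymbol, h0]
  add_mem' := by
    intro a b ha hb
    simp only [Set.mem_ofPred_eq, besselNorm_lt_top_iff] at *
    obtain ⟨g, hg⟩ := ha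
    obtain ⟨h, hh⟩ := hb
    refine ⟨g + h, ?_⟩
    rw [← MeasureTheory.Lp.toTemperedDistributionCLM_apply] at *
    rw [map_add, ← hg, ← hh]
    simp [besselSymbol, FourierTransform.fourier_add]
  smul_mem' := by
    intro c a ha
    simp only [Set.mem_ofPred_eq, besselNorm_lt_top_iff] at *
    obtain ⟨g, hg⟩ := ha
    refine ⟨c • g, ?_⟩
    rw [← MeasureTheory.Lp.toTemperedDistributionCLM_apply] at *
    rw [map_smul, ← hg]
    simp [besselSymbol, FourierTransform.fourier_smul]

/-! ### Distributions that are periodic in `α` and `α`-quasiperiodic in `x` -/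

/-- A tempered distribution is given by integration against the function `f`. -/
def IsRepr {E : Type*} [NormedAddCommGroup E] [NormedSpace ℝ E] [MeasureSpace E]
    (u : TemperedDistribution E ℂ) (f : E → ℂ) : Prop :=
  ∀ η : SchwartzMap E ℂ, Integrable (fun p => η p * f p) ∧ u η = ∫ p, η p * f p

/-- Distributions `ψ(α, x)` on `ℝ² × ℝ²` that are `Λ*`-periodic in `α` and `α`-quasiperiodic in `x`
with respect to `Λ`. Both relations are written in transposed form. (A distribution with these two
invariances is automatically tempered.) -/
def qpDist (L : Matrix (Fin 2) (Fin 2) ℝ) :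
    Submodule ℂ (TemperedDistribution (Plane × Plane) ℂ) where
  carrier := {ψ |
    (∀ (l : Idx) (Θ Θ' : SchwartzMap (Plane × Plane) ℂ),
      (∀ α x, Θ' (α, x) = Θ (α + lat (dualMat L) l, x)) → ψ Θ = ψ Θ') ∧
    (∀ (j : Idx) (Θ Θ' : SchwartzMap (Plane × Plane) ℂ),
      (∀ α x, Θ' (α, x) = expI (inner ℝ α (lat L j)) * Θ (α, x + lat L j)) → ψ Θ = ψ Θ')}
  zero_mem' := ⟨fun _ _ _ _ => rfl, fun _ _ _ _ => rfl⟩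
  add_mem' := by
    rintro a b ⟨ha, ha'⟩ ⟨hb, hb'⟩
    refine ⟨fun l Θ Θ' h => ?_, fun l Θ Θ' h => ?_⟩
    · change a Θ + b Θ = a Θ' + b Θ'
      rw [ha l Θ Θ' h, hb l Θ Θ' h]
    · change a Θ + b Θ = a Θ' + b Θ'
      rw [ha' l Θ Θ' h, hb' l Θ Θ' h]
  smul_mem' := by
    rintro c a ⟨ha, ha'⟩
    refine ⟨fun l Θ Θ' h => ?_, fun l Θ Θ' h => ?_⟩
    · change c • a Θ = c • a Θ'
      rw [ha l Θ Θ' h]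
    · change c • a Θ = c • a Θ'
      rw [ha' l Θ Θ' h]

/-- The smooth functions on `ℝ² × ℝ²` that are `Λ*`-periodic in `α` and `α`-quasiperiodic in `x`. -/
def IsSmoothQP (L : Matrix (Fin 2) (Fin 2) ℝ) (χ : Plane × Plane → ℂ) : Prop :=
  ContDiff ℝ ∞ χ ∧
  (∀ (l : Idx) (α x : Plane), χ (α + lat (dualMat L) l, x) = χ (α, x)) ∧
  (∀ (j : Idx) (α x : Plane), χ (α, x + lat L j) = expI (inner ℝ α (lat L j)) * χ (α, x))

/-- A smooth, compactly supported function whose translates by the lattice of `A` sum up to one.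
Integrating a periodic function over one cell is integrating it against such a function over the
plane, which is how periodic distributions are paired over one cell. -/
def IsPartition (A : Matrix (Fin 2) (Fin 2) ℝ) (ρ : Plane → ℂ) : Prop :=
  ContDiff ℝ ∞ ρ ∧ HasCompactSupport ρ ∧ ∀ x, ∑' k : Idx, ρ (x + lat A k) = 1

/-- The function `exp(-i α · x)` times the conjugate of the periodic exponential
`|det Λ|^(-1/2) exp(i Λ* j · x)`. -/
def fourierKernel (L : Matrix (Fin 2) (Fin 2) ℝ) (j : Idx) (α x : Plane) : ℂ :=
  ((√|L.det|)⁻¹ : ℂ) * expI (-(inner ℝ (lat (dualMat L) j + α) x))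

/-- `Θ` is a test function on `ℝ² × ℝ²` by which the `j`-th Fourier coefficient in `x`,
a distribution in `α`, is tested against `η`: the number `ψ Θ` is
`∫ η(α) ⟨ψ(α, ·), exp(i α · x) φ_j⟩ dα`, the pairing in `x` being over one cell. -/
def IsCoeffTest (L : Matrix (Fin 2) (Fin 2) ℝ) (j : Idx) (η : SchwartzMap Plane ℂ)
    (Θ : SchwartzMap (Plane × Plane) ℂ) : Prop :=
  ∃ ρ : Plane → ℂ, IsPartition L ρ ∧
    ∀ α x, Θ (α, x) = η α * ρ x * fourierKernel L j α x

/-- The partial derivative `∂^γ η = ∂₁^γ₁ ∂₂^γ₂ η` of a test function. -/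
def multiDeriv (γ : ℕ × ℕ) (η : SchwartzMap Plane ℂ) : SchwartzMap Plane ℂ :=
  (fun h : SchwartzMap Plane ℂ => ∂_{(EuclideanSpace.single 0 1 : Plane)} h)^[γ.1]
    ((fun h : SchwartzMap Plane ℂ => ∂_{(EuclideanSpace.single 1 1 : Plane)} h)^[γ.2] η)

/-- The function `G` is the weak derivative `∂^γ`, with respect to `α` in the whole plane, of the
`j`-th Fourier coefficient `α ↦ ψ̂(α, j)`. -/
def IsCoeffDeriv (L : Matrix (Fin 2) (Fin 2) ℝ) (ψ : qpDist L) (γ : ℕ × ℕ) (j : Idx)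
    (G : Plane → ℂ) : Prop :=
  LocallyIntegrable G ∧
  ∀ η : SchwartzMap Plane ℂ, HasCompactSupport η → ∀ Θ : SchwartzMap (Plane × Plane) ℂ,
    IsCoeffTest L j (multiDeriv γ η) Θ →
      (ψ : TemperedDistribution (Plane × Plane) ℂ) Θ =
        (-1) ^ (γ.1 + γ.2) * ∫ α, η α * G α

/-- The multiindices of order at most `m`. -/
def multiIdx (m : ℕ) : Finset (ℕ × ℕ) :=
  (Finset.range (m + 1) ×ˢ Finset.range (m + 1)).filter (fun γ => γ.1 + γ.2 ≤ m)

/-- The sum `∑_γ ∑ⱼ (1 + |j|²)^s ∫_{W*} |G_γ(α, j)|² dα`. -/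
def coeffSum (L : Matrix (Fin 2) (Fin 2) ℝ) (m : ℕ) (s : ℝ) (G : ℕ × ℕ → Idx → Plane → ℂ) :
    ℝ≥0∞ :=
  ∑ γ ∈ multiIdx m, ∑' j : Idx,
    ENNReal.ofReal (idxWt s j) * ∫⁻ α, ‖G γ j α‖ₑ ^ 2 ∂(cellMeasure (dualMat L))

/-- The squared norm of `H^m_0(W*; H^s_α(W))` for an integer `m ≥ 0`, that is
`∑_{|γ| ≤ m} ∑ⱼ (1 + |j|²)^s ∫_{W*} |∂^γ ψ̂(α, j)|² dα`, and `⊤` outside the space. The infimum is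
over the weak derivatives, which are unique up to null sets. -/
def intNormSq (L : Matrix (Fin 2) (Fin 2) ℝ) (m : ℕ) (s : ℝ) (ψ : qpDist L) : ℝ≥0∞ :=
  ⨅ (G : ℕ × ℕ → Idx → Plane → ℂ)
    (_ : ∀ γ ∈ multiIdx m, ∀ j, IsCoeffDeriv L ψ γ j (G γ j)), coeffSum L m s G

/-- The squared K-functional
`inf {‖ψ₀‖² + t² ‖ψ₁‖² : ψ = ψ₀ + ψ₁}` of the couple of the spaces of orders `m` and `m + 1`. -/
def kSq (L : Matrix (Fin 2) (Fin 2) ℝ) (m : ℕ) (s : ℝ) (t : ℝ) (ψ : qpDist L) : ℝ≥0∞ :=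
  ⨅ ψ₀ : qpDist L, intNormSq L m s ψ₀ + ENNReal.ofReal t ^ 2 * intNormSq L (m + 1) s (ψ - ψ₀)

/-- The squared norm `∫₀^∞ t^(-2θ) K(t, ψ)² dt/t` of the interpolation space of exponent `θ`
between the spaces of orders `m` and `m + 1`. -/
def interpNormSq (L : Matrix (Fin 2) (Fin 2) ℝ) (m : ℕ) (θ s : ℝ) (ψ : qpDist L) : ℝ≥0∞ :=
  ∫⁻ t in Set.Ioi (0 : ℝ), ENNReal.ofReal (t ^ (-2 * θ - 1)) * kSq L m s t ψ

/-- The squared norm of `H^r_0(W*; H^s_α(W))` for real `r ≥ 0`. -/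
def posNormSq (L : Matrix (Fin 2) (Fin 2) ℝ) (r s : ℝ) (ψ : qpDist L) : ℝ≥0∞ :=
  if Int.fract r = 0 then intNormSq L ⌊r⌋₊ s ψ else interpNormSq L ⌊r⌋₊ (Int.fract r) s ψ

/-- The Fourier coefficient `∫_W χ(α, x) exp(-i α · x) conj(φ_j(x)) dx` of a function. -/
def fourierCoeff (L : Matrix (Fin 2) (Fin 2) ℝ) (χ : Plane × Plane → ℂ) (α : Plane) (j : Idx) : ℂ :=
  ∫ x, χ (α, x) * fourierKernel L j α x ∂(cellMeasure L)

/-- `Θ` is a test function on `ℝ² × ℝ²` such that `ψ Θ` is the `L²(W*; H^s_α(W))` inner product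
`(ψ, χ) = ∑ⱼ ∫_{W*} (1 + |Λ* j + α|²)^s ψ̂(α, j) conj(χ̂(α, j)) dα` of `ψ` with the smooth `χ`.
Here `H^s_α(W)` carries the equivalent norm with the weight `(1 + |Λ* j + α|²)^s` in place of
`(1 + |j|²)^s`; this weight is a smooth function of `Λ* j + α`, so that the inner product makes
sense for distributions `ψ`. The function `f'` has the weighted coefficients of `χ`, and the inner
product is the pairing of `ψ` with the conjugate of `f'` over `W* × W`. -/
def IsDualTest (L : Matrix (Fin 2) (Fin 2) ℝ) (s : ℝ) (χ : qpDist L)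
    (Θ : SchwartzMap (Plane × Plane) ℂ) : Prop :=
  ∃ f f' : Plane × Plane → ℂ, IsSmoothQP L f ∧ IsSmoothQP L f' ∧
    IsRepr (χ : TemperedDistribution (Plane × Plane) ℂ) f ∧
    (∀ α j, fourierCoeff L f' α j = (wt s (lat (dualMat L) j + α) : ℂ) * fourierCoeff L f α j) ∧
    ∃ ρ σ : Plane → ℂ, IsPartition (dualMat L) ρ ∧ IsPartition L σ ∧
      ∀ α x, Θ (α, x) = ρ α * σ x * conj (f' (α, x))

/-- The norm of the dual of `H^r_0(W*; H^s_α(W))`, `r > 0`, with respect to the inner product of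
`L²(W*; H^s_α(W))`, as a space of distributions. -/
def dualNorm (L : Matrix (Fin 2) (Fin 2) ℝ) (r s : ℝ) (ψ : qpDist L) : ℝ≥0∞ :=
  ⨆ (χ : qpDist L) (Θ : SchwartzMap (Plane × Plane) ℂ) (_ : IsDualTest L s χ Θ)
    (_ : posNormSq L r s χ ≤ 1), ‖(ψ : TemperedDistribution (Plane × Plane) ℂ) Θ‖ₑ

/-- The norm of `H^r_0(W*; H^s_α(W))` for real `r` and `s`, with value `⊤` outside the space. -/
def qpNorm (L : Matrix (Fin 2) (Fin 2) ℝ) (r s : ℝ) (ψ : qpDist L) : ℝ≥0∞ :=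
  if 0 ≤ r then (posNormSq L r s ψ) ^ (1 / 2 : ℝ) else dualNorm L (-r) s ψ

/-! ### The spaces are vector spaces -/

theorem IsCoeffDeriv.add {L : Matrix (Fin 2) (Fin 2) ℝ} {ψ φ : qpDist L} {γ : ℕ × ℕ} {j : Idx}
    {G H : Plane → ℂ} (hG : IsCoeffDeriv L ψ γ j G) (hH : IsCoeffDeriv L φ γ j H) :
    IsCoeffDeriv L (ψ + φ) γ j (G + H) := by
  refine ⟨hG.1.add hH.1, fun η hη Θ hΘ => ?_⟩
  have i1 : Integrable (fun α => η α * G α) :=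
    hG.1.integrable_smul_left_of_hasCompactSupport η.continuous hη
  have i2 : Integrable (fun α => η α * H α) :=
    hH.1.integrable_smul_left_of_hasCompactSupport η.continuous hη
  have e1 := hG.2 η hη Θ hΘ
  have e2 := hH.2 η hη Θ hΘ
  change (ψ : TemperedDistribution (Plane × Plane) ℂ) Θ +
    (φ : TemperedDistribution (Plane × Plane) ℂ) Θ = _
  rw [e1, e2, ← mul_add, ← integral_add i1 i2]
  simp [mul_add]

theorem IsCoeffDeriv.smul {L : Matrix (Fin 2) (Fin 2) ℝ} {ψ : qpDist L} {γ : ℕ × ℕ} {j : Idx}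
    {G : Plane → ℂ} (c : ℂ) (hG : IsCoeffDeriv L ψ γ j G) :
    IsCoeffDeriv L (c • ψ) γ j (c • G) := by
  refine ⟨hG.1.smul c, fun η hη Θ hΘ => ?_⟩
  have e1 := hG.2 η hη Θ hΘ
  change c • (ψ : TemperedDistribution (Plane × Plane) ℂ) Θ = _
  have : (fun α => η α * (c • G) α) = fun α => c * (η α * G α) := by
    ext α; simp only [Pi.smul_apply, smul_eq_mul]; ring
  rw [e1, this, integral_const_mul, smul_eq_mul]
  ring

theorem enorm_add_sq_le (a b : ℂ) : ‖a + b‖ₑ ^ 2 ≤ 2 * ‖a‖ₑ ^ 2 + 2 * ‖b‖ₑ ^ 2 := by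
  have h : ‖a + b‖ ^ 2 ≤ 2 * ‖a‖ ^ 2 + 2 * ‖b‖ ^ 2 := by
    have := norm_add_le a b
    nlinarith [sq_nonneg (‖a‖ - ‖b‖), norm_nonneg a, norm_nonneg b, norm_nonneg (a + b)]
  have h' : ‖a + b‖₊ ^ 2 ≤ 2 * ‖a‖₊ ^ 2 + 2 * ‖b‖₊ ^ 2 := by
    rw [← NNReal.coe_le_coe]; push_cast; exact h
  simp only [enorm_eq_nnnorm]
  exact_mod_cast h'

theorem coeffSum_add_le (L : Matrix (Fin 2) (Fin 2) ℝ) (m : ℕ) (s : ℝ)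
    (G H : ℕ × ℕ → Idx → Plane → ℂ)
    (hG : ∀ γ ∈ multiIdx m, ∀ j, LocallyIntegrable (G γ j)) :
    coeffSum L m s (G + H) ≤ 2 * coeffSum L m s G + 2 * coeffSum L m s H := by
  simp only [coeffSum, Finset.mul_sum]
  rw [← Finset.sum_add_distrib]
  refine Finset.sum_le_sum fun γ hγ => ?_
  rw [← ENNReal.tsum_mul_left, ← ENNReal.tsum_mul_left, ← ENNReal.tsum_add]
  refine ENNReal.tsum_le_tsum fun j => ?_
  have hm : AEMeasurable (fun α => 2 * ‖G γ j α‖ₑ ^ 2) (cellMeasure (dualMat L)) :=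
    (((hG γ hγ j).aestronglyMeasurable.enorm.pow_const 2).const_mul 2).restrict
  have h1 : ∫⁻ α, ‖(G + H) γ j α‖ₑ ^ 2 ∂(cellMeasure (dualMat L)) ≤
      2 * ∫⁻ α, ‖G γ j α‖ₑ ^ 2 ∂(cellMeasure (dualMat L)) +
      2 * ∫⁻ α, ‖H γ j α‖ₑ ^ 2 ∂(cellMeasure (dualMat L)) := by
    rw [← lintegral_const_mul' _ _ (by simp), ← lintegral_const_mul' _ _ (by simp),
      ← lintegral_add_left' hm]
    exact lintegral_mono fun α => enorm_add_sq_le _ _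
  calc _ ≤ ENNReal.ofReal (idxWt s j) *
        (2 * ∫⁻ α, ‖G γ j α‖ₑ ^ 2 ∂(cellMeasure (dualMat L)) +
        2 * ∫⁻ α, ‖H γ j α‖ₑ ^ 2 ∂(cellMeasure (dualMat L))) := by gcongr
    _ = _ := by ring

theorem coeffSum_smul (L : Matrix (Fin 2) (Fin 2) ℝ) (m : ℕ) (s : ℝ) (c : ℂ)
    (G : ℕ × ℕ → Idx → Plane → ℂ) :
    coeffSum L m s (c • G) = ‖c‖ₑ ^ 2 * coeffSum L m s G := by
  simp only [coeffSum, Finset.mul_sum]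
  refine Finset.sum_congr rfl fun γ _ => ?_
  rw [← ENNReal.tsum_mul_left]
  refine tsum_congr fun j => ?_
  simp only [Pi.smul_apply, enorm_smul, mul_pow]
  rw [lintegral_const_mul' _ _ (by simp)]
  ring

theorem intNormSq_add_le (L : Matrix (Fin 2) (Fin 2) ℝ) (m : ℕ) (s : ℝ) (ψ φ : qpDist L) :
    intNormSq L m s (ψ + φ) ≤ 2 * intNormSq L m s ψ + 2 * intNormSq L m s φ := by
  simp only [intNormSq]
  rw [ENNReal.mul_iInf_of_ne (by simp) (by simp), ENNReal.mul_iInf_of_ne (by simp) (by simp)]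
  refine ENNReal.le_iInf_add_iInf fun G H => ?_
  rw [ENNReal.mul_iInf_of_ne (by simp) (by simp), ENNReal.mul_iInf_of_ne (by simp) (by simp)]
  refine ENNReal.le_iInf_add_iInf fun hG hH => ?_
  exact (iInf₂_le (G + H) fun γ hγ j => (hG γ hγ j).add (hH γ hγ j)).trans
    (coeffSum_add_le L m s G H fun γ hγ j => (hG γ hγ j).1)

theorem intNormSq_smul (L : Matrix (Fin 2) (Fin 2) ℝ) (m : ℕ) (s : ℝ) (c : ℂ) (hc : c ≠ 0)
    (ψ : qpDist L) :
    intNormSq L m s (c • ψ) ≤ ‖c‖ₑ ^ 2 * intNormSq L m s ψ := by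
  have hc' : ‖c‖ₑ ^ 2 ≠ 0 := by simpa using hc
  simp only [intNormSq]
  rw [ENNReal.mul_iInf_of_ne hc' (by simp)]
  refine le_iInf fun G => ?_
  rw [ENNReal.mul_iInf_of_ne hc' (by simp)]
  refine le_iInf fun hG => ?_
  rw [← coeffSum_smul]
  exact iInf₂_le (c • G) fun γ hγ j => (hG γ hγ j).smul c

theorem intNormSq_zero (L : Matrix (Fin 2) (Fin 2) ℝ) (m : ℕ) (s : ℝ) :
    intNormSq L m s 0 = 0 := by
  have h : ∀ γ ∈ multiIdx m, ∀ j, IsCoeffDeriv L 0 γ j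
      ((0 : ℕ × ℕ → Idx → Plane → ℂ) γ j) := fun γ _ j =>
    ⟨locallyIntegrable_const (0 : ℂ), fun η _ Θ _ => by simp⟩
  exact le_antisymm ((iInf₂_le _ h).trans (by simp [coeffSum])) bot_le

theorem kSq_mono (L : Matrix (Fin 2) (Fin 2) ℝ) (m : ℕ) (s : ℝ) (ψ : qpDist L) :
    Monotone fun t => kSq L m s t ψ := by
  intro t u htu
  simp only [kSq]
  gcongr

theorem kSq_add_le (L : Matrix (Fin 2) (Fin 2) ℝ) (m : ℕ) (s t : ℝ) (ψ φ : qpDist L) :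
    kSq L m s t (ψ + φ) ≤ 2 * kSq L m s t ψ + 2 * kSq L m s t φ := by
  simp only [kSq]
  rw [ENNReal.mul_iInf_of_ne (by simp) (by simp), ENNReal.mul_iInf_of_ne (by simp) (by simp)]
  refine ENNReal.le_iInf_add_iInf fun a b => ?_
  refine (iInf_le _ (a + b)).trans ?_
  have h : ψ + φ - (a + b) = (ψ - a) + (φ - b) := by abel
  rw [h]
  calc _ ≤ (2 * intNormSq L m s a + 2 * intNormSq L m s b) + ENNReal.ofReal t ^ 2 *
        (2 * intNormSq L (m + 1) s (ψ - a) + 2 * intNormSq L (m + 1) s (φ - b)) := by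
        gcongr <;> exact intNormSq_add_le ..
    _ = _ := by ring

theorem kSq_smul_le (L : Matrix (Fin 2) (Fin 2) ℝ) (m : ℕ) (s t : ℝ) (c : ℂ) (hc : c ≠ 0)
    (ψ : qpDist L) : kSq L m s t (c • ψ) ≤ ‖c‖ₑ ^ 2 * kSq L m s t ψ := by
  have hc' : ‖c‖ₑ ^ 2 ≠ 0 := by simpa using hc
  simp only [kSq]
  rw [ENNReal.mul_iInf_of_ne hc' (by simp)]
  refine le_iInf fun a => (iInf_le _ (c • a)).trans ?_
  rw [← smul_sub]
  calc _ ≤ ‖c‖ₑ ^ 2 * intNormSq L m s a + ENNReal.ofReal t ^ 2 *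
        (‖c‖ₑ ^ 2 * intNormSq L (m + 1) s (ψ - a)) := by
        gcongr <;> exact intNormSq_smul _ _ _ c hc _
    _ = _ := by ring

theorem interpNormSq_add_le (L : Matrix (Fin 2) (Fin 2) ℝ) (m : ℕ) (θ s : ℝ) (ψ φ : qpDist L) :
    interpNormSq L m θ s (ψ + φ) ≤
      2 * interpNormSq L m θ s ψ + 2 * interpNormSq L m θ s φ := by
  simp only [interpNormSq]
  have hm : Measurable fun t : ℝ =>
      2 * (ENNReal.ofReal (t ^ (-2 * θ - 1)) * kSq L m s t ψ) :=
    (Measurable.mul (by fun_prop) (kSq_mono L m s ψ).measurable).const_mul 2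
  rw [← lintegral_const_mul' _ _ (by simp), ← lintegral_const_mul' _ _ (by simp),
    ← lintegral_add_left hm]
  refine lintegral_mono fun t => ?_
  calc _ ≤ ENNReal.ofReal (t ^ (-2 * θ - 1)) *
        (2 * kSq L m s t ψ + 2 * kSq L m s t φ) := by
        gcongr; exact kSq_add_le ..
    _ = _ := by ring

theorem interpNormSq_smul_le (L : Matrix (Fin 2) (Fin 2) ℝ) (m : ℕ) (θ s : ℝ) (c : ℂ) (hc : c ≠ 0)
    (ψ : qpDist L) :
    interpNormSq L m θ s (c • ψ) ≤ ‖c‖ₑ ^ 2 * interpNormSq L m θ s ψ := by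
  simp only [interpNormSq]
  rw [← lintegral_const_mul' _ _ (by simp)]
  refine lintegral_mono fun t => ?_
  calc _ ≤ ENNReal.ofReal (t ^ (-2 * θ - 1)) * (‖c‖ₑ ^ 2 * kSq L m s t ψ) := by
        gcongr; exact kSq_smul_le _ _ _ _ c hc _
    _ = _ := by ring

theorem interpNormSq_zero (L : Matrix (Fin 2) (Fin 2) ℝ) (m : ℕ) (θ s : ℝ) :
    interpNormSq L m θ s 0 = 0 := by
  have h : ∀ t, kSq L m s t 0 = 0 := fun t =>
    le_antisymm ((iInf_le _ 0).trans (by simp [intNormSq_zero])) bot_le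
  simp [interpNormSq, h]

theorem posNormSq_zero (L : Matrix (Fin 2) (Fin 2) ℝ) (r s : ℝ) : posNormSq L r s 0 = 0 := by
  unfold posNormSq
  split_ifs
  · exact intNormSq_zero ..
  · exact interpNormSq_zero ..

theorem posNormSq_add_le (L : Matrix (Fin 2) (Fin 2) ℝ) (r s : ℝ) (ψ φ : qpDist L) :
    posNormSq L r s (ψ + φ) ≤ 2 * posNormSq L r s ψ + 2 * posNormSq L r s φ := by
  unfold posNormSq
  split_ifs
  · exact intNormSq_add_le ..
  · exact interpNormSq_add_le ..

theorem posNormSq_smul_le (L : Matrix (Fin 2) (Fin 2) ℝ) (r s : ℝ) (c : ℂ) (hc : c ≠ 0)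
    (ψ : qpDist L) : posNormSq L r s (c • ψ) ≤ ‖c‖ₑ ^ 2 * posNormSq L r s ψ := by
  unfold posNormSq
  split_ifs
  · exact intNormSq_smul _ _ _ c hc _
  · exact interpNormSq_smul_le _ _ _ _ c hc _

theorem dualNorm_add_le (L : Matrix (Fin 2) (Fin 2) ℝ) (r s : ℝ) (ψ φ : qpDist L) :
    dualNorm L r s (ψ + φ) ≤ dualNorm L r s ψ + dualNorm L r s φ := by
  refine iSup_le fun χ => iSup_le fun Θ => iSup_le fun h => iSup_le fun h' => ?_
  refine (enorm_add_le ((ψ : TemperedDistribution (Plane × Plane) ℂ) Θ)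
    ((φ : TemperedDistribution (Plane × Plane) ℂ) Θ)).trans (add_le_add ?_ ?_)
  · exact le_iSup_of_le χ (le_iSup_of_le Θ (le_iSup_of_le h (le_iSup_of_le h' le_rfl)))
  · exact le_iSup_of_le χ (le_iSup_of_le Θ (le_iSup_of_le h (le_iSup_of_le h' le_rfl)))

theorem dualNorm_smul_le (L : Matrix (Fin 2) (Fin 2) ℝ) (r s : ℝ) (c : ℂ) (ψ : qpDist L) :
    dualNorm L r s (c • ψ) ≤ ‖c‖ₑ * dualNorm L r s ψ := by
  refine iSup_le fun χ => iSup_le fun Θ => iSup_le fun h => iSup_le fun h' => ?_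
  change ‖c • (ψ : TemperedDistribution (Plane × Plane) ℂ) Θ‖ₑ ≤ _
  rw [enorm_smul]
  gcongr
  exact le_iSup_of_le χ (le_iSup_of_le Θ (le_iSup_of_le h (le_iSup_of_le h' le_rfl)))

/-- The space `H^r_0(W*; H^s_α(W))`. -/
def qpSpace (L : Matrix (Fin 2) (Fin 2) ℝ) (r s : ℝ) : Submodule ℂ (qpDist L) where
  carrier := {ψ | qpNorm L r s ψ < ⊤}
  zero_mem' := by
    simp only [Set.mem_ofPred_eq, qpNorm]
    split_ifs
    · simp [posNormSq_zero]
    · simp [dualNorm]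
  add_mem' := by
    intro a b ha hb
    simp only [Set.mem_ofPred_eq, qpNorm] at *
    split_ifs at *
    · rw [ENNReal.rpow_lt_top_iff_of_pos (by norm_num)] at *
      exact (posNormSq_add_le L r s a b).trans_lt (ENNReal.add_lt_top.2
        ⟨ENNReal.mul_lt_top (by simp) ha, ENNReal.mul_lt_top (by simp) hb⟩)
    · exact (dualNorm_add_le ..).trans_lt (ENNReal.add_lt_top.2 ⟨ha, hb⟩)
  smul_mem' := by
    intro c a ha
    simp only [Set.mem_ofPred_eq, qpNorm] at *
    split_ifs at *
    · rw [ENNReal.rpow_lt_top_iff_of_pos (by norm_num)] at *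
      by_cases hc : c = 0
      · simp [hc, posNormSq_zero]
      · exact (posNormSq_smul_le L r s c hc a).trans_lt (ENNReal.mul_lt_top (by simp) ha)
    · exact (dualNorm_smul_le ..).trans_lt (ENNReal.mul_lt_top (by simp) ha)

end Bloch

end

noncomputable section

namespace Bloch

/-! ### Continuous operators into Schwartz space; density of test functions -/

section Schwartz

variable {D E : Type*} [NormedAddCommGroup D] [NormedSpace ℝ D]
  [NormedAddCommGroup E] [NormedSpace ℝ E]

/-! Part (b) is proved for all tempered distributions at once, and the function spaces are compared
only afterwards. The Bloch transform is the transpose of a continuous operator `blochA` from test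
functions on ℝ² × ℝ² to Schwartz functions on ℝ². A right inverse of `blochA` is B: u ↦ κ ·
(reflected Bloch transform of u), where κ is a product of partitions of unity for the two lattices.
That `blochA` ∘ B = id makes the transpose injective. Conversely, by Poisson summation, B ∘ `blochA`
periodizes a test function over both lattices, and a quasiperiodic distribution does not notice this
(`qpDist_apply_eq`); so the transpose is onto. The result is the linear bijection `blochEquiv` from
tempered distributions on the plane onto the quasiperiodic distributions.

It remains to compare norms. Unfolding the sum over Λℤ² shows that the coefficient of ψ = Jφ at (α,
j) is the Fourier transform of φ at Λ*j + α, so that ∂_α^γ corresponds to multiplication of φ by x^γ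
up to a power of i. As the translates of W* tile the frequency plane, the norm of integer order m is
equivalent to the sum of the H^s norms of x^γ φ, |γ| ≤ m. This sum is equivalent to the H^s norm of
(1+|x|²)^(m/2) φ, because multiplication by symbols of order zero is bounded on H^s.

For fractional and negative orders the norm is rewritten. Let Φ = 𝓕(b 𝓕φ), where b is the frequency
weight of order s; `doubleNorm` is the L² norm of (1+|x|²)^(r/2) Φ. It is equivalent to the norm of
H^s_r (`l2Norm_swap_le`, `le_l2Norm_swap`), since a short-time Fourier transform with weights in
time and in frequency controls both. In terms of Φ all spaces are weighted L² spaces. The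
K-functional of two such spaces is minimized pointwise, which gives the weight of order m + θ
(`lintegral_weightedKSq`). The inner product (ψ, χ)_s becomes the plain L² product of the functions
Φ of the two factors, so that the dual space carries the reciprocal weight (`exists_dualNorm_le`,
`exists_le_dualNorm`).

Smooth quasiperiodic functions are exactly the Bloch transforms of Schwartz functions
(`IsSmoothQP.exists_bloch_eq`), for which formula (1) is the orthogonality of characters on W*.
Schwartz functions are dense in H^s_r, whence the statement about approximation.

Part (a) is a matter of Hilbert sums. L²(ℝ²) is the orthogonal sum of copies of L²(W), one for each
cell, and L²(W*; L²(W)) is the orthogonal sum of the plane waves with coefficients in L²(W). The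
Bloch transform matches the summands, and (1) is the formula for the Fourier coefficients.
Completeness of the waves again comes from Poisson summation (`ae_eq_zero_of_coeff`). -/

/-- A functional on the Schwartz space is dominated by a continuous seminorm. -/
def SeminormBounded (P : SchwartzMap E ℂ → ℝ) : Prop :=
  ∃ q : Seminorm ℂ (SchwartzMap E ℂ), Continuous q ∧ ∀ G, P G ≤ q G

theorem SeminormBounded.zero : SeminormBounded (fun _ : SchwartzMap E ℂ => 0) :=
  ⟨0, continuous_const, fun _ => le_rfl⟩

theorem SeminormBounded.add {P Q : SchwartzMap E ℂ → ℝ} (hP : SeminormBounded P)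
    (hQ : SeminormBounded Q) : SeminormBounded (fun G => P G + Q G) := by
  obtain ⟨p, hp, hpP⟩ := hP
  obtain ⟨q, hq, hqQ⟩ := hQ
  exact ⟨p + q, hp.add hq, fun G => add_le_add (hpP G) (hqQ G)⟩

theorem SeminormBounded.const_mul {P : SchwartzMap E ℂ → ℝ} (hP : SeminormBounded P) {C : ℝ}
    (hC : 0 ≤ C) : SeminormBounded (fun G => C * P G) := by
  obtain ⟨p, hp, hpP⟩ := hP
  refine ⟨(C.toNNReal : ℝ≥0) • p, ?_, fun G => ?_⟩
  · exact continuous_const.mul hp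
  · change C * P G ≤ (C.toNNReal : ℝ) * p G
    rw [Real.coe_toNNReal C hC]
    exact mul_le_mul_of_nonneg_left (hpP G) hC

theorem SeminormBounded.comp {P : SchwartzMap E ℂ → ℝ} (hP : SeminormBounded P)
    (L : SchwartzMap D ℂ →L[ℂ] SchwartzMap E ℂ) : SeminormBounded (fun G => P (L G)) := by
  obtain ⟨p, hp, hpP⟩ := hP
  exact ⟨p.comp L.toLinearMap, hp.comp L.continuous, fun G => hpP (L G)⟩

theorem SeminormBounded.finsetSum {ι : Type*} (s : Finset ι) {P : ι → SchwartzMap E ℂ → ℝ}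
    (hP : ∀ i ∈ s, SeminormBounded (P i)) : SeminormBounded (fun G => ∑ i ∈ s, P i G) := by
  classical
  induction s using Finset.induction_on with
  | empty => simpa using SeminormBounded.zero
  | insert a s ha ih =>
    simp only [Finset.sum_insert ha]
    exact (hP a (by simp)).add (ih fun i hi => hP i (by simp [hi]))

theorem SeminormBounded.listSum {ι : Type*} (l : List ι) {P : ι → SchwartzMap E ℂ → ℝ}
    (hP : ∀ i ∈ l, SeminormBounded (P i)) : SeminormBounded (fun G => (l.map fun i => P i G).sum) := by
  induction l with
  | nil => simpa using SeminormBounded.zero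
  | cons a l ih =>
    simp only [List.map_cons, List.sum_cons]
    exact (hP a (by simp)).add (ih fun i hi => hP i (by simp [hi]))

theorem continuous_schwartz_seminorm (k n : ℕ) :
    Continuous (SchwartzMap.seminorm ℂ k n : Seminorm ℂ (SchwartzMap E ℂ)) :=
  (schwartz_withSeminorms ℂ E ℂ).continuous_seminorm (k, n)

/-- The functional bounding all values `(1 + ‖x‖)^k ‖D^n G x‖`. -/
theorem exists_seminorm_one_add_pow (k n : ℕ) :
    ∃ q : Seminorm ℂ (SchwartzMap E ℂ), Continuous q ∧
      ∀ (G : SchwartzMap E ℂ) x, (1 + ‖x‖) ^ k * ‖iteratedFDeriv ℝ n G x‖ ≤ q G := by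
  refine ⟨(2 ^ k : ℝ≥0) • (Finset.Iic (k, n)).sup (schwartzSeminormFamily ℂ E ℂ), ?_, fun G x => ?_⟩
  · exact continuous_const.mul (Seminorm.continuous_finsetSup
      fun i _ => continuous_schwartz_seminorm i.1 i.2)
  · exact (SchwartzMap.one_add_le_sup_seminorm_apply (𝕜 := ℂ) (m := (k, n)) le_rfl le_rfl G x)

theorem SeminormBounded.exists_bound {P : SchwartzMap E ℂ → ℝ} (hP : SeminormBounded P) :
    ∃ (s : Finset (ℕ × ℕ)) (C : ℝ), 0 ≤ C ∧
      ∀ G, P G ≤ C * s.sup (schwartzSeminormFamily ℂ E ℂ) G := by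
  obtain ⟨q, hq, h⟩ := hP
  obtain ⟨s, C, -, hC⟩ := Seminorm.bound_of_continuous (schwartz_withSeminorms ℂ E ℂ) q hq
  exact ⟨s, C, C.2, fun G => (h G).trans (hC G)⟩

/-- A linear map into functions that is bounded by a seminorm and under which derivatives and
multiplications by linear functionals correspond to continuous operators, up to a change of a
parameter, is a continuous map into the Schwartz space. -/
theorem exists_clm_of_intertwining [FiniteDimensional ℝ D] {Ξ : Type*}
    (T : Ξ → SchwartzMap E ℂ →ₗ[ℂ] (D → ℂ))
    (hb : ∀ ξ, ∃ q : Seminorm ℂ (SchwartzMap E ℂ), Continuous q ∧ ∀ G y, ‖T ξ G y‖ ≤ q G)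
    (hd : ∀ ξ G, Differentiable ℝ (T ξ G))
    (hfd : ∀ ξ (e : D), ∃ l : List (Ξ × (SchwartzMap E ℂ →L[ℂ] SchwartzMap E ℂ)),
      ∀ G y, fderiv ℝ (T ξ G) y e = (l.map fun p => T p.1 (p.2 G) y).sum)
    (hm : ∀ ξ (a : D →L[ℝ] ℝ), ∃ l : List (Ξ × (SchwartzMap E ℂ →L[ℂ] SchwartzMap E ℂ)),
      ∀ G y, (a y : ℂ) * T ξ G y = (l.map fun p => T p.1 (p.2 G) y).sum) (ξ : Ξ) :
    ∃ S : SchwartzMap E ℂ →L[ℂ] SchwartzMap D ℂ, ∀ G y, S G y = T ξ G y := by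
  let b := Module.finBasis ℝ D
  let c : Fin (Module.finrank ℝ D) → D →L[ℝ] ℝ := fun i => LinearMap.toContinuousLinearMap (b.coord i)
  have hc : ∀ y, ∑ i, c i y • b i = y := fun y => by simp [c]
  have list_bound : ∀ l : List ℂ, ‖l.sum‖ ≤ (l.map fun z => ‖z‖).sum := by
    intro l
    induction l with
    | nil => simp
    | cons a l ih => simpa using (norm_add_le _ _).trans (add_le_add_right ih _)
  -- Each factor ‖y‖ is spread over the coordinates `c i`, and `hm` trades a coordinate for finitely
  -- many operators acting on `G`. This lowers `k` but changes the parameter, hence the induction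
  -- over all parameters at once.
  have hbk : ∀ k : ℕ, ∀ ξ, ∃ q : Seminorm ℂ (SchwartzMap E ℂ), Continuous q ∧
      ∀ G y, ‖y‖ ^ k * ‖T ξ G y‖ ≤ q G := by
    intro k
    induction k with
    | zero => simpa using hb
    | succ k ih =>
      intro ξ
      choose q hq hqT using ih
      choose l hl using fun i => hm ξ (c i)
      have hB : SeminormBounded (fun G : SchwartzMap E ℂ =>
          ∑ i, ‖b i‖ * ((l i).map fun p => q p.1 (p.2 G)).sum) :=
        SeminormBounded.finsetSum _ fun i _ => SeminormBounded.const_mul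
          (SeminormBounded.listSum _ fun p _ =>
            SeminormBounded.comp ⟨q p.1, hq p.1, fun _ => le_rfl⟩ p.2) (norm_nonneg _)
      obtain ⟨Q, hQ, hle⟩ := hB
      refine ⟨Q, hQ, fun G y => le_trans ?_ (hle G)⟩
      have h1 : ‖y‖ ≤ ∑ i, ‖c i y‖ * ‖b i‖ := by
        conv_lhs => rw [← hc y]
        exact (norm_sum_le _ _).trans (le_of_eq (by simp [norm_smul]))
      calc ‖y‖ ^ (k + 1) * ‖T ξ G y‖ = ‖y‖ * (‖y‖ ^ k * ‖T ξ G y‖) := by ring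
        _ ≤ (∑ i, ‖c i y‖ * ‖b i‖) * (‖y‖ ^ k * ‖T ξ G y‖) := by gcongr
        _ = ∑ i, ‖b i‖ * (‖y‖ ^ k * ‖(c i y : ℂ) * T ξ G y‖) := by
          rw [Finset.sum_mul]
          refine Finset.sum_congr rfl fun i _ => ?_
          rw [norm_mul, Complex.norm_real]; ring
        _ ≤ _ := by
          refine Finset.sum_le_sum fun i _ => ?_
          gcongr
          rw [hl i G y]
          refine (mul_le_mul_of_nonneg_left (list_bound _) (by positivity)).trans ?_
          rw [List.map_map, ← List.sum_map_mul_left]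
          refine List.sum_le_sum fun p _ => ?_
          exact hqT p.1 (p.2 G) y
  -- The Fréchet derivative is assembled from the directional derivatives along a basis, since only
  -- these are controlled by `hfd`.
  have hfderiv : ∀ f : D → ℂ, (fun y => fderiv ℝ f y) = fun y => ∑ i,
      ContinuousLinearMap.smulRightL ℝ D ℂ (c i) (fderiv ℝ f y (b i)) := by
    intro f; funext y; ext e
    conv_lhs => rw [← hc e]
    simp
  have hsmooth : ∀ n : ℕ, ∀ ξ G, ContDiff ℝ n (T ξ G) := by
    intro n
    induction n with
    | zero => intro ξ G; exact contDiff_zero.2 (hd ξ G).continuous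
    | succ n ih =>
      intro ξ G
      rw [show ((n + 1 : ℕ) : WithTop ℕ∞) = (n : WithTop ℕ∞) + 1 by norm_cast, contDiff_succ_iff_fderiv]
      refine ⟨hd ξ G, by simp, ?_⟩
      rw [show fderiv ℝ (T ξ G) = fun y => fderiv ℝ (T ξ G) y from rfl, hfderiv]
      refine ContDiff.sum fun i _ => (ContinuousLinearMap.contDiff _).comp ?_
      obtain ⟨l, hl⟩ := hfd ξ (b i)
      simp only [hl]
      clear hl
      induction l with
      | nil => simp [contDiff_const]
      | cons a l ih' =>
        simp only [List.map_cons, List.sum_cons]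
        exact (ih _ _).add ih'
  -- The same trade for derivatives: `hfd` lowers the order `n` by one and again changes the
  -- parameter.
  have hbn : ∀ n k : ℕ, ∀ ξ, ∃ q : Seminorm ℂ (SchwartzMap E ℂ), Continuous q ∧
      ∀ G y, ‖y‖ ^ k * ‖iteratedFDeriv ℝ n (T ξ G) y‖ ≤ q G := by
    intro n k
    induction n with
    | zero => intro ξ; simpa using hbk k ξ
    | succ n ih =>
      intro ξ
      choose q hq hqT using ih
      choose l hl using fun i => hfd ξ (b i)
      have hB : SeminormBounded (fun G : SchwartzMap E ℂ =>
          ∑ i, ‖ContinuousLinearMap.smulRightL ℝ D ℂ (c i)‖ *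
            ((l i).map fun p => q p.1 (p.2 G)).sum) :=
        SeminormBounded.finsetSum _ fun i _ => SeminormBounded.const_mul
          (SeminormBounded.listSum _ fun p _ =>
            SeminormBounded.comp ⟨q p.1, hq p.1, fun _ => le_rfl⟩ p.2)
            (ContinuousLinearMap.opNorm_nonneg _)
      obtain ⟨Q, hQ, hle⟩ := hB
      refine ⟨Q, hQ, fun G y => le_trans ?_ (hle G)⟩
      have hcd : ∀ i, ContDiff ℝ n (fun y => fderiv ℝ (T ξ G) y (b i)) := by
        intro i
        exact (((hsmooth (n + 1) ξ G).fderiv_right (m := n) (by norm_cast)).clm_apply contDiff_const)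
      rw [← norm_iteratedFDeriv_fderiv,
        show fderiv ℝ (T ξ G) = fun y => fderiv ℝ (T ξ G) y from rfl, hfderiv,
        iteratedFDeriv_sum (f := fun i y => ContinuousLinearMap.smulRightL ℝ D ℂ (c i)
          (fderiv ℝ (T ξ G) y (b i))) (fun i _ => (ContinuousLinearMap.contDiff _).comp (hcd i))]
      simp only [Finset.sum_apply]
      refine (mul_le_mul_of_nonneg_left (norm_sum_le _ _) (by positivity)).trans ?_
      rw [Finset.mul_sum]
      refine Finset.sum_le_sum fun i _ => ?_
      have h1 := (ContinuousLinearMap.smulRightL ℝ D ℂ (c i)).norm_iteratedFDeriv_comp_left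
        (hcd i).contDiffAt (n := n) (x := y) le_rfl
      refine (mul_le_mul_of_nonneg_left h1 (by positivity)).trans ?_
      rw [mul_left_comm]
      gcongr
      have h2 : iteratedFDeriv ℝ n (fun y => fderiv ℝ (T ξ G) y (b i)) y =
          ((l i).map fun p => iteratedFDeriv ℝ n (T p.1 (p.2 G)) y).sum := by
        simp only [hl i]
        generalize l i = l'
        induction l' with
        | nil => simp
        | cons a l' ih' =>
          simp only [List.map_cons, List.sum_cons]
          rw [← ih']
          refine iteratedFDeriv_add_apply (hsmooth n _ _).contDiffAt ?_
          clear ih'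
          refine ContDiff.contDiffAt ?_
          induction l' with
          | nil => simpa using contDiff_const
          | cons a l ih' =>
            simp only [List.map_cons, List.sum_cons]
            exact (hsmooth n _ _).add ih'
      rw [h2]
      generalize l i = l'
      induction l' with
      | nil => simp
      | cons a l' ih' =>
        simp only [List.map_cons, List.sum_cons]
        refine (mul_le_mul_of_nonneg_left (norm_add_le _ _) (by positivity)).trans ?_
        rw [mul_add]
        exact add_le_add (hqT _ _ _) ih'
  refine ⟨SchwartzMap.mkCLM (𝕜 := ℂ) (𝕜' := ℂ) (σ := RingHom.id ℂ) (fun G => T ξ G)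
    (fun f g x => by simp) (fun a f x => by simp) (fun f => contDiff_infty.2 fun n => hsmooth n ξ f)
    (fun n => ?_), fun G y => rfl⟩
  obtain ⟨q, hq, hle⟩ := hbn n.2 n.1 ξ
  obtain ⟨s, C, hC, h⟩ := SeminormBounded.exists_bound ⟨q, hq, fun G => le_rfl⟩
  exact ⟨s, C, hC, fun f x => (hle f x).trans (h f)⟩

/-- Test functions are dense in the Schwartz space. -/
theorem dense_hasCompactSupport [FiniteDimensional ℝ E] :
    Dense {f : SchwartzMap E ℂ | HasCompactSupport f} := by
  intro f
  let χ : ContDiffBump (0 : E) := ⟨1, 2, by norm_num, by norm_num⟩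
  have hχs : ContDiff ℝ ∞ (fun x => χ x) := χ.contDiff
  have hcs : ∀ n : ℕ, HasCompactSupport (fun x => χ (((n : ℝ) + 1)⁻¹ • x)) := fun n =>
    χ.hasCompactSupport.comp_smul (by positivity)
  let g : ℕ → E → ℂ := fun n x => (χ (((n : ℝ) + 1)⁻¹ • x) : ℂ)
  have hgs : ∀ n, ContDiff ℝ ∞ (g n) := fun n =>
    Complex.ofRealCLM.contDiff.comp (hχs.comp (contDiff_const_smul _))
  have hgc : ∀ n, HasCompactSupport (g n) := fun n => (hcs n).comp_left (g := Complex.ofReal) (by simp)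
  have hgt : ∀ n, (g n).HasTemperateGrowth := fun n => (hgc n).hasTemperateGrowth (hgs n)
  let u : ℕ → SchwartzMap E ℂ := fun n => SchwartzMap.smulLeftCLM ℂ (g n) f
  have hu : Filter.Tendsto u Filter.atTop (nhds f) := by
    rw [(schwartz_withSeminorms ℂ E ℂ).tendsto_nhds u f]
    rintro ⟨k, m⟩ ε hε
    -- bounds for the derivatives of the cutoff
    obtain ⟨C, hC⟩ : ∃ C : ℝ, ∀ i ≤ m, ∀ x, ‖iteratedFDeriv ℝ i (fun x => (χ x : ℂ)) x‖ ≤ C := by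
      have : ∀ i, ∃ C : ℝ, ∀ x, ‖iteratedFDeriv ℝ i (fun x => (χ x : ℂ)) x‖ ≤ C := by
        intro i
        have hcd : ContDiff ℝ ∞ (fun x => (χ x : ℂ)) := Complex.ofRealCLM.contDiff.comp hχs
        have hcc : HasCompactSupport (fun x => (χ x : ℂ)) :=
          χ.hasCompactSupport.comp_left (g := Complex.ofReal) (by simp)
        exact (hcc.iteratedFDeriv i).exists_bound_of_continuous
          (hcd.continuous_iteratedFDeriv (by exact_mod_cast le_top))
      choose C hC using this
      refine ⟨∑ i ∈ Finset.range (m + 1), |C i|, fun i hi x => (hC i x).trans ?_⟩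
      exact (le_abs_self _).trans (Finset.single_le_sum (f := fun i => |C i|)
        (fun _ _ => abs_nonneg _) (Finset.mem_range.2 (Nat.lt_succ_of_le hi)))
    have hC0 : 0 ≤ C := (norm_nonneg _).trans (hC 0 (Nat.zero_le _) 0)
    choose q hq hqf using fun j => exists_seminorm_one_add_pow (E := E) (k + 1) j
    let K : ℝ := ∑ i ∈ Finset.range (m + 1), (m.choose i : ℝ) * (C + 1) * q (m - i) f
    have hqn : ∀ j, 0 ≤ q j f := fun j => apply_nonneg _ _
    have hK : 0 ≤ K := Finset.sum_nonneg fun i _ => by have := hqn (m - i); positivity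
    have key : ∀ n : ℕ, SchwartzMap.seminorm ℂ k m (u n - f) ≤ K * ((n : ℝ) + 1)⁻¹ := by
      intro n
      refine SchwartzMap.seminorm_le_bound ℂ k m _ (by positivity) fun x => ?_
      have e1 : ⇑(u n - f) = fun x => (g n x - 1) * f x := by
        funext x
        simp only [u, _root_.sub_apply, SchwartzMap.smulLeftCLM_apply_apply (hgt n), smul_eq_mul]
        ring
      rw [e1]
      -- The cutoff equals one for ‖x‖ ≤ n + 1, beyond that 1 ≤ ‖x‖/(n + 1), and derivatives of
      -- positive order carry a factor 1/(n + 1). In all cases 1/(n + 1) is gained at the price of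
      -- one power of 1 + ‖x‖, which is why the seminorms `q` have weight k + 1.
      have hgd : ∀ i ≤ m, (1 : ℝ) * ‖iteratedFDeriv ℝ i (fun x => g n x - 1) x‖ ≤
          (C + 1) * ((n : ℝ) + 1)⁻¹ * (1 + ‖x‖) := by
        intro i hi
        rw [one_mul]
        have hn1 : ((n : ℝ) + 1)⁻¹ ≤ 1 := inv_le_one_of_one_le₀ (by linarith [n.cast_nonneg (α := ℝ)])
        rcases Nat.eq_zero_or_pos i with rfl | hpos
        · rw [norm_iteratedFDeriv_zero]
          by_cases hx : ‖x‖ ≤ n + 1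
          · have : χ (((n : ℝ) + 1)⁻¹ • x) = 1 := by
              apply χ.one_of_mem_closedBall
              simp only [mem_closedBall_zero_iff, norm_smul, norm_inv, Real.norm_eq_abs]
              rw [abs_of_pos (by positivity), inv_mul_le_iff₀ (by positivity)]
              simpa [χ] using hx
            simp [g, this]; positivity
          · push Not at hx
            have h1 : ‖g n x - 1‖ ≤ 1 := by
              have e : g n x - 1 = ((χ (((n : ℝ) + 1)⁻¹ • x) - 1 : ℝ) : ℂ) := by simp [g]
              rw [e, Complex.norm_real, Real.norm_eq_abs, abs_le]
              constructor <;> linarith [χ.nonneg (x := (((n : ℝ) + 1)⁻¹ • x)),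
                χ.le_one (x := (((n : ℝ) + 1)⁻¹ • x))]
            refine h1.trans ?_
            have : 1 ≤ ((n : ℝ) + 1)⁻¹ * ‖x‖ := by
              rw [inv_mul_eq_div, le_div_iff₀ (by positivity)]; linarith
            nlinarith [mul_nonneg hC0 (show 0 ≤ ((n : ℝ) + 1)⁻¹ * (1 + ‖x‖) by positivity),
              show 0 ≤ ((n : ℝ) + 1)⁻¹ by positivity]
        · have e2 : iteratedFDeriv ℝ i (fun x => g n x - 1) x =
              iteratedFDeriv ℝ i (g n) x := by
            have := iteratedFDeriv_sub_apply (𝕜 := ℝ) (i := i) (x := x) (f := g n)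
              (g := fun _ => (1 : ℂ)) ((hgs n).of_le (by exact_mod_cast le_top)).contDiffAt contDiff_const.contDiffAt
            rw [show (fun x => g n x - 1) = g n - fun _ => (1 : ℂ) from rfl, this,
              iteratedFDeriv_const_of_ne hpos.ne']
            simp
          have e3 : iteratedFDeriv ℝ i (g n) x = (((n : ℝ) + 1)⁻¹) ^ i •
              iteratedFDeriv ℝ i (fun x => (χ x : ℂ)) (((n : ℝ) + 1)⁻¹ • x) :=
            congrFun (iteratedFDeriv_comp_const_smul (((n : ℝ) + 1)⁻¹)
              (f := fun x => (χ x : ℂ)) (Complex.ofRealCLM.contDiff.comp (hχs.of_le (by exact_mod_cast le_top))) ) x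
          rw [e2, e3, norm_smul, norm_pow, norm_inv, Real.norm_eq_abs, abs_of_pos (by positivity)]
          calc _ ≤ (((n : ℝ) + 1)⁻¹) ^ 1 * C := by
                gcongr ?_ * ?_
                · exact pow_le_pow_of_le_one (by positivity) hn1 hpos
                · exact hC i hi _
            _ ≤ _ := by
              have h0 : 0 ≤ ((n : ℝ) + 1)⁻¹ := by positivity
              nlinarith [norm_nonneg x, mul_nonneg h0 (norm_nonneg x),
                mul_nonneg hC0 (mul_nonneg h0 (norm_nonneg x))]
      have hmul := norm_iteratedFDeriv_mul_le (𝕜 := ℝ) (n := m) (N := ∞)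
        (f := fun x => g n x - 1) ((hgs n).sub contDiff_const) (f.smooth ⊤) x (by exact_mod_cast le_top)
      refine (mul_le_mul_of_nonneg_left hmul (by positivity)).trans ?_
      rw [Finset.mul_sum, Finset.sum_mul]
      refine Finset.sum_le_sum fun i hi => ?_
      have hi' : i ≤ m := Nat.lt_succ_iff.1 (Finset.mem_range.1 hi)
      have h1 := hgd i hi'
      rw [one_mul] at h1
      calc _ ≤ (1 + ‖x‖) ^ k * ((m.choose i : ℝ) * ((C + 1) * ((n : ℝ) + 1)⁻¹ * (1 + ‖x‖)) *
            ‖iteratedFDeriv ℝ (m - i) f x‖) := by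
            gcongr
            linarith [norm_nonneg x]
        _ = (m.choose i : ℝ) * (C + 1) * ((n : ℝ) + 1)⁻¹ *
            ((1 + ‖x‖) ^ (k + 1) * ‖iteratedFDeriv ℝ (m - i) f x‖) := by ring
        _ ≤ (m.choose i : ℝ) * (C + 1) * ((n : ℝ) + 1)⁻¹ * q (m - i) f := by
            gcongr
            exact hqf _ f x
        _ = _ := by ring
    obtain ⟨n₀, hn₀⟩ := exists_nat_gt (K / ε)
    filter_upwards [Filter.eventually_ge_atTop n₀] with n hn
    refine (key n).trans_lt ?_
    rw [← div_eq_mul_inv, div_lt_iff₀ (by positivity)]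
    have : (n₀ : ℝ) ≤ n := by exact_mod_cast hn
    rw [div_lt_iff₀ hε] at hn₀
    nlinarith
  refine mem_closure_of_tendsto hu (Filter.Eventually.of_forall fun n => ?_)
  change HasCompactSupport (SchwartzMap.smulLeftCLM ℂ (g n) f)
  rw [SchwartzMap.smulLeftCLM_apply (hgt n)]
  exact (hgc n).smul_right

end Schwartz

/-! ### Symbols and moderate weights -/

section Weights

/-- A smooth function all of whose derivatives are bounded by multiples of `w`. -/
def IsSymbol (w : Plane → ℝ) (a : Plane → ℂ) : Prop :=
  ContDiff ℝ ∞ a ∧ ∀ n : ℕ, ∃ C : ℝ, 0 ≤ C ∧ ∀ x, ‖iteratedFDeriv ℝ n a x‖ ≤ C * w x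

/-- Translations change `w` at most by a polynomial factor. -/
def IsModerate (w : Plane → ℝ) : Prop :=
  ∃ (C : ℝ) (N : ℕ), 0 ≤ C ∧ ∀ x y, w (x + y) ≤ C * (1 + ‖x‖) ^ N * w y

/-- A positive even weight that is a symbol of its own order, and so is its inverse. -/
structure IsWeight (w : Plane → ℝ) : Prop where
  pos : ∀ x, 0 < w x
  even : ∀ x, w (-x) = w x
  moderate : IsModerate w
  symbol : IsSymbol w (fun x => (w x : ℂ))
  symbol_inv : IsSymbol (fun x => (w x)⁻¹) (fun x => ((w x)⁻¹ : ℂ))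

theorem IsSymbol.mul {w v : Plane → ℝ} {a b : Plane → ℂ} (ha : IsSymbol w a) (hb : IsSymbol v b) :
    IsSymbol (fun x => w x * v x) (fun x => a x * b x) := by
  refine ⟨ha.1.mul hb.1, fun n => ?_⟩
  choose C hC0 hC using ha.2
  choose K hK0 hK using hb.2
  refine ⟨∑ i ∈ Finset.range (n + 1), (n.choose i : ℝ) * C i * K (n - i),
    Finset.sum_nonneg fun i _ => by have := hC0 i; have := hK0 (n - i); positivity, fun x => ?_⟩
  refine (norm_iteratedFDeriv_mul_le ha.1 hb.1 x (by exact_mod_cast le_top)).trans ?_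
  rw [Finset.sum_mul]
  refine Finset.sum_le_sum fun i _ => ?_
  calc _ ≤ (n.choose i : ℝ) * (C i * w x) * (K (n - i) * v x) := by
        have h1 := hC i x
        have h2 := hK (n - i) x
        have := (norm_nonneg _).trans h1
        gcongr
    _ = _ := by ring

theorem IsSymbol.mono {w v : Plane → ℝ} {a : Plane → ℂ} (ha : IsSymbol w a) (h : ∀ x, w x ≤ v x) :
    IsSymbol v a := by
  refine ⟨ha.1, fun n => ?_⟩
  obtain ⟨C, hC0, hC⟩ := ha.2 n
  exact ⟨C, hC0, fun x => (hC x).trans (mul_le_mul_of_nonneg_left (h x) hC0)⟩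

theorem IsSymbol.hasTemperateGrowth {w : Plane → ℝ} {a : Plane → ℂ} (hw : IsModerate w)
    (ha : IsSymbol w a) : a.HasTemperateGrowth := by
  refine ⟨ha.1, fun n => ?_⟩
  obtain ⟨C, hC0, hC⟩ := ha.2 n
  obtain ⟨K, N, hK0, hK⟩ := hw
  refine ⟨N, C * K * w 0, fun x => (hC x).trans ?_⟩
  have := hK x 0
  rw [add_zero] at this
  calc C * w x ≤ C * (K * (1 + ‖x‖) ^ N * w 0) := by gcongr
    _ = _ := by ring

theorem isSymbol_one : IsSymbol (fun _ => 1) (fun _ => 1) := by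
  refine ⟨contDiff_const, fun n => ⟨1, zero_le_one, fun x => ?_⟩⟩
  rcases Nat.eq_zero_or_pos n with rfl | hn
  · simp
  · rw [iteratedFDeriv_const_of_ne hn.ne']; simp

theorem one_add_norm_add_sq_le (x y : Plane) :
    1 + ‖x + y‖ ^ 2 ≤ 2 * (1 + ‖x‖ ^ 2) * (1 + ‖y‖ ^ 2) := by
  have h := norm_add_le x y
  have h2 : ‖x + y‖ ^ 2 ≤ (‖x‖ + ‖y‖) ^ 2 := by gcongr
  nlinarith [sq_nonneg (‖x‖ - ‖y‖), sq_nonneg (‖x‖ * ‖y‖), norm_nonneg x, norm_nonneg y]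

theorem wt_pos (p : ℝ) (x : Plane) : 0 < wt p x := by unfold wt; positivity

theorem wt_add (p q : ℝ) (x : Plane) : wt (p + q) x = wt p x * wt q x :=
  Real.rpow_add (by positivity) _ _

theorem wt_neg (p : ℝ) (x : Plane) : wt (-p) x = (wt p x)⁻¹ :=
  Real.rpow_neg (by positivity) _

theorem wt_zero (x : Plane) : wt 0 x = 1 := Real.rpow_zero _

/-- Peetre's inequality. For negative p the roles of y and x + y are exchanged. -/
theorem wt_add_le (p : ℝ) (x y : Plane) :
    wt p (x + y) ≤ (2 * (1 + ‖x‖ ^ 2)) ^ |p| * wt p y := by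
  unfold wt
  rcases le_or_gt 0 p with hp | hp
  · rw [abs_of_nonneg hp, ← Real.mul_rpow (by positivity) (by positivity)]
    exact Real.rpow_le_rpow (by positivity) (one_add_norm_add_sq_le x y) hp
  · rw [abs_of_neg hp]
    have h := one_add_norm_add_sq_le (-x) (x + y)
    rw [neg_add_cancel_left, norm_neg] at h
    have h1 := Real.rpow_le_rpow (z := -p) (by positivity) h (by linarith)
    rw [Real.mul_rpow (by positivity) (by positivity), Real.rpow_neg (by positivity),
      Real.rpow_neg (x := 1 + ‖x + y‖ ^ 2) (by positivity)] at h1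
    have hA : 0 < (1 + ‖y‖ ^ 2) ^ p := by positivity
    have hB : 0 < (1 + ‖x + y‖ ^ 2) ^ p := by positivity
    rwa [inv_le_iff_one_le_mul₀ hA, ← div_eq_mul_inv, div_mul_eq_mul_div, one_le_div hB] at h1

theorem isModerate_wt (p : ℝ) : IsModerate (wt p) := by
  refine ⟨2 ^ ⌈|p|⌉₊, 2 * ⌈|p|⌉₊, by positivity, fun x y => (wt_add_le p x y).trans ?_⟩
  gcongr
  · exact (wt_pos _ _).le
  calc (2 * (1 + ‖x‖ ^ 2)) ^ |p| ≤ (2 * (1 + ‖x‖ ^ 2)) ^ ((⌈|p|⌉₊ : ℕ) : ℝ) :=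
        Real.rpow_le_rpow_of_exponent_le (by nlinarith [sq_nonneg ‖x‖]) (Nat.le_ceil _)
    _ = (2 * (1 + ‖x‖ ^ 2)) ^ ⌈|p|⌉₊ := Real.rpow_natCast _ _
    _ ≤ (2 * (1 + ‖x‖) ^ 2) ^ ⌈|p|⌉₊ := by
        gcongr; nlinarith [norm_nonneg x]
    _ = _ := by rw [mul_pow, pow_mul]

theorem contDiff_wt (p : ℝ) : ContDiff ℝ ∞ (wt p) :=
  (Function.hasTemperateGrowth_one_add_norm_sq_rpow Plane p).1

/-- After division by its value at x₀ the quadratic polynomial has derivatives at x₀ bounded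
uniformly in x₀, and those of order at least three vanish. The form 2^i is the one required of the
inner function in the estimate for derivatives of a composition. -/
theorem norm_iteratedFDeriv_norm_sq_div_le (x₀ : Plane) (i : ℕ) (hi : 1 ≤ i) :
    ‖iteratedFDeriv ℝ i (fun x : Plane => (1 + ‖x‖ ^ 2) / (1 + ‖x₀‖ ^ 2)) x₀‖ ≤ 2 ^ i := by
  set t := 1 + ‖x₀‖ ^ 2 with ht
  have ht1 : 1 ≤ t := by rw [ht]; nlinarith [sq_nonneg ‖x₀‖]
  have ht0 : 0 < t := by linarith
  let A : Plane →L[ℝ] Plane →L[ℝ] ℝ := (2 / t) • innerSL ℝ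
  have hA : fderiv ℝ (fun x : Plane => (1 + ‖x‖ ^ 2) / t) = A := by
    funext x
    have h1 : HasFDerivAt (fun x : Plane => ‖x‖ ^ 2) (2 • innerSL ℝ x) x := by
      have := (hasStrictFDerivAt_norm_sq x).hasFDerivAt
      exact this
    have h2 : HasFDerivAt (fun x : Plane => t⁻¹ • (1 + ‖x‖ ^ 2)) (t⁻¹ • (2 • innerSL ℝ x)) x :=
      (h1.const_add 1).const_smul t⁻¹
    have e : (fun x : Plane => (1 + ‖x‖ ^ 2) / t) = fun x : Plane => t⁻¹ • (1 + ‖x‖ ^ 2) := by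
      funext x; rw [smul_eq_mul, div_eq_inv_mul]
    rw [e, h2.fderiv]
    ext v
    change t⁻¹ * (2 • (inner ℝ x v : ℝ)) = 2 / t * inner ℝ x v
    rw [two_smul]
    ring
  have hAn : ‖A‖ ≤ 2 := by
    refine ContinuousLinearMap.opNorm_le_bound _ (by norm_num) fun v => ?_
    rw [show A v = (2 / t) • innerSL ℝ v from rfl, norm_smul, innerSL_apply_norm]
    rw [Real.norm_of_nonneg (by positivity)]
    gcongr
    rw [div_le_iff₀ ht0]; linarith
  obtain ⟨j, rfl⟩ : ∃ j, i = j + 1 := ⟨i - 1, by omega⟩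
  rw [← norm_iteratedFDeriv_fderiv, hA]
  rcases j with _ | _ | j
  · rw [norm_iteratedFDeriv_zero]
    rw [show A x₀ = (2 / t) • innerSL ℝ x₀ from rfl, norm_smul, innerSL_apply_norm]
    rw [Real.norm_of_nonneg (by positivity), div_mul_eq_mul_div, div_le_iff₀ ht0, ht]
    norm_num
    nlinarith [sq_nonneg (‖x₀‖ - 1)]
  · rw [← norm_iteratedFDeriv_fderiv, norm_iteratedFDeriv_zero, ContinuousLinearMap.fderiv]
    norm_num
    linarith
  · rw [← norm_iteratedFDeriv_fderiv]
    have : fderiv ℝ (A : Plane → Plane →L[ℝ] ℝ) = fun _ => A := by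
      funext x; exact ContinuousLinearMap.fderiv _
    rw [this, iteratedFDeriv_const_of_ne (by omega)]
    simp

/-- The weight is written as t^p u^p with t = 1 + |x₀|² and u = (1 + |x|²)/t. The outer function is
then always differentiated at u = 1, so its derivatives do not depend on x₀, and the prefactor t^p
is the weight itself. -/
theorem isSymbol_wt (p : ℝ) : IsSymbol (wt p) (fun x => (wt p x : ℂ)) := by
  refine ⟨Complex.ofRealCLM.contDiff.comp (contDiff_wt p), fun n => ?_⟩
  have hdiff : ContDiffOn ℝ ∞ (fun u : ℝ => u ^ p) (Set.Ioi 0) :=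
    contDiffOn_fun_id.rpow_const_of_ne fun x hx => (Set.mem_Ioi.1 hx).ne'
  let c : ℕ → ℝ := fun i => ‖iteratedFDerivWithin ℝ i (fun u : ℝ => u ^ p) (Set.Ioi 0) 1‖
  have hc : ∀ i, 0 ≤ c i := fun i => norm_nonneg _
  refine ⟨n.factorial * (∑ i ∈ Finset.range (n + 1), c i) * 2 ^ n, by
    have : 0 ≤ ∑ i ∈ Finset.range (n + 1), c i := Finset.sum_nonneg fun i _ => hc i
    positivity, fun x₀ => ?_⟩
  have h0 : ‖iteratedFDeriv ℝ n (fun x => (wt p x : ℂ)) x₀‖ ≤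
      ‖iteratedFDeriv ℝ n (wt p) x₀‖ := by
    have h1 := Complex.ofRealLI.norm_iteratedFDeriv_comp_left (𝕜 := ℝ)
      ((contDiff_wt p).contDiffAt (x := x₀)) (i := n) (by exact_mod_cast le_top)
    exact h1.le
  refine h0.trans ?_
  set t := 1 + ‖x₀‖ ^ 2 with ht
  have ht0 : 0 < t := by positivity
  have e : wt p = (fun u : ℝ => t ^ p • u ^ p) ∘ fun x : Plane => (1 + ‖x‖ ^ 2) / t := by
    funext x
    simp only [wt, Function.comp_apply, smul_eq_mul]
    rw [← Real.mul_rpow ht0.le (by positivity), mul_div_cancel₀ _ ht0.ne']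
  have hcont : ContDiff ℝ ∞ (fun x : Plane => (1 + ‖x‖ ^ 2) / t) := by
    exact (contDiff_const.add (contDiff_norm_sq ℝ)).div_const _
  have hf1 : (1 + ‖x₀‖ ^ 2) / t = 1 := div_self ht0.ne'
  have key := norm_iteratedFDeriv_comp_le' (𝕜 := ℝ) (n := n) (N := ∞)
    (g := fun u : ℝ => t ^ p • u ^ p)
    (f := fun x : Plane => (1 + ‖x‖ ^ 2) / t) (t := Set.Ioi 0)
    (by rintro - ⟨x, rfl⟩; exact Set.mem_Ioi.2 (by positivity)) (uniqueDiffOn_Ioi 0)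
    (hdiff.const_smul (t ^ p)) hcont (by exact_mod_cast le_top) x₀
    (C := (∑ i ∈ Finset.range (n + 1), c i) * wt p x₀) (D := 2) (fun i hi => ?_)
    (fun i hi _ => norm_iteratedFDeriv_norm_sq_div_le x₀ i hi)
  · rw [← e] at key
    calc _ ≤ _ := key
      _ = _ := by ring
  · rw [hf1, show (fun u : ℝ => t ^ p • u ^ p) = t ^ p • (fun u : ℝ => u ^ p) from rfl,
      iteratedFDerivWithin_const_smul_apply
      ((hdiff 1 (by simp)).of_le (by exact_mod_cast le_top)) (uniqueDiffOn_Ioi 0) (by simp), norm_smul,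
      Real.norm_of_nonneg (by positivity), mul_comm]
    gcongr
    · exact Finset.single_le_sum (f := c) (fun i _ => hc i) (Finset.mem_range.2 (by omega))
    · exact le_rfl

theorem IsSymbol.comp_smul {w : Plane → ℝ} {a : Plane → ℂ} (ha : IsSymbol w a) (c : ℝ) :
    IsSymbol (fun x => w (c • x)) (fun x => a (c • x)) := by
  refine ⟨ha.1.comp (contDiff_const_smul c), fun n => ?_⟩
  obtain ⟨C, hC0, hC⟩ := ha.2 n
  refine ⟨|c| ^ n * C, by positivity, fun x => ?_⟩
  rw [iteratedFDeriv_comp_const_smul c (ha.1.of_le (by exact_mod_cast le_top)), norm_smul, norm_pow,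
    Real.norm_eq_abs, mul_assoc]
  gcongr
  exact hC _

/-- The weights `(1 + |c x|²)^p`. -/
theorem isWeight_wt (c p : ℝ) : IsWeight (fun x => wt p (c • x)) where
  pos x := wt_pos _ _
  even x := by simp [wt]
  moderate := by
    obtain ⟨C, N, hC, h⟩ := isModerate_wt p
    refine ⟨C * (1 + |c|) ^ N, N, by positivity, fun x y => ?_⟩
    change wt p (c • (x + y)) ≤ C * (1 + |c|) ^ N * (1 + ‖x‖) ^ N * wt p (c • y)
    rw [smul_add]
    refine (h _ _).trans ?_
    rw [mul_assoc C ((1 + |c|) ^ N), ← mul_pow]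
    gcongr
    · exact (wt_pos _ _).le
    rw [norm_smul, Real.norm_eq_abs]
    nlinarith [norm_nonneg x, abs_nonneg c]
  symbol := (isSymbol_wt p).comp_smul c
  symbol_inv := by
    have := (isSymbol_wt (-p)).comp_smul c
    simpa [wt_neg] using this

theorem isWeight_wt_one (p : ℝ) : IsWeight (wt p) := by
  simpa using isWeight_wt 1 p

end Weights

/-! ### The short-time Fourier transform in weighted norms -/

section Stft

local notation "𝓢₂" => SchwartzMap Plane ℂ

/-- The product of two Schwartz functions. -/
def mulS (f g : 𝓢₂) : 𝓢₂ := SchwartzMap.pairing (ContinuousLinearMap.mul ℂ ℂ) f g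

@[simp] theorem mulS_apply (f g : 𝓢₂) (x : Plane) : mulS f g x = f x * g x := by simp [mulS]

/-- The translate `x ↦ g (x - y)`. -/
def shiftS (y : Plane) (g : 𝓢₂) : 𝓢₂ := SchwartzMap.compSubConstCLM ℂ y g

@[simp] theorem shiftS_apply (y : Plane) (g : 𝓢₂) (x : Plane) : shiftS y g x = g (x - y) := by
  simp [shiftS]

/-- The short-time Fourier transform of `f` with the window `g`. -/
def stft (g f : 𝓢₂) (y : Plane) : 𝓢₂ := 𝓕 (mulS f (shiftS y g))

/-- Time and frequency play symmetric roles in the short-time Fourier transform. -/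
theorem stft_eq (g f : 𝓢₂) (y ξ : Plane) :
    stft g f y ξ = (Real.fourierChar (-(inner ℝ y ξ)) : ℂ) * stft (𝓕⁻ g) (𝓕 f) ξ (-y) := by
  set p := 𝓕⁻ g with hp
  have hg : g = 𝓕 p := by rw [hp, FourierTransform.fourier_fourierInv_eq]
  let w : Plane → ℂ := fun ζ => (Real.fourierChar (inner ℝ ζ y) : ℂ) * p (ζ - ξ)
  have hw : Integrable w := by
    have h1 : Integrable (fun ζ => p (ζ - ξ)) := p.integrable.comp_sub_right ξ
    refine h1.bdd_mul (c := 1) ?_ ?_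
    · exact (Continuous.aestronglyMeasurable (by fun_prop))
    · exact Filter.Eventually.of_forall fun x => (Circle.norm_coe _).le
  -- The Fourier transform is moved from f to the shifted and modulated window `w`, whose own
  -- transform is a modulated translate of g.
  have key := VectorFourier.integral_fourierIntegral_smul_eq_flip (L := innerₗ Plane)
    Real.continuous_fourierChar continuous_inner (f.integrable (μ := volume)) hw
  have e1 : stft p (𝓕 f) ξ (-y) = ∫ ζ, VectorFourier.fourierIntegral Real.fourierChar volume
      (innerₗ Plane) f ζ • w ζ := by
    rw [stft, SchwartzMap.fourier_coe, Real.fourier_eq]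
    refine integral_congr_ae (Filter.Eventually.of_forall fun ζ => ?_)
    simp only [mulS_apply, shiftS_apply, w, Circle.smul_def, inner_neg_right, neg_neg, smul_eq_mul]
    rw [show VectorFourier.fourierIntegral Real.fourierChar volume
      (innerₗ Plane) f ζ = 𝓕 f ζ from rfl]
    ring
  have e2 : ∀ x, VectorFourier.fourierIntegral Real.fourierChar volume (innerₗ Plane).flip w x =
      (Real.fourierChar (-(inner ℝ (x - y) ξ)) : ℂ) * g (x - y) := by
    intro x
    rw [hg, SchwartzMap.fourier_coe, Real.fourier_eq, VectorFourier.fourierIntegral]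
    simp only [LinearMap.flip_apply, innerₗ_apply_apply, Circle.smul_def, smul_eq_mul, w]
    symm
    rw [← integral_const_mul, ← integral_sub_right_eq_self _ ξ]
    refine integral_congr_ae (Filter.Eventually.of_forall fun ζ => ?_)
    simp only
    rw [← mul_assoc, ← mul_assoc, ← Circle.coe_mul, ← Circle.coe_mul, ← AddChar.map_add_eq_mul,
      ← AddChar.map_add_eq_mul]
    have : -inner ℝ (x - y) ξ + -inner ℝ (ζ - ξ) (x - y) = -inner ℝ ζ x + inner ℝ ζ y := by
      simp only [inner_sub_left, inner_sub_right, real_inner_comm x ξ, real_inner_comm y ξ]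
      ring
    rw [this, real_inner_comm x ζ]
  rw [e1, key, ← integral_const_mul, stft, SchwartzMap.fourier_coe, Real.fourier_eq]
  refine integral_congr_ae (Filter.Eventually.of_forall fun x => ?_)
  simp only [e2, mulS_apply, shiftS_apply, Circle.smul_def, smul_eq_mul]
  have : Real.fourierChar (-(inner ℝ x ξ)) =
      Real.fourierChar (-(inner ℝ y ξ)) * Real.fourierChar (-(inner ℝ (x - y) ξ)) := by
    rw [← AddChar.map_add_eq_mul, inner_sub_left]
    congr 1; ring
  rw [this, Circle.coe_mul]
  ring

theorem enorm_stft (g f : 𝓢₂) (y ξ : Plane) :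
    ‖stft g f y ξ‖ₑ = ‖stft (𝓕⁻ g) (𝓕 f) ξ (-y)‖ₑ := by
  rw [stft_eq, enorm_mul, ← ofReal_norm, Circle.norm_coe]
  simp

theorem measurable_stft (g f : 𝓢₂) : Measurable (fun p : Plane × Plane => stft g f p.1 p.2) := by
  have e : (fun p : Plane × Plane => stft g f p.1 p.2) = fun p : Plane × Plane =>
      ∫ x, (Real.fourierChar (-(inner ℝ x p.2)) : ℂ) * (f x * g (x - p.1)) := by
    funext p
    rw [stft, SchwartzMap.fourier_coe, Real.fourier_eq]
    simp [Circle.smul_def]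
  rw [e]
  have : StronglyMeasurable (Function.uncurry fun (p : Plane × Plane) (x : Plane) =>
      (Real.fourierChar (-(inner ℝ x p.2)) : ℂ) * (f x * g (x - p.1))) := by
    apply Continuous.stronglyMeasurable
    have h1 : Continuous f := f.continuous
    have h2 : Continuous g := g.continuous
    unfold Function.uncurry
    fun_prop
  exact this.integral_prod_right.measurable

/-- The squared weighted `L²` norm of a function. -/
def wSq (b : Plane → ℝ) (f : 𝓢₂) : ℝ≥0∞ :=
  ∫⁻ ξ, ENNReal.ofReal (b ξ) ^ 2 * ‖f ξ‖ₑ ^ 2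

/-- The squared weighted norm of the short-time Fourier transform. -/
def stftSq (g : 𝓢₂) (a b : Plane → ℝ) (f : 𝓢₂) : ℝ≥0∞ :=
  ∫⁻ y, ENNReal.ofReal (a y) ^ 2 * wSq b (stft g f y)

theorem lintegral_enorm_sq_eq_enorm_toLp (h : 𝓢₂) : ∫⁻ x, ‖h x‖ₑ ^ 2 = ‖h.toLp 2 volume‖ₑ ^ 2 := by
  rw [Lp.enorm_def, eLpNorm_congr_ae (h.coeFn_toLp 2 volume),
    eLpNorm_eq_lintegral_rpow_enorm_toReal (by norm_num) (by norm_num)]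
  rw [← ENNReal.rpow_natCast, ← ENNReal.rpow_mul]
  simp

theorem lintegral_enorm_sq_fourier (h : 𝓢₂) : ∫⁻ ξ, ‖𝓕 h ξ‖ₑ ^ 2 = ∫⁻ x, ‖h x‖ₑ ^ 2 := by
  rw [lintegral_enorm_sq_eq_enorm_toLp, lintegral_enorm_sq_eq_enorm_toLp, ← ofReal_norm,
    ← ofReal_norm, SchwartzMap.norm_fourier_toL2_eq]

theorem lintegral_one_add_norm_pow_mul (N : ℕ) :
    ∃ q : Seminorm ℂ 𝓢₂, Continuous q ∧ ∀ h : 𝓢₂,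
      ∫⁻ u, ENNReal.ofReal ((1 + ‖u‖) ^ N) * ‖h u‖ₑ ≤ ENNReal.ofReal (q h) := by
  -- The surplus exponent 3 exceeds the dimension 2, so that (1 + ‖u‖)^(-3) is integrable.
  obtain ⟨q, hq, hle⟩ := exists_seminorm_one_add_pow (E := Plane) (N + 3) 0
  have hint : Integrable (fun x : Plane => (1 + ‖x‖) ^ (-3 : ℝ)) :=
    integrable_one_add_norm (by simp; norm_num)
  set K := ∫ x : Plane, (1 + ‖x‖) ^ (-3 : ℝ) with hK
  have hK0 : 0 ≤ K := integral_nonneg fun x => by positivity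
  refine ⟨K.toNNReal • q, continuous_const.mul hq, fun h => ?_⟩
  have hpt : ∀ u, ENNReal.ofReal ((1 + ‖u‖) ^ N) * ‖h u‖ₑ ≤
      ENNReal.ofReal ((1 + ‖u‖) ^ (-3 : ℝ)) * ENNReal.ofReal (q h) := by
    intro u
    rw [← ofReal_norm, ← ENNReal.ofReal_mul (by positivity), ← ENNReal.ofReal_mul (by positivity)]
    apply ENNReal.ofReal_le_ofReal
    have h1 := hle h u
    rw [norm_iteratedFDeriv_zero] at h1
    rw [show (-3 : ℝ) = -((3 : ℕ) : ℝ) by norm_num, Real.rpow_neg (by positivity), Real.rpow_natCast,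
      inv_mul_eq_div, le_div_iff₀ (by positivity)]
    calc _ = (1 + ‖u‖) ^ (N + 3) * ‖h u‖ := by ring
      _ ≤ _ := h1
  calc _ ≤ ∫⁻ u, ENNReal.ofReal ((1 + ‖u‖) ^ (-3 : ℝ)) * ENNReal.ofReal (q h) :=
        lintegral_mono hpt
    _ = ENNReal.ofReal K * ENNReal.ofReal (q h) := by
        rw [lintegral_mul_const' _ _ (by simp), hK,
          ofReal_integral_eq_lintegral_ofReal hint (Filter.Eventually.of_forall fun x => by positivity)]
    _ = _ := by
        rw [← ENNReal.ofReal_mul hK0]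
        congr 1
        change K * q h = (K.toNNReal : ℝ) * q h
        rw [Real.coe_toNNReal _ hK0]

theorem lintegral_one_add_norm_pow_mul_sq_lt_top (N : ℕ) (h : 𝓢₂) :
    ∫⁻ u, (ENNReal.ofReal ((1 + ‖u‖) ^ N) * ‖h u‖ₑ) ^ 2 < ⊤ := by
  obtain ⟨q, -, hle⟩ := exists_seminorm_one_add_pow (E := Plane) N 0
  obtain ⟨q', -, hle'⟩ := lintegral_one_add_norm_pow_mul N
  have hpt : ∀ u, (ENNReal.ofReal ((1 + ‖u‖) ^ N) * ‖h u‖ₑ) ^ 2 ≤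
      ENNReal.ofReal (q h) * (ENNReal.ofReal ((1 + ‖u‖) ^ N) * ‖h u‖ₑ) := by
    intro u
    rw [sq]
    gcongr
    rw [← ofReal_norm, ← ENNReal.ofReal_mul (by positivity)]
    apply ENNReal.ofReal_le_ofReal
    simpa using hle h u
  refine (lintegral_mono hpt).trans_lt ?_
  rw [lintegral_const_mul' _ _ (by simp)]
  exact ENNReal.mul_lt_top (by simp) ((hle' h).trans_lt (by simp))

/-- For fixed ξ the transform, read as one of 𝓕 f, is a Fourier transform in y, and Plancherel
removes y. What remains is a weighted norm of 𝓕 f in which b² is averaged with the density |𝓕⁻ g|².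
-/
theorem stftSq_one_eq (g f : 𝓢₂) {b : Plane → ℝ} (hb : Measurable b) :
    stftSq g (fun _ => 1) b f = ∫⁻ ζ, ‖𝓕 f ζ‖ₑ ^ 2 *
      ∫⁻ ξ, ENNReal.ofReal (b ξ) ^ 2 * ‖(𝓕⁻ g : 𝓢₂) (ζ - ξ)‖ₑ ^ 2 := by
  have hm := measurable_stft g f
  have hp : Measurable (𝓕⁻ g : 𝓢₂) := (𝓕⁻ g : 𝓢₂).continuous.measurable
  have hf : Measurable (𝓕 f : 𝓢₂) := (𝓕 f : 𝓢₂).continuous.measurable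
  unfold stftSq wSq
  simp only [ENNReal.ofReal_one, one_pow, one_mul]
  rw [lintegral_lintegral_swap (f := fun y ξ => ENNReal.ofReal (b ξ) ^ 2 * ‖stft g f y ξ‖ₑ ^ 2)
    (by unfold Function.uncurry; fun_prop)]
  have h1 : ∀ ξ, ∫⁻ y, ENNReal.ofReal (b ξ) ^ 2 * ‖stft g f y ξ‖ₑ ^ 2 =
      ∫⁻ ζ, ENNReal.ofReal (b ξ) ^ 2 * (‖𝓕 f ζ‖ₑ ^ 2 * ‖(𝓕⁻ g : 𝓢₂) (ζ - ξ)‖ₑ ^ 2) := by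
    intro ξ
    rw [lintegral_const_mul' _ _ (by simp), lintegral_const_mul' _ _ (by simp)]
    congr 1
    simp only [enorm_stft g f]
    rw [lintegral_neg_eq_self (fun y => ‖stft (𝓕⁻ g) (𝓕 f) ξ y‖ₑ ^ 2)]
    unfold stft
    rw [lintegral_enorm_sq_fourier]
    simp [mul_pow]
  simp only [h1]
  rw [lintegral_lintegral_swap (by unfold Function.uncurry; fun_prop)]
  refine lintegral_congr fun ζ => ?_
  rw [← lintegral_const_mul _ (by fun_prop)]
  refine lintegral_congr fun ξ => ?_
  ring

theorem IsModerate.sub_le {b : Plane → ℝ} {C : ℝ} {N : ℕ} (h : ∀ x y, b (x + y) ≤ C * (1 + ‖x‖) ^ N * b y)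
    (x y : Plane) : b x ≤ C * (1 + ‖y - x‖) ^ N * b y := by
  have := h (x - y) y
  rwa [sub_add_cancel, norm_sub_rev] at this

/-- A moderate weight at ξ is at most its value at ζ times a power of 1 + |ζ - ξ|, and this power is
absorbed by the rapid decay of 𝓕⁻ g. -/
theorem stftSq_one_le (g : 𝓢₂) {b : Plane → ℝ} (hbm : Measurable b) (hb : IsModerate b) :
    ∃ C : ℝ≥0, ∀ f, stftSq g (fun _ => 1) b f ≤ C * wSq b (𝓕 f) := by
  obtain ⟨C, N, hC, h⟩ := hb
  have hfin := lintegral_one_add_norm_pow_mul_sq_lt_top N (𝓕⁻ g)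
  set I := ∫⁻ u, (ENNReal.ofReal ((1 + ‖u‖) ^ N) * ‖(𝓕⁻ g : 𝓢₂) u‖ₑ) ^ 2 with hI
  have hp : Measurable (𝓕⁻ g : 𝓢₂) := (𝓕⁻ g : 𝓢₂).continuous.measurable
  have hfin' : ENNReal.ofReal C ^ 2 * I ≠ ⊤ := (ENNReal.mul_lt_top (by simp) hfin).ne
  refine ⟨(ENNReal.ofReal C ^ 2 * I).toNNReal, fun f => ?_⟩
  rw [ENNReal.coe_toNNReal hfin', stftSq_one_eq g f hbm, wSq,
    ← lintegral_const_mul' _ _ hfin']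
  refine lintegral_mono fun ζ => ?_
  calc _ ≤ ‖𝓕 f ζ‖ₑ ^ 2 * ∫⁻ ξ, (ENNReal.ofReal C ^ 2 * ENNReal.ofReal (b ζ) ^ 2) *
        (ENNReal.ofReal ((1 + ‖ζ - ξ‖) ^ N) * ‖(𝓕⁻ g : 𝓢₂) (ζ - ξ)‖ₑ) ^ 2 := by
        refine mul_le_mul_right (lintegral_mono fun ξ => ?_) _
        have h1 : ENNReal.ofReal (b ξ) ≤ ENNReal.ofReal C * ENNReal.ofReal ((1 + ‖ζ - ξ‖) ^ N) *
            ENNReal.ofReal (b ζ) := by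
          rw [← ENNReal.ofReal_mul hC, ← ENNReal.ofReal_mul (by positivity)]
          exact ENNReal.ofReal_le_ofReal (IsModerate.sub_le h ξ ζ)
        calc _ ≤ (ENNReal.ofReal C * ENNReal.ofReal ((1 + ‖ζ - ξ‖) ^ N) *
            ENNReal.ofReal (b ζ)) ^ 2 * ‖(𝓕⁻ g : 𝓢₂) (ζ - ξ)‖ₑ ^ 2 := by gcongr
          _ = _ := by ring
    _ = ‖𝓕 f ζ‖ₑ ^ 2 * (ENNReal.ofReal C ^ 2 * ENNReal.ofReal (b ζ) ^ 2 * I) := by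
        rw [lintegral_const_mul' _ _ (ENNReal.mul_ne_top (by simp) (by simp)),
          lintegral_sub_left_eq_self (fun u =>
            (ENNReal.ofReal ((1 + ‖u‖) ^ N) * ‖(𝓕⁻ g : 𝓢₂) u‖ₑ) ^ 2) ζ]
    _ = _ := by ring

/-- The average of b² is also bounded below by a multiple of b²: moderation costs a negative power
of 1 + |ζ - ξ|, and the integral of |𝓕⁻ g|² with such a factor is finite and, for a nonzero window,
positive. -/
theorem le_stftSq_one (g : 𝓢₂) (hg : g ≠ 0) {b : Plane → ℝ} (hbm : Measurable b)
    (hb : IsModerate b) :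
    ∃ C : ℝ≥0, ∀ f, wSq b (𝓕 f) ≤ C * stftSq g (fun _ => 1) b f := by
  obtain ⟨C, N, hC, h⟩ := hb
  set p := (𝓕⁻ g : 𝓢₂) with hp
  have hpc : Continuous p := p.continuous
  have hp0 : p ≠ 0 := by
    intro h0
    apply hg
    rw [show g = 𝓕 p by rw [hp, FourierTransform.fourier_fourierInv_eq], h0]
    exact (FourierTransform.fourierCLM ℂ 𝓢₂).map_zero
  set I := ∫⁻ u, (ENNReal.ofReal (((1 + ‖u‖) ^ N)⁻¹) * ‖p u‖ₑ) ^ 2 with hI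
  have hI0 : I ≠ 0 := by
    intro h0
    apply hp0
    rw [hI, lintegral_eq_zero_iff (by fun_prop)] at h0
    have h1 : p =ᵐ[volume] (fun _ => (0 : ℂ)) := by
      filter_upwards [h0] with u hu
      simp only [Pi.zero_apply, ne_eq, OfNat.ofNat_ne_zero, not_false_eq_true, pow_eq_zero_iff,
        mul_eq_zero, ENNReal.ofReal_eq_zero, enorm_eq_zero] at hu
      rcases hu with hu | hu
      · exact absurd hu (not_le.2 (by positivity))
      · exact hu
    have h2 := (Continuous.ae_eq_iff_eq volume hpc continuous_const).1 h1
    ext x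
    exact congrFun h2 x
  have hIt : I ≠ ⊤ := by
    have hfin := lintegral_one_add_norm_pow_mul_sq_lt_top 0 p
    refine ((lintegral_mono fun u => ?_).trans_lt hfin).ne
    gcongr
    rw [pow_zero]
    exact inv_le_one_of_one_le₀ (one_le_pow₀ (by linarith [norm_nonneg u]))
  have hfin' : I⁻¹ * ENNReal.ofReal C ^ 2 ≠ ⊤ := ENNReal.mul_ne_top (by simpa using hI0) (by simp)
  refine ⟨(I⁻¹ * ENNReal.ofReal C ^ 2).toNNReal, fun f => ?_⟩
  have hfm : Measurable (𝓕 f : 𝓢₂) := (𝓕 f : 𝓢₂).continuous.measurable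
  rw [ENNReal.coe_toNNReal hfin', mul_assoc, ← ENNReal.div_eq_inv_mul,
    ENNReal.le_div_iff_mul_le (Or.inl hI0) (Or.inl hIt), mul_comm]
  rw [stftSq_one_eq g f hbm, wSq, ← lintegral_const_mul' _ _ hIt,
    ← lintegral_const_mul' _ _ (by simp)]
  refine lintegral_mono fun ζ => ?_
  rw [← hp]
  calc _ = ‖𝓕 f ζ‖ₑ ^ 2 * (ENNReal.ofReal (b ζ) ^ 2 * I) := by ring
    _ = ‖𝓕 f ζ‖ₑ ^ 2 * ∫⁻ ξ, ENNReal.ofReal (b ζ) ^ 2 *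
        (ENNReal.ofReal (((1 + ‖ζ - ξ‖) ^ N)⁻¹) * ‖p (ζ - ξ)‖ₑ) ^ 2 := by
        rw [lintegral_const_mul' _ _ (by simp),
          lintegral_sub_left_eq_self (fun u =>
            (ENNReal.ofReal (((1 + ‖u‖) ^ N)⁻¹) * ‖p u‖ₑ) ^ 2) ζ]
    _ ≤ ‖𝓕 f ζ‖ₑ ^ 2 * ∫⁻ ξ, ENNReal.ofReal C ^ 2 * (ENNReal.ofReal (b ξ) ^ 2 *
        ‖p (ζ - ξ)‖ₑ ^ 2) := by
        refine mul_le_mul_right (lintegral_mono fun ξ => ?_) _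
        have h1 : ENNReal.ofReal (b ζ) * ENNReal.ofReal (((1 + ‖ζ - ξ‖) ^ N)⁻¹) ≤
            ENNReal.ofReal C * ENNReal.ofReal (b ξ) := by
          rw [← ENNReal.ofReal_mul hC, ← ENNReal.ofReal_mul' (by positivity)]
          apply ENNReal.ofReal_le_ofReal
          rw [← div_eq_mul_inv, div_le_iff₀ (by positivity)]
          have := IsModerate.sub_le h ζ ξ
          rw [norm_sub_rev] at this
          calc b ζ ≤ _ := this
            _ = _ := by ring
        calc _ = (ENNReal.ofReal (b ζ) * ENNReal.ofReal (((1 + ‖ζ - ξ‖) ^ N)⁻¹)) ^ 2 *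
            ‖p (ζ - ξ)‖ₑ ^ 2 := by ring
          _ ≤ (ENNReal.ofReal C * ENNReal.ofReal (b ξ)) ^ 2 * ‖p (ζ - ξ)‖ₑ ^ 2 := by gcongr
          _ = _ := by ring
    _ = _ := by rw [lintegral_const_mul' _ _ (by simp)]; ring

/-- Young's inequality for the convolution of a weighted `L¹` and a weighted `L²` function. -/
theorem lintegral_sq_lintegral_mul_le {H φ : Plane → ℝ≥0∞} (hH : Measurable H) (hφ : Measurable φ) :
    ∫⁻ ξ, (∫⁻ ζ, H (ζ - ξ) * φ ζ) ^ 2 ≤ (∫⁻ u, H u) ^ 2 * ∫⁻ ζ, φ ζ ^ 2 := by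
  -- Cauchy–Schwarz with the kernel split into two square roots.
  have h1 : ∀ ξ, (∫⁻ ζ, H (ζ - ξ) * φ ζ) ^ 2 ≤ (∫⁻ u, H u) * ∫⁻ ζ, H (ζ - ξ) * φ ζ ^ 2 := by
    intro ξ
    have hol := ENNReal.lintegral_mul_le_Lp_mul_Lq (volume : Measure Plane)
      (Real.HolderConjugate.two_two) (f := fun ζ => H (ζ - ξ) ^ (1 / 2 : ℝ))
      (g := fun ζ => H (ζ - ξ) ^ (1 / 2 : ℝ) * φ ζ) (by fun_prop) (by fun_prop)
    have e1 : ∀ ζ, (H (ζ - ξ) ^ (1 / 2 : ℝ)) * (H (ζ - ξ) ^ (1 / 2 : ℝ) * φ ζ) = H (ζ - ξ) * φ ζ := by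
      intro ζ
      rw [← mul_assoc, ← ENNReal.rpow_add_of_nonneg _ _ (by norm_num) (by norm_num)]
      norm_num
    have e2 : ∀ ζ, (H (ζ - ξ) ^ (1 / 2 : ℝ)) ^ (2 : ℝ) = H (ζ - ξ) := by
      intro ζ; rw [← ENNReal.rpow_mul]; norm_num
    have e3 : ∀ ζ, (H (ζ - ξ) ^ (1 / 2 : ℝ) * φ ζ) ^ (2 : ℝ) = H (ζ - ξ) * φ ζ ^ 2 := by
      intro ζ
      rw [ENNReal.mul_rpow_of_nonneg _ _ (by norm_num), e2, ENNReal.rpow_ofNat]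
    simp only [Pi.mul_apply, e1, e2, e3] at hol
    rw [lintegral_sub_right_eq_self (fun u => H u) ξ] at hol
    calc _ ≤ ((∫⁻ u, H u) ^ (1 / 2 : ℝ) * (∫⁻ ζ, H (ζ - ξ) * φ ζ ^ 2) ^ (1 / 2 : ℝ)) ^ 2 := by
          gcongr
      _ = _ := by
          rw [mul_pow, ← ENNReal.rpow_natCast, ← ENNReal.rpow_natCast, ← ENNReal.rpow_mul,
            ← ENNReal.rpow_mul]
          norm_num
  calc _ ≤ ∫⁻ ξ, (∫⁻ u, H u) * ∫⁻ ζ, H (ζ - ξ) * φ ζ ^ 2 := lintegral_mono h1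
    _ = (∫⁻ u, H u) * ∫⁻ ξ, ∫⁻ ζ, H (ζ - ξ) * φ ζ ^ 2 := by
        rw [lintegral_const_mul]
        exact Measurable.lintegral_prod_right (f := fun ξ ζ : Plane => H (ζ - ξ) * φ ζ ^ 2)
          (by unfold Function.uncurry; fun_prop)
    _ = (∫⁻ u, H u) * ∫⁻ ζ, ∫⁻ ξ, H (ζ - ξ) * φ ζ ^ 2 := by
        rw [lintegral_lintegral_swap (by unfold Function.uncurry; fun_prop)]
    _ = _ := by
        have : ∀ ζ, ∫⁻ ξ, H (ζ - ξ) * φ ζ ^ 2 = (∫⁻ u, H u) * φ ζ ^ 2 := by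
          intro ζ
          rw [lintegral_mul_const _ (by fun_prop), lintegral_sub_left_eq_self (fun u => H u) ζ]
        simp only [this]
        rw [lintegral_const_mul _ (by fun_prop)]
        ring

/-- Multiplication by a Schwartz function in weighted spaces of Fourier transforms. -/
theorem wSq_fourier_mulS_le {b : Plane → ℝ} (hbm : Measurable b) {C : ℝ} {N : ℕ}
    (hC : 0 ≤ C) (hb : ∀ x y, b (x + y) ≤ C * (1 + ‖x‖) ^ N * b y) (f h : 𝓢₂) :
    wSq b (𝓕 (mulS f h)) ≤ (ENNReal.ofReal C *
      ∫⁻ u, ENNReal.ofReal ((1 + ‖u‖) ^ N) * ‖(𝓕⁻ h : 𝓢₂) u‖ₑ) ^ 2 * wSq b (𝓕 f) := by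
  have hp : Measurable (𝓕⁻ h : 𝓢₂) := (𝓕⁻ h : 𝓢₂).continuous.measurable
  have hf : Measurable (𝓕 f : 𝓢₂) := (𝓕 f : 𝓢₂).continuous.measurable
  -- Multiplication by h is windowing by h at time zero, so `enorm_stft` takes the place of the
  -- convolution theorem.
  have hs : mulS f h = mulS f (shiftS 0 h) := by ext x; simp
  have h1 : ∀ ξ, ENNReal.ofReal (b ξ) * ‖𝓕 (mulS f h) ξ‖ₑ ≤
      ∫⁻ ζ, (ENNReal.ofReal C * (ENNReal.ofReal ((1 + ‖ζ - ξ‖) ^ N) * ‖(𝓕⁻ h : 𝓢₂) (ζ - ξ)‖ₑ)) *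
        (ENNReal.ofReal (b ζ) * ‖𝓕 f ζ‖ₑ) := by
    intro ξ
    rw [hs, show (𝓕 (mulS f (shiftS 0 h)) : 𝓢₂) ξ = stft h f 0 ξ from rfl, enorm_stft, neg_zero, stft,
      SchwartzMap.fourier_coe, Real.fourier_eq]
    calc _ ≤ ENNReal.ofReal (b ξ) * ∫⁻ ζ, ‖𝓕 f ζ‖ₑ * ‖(𝓕⁻ h : 𝓢₂) (ζ - ξ)‖ₑ := by
          gcongr
          refine (enorm_integral_le_lintegral_enorm _).trans (le_of_eq ?_)
          refine lintegral_congr fun ζ => ?_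
          simp [enorm_mul]
      _ = ∫⁻ ζ, ENNReal.ofReal (b ξ) * (‖𝓕 f ζ‖ₑ * ‖(𝓕⁻ h : 𝓢₂) (ζ - ξ)‖ₑ) := by
          rw [lintegral_const_mul' _ _ (by simp)]
      _ ≤ _ := by
          refine lintegral_mono fun ζ => ?_
          have h2 : ENNReal.ofReal (b ξ) ≤ ENNReal.ofReal C * ENNReal.ofReal ((1 + ‖ζ - ξ‖) ^ N) *
              ENNReal.ofReal (b ζ) := by
            rw [← ENNReal.ofReal_mul hC, ← ENNReal.ofReal_mul (by positivity)]
            exact ENNReal.ofReal_le_ofReal (IsModerate.sub_le hb ξ ζ)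
          calc _ ≤ (ENNReal.ofReal C * ENNReal.ofReal ((1 + ‖ζ - ξ‖) ^ N) *
              ENNReal.ofReal (b ζ)) * (‖𝓕 f ζ‖ₑ * ‖(𝓕⁻ h : 𝓢₂) (ζ - ξ)‖ₑ) := by gcongr
            _ = _ := by ring
  unfold wSq
  simp only [← mul_pow]
  refine (lintegral_mono fun ξ => pow_le_pow_left₀ bot_le (h1 ξ) 2).trans ?_
  refine (lintegral_sq_lintegral_mul_le (H := fun u => ENNReal.ofReal C *
    (ENNReal.ofReal ((1 + ‖u‖) ^ N) * ‖(𝓕⁻ h : 𝓢₂) u‖ₑ))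
    (φ := fun ζ => ENNReal.ofReal (b ζ) * ‖𝓕 f ζ‖ₑ) (by fun_prop) (by fun_prop)).trans ?_
  rw [lintegral_const_mul' _ _ (by simp)]

end Stft

/-! ### Symbols as multipliers and the exchange of weights -/

section StftEquivalence

local notation "𝓢₂" => SchwartzMap Plane ℂ

theorem IsModerate.inv {w : Plane → ℝ} (hpos : ∀ x, 0 < w x) (hw : IsModerate w) :
    IsModerate (fun x => (w x)⁻¹) := by
  obtain ⟨C, N, hC, h⟩ := hw
  refine ⟨C, N, hC, fun x y => ?_⟩
  have h1 := h (-x) (x + y)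
  rw [neg_add_cancel_left, norm_neg] at h1
  have hA := hpos y
  have hB := hpos (x + y)
  change (w (x + y))⁻¹ ≤ C * (1 + ‖x‖) ^ N * (w y)⁻¹
  rw [← div_eq_mul_inv, le_div_iff₀ hA, inv_mul_eq_div, div_le_iff₀ hB]
  exact h1

theorem isModerate_one : IsModerate (fun _ => 1) :=
  ⟨1, 0, zero_le_one, fun _ _ => by simp⟩

/-- Localizations of a symbol to translates of a window are bounded uniformly in the Schwartz
space, relative to the weight. -/
theorem IsSymbol.exists_seminorm_shift_le {w : Plane → ℝ} {a : Plane → ℂ} (hw0 : ∀ x, 0 ≤ w x)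
    (hw : IsModerate w) (ha : IsSymbol w a) (k : 𝓢₂) (q : Seminorm ℂ 𝓢₂) (hq : Continuous q) :
    ∃ C : ℝ, 0 ≤ C ∧ ∀ y, q (shiftS (-y) (SchwartzMap.smulLeftCLM ℂ a (shiftS y k))) ≤ C * w y := by
  have hat := ha.hasTemperateGrowth hw
  obtain ⟨s, C, -, hC⟩ := Seminorm.bound_of_continuous (schwartz_withSeminorms ℂ Plane ℂ) q hq
  obtain ⟨K, N, hK, hmod⟩ := hw
  choose A hA0 hA using ha.2
  have hsem : ∀ i : ℕ × ℕ, ∃ B : ℝ, 0 ≤ B ∧ ∀ y, SchwartzMap.seminorm ℂ i.1 i.2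
      (shiftS (-y) (SchwartzMap.smulLeftCLM ℂ a (shiftS y k))) ≤ B * w y := by
    rintro ⟨m, n⟩
    choose Q _ hQ using fun j => exists_seminorm_one_add_pow (E := Plane) (m + N) j
    have hQ0 : ∀ j, 0 ≤ Q j k := fun j => apply_nonneg _ _
    refine ⟨∑ i ∈ Finset.range (n + 1), (n.choose i : ℝ) * A i * K * Q (n - i) k,
      Finset.sum_nonneg fun i _ => by have := hA0 i; have := hQ0 (n - i); positivity, fun y => ?_⟩
    have hB : 0 ≤ ∑ i ∈ Finset.range (n + 1), (n.choose i : ℝ) * A i * K * Q (n - i) k :=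
      Finset.sum_nonneg fun i _ => by have := hA0 i; have := hQ0 (n - i); positivity
    refine SchwartzMap.seminorm_le_bound ℂ m n _ (mul_nonneg hB (hw0 y)) fun x => ?_
    have e : ⇑(shiftS (-y) (SchwartzMap.smulLeftCLM ℂ a (shiftS y k))) =
        fun x => a (x + y) * k x := by
      funext x
      simp [SchwartzMap.smulLeftCLM_apply_apply hat]
    rw [e]
    have hmul := norm_iteratedFDeriv_mul_le (𝕜 := ℝ) (n := n) (N := ∞) (f := fun x => a (x + y))
      (g := k) (ha.1.comp (contDiff_id.add contDiff_const)) (k.smooth ⊤) x (by exact_mod_cast le_top)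
    refine (mul_le_mul_of_nonneg_left hmul (by positivity)).trans ?_
    rw [Finset.mul_sum, Finset.sum_mul]
    refine Finset.sum_le_sum fun i _ => ?_
    rw [iteratedFDeriv_comp_add_right]
    have h1 : ‖iteratedFDeriv ℝ i a (x + y)‖ ≤ A i * (K * (1 + ‖x‖) ^ N * w y) :=
      (hA i _).trans (mul_le_mul_of_nonneg_left (hmod x y) (hA0 i))
    have h2 := hQ (n - i) k x
    calc _ ≤ (1 + ‖x‖) ^ m * ((n.choose i : ℝ) * (A i * (K * (1 + ‖x‖) ^ N * w y)) *
          ‖iteratedFDeriv ℝ (n - i) k x‖) := by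
          gcongr
          linarith [norm_nonneg x]
      _ = (n.choose i : ℝ) * A i * K * w y *
          ((1 + ‖x‖) ^ (m + N) * ‖iteratedFDeriv ℝ (n - i) k x‖) := by ring
      _ ≤ (n.choose i : ℝ) * A i * K * w y * Q (n - i) k := by
          have := hw0 y
          have := hA0 i
          gcongr
      _ = _ := by ring
  choose B hB0 hB using hsem
  refine ⟨C * ∑ i ∈ s, B i, mul_nonneg C.2 (Finset.sum_nonneg fun i _ => hB0 i), fun y => ?_⟩
  refine (hC _).trans ?_
  rw [mul_assoc]
  refine mul_le_mul_of_nonneg_left ?_ C.2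
  refine Seminorm.finset_sup_apply_le (mul_nonneg (Finset.sum_nonneg fun i _ => hB0 i) (hw0 y))
    fun i hi => (hB i y).trans ?_
  exact mul_le_mul_of_nonneg_right (Finset.single_le_sum (f := B) (fun i _ => hB0 i) hi) (hw0 y)

theorem enorm_fourierInv_shiftS (y : Plane) (h : 𝓢₂) (u : Plane) :
    ‖(𝓕⁻ (shiftS y h) : 𝓢₂) u‖ₑ = ‖(𝓕⁻ h : 𝓢₂) u‖ₑ := by
  have : (𝓕⁻ (shiftS y h) : 𝓢₂) u = (Real.fourierChar (inner ℝ y u) : ℂ) * (𝓕⁻ h : 𝓢₂) u := by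
    rw [SchwartzMap.fourierInv_coe, SchwartzMap.fourierInv_coe, Real.fourierInv_eq,
      Real.fourierInv_eq, ← integral_const_mul,
      ← integral_sub_right_eq_self (fun x => (Real.fourierChar (inner ℝ y u) : ℂ) *
        (Real.fourierChar (inner ℝ x u) • h x)) y]
    refine integral_congr_ae (Filter.Eventually.of_forall fun x => ?_)
    simp only [Circle.smul_def, smul_eq_mul, shiftS_apply]
    rw [← mul_assoc, ← Circle.coe_mul, ← AddChar.map_add_eq_mul, ← inner_add_left,
      add_sub_cancel]
  rw [this, enorm_mul, ← ofReal_norm, Circle.norm_coe]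
  simp

/-- Multiplication by a symbol costs a factor of the weight in the short-time Fourier transform. -/
theorem stftSq_mul_symbol_le {w b v : Plane → ℝ} {a : Plane → ℂ} (hw0 : ∀ x, 0 ≤ w x)
    (hw : IsModerate w) (ha : IsSymbol w a) (hbm : Measurable b) (hb : IsModerate b)
    (hv0 : ∀ x, 0 ≤ v x) (g k : 𝓢₂) :
    ∃ C : ℝ≥0, ∀ f : 𝓢₂, stftSq (mulS g k) v b (SchwartzMap.smulLeftCLM ℂ a f) ≤
      C * stftSq g (fun y => v y * w y) b f := by
  have hat := ha.hasTemperateGrowth hw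
  obtain ⟨C, N, hC, h⟩ := hb
  obtain ⟨q, hq, hle⟩ := lintegral_one_add_norm_pow_mul N
  let F : 𝓢₂ →L[ℂ] 𝓢₂ := FourierTransform.fourierInvCLM ℂ 𝓢₂
  obtain ⟨K, hK0, hK⟩ := ha.exists_seminorm_shift_le hw0 hw k (q.comp F.toLinearMap)
    (hq.comp F.continuous)
  refine ⟨(ENNReal.ofReal C * ENNReal.ofReal K).toNNReal ^ 2, fun f => ?_⟩
  have hCK : ENNReal.ofReal C * ENNReal.ofReal K ≠ ⊤ := ENNReal.mul_ne_top (by simp) (by simp)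
  rw [ENNReal.coe_pow, ENNReal.coe_toNNReal hCK]
  unfold stftSq
  rw [← lintegral_const_mul' _ _ (ENNReal.pow_ne_top hCK)]
  refine lintegral_mono fun y => ?_
  -- One factor of the window localizes f and the other localizes a. The localized symbol, moved
  -- back to the origin, is bounded in Schwartz space by a multiple of w y, so that multiplication
  -- by it is covered by the weighted Young inequality.
  have e : mulS (SchwartzMap.smulLeftCLM ℂ a f) (shiftS y (mulS g k)) =
      mulS (mulS f (shiftS y g)) (SchwartzMap.smulLeftCLM ℂ a (shiftS y k)) := by
    ext x
    simp [SchwartzMap.smulLeftCLM_apply_apply hat]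
    ring
  have h1 := wSq_fourier_mulS_le hbm hC h (mulS f (shiftS y g))
    (SchwartzMap.smulLeftCLM ℂ a (shiftS y k))
  have h2 : ∫⁻ u, ENNReal.ofReal ((1 + ‖u‖) ^ N) *
      ‖(𝓕⁻ (SchwartzMap.smulLeftCLM ℂ a (shiftS y k)) : 𝓢₂) u‖ₑ ≤
      ENNReal.ofReal K * ENNReal.ofReal (w y) := by
    rw [← ENNReal.ofReal_mul hK0]
    refine le_trans ?_ (ENNReal.ofReal_le_ofReal (hK y))
    refine le_trans (le_of_eq (lintegral_congr fun u => ?_)) (hle _)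
    change _ = _ * ‖(𝓕⁻ (shiftS (-y) (SchwartzMap.smulLeftCLM ℂ a (shiftS y k))) : 𝓢₂) u‖ₑ
    rw [enorm_fourierInv_shiftS]
  unfold stft
  rw [e, ENNReal.ofReal_mul (hv0 y)]
  calc _ ≤ ENNReal.ofReal (v y) ^ 2 * ((ENNReal.ofReal C * (ENNReal.ofReal K * ENNReal.ofReal (w y))) ^ 2 *
        wSq b (𝓕 (mulS f (shiftS y g)))) := by
        gcongr
        exact h1.trans (by gcongr)
    _ = _ := by ring

/-- Tonelli combined with the reflection of y that appears in `enorm_stft`; an even weight does not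
see it. -/
theorem lintegral_swap_neg {a b : Plane → ℝ≥0∞} {S : Plane × Plane → ℝ≥0∞} (ham : Measurable a)
    (hbm : Measurable b) (hS : Measurable S) (hat : ∀ x, a x ≠ ⊤) (hbt : ∀ x, b x ≠ ⊤)
    (hae : ∀ x, a (-x) = a x) :
    ∫⁻ y, a y * ∫⁻ ξ, b ξ * S (ξ, -y) = ∫⁻ ξ, b ξ * ∫⁻ y, a y * S (ξ, y) := by
  have h1 : ∀ y, a y * ∫⁻ ξ, b ξ * S (ξ, -y) = ∫⁻ ξ, a y * (b ξ * S (ξ, -y)) := fun y => by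
    rw [lintegral_const_mul' _ _ (hat y)]
  have hS' : Measurable (fun p : Plane × Plane => S (p.2, -p.1)) :=
    hS.comp (measurable_snd.prodMk measurable_fst.neg)
  simp only [h1]
  rw [lintegral_lintegral_swap ((ham.comp measurable_fst).mul
    ((hbm.comp measurable_snd).mul hS')).aemeasurable]
  refine lintegral_congr fun ξ => ?_
  rw [← lintegral_const_mul' _ _ (hbt ξ),
    ← lintegral_neg_eq_self (fun y => a y * (b ξ * S (ξ, -y)))]
  refine lintegral_congr fun y => ?_
  rw [neg_neg, hae]
  ring

/-- The weights change places when f is replaced by 𝓕 f. Each of them can thus be brought into the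
time variable, where multiplication by a symbol adds or removes it. -/
theorem stftSq_symm (k f : 𝓢₂) {a b : Plane → ℝ} (ham : Measurable a) (hbm : Measurable b)
    (hae : ∀ x, a (-x) = a x) : stftSq k a b f = stftSq (𝓕⁻ k) b a (𝓕 f) := by
  have hm := measurable_stft (𝓕⁻ k) (𝓕 f)
  have h := lintegral_swap_neg (a := fun y => ENNReal.ofReal (a y) ^ 2)
    (b := fun y => ENNReal.ofReal (b y) ^ 2)
    (S := fun p => ‖stft (𝓕⁻ k) (𝓕 f) p.1 p.2‖ₑ ^ 2) (ham.ennreal_ofReal.pow_const 2)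
    (hbm.ennreal_ofReal.pow_const 2) (hm.enorm.pow_const 2) (by simp) (by simp)
    (fun x => by rw [hae])
  unfold stftSq wSq
  refine Eq.trans (lintegral_congr fun y => ?_) h
  congr 1
  refine lintegral_congr fun ξ => ?_
  rw [enorm_stft]

theorem exists_schwartz_ne_zero : ∃ p : 𝓢₂, p ≠ 0 := by
  let χ : ContDiffBump (0 : Plane) := ⟨1, 2, by norm_num, by norm_num⟩
  have hs : ContDiff ℝ ∞ (fun x => (χ x : ℂ)) := Complex.ofRealCLM.contDiff.comp χ.contDiff
  have hc : HasCompactSupport (fun x => (χ x : ℂ)) :=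
    χ.hasCompactSupport.comp_left (g := Complex.ofReal) (by simp)
  refine ⟨hc.toSchwartzMap hs, fun h => ?_⟩
  have h1 : (hc.toSchwartzMap hs) 0 = (0 : 𝓢₂) 0 := by rw [h]
  have h2 : χ 0 = 1 := χ.one_of_mem_closedBall (by simp [χ])
  simp [h2] at h1

theorem mulS_self_ne_zero {p : 𝓢₂} (hp : p ≠ 0) : mulS p p ≠ 0 := by
  intro h
  apply hp
  ext x
  have h1 : mulS p p x = (0 : 𝓢₂) x := by rw [h]
  simpa using h1

theorem IsWeight.measurable {w : Plane → ℝ} (hw : IsWeight w) : Measurable w := by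
  have h := hw.symbol.1.continuous
  have : w = fun x => ((w x : ℂ)).re := by simp
  rw [this]
  exact (Complex.continuous_re.comp h).measurable

/-- Multiplication by a symbol of order zero is bounded in weighted spaces of Fourier transforms. -/
theorem wSq_fourier_symbol_le {b : Plane → ℝ} (hb : IsWeight b) {a : Plane → ℂ}
    (ha : IsSymbol (fun _ => 1) a) :
    ∃ C : ℝ≥0, ∀ f : 𝓢₂, wSq b (𝓕 (SchwartzMap.smulLeftCLM ℂ a f)) ≤ C * wSq b (𝓕 f) := by
  obtain ⟨p, hp⟩ := exists_schwartz_ne_zero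
  -- The window is a product because `stftSq_mul_symbol_le` uses up one of its factors.
  obtain ⟨C₁, h₁⟩ := le_stftSq_one (mulS p p) (mulS_self_ne_zero hp) hb.measurable hb.moderate
  obtain ⟨C₂, h₂⟩ := stftSq_mul_symbol_le (v := fun _ => 1) (fun _ => zero_le_one) isModerate_one ha
    hb.measurable hb.moderate (fun _ => zero_le_one) p p
  obtain ⟨C₃, h₃⟩ := stftSq_one_le p hb.measurable hb.moderate
  refine ⟨C₁ * (C₂ * C₃), fun f => (h₁ _).trans ?_⟩
  push_cast
  rw [mul_assoc, mul_assoc]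
  gcongr
  refine (h₂ f).trans ?_
  gcongr
  simpa using h₃ f

/-- Weights in time and in frequency may be interchanged. -/
theorem wSq_swap {a b : Plane → ℝ} (ha : IsWeight a) (hb : IsWeight b) :
    ∃ C : ℝ≥0, ∀ f : 𝓢₂,
      wSq b (𝓕 (SchwartzMap.smulLeftCLM ℂ (fun x => (a x : ℂ)) f)) ≤
        C * wSq a (𝓕 (SchwartzMap.smulLeftCLM ℂ (fun x => (b x : ℂ)) (𝓕 f))) := by
  obtain ⟨p, hp⟩ := exists_schwartz_ne_zero
  -- Two multiplications occur, by a on the side of f and by b⁻¹ on the side of 𝓕 f, and both need a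
  -- window of product form. The first uses k · k and leaves k; choosing k = 𝓕(p · p) makes the
  -- window after the exchange the product p · p.
  set P := mulS p p with hP
  set k : 𝓢₂ := 𝓕 P with hk
  have hkP : (𝓕⁻ k : 𝓢₂) = P := by rw [hk, FourierTransform.fourierInv_fourier_eq]
  have hk0 : k ≠ 0 := by
    intro h0
    apply mulS_self_ne_zero hp
    rw [← hP, ← hkP, h0]
    exact (FourierTransform.fourierInvCLM ℂ 𝓢₂).map_zero
  obtain ⟨C₁, h₁⟩ := le_stftSq_one (mulS k k) (mulS_self_ne_zero hk0) hb.measurable hb.moderate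
  obtain ⟨C₂, h₂⟩ := stftSq_mul_symbol_le (v := fun _ => 1) (fun x => (ha.pos x).le) ha.moderate
    ha.symbol hb.measurable hb.moderate (fun _ => zero_le_one) k k
  obtain ⟨C₃, h₃⟩ := stftSq_mul_symbol_le (v := b) (fun x => (inv_pos.2 (hb.pos x)).le)
    (hb.moderate.inv hb.pos) hb.symbol_inv ha.measurable ha.moderate (fun x => (hb.pos x).le) p p
  obtain ⟨C₄, h₄⟩ := stftSq_one_le p ha.measurable ha.moderate
  refine ⟨C₁ * (C₂ * (C₃ * C₄)), fun f => (h₁ _).trans ?_⟩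
  push_cast
  rw [mul_assoc, mul_assoc, mul_assoc]
  gcongr
  refine (h₂ f).trans ?_
  gcongr
  simp only [one_mul]
  rw [show (fun y => a y) = a from rfl, stftSq_symm k f ha.measurable hb.measurable ha.even, hkP]
  have hbt := hb.symbol.hasTemperateGrowth hb.moderate
  have hbt' := hb.symbol_inv.hasTemperateGrowth (hb.moderate.inv hb.pos)
  -- Multiplication by the symbol b⁻¹ cancels the time weight b. This leaves the transform of b 𝓕 f
  -- without a time weight, to which `stftSq_one_le` applies.
  have e : (𝓕 f : 𝓢₂) = SchwartzMap.smulLeftCLM ℂ (fun x => ((b x)⁻¹ : ℂ))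
      (SchwartzMap.smulLeftCLM ℂ (fun x => (b x : ℂ)) (𝓕 f)) := by
    ext x
    rw [SchwartzMap.smulLeftCLM_apply_apply hbt', SchwartzMap.smulLeftCLM_apply_apply hbt]
    have : (b x : ℂ) ≠ 0 := by exact_mod_cast (hb.pos x).ne'
    simp only [smul_eq_mul]
    field_simp
  rw [e]
  refine (h₃ _).trans ?_
  gcongr
  have e2 : (fun y => b y * (b y)⁻¹) = fun _ => 1 := by
    funext y; exact mul_inv_cancel₀ (hb.pos y).ne'
  rw [e2]
  refine (h₄ _).trans ?_
  rw [← e]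

end StftEquivalence

/-! ### L² norms of tempered distributions and extension of bounds by density -/

section TemperedL2

local notation "𝓢₂" => SchwartzMap Plane ℂ
local notation "𝓓₂" => TemperedDistribution Plane ℂ
local notation "𝓛₂" => Lp ℂ 2 (volume : Measure Plane)

/-- The distribution given by a Schwartz function. -/
abbrev ofS (f : 𝓢₂) : 𝓓₂ := SchwartzMap.toTemperedDistributionCLM Plane ℂ volume f

/-- The `L²` norm of a tempered distribution, `⊤` if it is not given by an `L²` function. -/
def l2Norm (u : 𝓓₂) : ℝ≥0∞ :=
  ⨅ (g : 𝓛₂) (_ : u = MeasureTheory.Lp.toTemperedDistribution g), ‖g‖ₑ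

theorem toTemperedDistribution_injective :
    Function.Injective (MeasureTheory.Lp.toTemperedDistribution : 𝓛₂ → 𝓓₂) :=
  LinearMap.ker_eq_bot.1 (MeasureTheory.Lp.ker_toTemperedDistributionCLM_eq_bot (F := ℂ)
    (μ := (volume : Measure Plane)) (p := 2))

@[simp] theorem l2Norm_toTemperedDistribution (g : 𝓛₂) :
    l2Norm (MeasureTheory.Lp.toTemperedDistribution g) = ‖g‖ₑ := by
  refine le_antisymm (iInf₂_le (f := fun (h : 𝓛₂) (_ : _ = MeasureTheory.Lp.toTemperedDistribution h) =>
    ‖h‖ₑ) g rfl) (le_iInf₂ fun h hh => ?_)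
  rw [toTemperedDistribution_injective hh]

theorem l2Norm_lt_top_iff {u : 𝓓₂} :
    l2Norm u < ⊤ ↔ ∃ g : 𝓛₂, u = MeasureTheory.Lp.toTemperedDistribution g := by
  simp [l2Norm, iInf_lt_iff]

theorem l2Norm_ofS (f : 𝓢₂) : l2Norm (ofS f) = ‖f.toLp 2 volume‖ₑ := by
  rw [ofS, ← MeasureTheory.Lp.toTemperedDistribution_toLp_eq (p := 2), l2Norm_toTemperedDistribution]

theorem l2Norm_add_le (u v : 𝓓₂) : l2Norm (u + v) ≤ l2Norm u + l2Norm v := by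
  by_cases hu : l2Norm u = ⊤
  · simp [hu]
  by_cases hv : l2Norm v = ⊤
  · simp [hv]
  obtain ⟨g, rfl⟩ := l2Norm_lt_top_iff.1 (lt_top_iff_ne_top.2 hu)
  obtain ⟨h, rfl⟩ := l2Norm_lt_top_iff.1 (lt_top_iff_ne_top.2 hv)
  have : MeasureTheory.Lp.toTemperedDistribution g + MeasureTheory.Lp.toTemperedDistribution h =
      MeasureTheory.Lp.toTemperedDistribution (g + h) :=
    (map_add (MeasureTheory.Lp.toTemperedDistributionCLM ℂ (volume : Measure Plane) 2) g h).symm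
  rw [this]
  simpa using enorm_add_le g h

theorem denseRange_toLp : DenseRange (SchwartzMap.toLpCLM ℂ ℂ 2 (volume : Measure Plane)) :=
  SchwartzMap.denseRange_toLpCLM (F := ℂ) (μ := (volume : Measure Plane)) (p := 2) (by simp)

/-- An operator on tempered distributions that is bounded in `L²` on Schwartz functions is bounded
in `L²`. -/
theorem l2Norm_map_le (T : 𝓓₂ →L[ℂ] 𝓓₂) (S : 𝓢₂ →ₗ[ℂ] 𝓢₂) (hTS : ∀ f, T (ofS f) = ofS (S f))
    (h : ∃ C : ℝ≥0, ∀ f, ‖(S f).toLp 2 volume‖ₑ ≤ C * ‖f.toLp 2 (volume : Measure Plane)‖ₑ) :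
    ∃ C : ℝ≥0, ∀ u, l2Norm (T u) ≤ C * l2Norm u := by
  obtain ⟨C, hC⟩ := h
  -- A nonzero constant makes the bound trivial where the norm of u is `⊤`, since `0 * ⊤ = 0`.
  refine ⟨C + 1, fun u => ?_⟩
  by_cases hu : l2Norm u = ⊤
  · rw [hu, ENNReal.mul_top (by simp)]; exact le_top
  obtain ⟨g, rfl⟩ := l2Norm_lt_top_iff.1 (lt_top_iff_ne_top.2 hu)
  set e : 𝓢₂ →ₗ[ℂ] 𝓛₂ := (SchwartzMap.toLpCLM ℂ ℂ 2 (volume : Measure Plane)).toLinearMap with he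
  have hden : DenseRange e := denseRange_toLp
  have hb : ∀ f, ‖(e ∘ₗ S) f‖ ≤ C * ‖e f‖ := by
    intro f
    have := hC f
    rwa [← ofReal_norm, ← ofReal_norm, ← ENNReal.ofReal_coe_nnreal,
      ← ENNReal.ofReal_mul C.coe_nonneg, ENNReal.ofReal_le_ofReal_iff (by positivity)] at this
  set X := (e ∘ₗ S).extendOfNorm e with hX
  have hXe : ∀ f, X (e f) = e (S f) := fun f => LinearMap.extendOfNorm_eq hden ⟨C, hb⟩ f
  have hXn : ‖X g‖ ≤ C * ‖g‖ := LinearMap.norm_extendOfNorm_apply_le hden C hb g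
  -- Both sides are continuous from L² into the tempered distributions and agree on the dense set of
  -- Schwartz functions; hence T is given on all of L² by the bounded extension X.
  have key : (fun g : 𝓛₂ => T (MeasureTheory.Lp.toTemperedDistributionCLM ℂ (volume : Measure Plane) 2 g)) =
      fun g => MeasureTheory.Lp.toTemperedDistributionCLM ℂ (volume : Measure Plane) 2 (X g) := by
    refine DenseRange.equalizer hden (by fun_prop) (by fun_prop) ?_
    funext f
    simp only [Function.comp_apply, hXe]
    have h1 := hTS f
    rw [ofS, ofS, ← MeasureTheory.Lp.toTemperedDistribution_toLp_eq (p := 2),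
      ← MeasureTheory.Lp.toTemperedDistribution_toLp_eq (p := 2)] at h1
    exact h1
  have := congrFun key g
  simp only [MeasureTheory.Lp.toTemperedDistributionCLM_apply] at this
  rw [this, l2Norm_toTemperedDistribution, l2Norm_toTemperedDistribution]
  have h2 : ‖X g‖ₑ ≤ C * ‖g‖ₑ := by
    rw [← ofReal_norm, ← ofReal_norm, ← ENNReal.ofReal_coe_nnreal,
      ← ENNReal.ofReal_mul C.coe_nonneg]
    exact ENNReal.ofReal_le_ofReal hXn
  refine h2.trans ?_
  gcongr
  simp

/-- Multiplication of distributions by a function. -/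
abbrev mulD (a : Plane → ℂ) : 𝓓₂ →L[ℂ] 𝓓₂ := TemperedDistribution.smulLeftCLM ℂ a

/-- Multiplication of Schwartz functions by a function. -/
abbrev mulF (a : Plane → ℂ) : 𝓢₂ →L[ℂ] 𝓢₂ := SchwartzMap.smulLeftCLM ℂ a

theorem mulD_ofS {a : Plane → ℂ} (ha : a.HasTemperateGrowth) (f : 𝓢₂) :
    mulD a (ofS f) = ofS (mulF a f) := by
  ext η
  rw [mulD, TemperedDistribution.smulLeftCLM_apply_apply]
  simp only [ofS, SchwartzMap.toTemperedDistributionCLM_apply_apply, mulF,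
    SchwartzMap.smulLeftCLM_apply_apply ha, smul_eq_mul]
  congr 1; funext x; ring

theorem fourier_ofS (f : 𝓢₂) : 𝓕 (ofS f) = ofS (𝓕 f) :=
  TemperedDistribution.fourier_toTemperedDistributionCLM_eq f

theorem fourierInv_ofS (f : 𝓢₂) : 𝓕⁻ (ofS f) = ofS (𝓕⁻ f) :=
  TemperedDistribution.fourierInv_toTemperedDistributionCLM_eq f

theorem mulD_mulD {a b : Plane → ℂ} (ha : a.HasTemperateGrowth) (hb : b.HasTemperateGrowth) (u : 𝓓₂) :
    mulD a (mulD b u) = mulD (fun x => a x * b x) u := by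
  rw [mulD, mulD, TemperedDistribution.smulLeftCLM_smulLeftCLM_apply hb ha]
  congr 2
  funext x
  simp [mul_comm]

theorem mulD_one (u : 𝓓₂) : mulD (fun _ => 1) u = u := by
  rw [mulD, TemperedDistribution.smulLeftCLM_const, one_smul]

theorem mulD_inv_cancel {a b : Plane → ℂ} (ha : a.HasTemperateGrowth) (hb : b.HasTemperateGrowth)
    (h : ∀ x, a x * b x = 1) (u : 𝓓₂) : mulD a (mulD b u) = u := by
  rw [mulD_mulD ha hb, show (fun x => a x * b x) = fun _ => 1 from funext h, mulD_one]

theorem wSq_eq_enorm_toLp {b : Plane → ℝ} (hb0 : ∀ x, 0 ≤ b x)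
    (hb : Function.HasTemperateGrowth (fun x => (b x : ℂ))) (f : 𝓢₂) :
    wSq b f = ‖(mulF (fun x => (b x : ℂ)) f).toLp 2 volume‖ₑ ^ 2 := by
  rw [← lintegral_enorm_sq_eq_enorm_toLp, wSq]
  refine lintegral_congr fun x => ?_
  rw [mulF, SchwartzMap.smulLeftCLM_apply_apply hb, smul_eq_mul, enorm_mul, mul_pow,
    ← ofReal_norm (b x : ℂ), Complex.norm_of_nonneg (hb0 x)]

theorem IsWeight.hasTemperateGrowth {a : Plane → ℝ} (ha : IsWeight a) :
    Function.HasTemperateGrowth (fun x => (a x : ℂ)) :=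
  ha.symbol.hasTemperateGrowth ha.moderate

theorem IsWeight.hasTemperateGrowth_inv {a : Plane → ℝ} (ha : IsWeight a) :
    Function.HasTemperateGrowth (fun x => ((a x)⁻¹ : ℂ)) :=
  ha.symbol_inv.hasTemperateGrowth (ha.moderate.inv ha.pos)

theorem IsWeight.mul_inv {a : Plane → ℝ} (ha : IsWeight a) (x : Plane) :
    (a x : ℂ) * ((a x)⁻¹ : ℂ) = 1 :=
  mul_inv_cancel₀ (by exact_mod_cast (ha.pos x).ne')

theorem IsWeight.inv_mul {a : Plane → ℝ} (ha : IsWeight a) (x : Plane) :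
    ((a x)⁻¹ : ℂ) * (a x : ℂ) = 1 :=
  inv_mul_cancel₀ (by exact_mod_cast (ha.pos x).ne')

theorem enorm_le_of_sq_le {x y : ℝ≥0∞} {C : ℝ≥0} (h : x ^ 2 ≤ C * y ^ 2) :
    x ≤ (NNReal.sqrt C) * y := by
  have : x ^ 2 ≤ (NNReal.sqrt C * y) ^ 2 := by
    rw [mul_pow, ← ENNReal.coe_pow, NNReal.sq_sqrt]; exact h
  exact (ENNReal.pow_le_pow_left_iff (n := 2) (by norm_num)).1 this

/-- Multiplication by a symbol of order zero is bounded in Bessel potential spaces. -/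
theorem l2Norm_fourier_symbol_le {b : Plane → ℝ} (hb : IsWeight b) {a : Plane → ℂ}
    (ha : IsSymbol (fun _ => 1) a) :
    ∃ C : ℝ≥0, ∀ u : 𝓓₂, l2Norm (mulD (fun x => (b x : ℂ)) (𝓕 (mulD a u))) ≤
      C * l2Norm (mulD (fun x => (b x : ℂ)) (𝓕 u)) := by
  have hat := ha.hasTemperateGrowth isModerate_one
  have hbt := hb.hasTemperateGrowth
  have hbi := hb.hasTemperateGrowth_inv
  -- Conjugation with the weight and the Fourier transform turns the bound between weighted norms
  -- into a bound on L².
  let T : 𝓓₂ →L[ℂ] 𝓓₂ := mulD (fun x => (b x : ℂ)) ∘L FourierTransform.fourierCLM ℂ 𝓓₂ ∘L mulD a ∘L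
    FourierTransform.fourierInvCLM ℂ 𝓓₂ ∘L mulD (fun x => ((b x)⁻¹ : ℂ))
  let S : 𝓢₂ →L[ℂ] 𝓢₂ := mulF (fun x => (b x : ℂ)) ∘L FourierTransform.fourierCLM ℂ 𝓢₂ ∘L mulF a ∘L
    FourierTransform.fourierInvCLM ℂ 𝓢₂ ∘L mulF (fun x => ((b x)⁻¹ : ℂ))
  have hTS : ∀ f, T (ofS f) = ofS (S f) := by
    intro f
    change mulD (fun x => (b x : ℂ)) (𝓕 (mulD a (𝓕⁻ (mulD (fun x => ((b x)⁻¹ : ℂ)) (ofS f))))) = _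
    rw [mulD_ofS hbi, fourierInv_ofS, mulD_ofS hat, fourier_ofS, mulD_ofS hbt]
    rfl
  obtain ⟨C, hC⟩ := wSq_fourier_symbol_le hb ha
  obtain ⟨K, hK⟩ := l2Norm_map_le T S.toLinearMap hTS ⟨NNReal.sqrt C, fun f => by
    apply enorm_le_of_sq_le
    have h1 := hC (𝓕⁻ (mulF (fun x => ((b x)⁻¹ : ℂ)) f))
    rw [FourierTransform.fourier_fourierInv_eq, wSq_eq_enorm_toLp (fun x => (hb.pos x).le) hbt,
      wSq_eq_enorm_toLp (fun x => (hb.pos x).le) hbt] at h1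
    have h2 : mulF (fun x => (b x : ℂ)) (mulF (fun x => ((b x)⁻¹ : ℂ)) f) = f := by
      ext x
      simp only [mulF, SchwartzMap.smulLeftCLM_apply_apply hbt,
        SchwartzMap.smulLeftCLM_apply_apply hbi, smul_eq_mul]
      rw [← mul_assoc, hb.mul_inv, one_mul]
    rw [h2] at h1
    exact h1⟩
  refine ⟨K, fun u => ?_⟩
  have h1 := hK (mulD (fun x => (b x : ℂ)) (𝓕 u))
  have h2 : T (mulD (fun x => (b x : ℂ)) (𝓕 u)) = mulD (fun x => (b x : ℂ)) (𝓕 (mulD a u)) := by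
    change mulD (fun x => (b x : ℂ)) (𝓕 (mulD a (𝓕⁻ (mulD (fun x => ((b x)⁻¹ : ℂ))
      (mulD (fun x => (b x : ℂ)) (𝓕 u)))))) = _
    rw [mulD_inv_cancel hbi hbt hb.inv_mul, FourierTransform.fourierInv_fourier_eq]
  rwa [h2] at h1

/-- The square of the Fourier transform is the reflection at the origin, to which even weights are
blind. -/
theorem wSq_fourier_fourier_fourier {a b : Plane → ℝ} (ha : IsWeight a) (hb : IsWeight b) (f : 𝓢₂) :
    wSq b (𝓕 (mulF (fun x => (a x : ℂ)) (𝓕 (𝓕 f)))) = wSq b (𝓕 (mulF (fun x => (a x : ℂ)) f)) := by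
  have hneg : ∀ (g : 𝓢₂) x, (𝓕 g : 𝓢₂) (-x) = (𝓕⁻ g : 𝓢₂) x := by
    intro g x
    rw [SchwartzMap.fourier_coe, SchwartzMap.fourierInv_coe, Real.fourierInv_eq_fourier_neg]
  have hff : ∀ x, (𝓕 (𝓕 f) : 𝓢₂) x = f (-x) := by
    intro x
    rw [← neg_neg x, hneg, FourierTransform.fourierInv_fourier_eq, neg_neg]
  have key : ∀ ξ, (𝓕 (mulF (fun x => (a x : ℂ)) (𝓕 (𝓕 f))) : 𝓢₂) ξ =
      (𝓕 (mulF (fun x => (a x : ℂ)) f) : 𝓢₂) (-ξ) := by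
    intro ξ
    rw [hneg, SchwartzMap.fourier_coe, SchwartzMap.fourierInv_coe, Real.fourier_eq,
      Real.fourierInv_eq, ← integral_neg_eq_self]
    refine integral_congr_ae (Filter.Eventually.of_forall fun x => ?_)
    simp only [mulF, SchwartzMap.smulLeftCLM_apply_apply ha.hasTemperateGrowth, hff, neg_neg, ha.even,
      inner_neg_left]
  unfold wSq
  rw [← lintegral_neg_eq_self]
  refine lintegral_congr fun ξ => ?_
  rw [key, neg_neg, hb.even]

/-- The operator `T` undoes the right-hand expression and then applies the left-hand one. Its L²
bound on Schwartz functions is `wSq_swap`, and `l2Norm_map_le` extends it to distributions. -/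
theorem l2Norm_swap_le {a b : Plane → ℝ} (ha : IsWeight a) (hb : IsWeight b) :
    ∃ C : ℝ≥0, ∀ u : 𝓓₂,
      l2Norm (mulD (fun x => (b x : ℂ)) (𝓕 (mulD (fun x => (a x : ℂ)) u))) ≤
        C * l2Norm (mulD (fun x => (a x : ℂ)) (𝓕 (mulD (fun x => (b x : ℂ)) (𝓕 u)))) := by
  have hat := ha.hasTemperateGrowth
  have hai := ha.hasTemperateGrowth_inv
  have hbt := hb.hasTemperateGrowth
  have hbi := hb.hasTemperateGrowth_inv
  let T : 𝓓₂ →L[ℂ] 𝓓₂ := mulD (fun x => (b x : ℂ)) ∘L FourierTransform.fourierCLM ℂ 𝓓₂ ∘L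
    mulD (fun x => (a x : ℂ)) ∘L FourierTransform.fourierInvCLM ℂ 𝓓₂ ∘L mulD (fun x => ((b x)⁻¹ : ℂ)) ∘L
    FourierTransform.fourierInvCLM ℂ 𝓓₂ ∘L mulD (fun x => ((a x)⁻¹ : ℂ))
  let S : 𝓢₂ →L[ℂ] 𝓢₂ := mulF (fun x => (b x : ℂ)) ∘L FourierTransform.fourierCLM ℂ 𝓢₂ ∘L
    mulF (fun x => (a x : ℂ)) ∘L FourierTransform.fourierInvCLM ℂ 𝓢₂ ∘L mulF (fun x => ((b x)⁻¹ : ℂ)) ∘L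
    FourierTransform.fourierInvCLM ℂ 𝓢₂ ∘L mulF (fun x => ((a x)⁻¹ : ℂ))
  have hTS : ∀ f, T (ofS f) = ofS (S f) := by
    intro f
    change mulD (fun x => (b x : ℂ)) (𝓕 (mulD (fun x => (a x : ℂ)) (𝓕⁻ (mulD (fun x => ((b x)⁻¹ : ℂ))
      (𝓕⁻ (mulD (fun x => ((a x)⁻¹ : ℂ)) (ofS f))))))) = _
    rw [mulD_ofS hai, fourierInv_ofS, mulD_ofS hbi, fourierInv_ofS, mulD_ofS hat, fourier_ofS,
      mulD_ofS hbt]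
    rfl
  have hF : ∀ {c : Plane → ℝ} (_ : IsWeight c) (f : 𝓢₂),
      mulF (fun x => (c x : ℂ)) (mulF (fun x => ((c x)⁻¹ : ℂ)) f) = f := by
    intro c hc f
    ext x
    simp only [mulF, SchwartzMap.smulLeftCLM_apply_apply hc.hasTemperateGrowth,
      SchwartzMap.smulLeftCLM_apply_apply hc.hasTemperateGrowth_inv, smul_eq_mul]
    rw [← mul_assoc, hc.mul_inv, one_mul]
  obtain ⟨C, hC⟩ := wSq_swap ha hb
  obtain ⟨K, hK⟩ := l2Norm_map_le T S.toLinearMap hTS ⟨NNReal.sqrt C, fun f => by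
    apply enorm_le_of_sq_le
    have h1 := hC (𝓕⁻ (mulF (fun x => ((b x)⁻¹ : ℂ)) (𝓕⁻ (mulF (fun x => ((a x)⁻¹ : ℂ)) f))))
    rw [FourierTransform.fourier_fourierInv_eq, ← mulF, ← mulF, hF hb,
      FourierTransform.fourier_fourierInv_eq,
      wSq_eq_enorm_toLp (fun x => (hb.pos x).le) hbt,
      wSq_eq_enorm_toLp (fun x => (ha.pos x).le) hat, hF ha] at h1
    exact h1⟩
  refine ⟨K, fun u => ?_⟩
  have h1 := hK (mulD (fun x => (a x : ℂ)) (𝓕 (mulD (fun x => (b x : ℂ)) (𝓕 u))))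
  have h2 : T (mulD (fun x => (a x : ℂ)) (𝓕 (mulD (fun x => (b x : ℂ)) (𝓕 u)))) =
      mulD (fun x => (b x : ℂ)) (𝓕 (mulD (fun x => (a x : ℂ)) u)) := by
    change mulD (fun x => (b x : ℂ)) (𝓕 (mulD (fun x => (a x : ℂ)) (𝓕⁻ (mulD (fun x => ((b x)⁻¹ : ℂ))
      (𝓕⁻ (mulD (fun x => ((a x)⁻¹ : ℂ)) (mulD (fun x => (a x : ℂ)) (𝓕 (mulD (fun x => (b x : ℂ)) (𝓕 u))))))))))
      = _
    rw [mulD_inv_cancel hai hat ha.inv_mul, FourierTransform.fourierInv_fourier_eq,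
      mulD_inv_cancel hbi hbt hb.inv_mul, FourierTransform.fourierInv_fourier_eq]
  rwa [h2] at h1

/-- This too is `wSq_swap`, with the two weights interchanged and with 𝓕 u as the function; the
superfluous double Fourier transform is removed by `wSq_fourier_fourier_fourier`. -/
theorem le_l2Norm_swap {a b : Plane → ℝ} (ha : IsWeight a) (hb : IsWeight b) :
    ∃ C : ℝ≥0, ∀ u : 𝓓₂,
      l2Norm (mulD (fun x => (a x : ℂ)) (𝓕 (mulD (fun x => (b x : ℂ)) (𝓕 u)))) ≤
      C * l2Norm (mulD (fun x => (b x : ℂ)) (𝓕 (mulD (fun x => (a x : ℂ)) u))) := by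
  have hat := ha.hasTemperateGrowth
  have hai := ha.hasTemperateGrowth_inv
  have hbt := hb.hasTemperateGrowth
  have hbi := hb.hasTemperateGrowth_inv
  let T : 𝓓₂ →L[ℂ] 𝓓₂ := mulD (fun x => (a x : ℂ)) ∘L FourierTransform.fourierCLM ℂ 𝓓₂ ∘L
    mulD (fun x => (b x : ℂ)) ∘L FourierTransform.fourierCLM ℂ 𝓓₂ ∘L mulD (fun x => ((a x)⁻¹ : ℂ)) ∘L
    FourierTransform.fourierInvCLM ℂ 𝓓₂ ∘L mulD (fun x => ((b x)⁻¹ : ℂ))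
  let S : 𝓢₂ →L[ℂ] 𝓢₂ := mulF (fun x => (a x : ℂ)) ∘L FourierTransform.fourierCLM ℂ 𝓢₂ ∘L
    mulF (fun x => (b x : ℂ)) ∘L FourierTransform.fourierCLM ℂ 𝓢₂ ∘L mulF (fun x => ((a x)⁻¹ : ℂ)) ∘L
    FourierTransform.fourierInvCLM ℂ 𝓢₂ ∘L mulF (fun x => ((b x)⁻¹ : ℂ))
  have hTS : ∀ f, T (ofS f) = ofS (S f) := by
    intro f
    change mulD (fun x => (a x : ℂ)) (𝓕 (mulD (fun x => (b x : ℂ)) (𝓕 (mulD (fun x => ((a x)⁻¹ : ℂ))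
      (𝓕⁻ (mulD (fun x => ((b x)⁻¹ : ℂ)) (ofS f))))))) = _
    rw [mulD_ofS hbi, fourierInv_ofS, mulD_ofS hai, fourier_ofS, mulD_ofS hbt, fourier_ofS,
      mulD_ofS hat]
    rfl
  have hF : ∀ {c : Plane → ℝ} (_ : IsWeight c) (f : 𝓢₂),
      mulF (fun x => (c x : ℂ)) (mulF (fun x => ((c x)⁻¹ : ℂ)) f) = f := by
    intro c hc f
    ext x
    simp only [mulF, SchwartzMap.smulLeftCLM_apply_apply hc.hasTemperateGrowth,
      SchwartzMap.smulLeftCLM_apply_apply hc.hasTemperateGrowth_inv, smul_eq_mul]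
    rw [← mul_assoc, hc.mul_inv, one_mul]
  obtain ⟨C, hC⟩ := wSq_swap hb ha
  obtain ⟨K, hK⟩ := l2Norm_map_le T S.toLinearMap hTS ⟨NNReal.sqrt C, fun f => by
    apply enorm_le_of_sq_le
    have h1 := hC (𝓕 (mulF (fun x => ((a x)⁻¹ : ℂ)) (𝓕⁻ (mulF (fun x => ((b x)⁻¹ : ℂ)) f))))
    rw [← mulF, ← mulF, wSq_fourier_fourier_fourier ha hb, hF ha,
      FourierTransform.fourier_fourierInv_eq,
      wSq_eq_enorm_toLp (fun x => (hb.pos x).le) hbt,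
      wSq_eq_enorm_toLp (fun x => (ha.pos x).le) hat, hF hb] at h1
    exact h1⟩
  refine ⟨K, fun u => ?_⟩
  have h1 := hK (mulD (fun x => (b x : ℂ)) (𝓕 (mulD (fun x => (a x : ℂ)) u)))
  have h2 : T (mulD (fun x => (b x : ℂ)) (𝓕 (mulD (fun x => (a x : ℂ)) u))) =
      mulD (fun x => (a x : ℂ)) (𝓕 (mulD (fun x => (b x : ℂ)) (𝓕 u))) := by
    change mulD (fun x => (a x : ℂ)) (𝓕 (mulD (fun x => (b x : ℂ)) (𝓕 (mulD (fun x => ((a x)⁻¹ : ℂ))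
      (𝓕⁻ (mulD (fun x => ((b x)⁻¹ : ℂ)) (mulD (fun x => (b x : ℂ)) (𝓕 (mulD (fun x => (a x : ℂ)) u)))))))))
      = _
    rw [mulD_inv_cancel hbi hbt hb.inv_mul, FourierTransform.fourierInv_fourier_eq,
      mulD_inv_cancel hai hat ha.inv_mul]
  rwa [h2] at h1

/-- The `L²` norm of a distribution given by a locally integrable function. -/
theorem l2Norm_sq_eq_lintegral {u : 𝓓₂} {f : Plane → ℂ} (hf : LocallyIntegrable f)
    (h : ∀ η : 𝓢₂, HasCompactSupport η → u η = ∫ x, η x * f x) :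
    l2Norm u ^ 2 = ∫⁻ x, ‖f x‖ₑ ^ 2 := by
  have hnorm : ∀ g : 𝓛₂, ‖g‖ₑ ^ 2 = ∫⁻ x, ‖g x‖ₑ ^ 2 := by
    intro g
    rw [Lp.enorm_def, eLpNorm_eq_lintegral_rpow_enorm_toReal (by norm_num) (by norm_num),
      ← ENNReal.rpow_natCast, ← ENNReal.rpow_mul]
    simp
  -- The fundamental lemma of the calculus of variations: a representing L² function must agree with
  -- f almost everywhere.
  have hge : ∀ g : 𝓛₂, u = MeasureTheory.Lp.toTemperedDistribution g → ∀ᵐ x, f x = g x := by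
    intro g hg
    refine ae_eq_of_integral_contDiff_smul_eq hf ((Lp.memLp g).locallyIntegrable (by norm_num))
      fun k hk hkc => ?_
    have hk1 : HasCompactSupport (Complex.ofRealCLM ∘ k) := hkc.comp_left rfl
    have hk2 : ContDiff ℝ ∞ (Complex.ofRealCLM ∘ k) := by fun_prop
    have h1 := h (hk1.toSchwartzMap hk2) hk1
    rw [hg] at h1
    simp only [MeasureTheory.Lp.toTemperedDistribution_apply] at h1
    simpa using h1.symm
  by_cases hfin : ∫⁻ x, ‖f x‖ₑ ^ 2 = ⊤
  · have : l2Norm u = ⊤ := by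
      by_contra hne
      obtain ⟨g, hg⟩ := l2Norm_lt_top_iff.1 (lt_top_iff_ne_top.2 hne)
      have h1 := hge g hg
      have h2 : ∫⁻ x, ‖f x‖ₑ ^ 2 = ∫⁻ x, ‖g x‖ₑ ^ 2 :=
        lintegral_congr_ae (by filter_upwards [h1] with x hx; rw [hx])
      rw [h2, ← hnorm] at hfin
      simp at hfin
    rw [this, hfin]; simp
  · have hm : MemLp f 2 (volume : Measure Plane) := by
      refine ⟨hf.aestronglyMeasurable, ?_⟩
      rw [eLpNorm_eq_lintegral_rpow_enorm_toReal (by norm_num) (by norm_num)]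
      refine ENNReal.rpow_lt_top_of_nonneg (by simp) ?_
      simpa using hfin
    have hu : u = MeasureTheory.Lp.toTemperedDistribution (hm.toLp f) := by
      have : (fun η : 𝓢₂ => u η) = fun η => MeasureTheory.Lp.toTemperedDistribution (hm.toLp f) η := by
        refine Continuous.ext_on dense_hasCompactSupport
          (map_continuous u)
          (map_continuous _) fun η hη => ?_
        rw [h η hη, MeasureTheory.Lp.toTemperedDistribution_apply]
        refine integral_congr_ae ?_
        filter_upwards [hm.coeFn_toLp] with x hx
        rw [hx, smul_eq_mul]
      ext η
      exact congrFun this η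
    rw [hu, l2Norm_toTemperedDistribution, hnorm]
    refine lintegral_congr_ae ?_
    filter_upwards [hm.coeFn_toLp] with x hx
    rw [hx]

end TemperedL2

/-! ### Weighted L² spaces and L² duality -/

section WeightedL2

local notation "𝓢₂" => SchwartzMap Plane ℂ
local notation "𝓓₂" => TemperedDistribution Plane ℂ
local notation "𝓛₂" => Lp ℂ 2 (volume : Measure Plane)

theorem enorm_sq_eq_lintegral (g : 𝓛₂) : ‖g‖ₑ ^ 2 = ∫⁻ x, ‖g x‖ₑ ^ 2 := by
  rw [Lp.enorm_def, eLpNorm_eq_lintegral_rpow_enorm_toReal (by norm_num) (by norm_num),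
    ← ENNReal.rpow_natCast, ← ENNReal.rpow_mul]
  simp

theorem l2Norm_mulD_sq {a : Plane → ℂ} (ha : a.HasTemperateGrowth) (g : 𝓛₂) :
    l2Norm (mulD a (MeasureTheory.Lp.toTemperedDistribution g)) ^ 2 = ∫⁻ x, ‖a x * g x‖ₑ ^ 2 := by
  have hg : LocallyIntegrable g := (Lp.memLp g).locallyIntegrable (by norm_num)
  refine l2Norm_sq_eq_lintegral (f := fun x => a x * g x) ?_ fun η _ => ?_
  · rw [← locallyIntegrableOn_univ] at hg ⊢
    exact hg.continuousOn_mul ha.1.continuous.continuousOn isOpen_univ.isLocallyClosed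
  · rw [mulD, TemperedDistribution.smulLeftCLM_apply_apply,
      MeasureTheory.Lp.toTemperedDistribution_apply]
    refine integral_congr_ae (Filter.Eventually.of_forall fun x => ?_)
    simp only [SchwartzMap.smulLeftCLM_apply_apply ha, smul_eq_mul]
    ring

theorem l2Norm_mulD_le {a : Plane → ℂ} (ha : a.HasTemperateGrowth) (h1 : ∀ x, ‖a x‖ ≤ 1) (u : 𝓓₂) :
    l2Norm (mulD a u) ≤ l2Norm u := by
  by_cases hu : l2Norm u = ⊤
  · simp [hu]
  obtain ⟨g, rfl⟩ := l2Norm_lt_top_iff.1 (lt_top_iff_ne_top.2 hu)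
  rw [← ENNReal.pow_le_pow_left_iff (n := 2) (by norm_num), l2Norm_mulD_sq ha,
    l2Norm_toTemperedDistribution, enorm_sq_eq_lintegral]
  refine lintegral_mono fun x => ?_
  rw [enorm_mul]
  have : ‖a x‖ₑ ≤ 1 := by rw [← ofReal_norm]; exact ENNReal.ofReal_le_one.2 (h1 x)
  gcongr
  exact mul_le_of_le_one_left' this

theorem wt_le_one {p : ℝ} (hp : p ≤ 0) (x : Plane) : wt p x ≤ 1 :=
  Real.rpow_le_one_of_one_le_of_nonpos (by nlinarith [sq_nonneg ‖x‖]) hp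

theorem hasTemperateGrowth_wt (p : ℝ) : Function.HasTemperateGrowth (fun x => (wt p x : ℂ)) :=
  (isWeight_wt_one p).hasTemperateGrowth

theorem mulD_wt_mulD_wt (p q : ℝ) (u : 𝓓₂) :
    mulD (fun x => (wt p x : ℂ)) (mulD (fun x => (wt q x : ℂ)) u) =
      mulD (fun x => (wt (p + q) x : ℂ)) u := by
  rw [mulD_mulD (hasTemperateGrowth_wt p) (hasTemperateGrowth_wt q)]
  congr 2
  funext x
  rw [wt_add]; push_cast; rfl

theorem mulD_wt_zero (u : 𝓓₂) : mulD (fun x => (wt 0 x : ℂ)) u = u := by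
  simp only [wt_zero, Complex.ofReal_one, mulD_one]

theorem l2Norm_le_wt {p : ℝ} (hp : 0 ≤ p) (u : 𝓓₂) :
    l2Norm u ≤ l2Norm (mulD (fun x => (wt p x : ℂ)) u) := by
  have h : mulD (fun x => (wt (-p) x : ℂ)) (mulD (fun x => (wt p x : ℂ)) u) = u := by
    rw [mulD_wt_mulD_wt, neg_add_cancel, mulD_wt_zero]
  conv_lhs => rw [← h]
  refine l2Norm_mulD_le (hasTemperateGrowth_wt _) (fun x => ?_) _
  rw [Complex.norm_of_nonneg (wt_pos _ _).le]
  exact wt_le_one (by linarith) x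

/-- A distribution that is bounded in `L²` on Schwartz functions is an `L²` function. -/
theorem l2Norm_le_of_forall_enorm_le {u : 𝓓₂} {M : ℝ≥0}
    (h : ∀ η : 𝓢₂, ‖u η‖ₑ ≤ M * ‖η.toLp 2 (volume : Measure Plane)‖ₑ) : l2Norm u ≤ M := by
  set e : 𝓢₂ →ₗ[ℂ] 𝓛₂ := (SchwartzMap.toLpCLM ℂ ℂ 2 (volume : Measure Plane)).toLinearMap with he
  have hden : DenseRange e := denseRange_toLp
  let U : 𝓢₂ →ₗ[ℂ] ℂ := ⟨⟨fun η => u η, fun a b => map_add u a b⟩, fun c a => map_smul u c a⟩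
  have hb : ∀ f, ‖U f‖ ≤ M * ‖e f‖ := by
    intro f
    have := h f
    rwa [← ofReal_norm, ← ofReal_norm, ← ENNReal.ofReal_coe_nnreal,
      ← ENNReal.ofReal_mul M.coe_nonneg, ENNReal.ofReal_le_ofReal_iff (by positivity)] at this
  set X := U.extendOfNorm e with hX
  have hXe : ∀ f, X (e f) = U f := fun f => LinearMap.extendOfNorm_eq hden ⟨M, hb⟩ f
  have hXn : ‖X‖ ≤ M := LinearMap.opNorm_extendOfNorm_le hden M.coe_nonneg hb
  set g : 𝓛₂ := (InnerProductSpace.toDual ℂ 𝓛₂).symm X with hg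
  have hgn : ‖g‖ₑ ≤ M := by
    rw [← ofReal_norm, ← ENNReal.ofReal_coe_nnreal]
    apply ENNReal.ofReal_le_ofReal
    rwa [hg, LinearIsometryEquiv.norm_map]
  rw [← ENNReal.pow_le_pow_left_iff (n := 2) (by norm_num)]
  -- Distributions pair bilinearly, whereas the inner product is conjugate linear in its first
  -- argument. The representing function is therefore the conjugate of the Riesz vector.
  have key := l2Norm_sq_eq_lintegral (u := u) (f := fun x => conj (g x)) ?_ fun η _ => ?_
  · rw [key]
    calc _ = ‖g‖ₑ ^ 2 := by
          rw [enorm_sq_eq_lintegral]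
          refine lintegral_congr fun x => ?_
          rw [← ofReal_norm, ← ofReal_norm, RCLike.norm_conj]
      _ ≤ _ := by gcongr
  · have hgl : LocallyIntegrable g := (Lp.memLp g).locallyIntegrable (by norm_num)
    intro x
    obtain ⟨s, hs, hi⟩ := hgl x
    exact ⟨s, hs, Complex.conjCLE.toContinuousLinearMap.integrable_comp hi⟩
  · have h1 : u η = X (e η) := (hXe η).symm
    have h2 : X (e η) = inner ℂ g (e η) := by
      rw [hg, InnerProductSpace.toDual_symm_apply]
    rw [h1, h2, L2.inner_def]
    refine integral_congr_ae ?_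
    filter_upwards [η.coeFn_toLp 2 (volume : Measure Plane)] with x hx
    change inner ℂ (g x) ((η.toLp 2 volume) x) = _
    rw [hx]
    simp

theorem enorm_apply_le_l2Norm_mul (u : 𝓓₂) (η : 𝓢₂) :
    ‖u η‖ₑ ≤ l2Norm u * ‖η.toLp 2 (volume : Measure Plane)‖ₑ := by
  by_cases hu : l2Norm u = ⊤
  -- The right-hand side is infinite only for η ≠ 0, because `⊤ * 0 = 0`.
  · by_cases hη : η = 0
    · subst hη; rw [map_zero]; simp
    · rw [hu, ENNReal.top_mul]
      · exact le_top
      · rw [enorm_ne_zero]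
        intro h0
        apply hη
        refine SchwartzMap.injective_toLp 2 volume (?_ : η.toLp 2 volume = (0 : 𝓢₂).toLp 2 volume)
        rw [h0]
        exact (map_zero (SchwartzMap.toLpCLM ℂ ℂ 2 (volume : Measure Plane))).symm
  obtain ⟨g, rfl⟩ := l2Norm_lt_top_iff.1 (lt_top_iff_ne_top.2 hu)
  rw [l2Norm_toTemperedDistribution, MeasureTheory.Lp.toTemperedDistribution_apply]
  refine (enorm_integral_le_lintegral_enorm _).trans ?_
  have hol := ENNReal.lintegral_mul_le_Lp_mul_Lq (volume : Measure Plane)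
      (Real.HolderConjugate.two_two) (f := fun x => ‖g x‖ₑ) (g := fun x => ‖η x‖ₑ)
      (Lp.aestronglyMeasurable g).enorm η.continuous.aestronglyMeasurable.enorm
  have e1 : ∀ x, ‖η x • g x‖ₑ = ‖g x‖ₑ * ‖η x‖ₑ := fun x => by rw [enorm_smul, mul_comm]
  simp only [e1]
  refine hol.trans (le_of_eq ?_)
  congr 1
  · simp only [ENNReal.rpow_ofNat]
    rw [← enorm_sq_eq_lintegral, ← ENNReal.rpow_natCast, ← ENNReal.rpow_mul]; simp
  · simp only [ENNReal.rpow_ofNat]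
    rw [lintegral_enorm_sq_eq_enorm_toLp, ← ENNReal.rpow_natCast, ← ENNReal.rpow_mul]; simp

end WeightedL2

/-! ### Real interpolation of weighted L² spaces -/

section Interpolation

local notation "𝓢₂" => SchwartzMap Plane ℂ
local notation "𝓓₂" => TemperedDistribution Plane ℂ
local notation "𝓛₂" => Lp ℂ 2 (volume : Measure Plane)

/-- The squared K-functional of `L²` and the space `L²` with the weight `(1 + |x|²)^(1/2)`. -/
def weightedKSq (t : ℝ) (y : 𝓓₂) : ℝ≥0∞ :=
  ⨅ y₀ : 𝓓₂, l2Norm y₀ ^ 2 +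
    ENNReal.ofReal t ^ 2 * l2Norm (mulD (fun x => (wt (1 / 2) x : ℂ)) (y - y₀)) ^ 2

theorem wt_half_sq (x : Plane) : wt (1 / 2) x ^ 2 = 1 + ‖x‖ ^ 2 := by
  unfold wt
  rw [← Real.rpow_natCast, ← Real.rpow_mul (by positivity)]
  simp

/-- The infimum may be taken pointwise: with τ = t²(1 + |x|²), the expression |h|² + τ|g - h|² is
smallest for h = τ/(1 + τ) g, where it equals τ/(1 + τ) |g|². This minimizer is again in L². -/
theorem weightedKSq_toTemperedDistribution {t : ℝ} (ht : 0 < t) (g : 𝓛₂) :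
    weightedKSq t (MeasureTheory.Lp.toTemperedDistribution g) =
      ∫⁻ x, ENNReal.ofReal (t ^ 2 * (1 + ‖x‖ ^ 2) / (1 + t ^ 2 * (1 + ‖x‖ ^ 2))) * ‖g x‖ₑ ^ 2 := by
  have hsub : ∀ h : 𝓛₂, MeasureTheory.Lp.toTemperedDistribution g -
      MeasureTheory.Lp.toTemperedDistribution h = MeasureTheory.Lp.toTemperedDistribution (g - h) :=
    fun h => (map_sub (MeasureTheory.Lp.toTemperedDistributionCLM ℂ (volume : Measure Plane) 2) g h).symm
  have hval : ∀ h : 𝓛₂, l2Norm (MeasureTheory.Lp.toTemperedDistribution h) ^ 2 +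
      ENNReal.ofReal t ^ 2 * l2Norm (mulD (fun x => (wt (1 / 2) x : ℂ))
        (MeasureTheory.Lp.toTemperedDistribution g - MeasureTheory.Lp.toTemperedDistribution h)) ^ 2 =
      ∫⁻ x, ENNReal.ofReal (‖h x‖ ^ 2 + t ^ 2 * (1 + ‖x‖ ^ 2) * ‖g x - h x‖ ^ 2) := by
    intro h
    rw [hsub, l2Norm_mulD_sq (hasTemperateGrowth_wt _), l2Norm_toTemperedDistribution,
      enorm_sq_eq_lintegral, ← lintegral_const_mul' _ _ (by simp),
      ← lintegral_add_left' ((Lp.aestronglyMeasurable h).enorm.pow_const 2)]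
    refine lintegral_congr_ae ?_
    filter_upwards [Lp.coeFn_sub g h] with x hx
    rw [hx, Pi.sub_apply, ENNReal.ofReal_add (by positivity) (by positivity), enorm_mul,
      ← ofReal_norm, ← ofReal_norm, ← ofReal_norm, Complex.norm_of_nonneg (wt_pos _ _).le,
      ← ENNReal.ofReal_mul (wt_pos _ _).le, ← ENNReal.ofReal_pow (norm_nonneg _),
      ← ENNReal.ofReal_pow (mul_nonneg (wt_pos _ _).le (norm_nonneg _)),
      ← ENNReal.ofReal_pow ht.le, ← ENNReal.ofReal_mul (by positivity), mul_pow, wt_half_sq]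
    congr 2; ring
  have hrhs : ∀ x, ENNReal.ofReal (t ^ 2 * (1 + ‖x‖ ^ 2) / (1 + t ^ 2 * (1 + ‖x‖ ^ 2))) * ‖g x‖ₑ ^ 2 =
      ENNReal.ofReal (t ^ 2 * (1 + ‖x‖ ^ 2) / (1 + t ^ 2 * (1 + ‖x‖ ^ 2)) * ‖g x‖ ^ 2) := by
    intro x
    rw [← ofReal_norm, ← ENNReal.ofReal_pow (norm_nonneg _), ← ENNReal.ofReal_mul (by positivity)]
  simp only [hrhs]
  apply le_antisymm
  · set m : Plane → ℝ := fun x => t ^ 2 * (1 + ‖x‖ ^ 2) / (1 + t ^ 2 * (1 + ‖x‖ ^ 2)) with hm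
    have hmem : MemLp (fun x => (m x : ℂ) * g x) 2 (volume : Measure Plane) := by
      have hc : Continuous (fun x => (m x : ℂ)) := Complex.continuous_ofReal.comp
        (Continuous.div (by fun_prop) (by fun_prop) fun x => by positivity)
      refine (Lp.memLp g).mono (hc.aestronglyMeasurable.mul (Lp.aestronglyMeasurable g))
        (Filter.Eventually.of_forall fun x => ?_)
      rw [norm_mul, Complex.norm_of_nonneg (by positivity)]
      refine mul_le_of_le_one_left (norm_nonneg _) ?_
      rw [div_le_one (by positivity)]
      linarith
    refine (iInf_le _ (MeasureTheory.Lp.toTemperedDistribution (hmem.toLp _))).trans ?_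
    rw [hval]
    refine le_of_eq (lintegral_congr_ae ?_)
    filter_upwards [hmem.coeFn_toLp] with x hx
    rw [hx]
    congr 1
    have e1 : g x - (m x : ℂ) * g x = ((1 - m x : ℝ) : ℂ) * g x := by push_cast; ring
    rw [e1, norm_mul, norm_mul, Complex.norm_real, Complex.norm_real, Real.norm_eq_abs,
      Real.norm_eq_abs, mul_pow, mul_pow, sq_abs, sq_abs, hm]
    have : 1 + t ^ 2 * (1 + ‖x‖ ^ 2) ≠ 0 := by positivity
    field_simp
    ring
  · refine le_iInf fun y₀ => ?_
    by_cases hy : l2Norm y₀ = ⊤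
    · simp [hy]
    obtain ⟨h, rfl⟩ := l2Norm_lt_top_iff.1 (lt_top_iff_ne_top.2 hy)
    rw [hval]
    refine lintegral_mono fun x => ENNReal.ofReal_le_ofReal ?_
    set s := t ^ 2 * (1 + ‖x‖ ^ 2) with hs
    have hs0 : 0 ≤ s := by positivity
    have h1 : ‖g x‖ ≤ ‖h x‖ + ‖g x - h x‖ := by
      calc ‖g x‖ = ‖h x + (g x - h x)‖ := by congr 1; ring
        _ ≤ _ := norm_add_le _ _
    rw [div_mul_eq_mul_div, div_le_iff₀ (by positivity)]
    have h2 : ‖g x‖ ^ 2 ≤ (‖h x‖ + ‖g x - h x‖) ^ 2 := by gcongr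
    -- The difference (1 + s)(a² + s d²) - s(a + d)² is the square (a - s d)².
    nlinarith [sq_nonneg (‖h x‖ - s * ‖g x - h x‖)]

theorem l2Norm_lt_top_of_weightedKSq {t : ℝ} (ht : 0 < t) {y : 𝓓₂} (h : weightedKSq t y < ⊤) :
    l2Norm y < ⊤ := by
  obtain ⟨y₀, hy⟩ := iInf_lt_iff.1 h
  rw [ENNReal.add_lt_top] at hy
  have h0 : l2Norm y₀ < ⊤ := by
    by_contra hc
    rw [not_lt, top_le_iff] at hc
    simp [hc] at hy
  have h1 : l2Norm (y - y₀) < ⊤ := by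
    refine (l2Norm_le_wt (p := 1 / 2) (by norm_num) _).trans_lt ?_
    by_contra hc
    rw [not_lt, top_le_iff] at hc
    rw [hc] at hy
    have := hy.2
    rw [ENNReal.top_pow (by norm_num), ENNReal.mul_top (by simpa using ht)] at this
    exact lt_irrefl _ this
  have := l2Norm_add_le y₀ (y - y₀)
  rw [add_sub_cancel] at this
  exact this.trans_lt (ENNReal.add_lt_top.2 ⟨h0, h1⟩)

theorem lintegral_Ioi_comp_mul_left (f : ℝ → ℝ≥0∞) {l : ℝ} (hl : 0 < l) :
    ∫⁻ t in Set.Ioi (0 : ℝ), f (l * t) = ENNReal.ofReal l⁻¹ * ∫⁻ t in Set.Ioi (0 : ℝ), f t := by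
  have h1 := lintegral_map_equiv (μ := (volume : Measure ℝ)) ((Set.Ioi (0 : ℝ)).indicator f)
    (Homeomorph.mulLeft₀ l hl.ne').toMeasurableEquiv
  have h2 : Measure.map (Homeomorph.mulLeft₀ l hl.ne').toMeasurableEquiv (volume : Measure ℝ) =
      ENNReal.ofReal l⁻¹ • volume := by
    have := Measure.map_addHaar_smul (volume : Measure ℝ) hl.ne'
    simpa [abs_of_pos (inv_pos.2 hl)] using this
  rw [h2, lintegral_smul_measure, lintegral_indicator measurableSet_Ioi, smul_eq_mul] at h1
  rw [h1, ← lintegral_indicator measurableSet_Ioi]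
  refine lintegral_congr fun t => ?_
  change _ = (Set.Ioi (0 : ℝ)).indicator f (l * t)
  by_cases ht : 0 < t
  · rw [Set.indicator_of_mem (Set.mem_Ioi.2 ht), Set.indicator_of_mem (Set.mem_Ioi.2 (by positivity))]
  · rw [Set.indicator_of_notMem (by simpa using ht), Set.indicator_of_notMem]
    simp only [Set.mem_Ioi, not_lt] at *
    exact mul_nonpos_of_nonneg_of_nonpos hl.le ht

/-- The normalizing constant of the interpolation norm. -/
def interpConst (θ : ℝ) : ℝ≥0∞ :=
  ∫⁻ t in Set.Ioi (0 : ℝ), ENNReal.ofReal (t ^ (-2 * θ - 1) * (t ^ 2 / (1 + t ^ 2)))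

theorem interpConst_ne_zero (θ : ℝ) : interpConst θ ≠ 0 := by
  refine (setLIntegral_pos_iff (by fun_prop) |>.2 ?_).ne'
  have : Set.Ioi (0 : ℝ) ⊆ (Function.support fun t : ℝ =>
      ENNReal.ofReal (t ^ (-2 * θ - 1) * (t ^ 2 / (1 + t ^ 2)))) ∩ Set.Ioi 0 := by
    intro t ht
    have ht0 : 0 < t := ht
    refine ⟨?_, ht⟩
    simp only [Function.mem_support, ne_eq, ENNReal.ofReal_eq_zero, not_le]
    positivity
  exact (show (0 : ℝ≥0∞) < volume (Set.Ioi (0 : ℝ)) by simp).trans_le (measure_mono this)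

/-- The integrand behaves like t^(1 - 2θ) at zero and like t^(-2θ - 1) at infinity, so convergence
at the two ends is θ < 1 and 0 < θ. -/
theorem interpConst_ne_top {θ : ℝ} (h0 : 0 < θ) (h1 : θ < 1) : interpConst θ ≠ ⊤ := by
  unfold interpConst
  rw [← Set.Ioc_union_Ioi_eq_Ioi (zero_le_one' ℝ)]
  refine ((lintegral_union_le _ _ _).trans_lt (ENNReal.add_lt_top.2 ⟨?_, ?_⟩)).ne
  · have hi : IntegrableOn (fun t : ℝ => t ^ (1 - 2 * θ)) (Set.Ioc 0 1) := by
      rw [← intervalIntegrable_iff_integrableOn_Ioc_of_le zero_le_one]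
      exact intervalIntegral.intervalIntegrable_rpow' (by linarith)
    refine lt_of_le_of_lt (setLIntegral_mono' measurableSet_Ioc fun t ht => ?_) hi.lintegral_lt_top
    apply ENNReal.ofReal_le_ofReal
    have ht0 : 0 < t := ht.1
    rw [show (1 - 2 * θ) = (-2 * θ - 1) + 2 by ring, Real.rpow_add ht0]
    gcongr
    rw [Real.rpow_ofNat]
    exact div_le_self (by positivity) (by nlinarith)
  · have hi : IntegrableOn (fun t : ℝ => t ^ (-2 * θ - 1)) (Set.Ioi 1) :=
      integrableOn_Ioi_rpow_of_lt (by linarith) zero_lt_one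
    refine lt_of_le_of_lt (setLIntegral_mono' measurableSet_Ioi fun t ht => ?_) hi.lintegral_lt_top
    apply ENNReal.ofReal_le_ofReal
    have ht0 : 0 < t := zero_lt_one.trans ht
    refine mul_le_of_le_one_right (by positivity) ?_
    rw [div_le_one (by positivity)]; linarith

/-- The substitution t ↦ l t with l = (1 + |x|²)^(1/2) removes x from the integrand and produces the
factor l^(2θ). -/
theorem lintegral_interp_eq (θ : ℝ) (x : Plane) :
    ∫⁻ t in Set.Ioi (0 : ℝ), ENNReal.ofReal (t ^ (-2 * θ - 1)) *
      ENNReal.ofReal (t ^ 2 * (1 + ‖x‖ ^ 2) / (1 + t ^ 2 * (1 + ‖x‖ ^ 2))) =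
      interpConst θ * ENNReal.ofReal (wt θ x) := by
  set l := wt (1 / 2) x with hl
  have hl0 : 0 < l := wt_pos _ _
  have h := lintegral_Ioi_comp_mul_left
    (fun t => ENNReal.ofReal (t ^ (-2 * θ - 1) * (t ^ 2 / (1 + t ^ 2)))) hl0
  have hwt : wt θ x = l ^ (2 * θ + 1) * l⁻¹ := by
    rw [← Real.rpow_neg_one l, ← Real.rpow_add hl0, hl, wt, wt, ← Real.rpow_mul (by positivity)]
    congr 1; ring
  rw [hwt, ENNReal.ofReal_mul (by positivity), mul_comm (interpConst θ), mul_assoc, interpConst, ← h,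
    ← lintegral_const_mul' _ _ (by simp)]
  refine setLIntegral_congr_fun measurableSet_Ioi fun t ht => ?_
  have ht0 : 0 < t := ht
  rw [← ENNReal.ofReal_mul (by positivity), ← ENNReal.ofReal_mul (by positivity)]
  congr 1
  rw [Real.mul_rpow hl0.le ht0.le, ← wt_half_sq, ← hl]
  have e : l ^ (2 * θ + 1) * l ^ (-2 * θ - 1) = 1 := by
    rw [← Real.rpow_add hl0]; simp
  calc _ = (l ^ (2 * θ + 1) * l ^ (-2 * θ - 1)) * (t ^ (-2 * θ - 1) * (t ^ 2 * l ^ 2 / (1 + t ^ 2 * l ^ 2))) := by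
        rw [e, one_mul]
    _ = _ := by rw [mul_pow]; ring

/-- Interpolation between `L²` and a weighted `L²` space. -/
theorem lintegral_weightedKSq {θ : ℝ} (h0 : 0 < θ) (y : 𝓓₂) :
    ∫⁻ t in Set.Ioi (0 : ℝ), ENNReal.ofReal (t ^ (-2 * θ - 1)) * weightedKSq t y =
      interpConst θ * l2Norm (mulD (fun x => (wt (θ / 2) x : ℂ)) y) ^ 2 := by
  -- Outside L² both sides are infinite: as the weight is at least one, a finite K-functional at a
  -- single t > 0 would put y into L².
  by_cases hy : l2Norm y = ⊤
  · have h1 : l2Norm (mulD (fun x => (wt (θ / 2) x : ℂ)) y) = ⊤ :=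
      top_le_iff.1 (hy ▸ l2Norm_le_wt (by positivity) y)
    rw [h1, ENNReal.top_pow (by norm_num), ENNReal.mul_top (interpConst_ne_zero θ)]
    have : ∀ t ∈ Set.Ioi (0 : ℝ), ENNReal.ofReal (t ^ (-2 * θ - 1)) * weightedKSq t y = ⊤ := by
      intro t ht
      have ht0 : 0 < t := ht
      have h2 : weightedKSq t y = ⊤ := by
        by_contra hc
        exact (l2Norm_lt_top_of_weightedKSq ht0 (lt_top_iff_ne_top.2 hc)).ne hy
      rw [h2, ENNReal.mul_top]
      simp only [ne_eq, ENNReal.ofReal_eq_zero, not_le]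
      positivity
    rw [setLIntegral_congr_fun measurableSet_Ioi this]
    simp
  obtain ⟨g, rfl⟩ := l2Norm_lt_top_iff.1 (lt_top_iff_ne_top.2 hy)
  have hg : AEMeasurable (fun x => ‖g x‖ₑ ^ 2) (volume : Measure Plane) :=
    (Lp.aestronglyMeasurable g).enorm.pow_const 2
  have e1 : ∀ t ∈ Set.Ioi (0 : ℝ), ENNReal.ofReal (t ^ (-2 * θ - 1)) *
      weightedKSq t (MeasureTheory.Lp.toTemperedDistribution g) = ∫⁻ x, ENNReal.ofReal (t ^ (-2 * θ - 1)) *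
      (ENNReal.ofReal (t ^ 2 * (1 + ‖x‖ ^ 2) / (1 + t ^ 2 * (1 + ‖x‖ ^ 2))) * ‖g x‖ₑ ^ 2) := by
    intro t ht
    rw [weightedKSq_toTemperedDistribution ht, lintegral_const_mul' _ _ (by simp)]
  rw [setLIntegral_congr_fun measurableSet_Ioi e1, lintegral_lintegral_swap]
  · rw [l2Norm_mulD_sq (hasTemperateGrowth_wt _), ← lintegral_const_mul'' _ ?_]
    · refine lintegral_congr fun x => ?_
      calc _ = (∫⁻ t in Set.Ioi (0 : ℝ), ENNReal.ofReal (t ^ (-2 * θ - 1)) *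
          ENNReal.ofReal (t ^ 2 * (1 + ‖x‖ ^ 2) / (1 + t ^ 2 * (1 + ‖x‖ ^ 2)))) * ‖g x‖ₑ ^ 2 := by
            rw [← lintegral_mul_const' _ _ (by simp)]
            simp only [mul_assoc]
        _ = _ := by
            rw [lintegral_interp_eq, enorm_mul, mul_pow, mul_assoc]
            congr 2
            rw [← ofReal_norm, Complex.norm_of_nonneg (wt_pos _ _).le,
              ← ENNReal.ofReal_pow (wt_pos _ _).le, sq, ← wt_add]
            congr 2; ring
    · have hc : Continuous (fun x => (wt (θ / 2) x : ℂ)) := (hasTemperateGrowth_wt (θ / 2)).1.continuous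
      exact ((hc.aestronglyMeasurable.mul (Lp.aestronglyMeasurable g)).enorm.pow_const 2)
  · have m1 : Measurable (fun p : ℝ × Plane => ENNReal.ofReal (p.1 ^ (-2 * θ - 1))) := by fun_prop
    have m2 : Measurable (fun p : ℝ × Plane =>
      ENNReal.ofReal (p.1 ^ 2 * (1 + ‖p.2‖ ^ 2) / (1 + p.1 ^ 2 * (1 + ‖p.2‖ ^ 2)))) := by fun_prop
    exact m1.aemeasurable.mul (m2.aemeasurable.mul hg.comp_snd)

end Interpolation

/-! ### Lattices, fundamental cells and the dual lattice -/

section Lattice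

theorem expI_add (s t : ℝ) : expI (s + t) = expI s * expI t := by
  simp [expI, mul_add, Complex.exp_add]

theorem expI_zero : expI 0 = 1 := by simp [expI]

theorem expI_neg (t : ℝ) : expI (-t) = conj (expI t) := by
  simp [expI, ← Complex.exp_conj]

theorem norm_expI (t : ℝ) : ‖expI t‖ = 1 := by
  rw [expI, mul_comm, Complex.norm_exp_ofReal_mul_I]

theorem expI_mul_expI_neg (t : ℝ) : expI t * expI (-t) = 1 := by
  rw [← expI_add, add_neg_cancel, expI_zero]

theorem expI_two_pi_int (n : ℤ) : expI (2 * Real.pi * n) = 1 := by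
  rw [expI, Complex.exp_eq_one_iff]
  exact ⟨n, by push_cast; ring⟩

theorem hasDerivAt_expI (t : ℝ) : HasDerivAt expI (Complex.I * expI t) t := by
  have h : HasDerivAt (fun t : ℝ => Complex.I * (t : ℂ)) (Complex.I * 1) t :=
    (Complex.ofRealCLM.hasDerivAt (x := t)).const_mul Complex.I
  have := h.cexp
  rw [mul_one, mul_comm] at this
  exact this

theorem contDiff_expI : ContDiff ℝ ∞ expI := by
  unfold expI
  exact Complex.contDiff_exp.comp (contDiff_const.mul Complex.ofRealCLM.contDiff)

theorem continuous_expI : Continuous expI := contDiff_expI.continuous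

variable (A : Matrix (Fin 2) (Fin 2) ℝ)

/-- `matVec` as a linear map. -/
def matVecL : (Fin 2 → ℝ) →L[ℝ] Plane :=
  LinearMap.toContinuousLinearMap
    ((WithLp.linearEquiv 2 ℝ (Fin 2 → ℝ)).symm.toLinearMap ∘ₗ A.mulVecLin)

theorem matVecL_apply (z : Fin 2 → ℝ) : matVecL A z = matVec A z := rfl

theorem lat_add (j k : Idx) : lat A (j + k) = lat A j + lat A k := by
  unfold lat
  rw [← matVecL_apply, ← matVecL_apply, ← matVecL_apply, ← map_add]
  congr 1; funext i; simp

theorem lat_zero : lat A 0 = 0 := by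
  unfold lat
  rw [← matVecL_apply, ← map_zero (matVecL A)]
  congr 1; funext i; simp

theorem lat_neg (j : Idx) : lat A (-j) = -lat A j :=
  eq_neg_of_add_eq_zero_left (by rw [← lat_add, neg_add_cancel, lat_zero])

theorem lat_sub (j k : Idx) : lat A (j - k) = lat A j - lat A k := by
  rw [sub_eq_add_neg, lat_add, lat_neg, sub_eq_add_neg]

/-- The coordinates of a point with respect to the columns of `A`. -/
def coords (x : Plane) : Fin 2 → ℝ := A⁻¹ *ᵥ x.ofLp

variable {A}

theorem matVec_coords (hA : A.det ≠ 0) (x : Plane) : matVec A (coords A x) = x := by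
  unfold matVec coords
  rw [Matrix.mulVec_mulVec, Matrix.mul_nonsing_inv _ (isUnit_iff_ne_zero.2 hA), Matrix.one_mulVec]

theorem coords_matVec (hA : A.det ≠ 0) (z : Fin 2 → ℝ) : coords A (matVec A z) = z := by
  unfold matVec coords
  rw [Matrix.mulVec_mulVec, Matrix.nonsing_inv_mul _ (isUnit_iff_ne_zero.2 hA), Matrix.one_mulVec]

theorem continuous_coords : Continuous (coords A) := by
  unfold coords
  exact Continuous.matrix_mulVec continuous_const (PiLp.continuous_ofLp 2 _)

theorem coords_add (x y : Plane) : coords A (x + y) = coords A x + coords A y := by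
  simp [coords, Matrix.mulVec_add]

theorem coords_lat (hA : A.det ≠ 0) (j : Idx) : coords A (lat A j) = fun i => (j i : ℝ) :=
  coords_matVec hA _

theorem mem_cell_iff (hA : A.det ≠ 0) {x : Plane} :
    x ∈ cell A ↔ ∀ i, -(1 / 2) < coords A x i ∧ coords A x i ≤ 1 / 2 := by
  constructor
  · rintro ⟨z, hz, rfl⟩
    rwa [coords_matVec hA]
  · intro h
    exact ⟨_, h, (matVec_coords hA x).symm⟩

theorem measurableSet_cell (hA : A.det ≠ 0) : MeasurableSet (cell A) := by
  have : cell A = coords A ⁻¹' Set.univ.pi (fun _ => Set.Ioc (-(1 / 2)) (1 / 2)) := by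
    ext x; simp [mem_cell_iff hA]
  rw [this]
  exact continuous_coords.measurable (MeasurableSet.univ_pi fun _ => measurableSet_Ioc)

theorem isBounded_cell : Bornology.IsBounded (cell A) := by
  have : cell A ⊆ matVecL A '' Set.univ.pi (fun _ => Set.Icc (-(1 / 2)) (1 / 2)) := by
    rintro _ ⟨z, hz, rfl⟩
    exact ⟨z, fun i _ => ⟨(hz i).1.le, (hz i).2⟩, rfl⟩
  exact (((isCompact_univ_pi fun _ => isCompact_Icc).image
    (matVecL A).continuous).isBounded).subset this

theorem exists_cell_bound (A : Matrix (Fin 2) (Fin 2) ℝ) : ∃ R : ℝ, 0 ≤ R ∧ ∀ x ∈ cell A, ‖x‖ ≤ R := by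
  obtain ⟨R, hR⟩ := (isBounded_cell (A := A)).exists_norm_le
  exact ⟨max R 0, le_max_right _ _, fun x hx => (hR x hx).trans (le_max_left _ _)⟩

theorem exists_sub_lat_mem_cell (hA : A.det ≠ 0) (x : Plane) : ∃ j, x - lat A j ∈ cell A := by
  refine ⟨fun i => ⌈coords A x i - 1 / 2⌉, (mem_cell_iff hA).2 fun i => ?_⟩
  rw [sub_eq_add_neg, ← lat_neg, coords_add, Pi.add_apply, coords_lat hA]
  have h1 := Int.le_ceil (coords A x i - 1 / 2)
  have h2 := Int.ceil_lt_add_one (coords A x i - 1 / 2)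
  constructor
  · simp only [Pi.neg_apply, Int.cast_neg]; linarith
  · simp only [Pi.neg_apply, Int.cast_neg]; linarith

theorem eq_zero_of_mem_cell (hA : A.det ≠ 0) {x : Plane} {j : Idx} (hx : x ∈ cell A)
    (hj : x + lat A j ∈ cell A) : j = 0 := by
  funext i
  have h1 := (mem_cell_iff hA).1 hx i
  have h2 := (mem_cell_iff hA).1 hj i
  rw [coords_add, Pi.add_apply, coords_lat hA] at h2
  have h3 : ((j i : ℤ) : ℝ) < 1 := by linarith
  have h4 : (-1 : ℝ) < ((j i : ℤ) : ℝ) := by linarith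
  have h5 : j i < 1 := by exact_mod_cast h3
  have h6 : -1 < j i := by exact_mod_cast h4
  simp only [Pi.zero_apply]; omega

theorem lat_injective (hA : A.det ≠ 0) : Function.Injective (lat A) := by
  intro j k h
  have := congrArg (coords A) h
  rw [coords_lat hA, coords_lat hA] at this
  funext i
  exact_mod_cast congrFun this i

/-- The translate of the cell by a lattice point. -/
def cellAt (A : Matrix (Fin 2) (Fin 2) ℝ) (j : Idx) : Set Plane := {x | x - lat A j ∈ cell A}

theorem measurableSet_cellAt (hA : A.det ≠ 0) (j : Idx) : MeasurableSet (cellAt A j) :=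
  (measurable_id.sub_const _) (measurableSet_cell hA)

theorem iUnion_cellAt (hA : A.det ≠ 0) : ⋃ j, cellAt A j = Set.univ :=
  Set.eq_univ_of_forall fun x => Set.mem_iUnion.2 (exists_sub_lat_mem_cell hA x)

theorem pairwise_disjoint_cellAt (hA : A.det ≠ 0) : Pairwise (Function.onFun Disjoint (cellAt A)) := by
  intro j k hjk
  refine Set.disjoint_left.2 fun x hj hk => hjk ?_
  have : x - lat A k = (x - lat A j) + lat A (j - k) := by rw [lat_sub]; abel
  have h := eq_zero_of_mem_cell hA (j := j - k) hj (by rw [← this]; exact hk)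
  exact sub_eq_zero.1 h

theorem map_add_cellMeasure (hA : A.det ≠ 0) (j : Idx) :
    MeasurePreserving (fun x => x + lat A j) (cellMeasure A) (volume.restrict (cellAt A j)) := by
  have h := (measurePreserving_add_right (volume : Measure Plane) (lat A j)).restrict_preimage
    (measurableSet_cellAt hA j)
  have : (fun x => x + lat A j) ⁻¹' cellAt A j = cell A := by
    ext x; simp [cellAt]
  rwa [this] at h

theorem setLIntegral_cellAt (hA : A.det ≠ 0) (f : Plane → ℝ≥0∞) (j : Idx) :
    ∫⁻ x in cellAt A j, f x = ∫⁻ x, f (x + lat A j) ∂(cellMeasure A) :=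
  ((map_add_cellMeasure hA j).lintegral_comp_emb (measurableEmbedding_addRight _) f).symm

theorem setIntegral_cellAt {E : Type*} [NormedAddCommGroup E] [NormedSpace ℝ E] (hA : A.det ≠ 0)
    (f : Plane → E) (j : Idx) :
    ∫ x in cellAt A j, f x = ∫ x, f (x + lat A j) ∂(cellMeasure A) :=
  ((map_add_cellMeasure hA j).integral_comp (measurableEmbedding_addRight _) f).symm

theorem lintegral_eq_tsum_cell (hA : A.det ≠ 0) (f : Plane → ℝ≥0∞) :
    ∫⁻ x, f x = ∑' j, ∫⁻ x, f (x + lat A j) ∂(cellMeasure A) := by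
  rw [← setLIntegral_univ, ← iUnion_cellAt hA,
    lintegral_iUnion (measurableSet_cellAt hA) (pairwise_disjoint_cellAt hA)]
  simp only [setLIntegral_cellAt hA]

theorem hasSum_integral_cell {E : Type*} [NormedAddCommGroup E] [NormedSpace ℝ E] (hA : A.det ≠ 0)
    {f : Plane → E} (hf : Integrable f) :
    HasSum (fun j => ∫ x, f (x + lat A j) ∂(cellMeasure A)) (∫ x, f x) := by
  have := hasSum_integral_iUnion (measurableSet_cellAt hA) (pairwise_disjoint_cellAt hA)
    (f := f) (μ := volume) (by rw [iUnion_cellAt hA]; exact hf.integrableOn)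
  rw [iUnion_cellAt hA, setIntegral_univ] at this
  simpa only [setIntegral_cellAt hA] using this

theorem volume_cell (A : Matrix (Fin 2) (Fin 2) ℝ) : volume (cell A) = ENNReal.ofReal |A.det| := by
  let Q : Set (Fin 2 → ℝ) := Set.univ.pi (fun _ => Set.Ioc (-(1 / 2)) (1 / 2))
  have h1 : cell A = (@WithLp.ofLp 2 (Fin 2 → ℝ)) ⁻¹' (Matrix.toLin' A '' Q) := by
    ext x
    constructor
    · rintro ⟨z, hz, rfl⟩
      exact ⟨z, fun i _ => hz i, rfl⟩
    · rintro ⟨z, hz, h⟩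
      refine ⟨z, fun i => hz i trivial, ?_⟩
      unfold matVec
      rw [Matrix.toLin'_apply] at h
      rw [h]
  have hQ : volume Q = 1 := by
    rw [Real.volume_pi_Ioc]; norm_num
  have h2 := (EuclideanSpace.volume_preserving_symm_measurableEquiv_toLp (Fin 2)).measure_preimage_equiv
    (Matrix.toLin' A '' Q)
  rw [h1]
  refine h2.trans ?_
  rw [Measure.addHaar_image_linearMap, hQ, mul_one, LinearMap.det_toLin']

theorem volume_cell_lt_top (A : Matrix (Fin 2) (Fin 2) ℝ) : volume (cell A) < ⊤ := by
  rw [volume_cell]; exact ENNReal.ofReal_lt_top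

theorem volume_cell_pos (hA : A.det ≠ 0) : 0 < volume (cell A) := by
  rw [volume_cell]; simpa using hA

instance isFiniteMeasure_cellMeasure (A : Matrix (Fin 2) (Fin 2) ℝ) :
    IsFiniteMeasure (cellMeasure A) :=
  ⟨by rw [Measure.restrict_apply_univ]; exact volume_cell_lt_top A⟩

variable {L : Matrix (Fin 2) (Fin 2) ℝ}

theorem det_dualMat (L : Matrix (Fin 2) (Fin 2) ℝ) :
    (dualMat L).det = (2 * Real.pi) ^ 2 * (L.det)⁻¹ := by
  simp [dualMat, Matrix.det_nonsing_inv]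

theorem det_dualMat_ne_zero (hL : L.det ≠ 0) : (dualMat L).det ≠ 0 := by
  rw [det_dualMat]
  have := Real.pi_pos
  exact mul_ne_zero (by positivity) (inv_ne_zero hL)

theorem normConst_pos (hL : L.det ≠ 0) : 0 < normConst L := by
  have := Real.pi_pos
  unfold normConst; positivity

/-- The dual cell has area (2π)²/|det Λ|, so the normalizing constant is the one that makes the
characters orthonormal on it. -/
theorem normConst_sq_mul_volume (hL : L.det ≠ 0) :
    normConst L ^ 2 * volume.real (cell (dualMat L)) = 1 := by
  have := Real.pi_pos
  have h : |L.det| ≠ 0 := by simpa using hL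
  rw [Measure.real, volume_cell, ENNReal.toReal_ofReal (abs_nonneg _), det_dualMat, abs_mul, abs_inv,
    normConst, div_pow, Real.sq_sqrt (abs_nonneg _), abs_of_pos (show (0 : ℝ) < (2 * Real.pi) ^ 2 by positivity)]
  field_simp

theorem inner_matVec_dualMat (hL : L.det ≠ 0) (w z : Fin 2 → ℝ) :
    inner ℝ (matVec (dualMat L) w) (matVec L z) = 2 * Real.pi * (w ⬝ᵥ z) := by
  have h1 : inner ℝ (matVec (dualMat L) w) (matVec L z) = (dualMat L *ᵥ w) ⬝ᵥ (L *ᵥ z) := by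
    simp [matVec, PiLp.inner_apply, dotProduct, mul_comm]
  have hu : IsUnit (Lᵀ).det := by rw [Matrix.det_transpose]; exact isUnit_iff_ne_zero.2 hL
  rw [h1, Matrix.dotProduct_mulVec, ← Matrix.mulVec_transpose, Matrix.mulVec_mulVec, dualMat,
    Matrix.mul_smul, Matrix.mul_nonsing_inv _ hu, Matrix.smul_mulVec, Matrix.one_mulVec,
    smul_dotProduct, smul_eq_mul]

theorem inner_lat_dualMat (hL : L.det ≠ 0) (l j : Idx) :
    inner ℝ (lat (dualMat L) l) (lat L j) = 2 * Real.pi * ((∑ i, l i * j i : ℤ) : ℝ) := by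
  unfold lat
  rw [inner_matVec_dualMat hL]
  simp [dotProduct]

theorem expI_inner_lat_dualMat (hL : L.det ≠ 0) (l j : Idx) :
    expI (inner ℝ (lat (dualMat L) l) (lat L j)) = 1 := by
  rw [inner_lat_dualMat hL, expI_two_pi_int]

theorem expI_inner_add_lat (hL : L.det ≠ 0) (α : Plane) (l j : Idx) :
    expI (inner ℝ (α + lat (dualMat L) l) (lat L j)) = expI (inner ℝ α (lat L j)) := by
  rw [inner_add_left, expI_add, expI_inner_lat_dualMat hL, mul_one]

end Lattice

/-! ### Lattice sums, partitions of unity, orthogonality of characters -/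

section LatticeSums

local notation "𝓢₂" => SchwartzMap Plane ℂ

variable {A : Matrix (Fin 2) (Fin 2) ℝ}

/-- A function that is summable over lattices in the plane. -/
def decay {E : Type*} [NormedAddCommGroup E] (x : E) : ℝ := ((1 + ‖x‖) ^ 3)⁻¹

theorem decay_pos {E : Type*} [NormedAddCommGroup E] (x : E) : 0 < decay x := by
  unfold decay; positivity

theorem decay_neg {E : Type*} [NormedAddCommGroup E] (x : E) : decay (-x) = decay x := by
  unfold decay; rw [norm_neg]

theorem decay_le_one {E : Type*} [NormedAddCommGroup E] (x : E) : decay x ≤ 1 :=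
  inv_le_one_of_one_le₀ (one_le_pow₀ (by linarith [norm_nonneg x]))

theorem decay_add_le {E : Type*} [NormedAddCommGroup E] (x y : E) :
    decay (x + y) ≤ (1 + ‖x‖) ^ 3 * decay y := by
  unfold decay
  rw [← div_eq_mul_inv, inv_eq_one_div, div_le_div_iff₀ (by positivity) (by positivity), one_mul,
    ← mul_pow]
  have h : ‖y‖ ≤ ‖x + y‖ + ‖x‖ := by
    calc ‖y‖ = ‖x + y - x‖ := by congr 1; abel
      _ ≤ _ := norm_sub_le _ _
  gcongr
  nlinarith [norm_nonneg x, norm_nonneg (x + y)]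

theorem integrable_decay : Integrable (decay : Plane → ℝ) := by
  have h : Integrable (fun x : Plane => (1 + ‖x‖) ^ (-3 : ℝ)) :=
    integrable_one_add_norm (by simp; norm_num)
  convert h using 2 with x
  rw [show (-3 : ℝ) = -((3 : ℕ) : ℝ) by norm_num, Real.rpow_neg (by positivity), Real.rpow_natCast,
    decay]

/-- Comparison with an integral: over a translate of the cell `decay` varies only by a bounded
factor, so each term is at most a constant times its mean over a cell, and the cells fill the plane.
-/
theorem exists_tsum_decay_le (hA : A.det ≠ 0) :
    ∃ C : ℝ≥0, ∀ x, ∑' j, ENNReal.ofReal (decay (x + lat A j)) ≤ C := by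
  obtain ⟨R, hR0, hR⟩ := exists_cell_bound A
  set I := ∫⁻ y : Plane, ENNReal.ofReal (decay y) with hI
  have hIt : I ≠ ⊤ := integrable_decay.lintegral_lt_top.ne
  have hv0 := (volume_cell_pos hA).ne'
  have hvt := (volume_cell_lt_top A).ne
  have hfin : ENNReal.ofReal ((1 + R) ^ 3) * I / volume (cell A) ≠ ⊤ :=
    ENNReal.div_ne_top (ENNReal.mul_ne_top (by simp) hIt) hv0
  refine ⟨(ENNReal.ofReal ((1 + R) ^ 3) * I / volume (cell A)).toNNReal, fun x => ?_⟩
  rw [ENNReal.coe_toNNReal hfin, ENNReal.le_div_iff_mul_le (Or.inl hv0) (Or.inl hvt),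
    ← ENNReal.tsum_mul_right]
  have h1 : ∀ j, ENNReal.ofReal (decay (x + lat A j)) * volume (cell A) ≤
      ENNReal.ofReal ((1 + R) ^ 3) * ∫⁻ y, ENNReal.ofReal (decay (x + (y + lat A j))) ∂(cellMeasure A) := by
    intro j
    rw [← lintegral_const_mul' _ _ (by simp), ← setLIntegral_const]
    refine setLIntegral_mono' (measurableSet_cell hA) fun y hy => ?_
    rw [← ENNReal.ofReal_mul (by positivity)]
    apply ENNReal.ofReal_le_ofReal
    have h2 := decay_add_le (-y) (x + (y + lat A j))
    rw [show -y + (x + (y + lat A j)) = x + lat A j by abel, norm_neg] at h2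
    refine h2.trans ?_
    have := (decay_pos (x + (y + lat A j))).le
    have := hR y hy
    gcongr
  refine (ENNReal.tsum_le_tsum h1).trans ?_
  rw [ENNReal.tsum_mul_left, ← lintegral_eq_tsum_cell hA (fun y => ENNReal.ofReal (decay (x + y))),
    lintegral_add_left_eq_self (fun y => ENNReal.ofReal (decay y)) x]

theorem summable_decay (hA : A.det ≠ 0) (x : Plane) : Summable fun j => decay (x + lat A j) := by
  obtain ⟨C, hC⟩ := exists_tsum_decay_le hA
  have h := ENNReal.summable_toReal ((hC x).trans_lt ENNReal.coe_lt_top).ne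
  simpa [ENNReal.toReal_ofReal (decay_pos _).le] using h

theorem exists_tsum_decay_le_real (hA : A.det ≠ 0) :
    ∃ C : ℝ, 0 ≤ C ∧ ∀ x, ∑' j, decay (x + lat A j) ≤ C := by
  obtain ⟨C, hC⟩ := exists_tsum_decay_le hA
  refine ⟨C, C.2, fun x => ?_⟩
  have h := hC x
  rw [← ENNReal.ofReal_tsum_of_nonneg (fun j => (decay_pos _).le) (summable_decay hA x),
    ← ENNReal.ofReal_coe_nnreal] at h
  exact (ENNReal.ofReal_le_ofReal_iff C.2).1 h

/-- A summable family exceeds a positive bound only finitely often. -/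
theorem finite_norm_lat_le (hA : A.det ≠ 0) (R : ℝ) : {j : Idx | ‖lat A j‖ ≤ R}.Finite := by
  by_cases hR : 0 ≤ R
  · have h := (summable_decay hA 0).tendsto_cofinite_zero
    have h1 := h.eventually_lt_const (u := ((1 + R) ^ 3)⁻¹) (by positivity)
    rw [Filter.eventually_cofinite] at h1
    refine h1.subset fun j hj => ?_
    simp only [Set.mem_ofPred_eq, zero_add, not_lt, decay] at hj ⊢
    gcongr
  · convert Set.finite_empty
    ext j
    simp only [Set.mem_ofPred_eq, Set.mem_empty_iff_false, iff_false]
    linarith [norm_nonneg (lat A j)]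

/-- On a bounded set only finitely many translates of a compactly supported function matter. -/
theorem exists_finset_lat (hA : A.det ≠ 0) {E : Type*} [Zero E] {f : Plane → E} (hf : HasCompactSupport f) (R : ℝ) :
    ∃ s : Finset Idx, ∀ x, ‖x‖ ≤ R → ∀ j ∉ s, f (x + lat A j) = 0 := by
  obtain ⟨M, hM⟩ := hf.isBounded.exists_norm_le
  refine ⟨(finite_norm_lat_le hA (R + M)).toFinset, fun x hx j hj => ?_⟩
  by_contra h0
  apply hj
  rw [Set.Finite.mem_toFinset]
  have h1 := hM _ (subset_tsupport f h0)
  calc ‖lat A j‖ = ‖(x + lat A j) - x‖ := by congr 1; abel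
    _ ≤ ‖x + lat A j‖ + ‖x‖ := norm_sub_le _ _
    _ ≤ R + M := by linarith

theorem continuous_tsum_lat (hA : A.det ≠ 0) {f : Plane → ℂ} (hf : Continuous f) {K : ℝ}
    (hK : ∀ x, ‖f x‖ ≤ K * decay x) : Continuous fun x => ∑' l, f (x + lat A l) := by
  have hK0 : 0 ≤ K := by
    have := (norm_nonneg _).trans (hK 0)
    exact nonneg_of_mul_nonneg_left this (decay_pos _)
  rw [continuous_iff_continuousAt]
  intro x₀
  have hc : ContinuousOn (fun x => ∑' l, f (x + lat A l)) (Metric.ball x₀ 1) := by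
    refine continuousOn_tsum (u := fun l => K * ((1 + (‖x₀‖ + 1)) ^ 3 * decay (lat A l)))
      (fun l => (hf.comp (continuous_add_const _)).continuousOn) ?_ fun l x hx => ?_
    · exact ((by simpa using summable_decay hA 0 :
        Summable fun l => decay (lat A l)).mul_left _).mul_left _
    · refine (hK _).trans (mul_le_mul_of_nonneg_left ((decay_add_le _ _).trans ?_) hK0)
      have : ‖x‖ ≤ ‖x₀‖ + 1 := by
        have h1 : ‖x - x₀‖ < 1 := by rwa [← dist_eq_norm]
        have h2 := norm_add_le x₀ (x - x₀)
        rw [add_sub_cancel] at h2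
        linarith
      have := (decay_pos (lat A l)).le
      gcongr
  exact hc.continuousAt (Metric.ball_mem_nhds x₀ one_pos)

theorem exists_decay_bound {E : Type*} [NormedAddCommGroup E] [NormedSpace ℝ E] (g : SchwartzMap E ℂ) :
    ∃ K : ℝ, 0 ≤ K ∧ ∀ x, ‖g x‖ ≤ K * decay x := by
  obtain ⟨q, -, hq⟩ := exists_seminorm_one_add_pow (E := E) 3 0
  refine ⟨q g, apply_nonneg _ _, fun x => ?_⟩
  have := hq g x
  rw [norm_iteratedFDeriv_zero] at this
  rw [decay, ← div_eq_mul_inv, le_div_iff₀ (by positivity), mul_comm]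
  exact this

/-- Periodizing does not change the integral. -/
theorem integral_cell_tsum (hA : A.det ≠ 0) {f : Plane → ℂ} (hf : Integrable f) :
    ∫ x, ∑' l, f (x + lat A l) ∂(cellMeasure A) = ∫ x, f x := by
  have hm : ∀ l, AEStronglyMeasurable (fun x => f (x + lat A l)) (cellMeasure A) := fun l =>
    (hf.comp_add_right (lat A l)).aestronglyMeasurable.restrict
  rw [integral_tsum hm, (hasSum_integral_cell hA hf).tsum_eq]
  rw [← lintegral_eq_tsum_cell hA (fun x => ‖f x‖ₑ)]
  exact hf.2.ne

/-- Integrating a periodic function over a cell by a partition of unity. -/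
theorem integral_partition_mul (hA : A.det ≠ 0) {ρ : Plane → ℂ} (hρ : IsPartition A ρ) {f : Plane → ℂ}
    (hf : Continuous f) (hper : ∀ k x, f (x + lat A k) = f x) :
    ∫ x, ρ x * f x = ∫ x, f x ∂(cellMeasure A) := by
  have hi : Integrable (fun x => ρ x * f x) :=
    (hρ.1.continuous.mul hf).integrable_of_hasCompactSupport hρ.2.1.mul_right
  rw [← integral_cell_tsum hA hi]
  refine integral_congr_ae (Filter.Eventually.of_forall fun x => ?_)
  simp only [hper]
  rw [tsum_mul_right, hρ.2.2, one_mul]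

theorem IsPartition.translate {ρ : Plane → ℂ} (hρ : IsPartition A ρ) (β : Plane) :
    IsPartition A (fun x => ρ (x - β)) := by
  refine ⟨hρ.1.comp (contDiff_id.sub contDiff_const), ?_, fun x => ?_⟩
  · exact hρ.2.1.comp_homeomorph (Homeomorph.subRight β)
  · simp only [add_sub_right_comm]
    exact hρ.2.2 _

theorem exists_contDiff_integral_eq_one :
    ∃ φ : Plane → ℝ, ContDiff ℝ ∞ φ ∧ HasCompactSupport φ ∧ ∫ x, φ x = 1 := by
  let χ : ContDiffBump (0 : Plane) := ⟨1, 2, by norm_num, by norm_num⟩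
  exact ⟨χ.normed volume, χ.contDiff_normed, χ.hasCompactSupport_normed, χ.integral_normed⟩

/-- The lattice translates of the indicator function of the cell sum to one. Convolution with a bump
function of integral one preserves this and makes the function smooth. -/
theorem exists_isPartition (hA : A.det ≠ 0) : ∃ ρ, IsPartition A ρ := by
  obtain ⟨φ, hφs, hφc, hφ1⟩ := exists_contDiff_integral_eq_one
  obtain ⟨ι, hι⟩ : ∃ ι : Plane → ℝ, ι = (cell A).indicator fun _ => 1 := ⟨_, rfl⟩
  have hιi : Integrable ι := hι ▸ (integrable_indicator_iff (measurableSet_cell hA)).2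
    (integrableOn_const (volume_cell_lt_top A).ne)
  have hιc : HasCompactSupport ι := by
    refine HasCompactSupport.of_support_subset_isCompact
      (isBounded_cell (A := A)).isCompact_closure ?_
    rw [hι]
    exact Set.support_indicator_subset.trans subset_closure
  obtain ⟨ρ, hρd⟩ : ∃ ρ, ρ = convolution ι φ (ContinuousLinearMap.lsmul ℝ ℝ) volume := ⟨_, rfl⟩
  have hρs : ContDiff ℝ ∞ ρ := by
    rw [hρd]
    exact HasCompactSupport.contDiff_convolution_right (𝕜 := ℝ) (n := ⊤) (μ := volume)
      (ContinuousLinearMap.lsmul ℝ ℝ) hφc hιi.locallyIntegrable hφs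
  have hρc : HasCompactSupport ρ := by
    rw [hρd]
    exact HasCompactSupport.convolution (μ := volume) (ContinuousLinearMap.lsmul ℝ ℝ) hιc hφc
  have hρ : ∀ x, ρ x = ∫ t, φ (x - t) ∂(cellMeasure A) := by
    intro x
    rw [hρd, convolution_def, ← integral_indicator (measurableSet_cell hA)]
    refine integral_congr_ae (Filter.Eventually.of_forall fun t => ?_)
    by_cases ht : t ∈ cell A <;> simp [hι, ht]
  refine ⟨fun x => (ρ x : ℂ), ?_, ?_, fun x => ?_⟩
  · exact Complex.ofRealCLM.contDiff.comp hρs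
  · exact hρc.comp_left (g := Complex.ofReal) (by simp)
  · have h1 := hasSum_integral_cell hA (f := fun t => φ (x - t))
      ((hφs.continuous.integrable_of_hasCompactSupport hφc).comp_sub_left x)
    rw [integral_sub_left_eq_self φ volume x, hφ1] at h1
    have h2 := (Equiv.neg Idx).hasSum_iff.2 h1
    have h3 : HasSum (fun k => ρ (x + lat A k)) 1 := by
      refine h2.congr_fun fun k => ?_
      simp only [Function.comp_apply, Equiv.neg_apply, hρ, lat_neg]
      congr 1; funext t; congr 1; abel
    have h4 := (Complex.ofRealCLM.hasSum h3).tsum_eq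
    simpa using h4

variable {L : Matrix (Fin 2) (Fin 2) ℝ}

/-- For k ≠ 0 a shift by β with β · Λk = π changes the sign of the exponential. The integral of a
periodic function over the cell can be computed with the partition or with its translate by β, so it
equals its own negative. -/
theorem integral_expI_cell (hL : L.det ≠ 0) (k : Idx) :
    ∫ α, expI (inner ℝ α (lat L k)) ∂(cellMeasure (dualMat L)) =
      if k = 0 then (volume.real (cell (dualMat L)) : ℂ) else 0 := by
  split_ifs with hk
  · simp [hk, lat_zero, expI_zero]
  have hA := det_dualMat_ne_zero hL
  obtain ⟨ρ, hρ⟩ := exists_isPartition hA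
  have hc : Continuous fun α : Plane => expI (inner ℝ α (lat L k)) :=
    continuous_expI.comp (by fun_prop)
  have hper : ∀ l α, expI (inner ℝ (α + lat (dualMat L) l) (lat L k)) = expI (inner ℝ α (lat L k)) :=
    fun l α => expI_inner_add_lat hL α l k
  have hl0 : lat L k ≠ 0 := by
    intro h
    exact hk (lat_injective hL (by rw [h, lat_zero]))
  set β : Plane := (Real.pi / ‖lat L k‖ ^ 2) • lat L k with hβ
  have hβk : inner ℝ β (lat L k) = Real.pi := by
    rw [hβ, inner_smul_left, real_inner_self_eq_norm_sq]
    have : ‖lat L k‖ ≠ 0 := norm_ne_zero_iff.2 hl0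
    simp only [conj_trivial]
    field_simp
  have h1 := integral_partition_mul hA hρ hc hper
  have h2 := integral_partition_mul hA (hρ.translate β) hc hper
  have h3 : ∫ x, ρ (x - β) * expI (inner ℝ x (lat L k)) =
      ∫ x, ρ x * expI (inner ℝ (x + β) (lat L k)) := by
    rw [← integral_sub_right_eq_self (fun x => ρ x * expI (inner ℝ (x + β) (lat L k))) β]
    simp only [sub_add_cancel]
  have h4 : ∀ x : Plane, ρ x * expI (inner ℝ (x + β) (lat L k)) =
      -1 * (ρ x * expI (inner ℝ x (lat L k))) := by
    intro x
    rw [inner_add_left, expI_add, hβk]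
    have : expI Real.pi = -1 := by rw [expI, mul_comm, Complex.exp_pi_mul_I]
    rw [this]; ring
  simp only [h3, h4, integral_const_mul, h1] at h2
  have : (2 : ℂ) * ∫ α, expI (inner ℝ α (lat L k)) ∂(cellMeasure (dualMat L)) = 0 := by
    linear_combination (-1 : ℂ) * h2
  simpa using this

end LatticeSums

/-! ### Poisson summation -/

section Poisson

local notation "𝓢₂" => SchwartzMap Plane ℂ

variable {A L : Matrix (Fin 2) (Fin 2) ℝ}

/-- The linear change of variables to the unit square, over which Fourier coefficients on the torus
are integrals. The upper end is written -1/2 + 1 to match that formula. -/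
theorem setIntegral_cell_eq (hA : A.det ≠ 0) (f : Plane → ℂ) :
    ∫ x, f x ∂(cellMeasure A) = ((|A.det| : ℝ) : ℂ) *
      ∫ z in {z : Fin 2 → ℝ | ∀ i, z i ∈ Set.Ioc (-(1 / 2) : ℝ) (-(1 / 2) + 1)}, f (matVec A z) := by
  set Q := {z : Fin 2 → ℝ | ∀ i, z i ∈ Set.Ioc (-(1 / 2) : ℝ) (-(1 / 2) + 1)} with hQ
  have hQm : MeasurableSet Q := MeasurableSet.univ_pi' fun _ => measurableSet_Ioc
  have h1 : cell A = (MeasurableEquiv.toLp 2 (Fin 2 → ℝ)).symm ⁻¹' (Matrix.toLin' A '' Q) := by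
    ext x
    constructor
    · rintro ⟨z, hz, rfl⟩
      refine ⟨z, fun i => ⟨(hz i).1, (hz i).2.trans (by norm_num)⟩, rfl⟩
    · rintro ⟨z, hz, h⟩
      refine ⟨z, fun i => ⟨(hz i).1, (hz i).2.trans (by norm_num)⟩, ?_⟩
      unfold matVec
      rw [Matrix.toLin'_apply] at h
      rw [h]
      rfl
  have h2 := (EuclideanSpace.volume_preserving_symm_measurableEquiv_toLp (Fin 2)).setIntegral_preimage_emb
    (MeasurableEquiv.measurableEmbedding _) (fun y => f (WithLp.toLp 2 y)) (Matrix.toLin' A '' Q)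
  rw [← h1] at h2
  have h3 := integral_image_eq_integral_abs_det_fderiv_smul volume hQm
    (f := Matrix.toLin' A) (f' := fun _ => LinearMap.toContinuousLinearMap (Matrix.toLin' A))
    (fun z _ => (LinearMap.toContinuousLinearMap (Matrix.toLin' A)).hasFDerivAt.hasFDerivWithinAt)
    (fun x _ y _ hxy => by
      have h := congrArg (A⁻¹ *ᵥ ·) hxy
      simp only [Matrix.toLin'_apply] at h
      rwa [Matrix.mulVec_mulVec, Matrix.mulVec_mulVec,
        Matrix.nonsing_inv_mul _ (isUnit_iff_ne_zero.2 hA), Matrix.one_mulVec,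
        Matrix.one_mulVec] at h)
    (fun y => f (WithLp.toLp 2 y))
  rw [h3] at h2
  refine h2.trans ?_
  rw [integral_smul]
  simp only [LinearMap.det_toContinuousLinearMap, LinearMap.det_toLin']
  rfl

theorem mFourier_coe (n : Fin 2 → ℤ) (z : Fin 2 → ℝ) :
    UnitAddTorus.mFourier n (fun i => (z i : UnitAddCircle)) =
      expI (2 * Real.pi * (z ⬝ᵥ fun i => (n i : ℝ))) := by
  change ∏ i, fourier (n i) (z i : UnitAddCircle) = _
  simp only [fourier_coe_apply]
  rw [← Complex.exp_sum, expI]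
  congr 1
  simp only [dotProduct, Fin.sum_univ_two]
  push_cast
  ring

theorem continuous_torus_of_comp {f : UnitAddTorus (Fin 2) → ℂ}
    (h : Continuous fun z : Fin 2 → ℝ => f fun i => (z i : UnitAddCircle)) : Continuous f := by
  have hq : IsOpenQuotientMap (Pi.map fun (_ : Fin 2) (x : ℝ) => (x : UnitAddCircle)) :=
    IsOpenQuotientMap.piMap fun _ => QuotientAddGroup.isOpenQuotientMap_mk
  exact hq.continuous_comp_iff.1 h

theorem fourier_lat_eq (g : 𝓢₂) (k : Idx) :
    ∫ α, expI (-(inner ℝ α (lat L k))) * g α = (𝓕 g : 𝓢₂) ((2 * Real.pi)⁻¹ • lat L k) := by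
  have := Real.pi_pos
  rw [SchwartzMap.fourier_coe, Real.fourier_eq]
  refine integral_congr_ae (Filter.Eventually.of_forall fun α => ?_)
  simp only [Circle.smul_def, smul_eq_mul, Real.fourierChar_apply, expI]
  congr 2
  rw [inner_smul_right]
  push_cast
  field_simp

theorem decay_smul_le (g : 𝓢₂) (c : ℝ) (hc : c ≠ 0) :
    ∃ K : ℝ, 0 ≤ K ∧ ∀ x, ‖g (c • x)‖ ≤ K * decay x := by
  obtain ⟨K, hK0, hK⟩ := exists_decay_bound g
  refine ⟨K * (1 + |c|⁻¹) ^ 3, by positivity, fun x => (hK _).trans ?_⟩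
  rw [mul_assoc]
  gcongr
  unfold decay
  rw [← div_eq_mul_inv, inv_eq_one_div, div_le_div_iff₀ (by positivity) (by positivity), one_mul,
    ← mul_pow]
  gcongr
  rw [norm_smul, Real.norm_eq_abs]
  have : 0 < |c| := abs_pos.2 hc
  have h1 : |c|⁻¹ * (|c| * ‖x‖) = ‖x‖ := by field_simp
  nlinarith [norm_nonneg x, inv_pos.2 this, mul_nonneg this.le (norm_nonneg x)]

/-- The Poisson summation formula for the lattice of `Λ*`. -/
theorem hasSum_poisson (hL : L.det ≠ 0) (g : 𝓢₂) (α : Plane) :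
    HasSum (fun k => (normConst L : ℂ) ^ 2 * (expI (inner ℝ α (lat L k)) *
      ∫ α', expI (-(inner ℝ α' (lat L k))) * g α')) (∑' l, g (α + lat (dualMat L) l)) := by
  have hA := det_dualMat_ne_zero hL
  set F : Plane → ℂ := fun α => ∑' l, g (α + lat (dualMat L) l) with hF
  obtain ⟨K, hK0, hK⟩ := exists_decay_bound g
  have hFc : Continuous F := continuous_tsum_lat hA g.continuous hK
  have hFper : ∀ α l, F (α + lat (dualMat L) l) = F α := by
    intro α l
    simp only [hF]
    rw [← (Equiv.addLeft l).tsum_eq (fun m => g (α + lat (dualMat L) m))]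
    refine tsum_congr fun m => ?_
    rw [Equiv.coe_addLeft, lat_add, add_assoc]
  -- The periodization is moved to the torus by means of arbitrary real representatives; lattice
  -- periodicity makes the choice irrelevant.
  set f₀ : UnitAddTorus (Fin 2) → ℂ := fun t => F (matVec (dualMat L) fun i => (t i).out) with hf₀
  have hf₀c : ∀ z : Fin 2 → ℝ, f₀ (fun i => (z i : UnitAddCircle)) = F (matVec (dualMat L) z) := by
    intro z
    have : ∀ i, ∃ n : ℤ, ((z i : UnitAddCircle)).out = z i + n := by
      intro i
      have h1 : (((z i : UnitAddCircle).out : ℝ) : UnitAddCircle) = (z i : UnitAddCircle) :=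
        QuotientAddGroup.out_eq' _
      rw [QuotientAddGroup.eq] at h1
      obtain ⟨n, hn⟩ := AddSubgroup.mem_zmultiples_iff.1 h1
      refine ⟨-n, ?_⟩
      simp only [zsmul_eq_mul, mul_one] at hn
      push_cast
      linarith
    choose n hn using this
    simp only [hf₀, hn]
    have e : matVec (dualMat L) (fun i => z i + (n i : ℝ)) = matVec (dualMat L) z + lat (dualMat L) n := by
      unfold lat
      rw [← matVecL_apply, ← matVecL_apply, ← matVecL_apply, ← map_add]
      rfl
    rw [e, hFper]
  let f : C(UnitAddTorus (Fin 2), ℂ) := ⟨f₀, continuous_torus_of_comp (by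
    simp only [hf₀c]
    exact hFc.comp (matVecL (dualMat L)).continuous)⟩
  have hinner : ∀ (z : Fin 2 → ℝ) (k : Idx),
      inner ℝ (matVec (dualMat L) z) (lat L k) = 2 * Real.pi * (z ⬝ᵥ fun i => (k i : ℝ)) :=
    fun z k => inner_matVec_dualMat hL z _
  have hdet : (normConst L : ℂ) ^ 2 * ((|(dualMat L).det| : ℝ) : ℂ) = 1 := by
    have := normConst_sq_mul_volume hL
    rw [Measure.real, volume_cell, ENNReal.toReal_ofReal (abs_nonneg _)] at this
    exact_mod_cast this
  have hcoef : ∀ k, UnitAddTorus.mFourierCoeff f k = (normConst L : ℂ) ^ 2 *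
      ∫ α', expI (-(inner ℝ α' (lat L k))) * g α' := by
    intro k
    have hi : Integrable (fun α' => expI (-(inner ℝ α' (lat L k))) * g α') := by
      refine g.integrable.bdd_mul (c := 1) ?_ (Filter.Eventually.of_forall fun x => (norm_expI _).le)
      exact (continuous_expI.comp (by fun_prop)).aestronglyMeasurable
    -- The integral over the plane is folded onto the dual cell, which is the image of the unit
    -- square; `hdet` cancels the Jacobian.
    rw [← integral_cell_tsum hA hi, setIntegral_cell_eq hA, ← mul_assoc, hdet, one_mul,
      UnitAddTorus.mFourierCoeff_eq_integral _ k (fun _ => -(1 / 2))]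
    refine integral_congr_ae (Filter.Eventually.of_forall fun z => ?_)
    simp only
    change UnitAddTorus.mFourier (-k) (fun i => (z i : UnitAddCircle)) •
      f₀ (fun i => (z i : UnitAddCircle)) = _
    rw [hf₀c, mFourier_coe, smul_eq_mul]
    have e : ∀ l, expI (-(inner ℝ (matVec (dualMat L) z + lat (dualMat L) l) (lat L k))) =
        expI (2 * Real.pi * (z ⬝ᵥ fun i => ((-k) i : ℝ))) := by
      intro l
      rw [expI_neg, expI_inner_add_lat hL, ← expI_neg, hinner]
      congr 1
      simp [dotProduct]
      ring
    simp only [e]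
    rw [tsum_mul_left]
  -- The coefficients are values of the Schwartz function 𝓕 g at lattice points, so the Fourier
  -- series converges absolutely and represents the periodization at every point.
  have hsum : Summable (UnitAddTorus.mFourierCoeff f) := by
    obtain ⟨K', hK'0, hK'⟩ := decay_smul_le (𝓕 g) (2 * Real.pi)⁻¹ (by
      have := Real.pi_pos; positivity)
    refine Summable.of_norm_bounded (g := fun k => normConst L ^ 2 * (K' * decay (lat L k))) ?_ fun k => ?_
    · exact ((by simpa using summable_decay hL 0 :
        Summable fun l => decay (lat L l)).mul_left _).mul_left _
    · rw [hcoef, fourier_lat_eq, norm_mul, norm_pow, Complex.norm_real, Real.norm_eq_abs, sq_abs]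
      gcongr
      exact hK' _
  have key := UnitAddTorus.hasSum_mFourier_series_apply_of_summable hsum
    (fun i => ((coords (dualMat L) α i : ℝ) : UnitAddCircle))
  have e1 : f (fun i => ((coords (dualMat L) α i : ℝ) : UnitAddCircle)) = F α := by
    change f₀ _ = _
    rw [hf₀c, matVec_coords hA]
  rw [e1] at key
  refine key.congr_fun fun k => ?_
  rw [hcoef, mFourier_coe, ← hinner, matVec_coords hA, smul_eq_mul]
  ring

end Poisson

/-! ### Differentiation under sums and integrals with oscillating factors -/

section Oscillatory

variable {D E : Type*} [NormedAddCommGroup D] [NormedSpace ℝ D] [NormedAddCommGroup E]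
  [NormedSpace ℝ E] {Ω : Type*} [MeasurableSpace Ω] {μ : Measure Ω}

theorem inv_one_add_norm_add_pow_le {E : Type*} [NormedAddCommGroup E] (x y : E) (n : ℕ) :
    ((1 + ‖x + y‖) ^ n)⁻¹ ≤ (1 + ‖x‖) ^ n * ((1 + ‖y‖) ^ n)⁻¹ := by
  rw [← div_eq_mul_inv, inv_eq_one_div, div_le_div_iff₀ (by positivity) (by positivity), one_mul,
    ← mul_pow]
  have h : ‖y‖ ≤ ‖x + y‖ + ‖x‖ := by
    calc ‖y‖ = ‖x + y - x‖ := by congr 1; abel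
      _ ≤ _ := norm_sub_le _ _
  gcongr
  nlinarith [norm_nonneg x, norm_nonneg (x + y)]

theorem exists_bound_translate (G : SchwartzMap E ℂ) (n k : ℕ) :
    ∃ q : ℝ, 0 ≤ q ∧ ∀ x y : E, ‖iteratedFDeriv ℝ k G (x + y)‖ ≤
      q * ((1 + ‖x‖) ^ n * ((1 + ‖y‖) ^ n)⁻¹) := by
  obtain ⟨q, -, hq⟩ := exists_seminorm_one_add_pow (E := E) n k
  refine ⟨q G, apply_nonneg _ _, fun x y => ?_⟩
  calc _ ≤ q G * ((1 + ‖x + y‖) ^ n)⁻¹ := by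
        rw [← div_eq_mul_inv, le_div_iff₀ (by positivity), mul_comm]
        exact hq G _
    _ ≤ _ := by
        gcongr
        exact inv_one_add_norm_add_pow_le x y n

/-- Superpositions of translates of a Schwartz function with oscillating factors are
differentiable, and the derivative is taken under the integral. -/
theorem differentiable_oscillatory (G : SchwartzMap E ℂ) (l : D →L[ℝ] E) {p : Ω → E} {κ : Ω → ℝ}
    {τ : Ω → D →L[ℝ] ℝ} (hp : StronglyMeasurable p) (hκ : StronglyMeasurable κ)
    (hτ : StronglyMeasurable τ) {C : ℝ} (hτp : ∀ w, ‖τ w‖ ≤ C * (1 + ‖p w‖))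
    (hi : Integrable (fun w => ((1 + ‖p w‖) ^ 6)⁻¹) μ) :
    Differentiable ℝ (fun y => ∫ w, expI (κ w + τ w y) * G (l y + p w) ∂μ) ∧
    ∀ y e, fderiv ℝ (fun y => ∫ w, expI (κ w + τ w y) * G (l y + p w) ∂μ) y e =
      ∫ w, expI (κ w + τ w y) * ((∂_{l e} G : SchwartzMap E ℂ) (l y + p w) +
        Complex.I * (τ w e : ℂ) * G (l y + p w)) ∂μ := by
  -- Differentiating the phase costs one power of 1 + ‖p w‖. Of seven powers of decay six remain,
  -- which is what the hypothesis `hi` integrates.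
  obtain ⟨q₀, hq₀0, hq₀⟩ := exists_bound_translate G 7 0
  obtain ⟨q₁, hq₁0, hq₁⟩ := exists_bound_translate G 7 1
  simp only [norm_iteratedFDeriv_zero] at hq₀
  simp only [norm_iteratedFDeriv_one] at hq₁
  set F : D → Ω → ℂ := fun y w => expI (κ w + τ w y) * G (l y + p w) with hF
  set F' : D → Ω → D →L[ℝ] ℂ := fun y w =>
    expI (κ w + τ w y) • ((fderiv ℝ G (l y + p w)).comp l) +
      (Complex.I * expI (κ w + τ w y) * G (l y + p w)) • (Complex.ofRealCLM.comp (τ w)) with hF'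
  have hdiff : ∀ w y, HasFDerivAt (fun y => F y w) (F' y w) y := by
    intro w y
    have h1 : HasFDerivAt (fun y => κ w + τ w y) (τ w) y := (τ w).hasFDerivAt.const_add _
    have h2 : HasFDerivAt (fun y => expI (κ w + τ w y))
        ((Complex.I * expI (κ w + τ w y)) • (Complex.ofRealCLM.comp (τ w))) y := by
      have h := (hasDerivAt_expI (κ w + τ w y)).hasFDerivAt.comp y h1
      refine h.congr_fderiv ?_
      ext v
      simp [mul_comm]
    have h3 : HasFDerivAt (fun y => G (l y + p w)) ((fderiv ℝ G (l y + p w)).comp l) y :=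
      (G.differentiableAt.hasFDerivAt (x := l y + p w)).comp y (l.hasFDerivAt.add_const _)
    refine (h2.mul h3).congr_fderiv ?_
    ext v
    simp [hF']
    ring
  have hGm : ∀ y, StronglyMeasurable fun w => G (l y + p w) := fun y =>
    G.continuous.comp_stronglyMeasurable (stronglyMeasurable_const.add hp)
  have hτy : ∀ y, StronglyMeasurable fun w => τ w y := fun y =>
    (ContinuousLinearMap.apply ℝ ℝ y).continuous.comp_stronglyMeasurable hτ
  have hEm : ∀ y, StronglyMeasurable fun w => expI (κ w + τ w y) := fun y =>
    continuous_expI.comp_stronglyMeasurable (hκ.add (hτy y))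
  have hFm : ∀ y, StronglyMeasurable (F y) := fun y => (hEm y).mul (hGm y)
  have hF'm : ∀ y, StronglyMeasurable (F' y) := by
    intro y
    have h1 : StronglyMeasurable fun w => (fderiv ℝ G (l y + p w)).comp l := by
      have hc : Continuous fun x => (fderiv ℝ G x).comp l :=
        ((G.smooth 1).continuous_fderiv one_ne_zero).clm_comp continuous_const
      exact hc.comp_stronglyMeasurable (stronglyMeasurable_const.add hp)
    have h2 : StronglyMeasurable fun w => Complex.ofRealCLM.comp (τ w) :=
      ((ContinuousLinearMap.compL ℝ D ℝ ℂ Complex.ofRealCLM).continuous).comp_stronglyMeasurable hτ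
    exact ((hEm y).smul h1).add (((stronglyMeasurable_const.mul (hEm y)).mul (hGm y)).smul h2)
  have key : ∀ y₀, HasFDerivAt (fun y => ∫ w, F y w ∂μ) (∫ w, F' y₀ w ∂μ) y₀ ∧
      Integrable (F' y₀) μ := by
    intro y₀
    -- M bounds 1 + ‖l y‖ on the unit ball around y₀ and so makes the dominating function
    -- independent of y there.
    set M := 1 + ‖l‖ * (‖y₀‖ + 1) with hM
    have hM1 : 1 ≤ M := by rw [hM]; nlinarith [mul_nonneg (norm_nonneg l) (by positivity : 0 ≤ ‖y₀‖ + 1)]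
    set bd : Ω → ℝ := fun w => (q₁ * M ^ 7 * ‖l‖ + q₀ * M ^ 7 * C) * ((1 + ‖p w‖) ^ 6)⁻¹ with hbd
    have hbdi : Integrable bd μ := hi.const_mul _
    have hball : ∀ y ∈ Metric.ball y₀ 1, 1 + ‖l y‖ ≤ M := by
      intro y hy
      have h1 : ‖y - y₀‖ < 1 := by rwa [← dist_eq_norm]
      have h2 := norm_add_le y₀ (y - y₀)
      rw [add_sub_cancel] at h2
      have h3 := l.le_opNorm y
      have : ‖l‖ * ‖y‖ ≤ ‖l‖ * (‖y₀‖ + 1) := by gcongr; linarith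
      linarith
    have hinv : ∀ w, ((1 + ‖p w‖) ^ 7)⁻¹ * (1 + ‖p w‖) = ((1 + ‖p w‖) ^ 6)⁻¹ := by
      intro w
      have : 1 + ‖p w‖ ≠ 0 := by positivity
      field_simp
    have hinv' : ∀ w, ((1 + ‖p w‖) ^ 7)⁻¹ ≤ ((1 + ‖p w‖) ^ 6)⁻¹ := by
      intro w
      rw [← hinv]
      exact le_mul_of_one_le_right (by positivity) (by linarith [norm_nonneg (p w)])
    have hFb : ∀ y ∈ Metric.ball y₀ 1, ∀ w, ‖G (l y + p w)‖ ≤ q₀ * M ^ 7 * ((1 + ‖p w‖) ^ 7)⁻¹ := by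
      intro y hy w
      refine (hq₀ _ _).trans ?_
      rw [mul_assoc]
      have := hball y hy
      gcongr
    have hbound : ∀ y ∈ Metric.ball y₀ 1, ∀ w, ‖F' y w‖ ≤ bd w := by
      intro y hy w
      have hb := hball y hy
      have h1 : ‖expI (κ w + τ w y) • ((fderiv ℝ G (l y + p w)).comp l)‖ ≤
          q₁ * M ^ 7 * ‖l‖ * ((1 + ‖p w‖) ^ 6)⁻¹ := by
        rw [norm_smul, norm_expI, one_mul]
        refine (ContinuousLinearMap.opNorm_comp_le _ _).trans ?_
        calc _ ≤ (q₁ * (M ^ 7 * ((1 + ‖p w‖) ^ 6)⁻¹)) * ‖l‖ := by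
              gcongr
              refine (hq₁ _ _).trans ?_
              have := hinv' w
              gcongr
          _ = _ := by ring
      have h2 : ‖(Complex.I * expI (κ w + τ w y) * G (l y + p w)) • (Complex.ofRealCLM.comp (τ w))‖ ≤
          q₀ * M ^ 7 * C * ((1 + ‖p w‖) ^ 6)⁻¹ := by
        rw [norm_smul, norm_mul, norm_mul, Complex.norm_I, norm_expI, one_mul, one_mul]
        have h3 : ‖Complex.ofRealCLM.comp (τ w)‖ ≤ C * (1 + ‖p w‖) := by
          refine (ContinuousLinearMap.opNorm_comp_le _ _).trans ?_
          rw [Complex.ofRealCLM_norm, one_mul]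
          exact hτp w
        calc _ ≤ (q₀ * M ^ 7 * ((1 + ‖p w‖) ^ 7)⁻¹) * (C * (1 + ‖p w‖)) := by
              have := hFb y hy w
              gcongr
          _ = q₀ * M ^ 7 * C * (((1 + ‖p w‖) ^ 7)⁻¹ * (1 + ‖p w‖)) := by ring
          _ = _ := by rw [hinv]
      calc _ ≤ _ := norm_add_le _ _
        _ ≤ q₁ * M ^ 7 * ‖l‖ * ((1 + ‖p w‖) ^ 6)⁻¹ + q₀ * M ^ 7 * C * ((1 + ‖p w‖) ^ 6)⁻¹ :=
            add_le_add h1 h2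
        _ = _ := by simp only [hbd]; ring
    have hy₀ : y₀ ∈ Metric.ball y₀ 1 := Metric.mem_ball_self one_pos
    have hFi : Integrable (F y₀) μ := by
      refine (hi.const_mul (q₀ * M ^ 7)).mono' (hFm y₀).aestronglyMeasurable
        (Filter.Eventually.of_forall fun w => ?_)
      rw [hF]
      simp only [norm_mul, norm_expI, one_mul]
      refine (hFb y₀ hy₀ w).trans ?_
      have := hinv' w
      gcongr
    have hF'i : Integrable (F' y₀) μ := hbdi.mono' (hF'm y₀).aestronglyMeasurable
      (Filter.Eventually.of_forall fun w => hbound y₀ hy₀ w)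
    refine ⟨hasFDerivAt_integral_of_dominated_of_fderiv_le (bound := bd) (Metric.ball_mem_nhds y₀ one_pos)
      (Filter.Eventually.of_forall fun y => (hFm y).aestronglyMeasurable) hFi
      (hF'm y₀).aestronglyMeasurable (Filter.Eventually.of_forall fun w y hy => hbound y hy w) hbdi
      (Filter.Eventually.of_forall fun w y _ => hdiff w y), hF'i⟩
  refine ⟨fun y => (key y).1.differentiableAt, fun y e => ?_⟩
  rw [(key y).1.fderiv, ContinuousLinearMap.integral_apply (key y).2]
  refine integral_congr_ae (Filter.Eventually.of_forall fun w => ?_)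
  simp only [hF', SchwartzMap.lineDerivOp_apply_eq_fderiv]
  simp
  ring

end Oscillatory

/-! ### The operator on test functions whose transpose is the Bloch transform -/

section BlochOperators

local notation "𝓢₂" => SchwartzMap Plane ℂ
local notation "𝓢₄" => SchwartzMap (Plane × Plane) ℂ

variable {L : Matrix (Fin 2) (Fin 2) ℝ}

/-- The product of Lebesgue measure and counting measure. -/
abbrev prodCount : Measure (Plane × Idx) := (volume : Measure Plane).prod Measure.count

theorem integral_count_eq_tsum {f : Idx → ℂ} (hf : Integrable f Measure.count) :
    ∫ j, f j ∂Measure.count = ∑' j, f j := by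
  rw [integral_countable hf]
  simp [Measure.real]

/-- Six powers of the joint norm provide three for each variable, enough for an integral over the
plane in one and a lattice sum in the other. -/
theorem inv_one_add_norm_prod_pow_le (a b : Plane) :
    ((1 + ‖(a, b)‖) ^ 6)⁻¹ ≤ decay a * decay b := by
  unfold decay
  rw [← mul_inv]
  have h1 : ‖a‖ ≤ ‖(a, b)‖ := le_max_left _ _
  have h2 : ‖b‖ ≤ ‖(a, b)‖ := le_max_right _ _
  calc ((1 + ‖(a, b)‖) ^ 6)⁻¹ = ((1 + ‖(a, b)‖) ^ 3 * (1 + ‖(a, b)‖) ^ 3)⁻¹ := by ring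
    _ ≤ _ := by gcongr

theorem integrable_decay_prod (hL : L.det ≠ 0) (x : Plane) :
    Integrable (fun w : Plane × Idx => decay w.1 * decay (x + lat L w.2)) prodCount := by
  refine Integrable.mul_prod (f := fun α : Plane => decay α) (g := fun j => decay (x + lat L j))
    integrable_decay ?_
  rw [integrable_count_iff]
  simpa [abs_of_pos (decay_pos _)] using summable_decay hL x

theorem exists_seminorm_decay_prod :
    ∃ q : Seminorm ℂ 𝓢₄, Continuous q ∧ ∀ G a b, ‖G (a, b)‖ ≤ q G * (decay a * decay b) := by
  obtain ⟨q, hqc, hq⟩ := exists_seminorm_one_add_pow (E := Plane × Plane) 6 0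
  refine ⟨q, hqc, fun G a b => ?_⟩
  have h := hq G (a, b)
  rw [norm_iteratedFDeriv_zero] at h
  calc ‖G (a, b)‖ ≤ q G * ((1 + ‖(a, b)‖) ^ 6)⁻¹ := by
        rw [← div_eq_mul_inv, le_div_iff₀ (by positivity), mul_comm]; exact h
    _ ≤ _ := by
        gcongr
        exact inv_one_add_norm_prod_pow_le a b

theorem measurable_lat_snd : StronglyMeasurable fun w : Plane × Idx => lat L w.2 :=
  (StronglyMeasurable.of_discrete (f := lat L)).comp_measurable measurable_snd

theorem integrable_blochA (hL : L.det ≠ 0) (G : 𝓢₄) (x : Plane) :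
    Integrable (fun w : Plane × Idx => expI (-(inner ℝ w.1 (lat L w.2))) * G (w.1, x - lat L w.2))
      prodCount := by
  obtain ⟨q, -, hq⟩ := exists_seminorm_decay_prod
  have hm := measurable_lat_snd (L := L)
  refine ((integrable_decay_prod hL (-x)).const_mul (q G)).mono' ?_ (Filter.Eventually.of_forall fun w => ?_)
  · refine StronglyMeasurable.aestronglyMeasurable ?_
    refine StronglyMeasurable.mul ?_ ?_
    · exact continuous_expI.comp_stronglyMeasurable
        (measurable_fst.stronglyMeasurable.inner hm).neg
    · exact G.continuous.comp_stronglyMeasurable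
        (measurable_fst.stronglyMeasurable.prodMk (stronglyMeasurable_const.sub hm))
  · rw [norm_mul, norm_expI, one_mul]
    refine (hq G _ _).trans ?_
    rw [← decay_neg (x - lat L w.2), neg_sub, sub_eq_neg_add]

theorem integral_prodCount {f : Plane × Idx → ℂ} (hf : Integrable f prodCount) :
    ∫ w, f w ∂prodCount = ∑' j, ∫ α, f (α, j) := by
  rw [integral_prod_symm _ hf, integral_count_eq_tsum hf.integral_prod_right]

/-- The pre-adjoint of the Bloch transform, as a linear map into functions. -/
def blochAFun (hL : L.det ≠ 0) : 𝓢₄ →ₗ[ℂ] (Plane → ℂ) where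
  toFun G x := (normConst L : ℂ) * ∫ w : Plane × Idx,
    expI (-(inner ℝ w.1 (lat L w.2))) * G (w.1, x - lat L w.2) ∂prodCount
  map_add' G H := by
    funext x
    simp only [_root_.add_apply, Pi.add_apply, mul_add]
    rw [integral_add (integrable_blochA hL G x) (integrable_blochA hL H x)]
    ring
  map_smul' c G := by
    funext x
    simp only [_root_.smul_apply, smul_eq_mul, RingHom.id_apply, Pi.smul_apply]
    simp only [mul_left_comm _ c, integral_const_mul]

theorem blochAFun_apply (hL : L.det ≠ 0) (G : 𝓢₄) (x : Plane) :
    blochAFun hL G x = (normConst L : ℂ) * ∫ w : Plane × Idx,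
      expI (-(inner ℝ w.1 (lat L w.2))) * G (w.1, x - lat L w.2) ∂prodCount := rfl

theorem fderiv_expI_neg_inner (v b α : Plane) :
    fderiv ℝ (fun α : Plane => expI (-(inner ℝ α v))) α b =
      -(Complex.I * (inner ℝ b v : ℝ)) * expI (-(inner ℝ α v)) := by
  have h1 : HasFDerivAt (fun α : Plane => -(inner ℝ α v)) (-(innerSL ℝ v)) α := by
    have := ((innerSL ℝ v).hasFDerivAt (x := α)).neg
    refine this.congr_of_eventuallyEq (Filter.Eventually.of_forall fun y => ?_)
    simp [real_inner_comm]
  have h2 := (hasDerivAt_expI (-(inner ℝ α v))).hasFDerivAt.comp α h1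
  have h3 : fderiv ℝ (fun α : Plane => expI (-(inner ℝ α v))) α = _ := h2.fderiv
  rw [h3]
  simp [real_inner_comm]
  ring

theorem contDiff_expI_neg_inner (v : Plane) : ContDiff ℝ ∞ fun α : Plane => expI (-(inner ℝ α v)) :=
  contDiff_expI.comp ((contDiff_id.inner ℝ contDiff_const).neg)

/-- Integration by parts: a derivative in α produces the lattice vector, and hence gives control of
its growth. -/
theorem integral_expI_mul_fderiv (G : 𝓢₄) (v y b : Plane) :
    ∫ α, expI (-(inner ℝ α v)) * (∂_{((b, 0) : Plane × Plane)} G : 𝓢₄) (α, y) =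
      Complex.I * (inner ℝ b v : ℝ) * ∫ α, expI (-(inner ℝ α v)) * G (α, y) := by
  obtain ⟨q, -, hq⟩ := exists_seminorm_decay_prod
  have hint : ∀ H : 𝓢₄, Integrable fun α => expI (-(inner ℝ α v)) * H (α, y) := by
    intro H
    refine (integrable_decay.const_mul (q H * decay y)).mono' ?_ (Filter.Eventually.of_forall fun α => ?_)
    · exact ((contDiff_expI_neg_inner v).continuous.mul
        (H.continuous.comp (by fun_prop))).aestronglyMeasurable
    · rw [norm_mul, norm_expI, one_mul]
      exact (hq H α y).trans (le_of_eq (by ring))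
  have hfd : ∀ α, fderiv ℝ (fun α => G (α, y)) α b = (∂_{((b, 0) : Plane × Plane)} G : 𝓢₄) (α, y) := by
    intro α
    rw [SchwartzMap.lineDerivOp_apply_eq_fderiv]
    have h1 : HasFDerivAt (fun α : Plane => (α, y)) (ContinuousLinearMap.inl ℝ Plane Plane) α :=
      hasFDerivAt_prodMk_left α y
    have h2 := (G.differentiableAt.hasFDerivAt (x := (α, y))).comp α h1
    have h3 : fderiv ℝ (fun α => G (α, y)) α = _ := h2.fderiv
    rw [h3]
    simp
  have key := integral_mul_fderiv_eq_neg_fderiv_mul_of_integrable (μ := (volume : Measure Plane))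
    (f := fun α => expI (-(inner ℝ α v))) (g := fun α => G (α, y)) (v := b)
    (by
      simp only [fderiv_expI_neg_inner, mul_assoc]
      exact (hint G).const_mul _)
    (by simp only [hfd]; exact hint _) (hint G)
    (fun α _ => (contDiff_expI_neg_inner v).differentiable (by simp) α)
    (fun α _ => (G.differentiable.comp (by fun_prop : Differentiable ℝ fun α : Plane => (α, y))) α)
  simp only [hfd, fderiv_expI_neg_inner, mul_assoc, integral_const_mul] at key
  rw [key]
  ring

/-- The formula arises from pairing G with the Bloch transform and substituting x - Λj for x in the
j-th term. Sum and integral are treated as one integral over `Plane × Idx` for differentiation.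
Derivatives in x fall on G, and multiplication by a coordinate is handled by a product and an
α-derivative, so `exists_clm_of_intertwining` applies with a trivial parameter. -/
theorem exists_blochA (hL : L.det ≠ 0) :
    ∃ S : 𝓢₄ →L[ℂ] 𝓢₂, ∀ G x, S G x = (normConst L : ℂ) * ∑' j,
      ∫ α, expI (-(inner ℝ α (lat L j))) * G (α, x - lat L j) := by
  have main : ∃ S : 𝓢₄ →L[ℂ] 𝓢₂, ∀ G x, S G x = blochAFun hL G x := by
    refine exists_clm_of_intertwining (Ξ := Unit) (fun _ => blochAFun hL) ?_ ?_ ?_ ?_ ()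
    · intro _
      obtain ⟨q, hqc, hq⟩ := exists_seminorm_decay_prod
      obtain ⟨C, hC0, hC⟩ := exists_tsum_decay_le_real hL
      set I := ∫ α : Plane, decay α with hI
      have hI0 : 0 ≤ I := integral_nonneg fun α => (decay_pos α).le
      have hn := (normConst_pos hL).le
      refine ⟨(normConst L * (I * C)).toNNReal • q, continuous_const.mul hqc,
        fun G x => ?_⟩
      change ‖(normConst L : ℂ) * ∫ w : Plane × Idx,
        expI (-(inner ℝ w.1 (lat L w.2))) * G (w.1, x - lat L w.2) ∂prodCount‖ ≤
        ((normConst L * (I * C)).toNNReal : ℝ) * q G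
      rw [Real.coe_toNNReal _ (by positivity), norm_mul, Complex.norm_of_nonneg hn, mul_assoc]
      gcongr
      have h1 : ∀ w : Plane × Idx, ‖expI (-(inner ℝ w.1 (lat L w.2))) * G (w.1, x - lat L w.2)‖ ≤
          q G * (decay w.1 * decay (-x + lat L w.2)) := by
        intro w
        rw [norm_mul, norm_expI, one_mul]
        refine (hq G _ _).trans ?_
        rw [← decay_neg (x - lat L w.2), neg_sub, sub_eq_neg_add]
      refine (norm_integral_le_of_norm_le ((integrable_decay_prod hL (-x)).const_mul (q G))
        (Filter.Eventually.of_forall h1)).trans ?_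
      rw [integral_const_mul, integral_prod_mul (fun α : Plane => decay α) (fun j => decay (-x + lat L j)),
        mul_comm]
      gcongr
      have h2 : ∫ j, decay (-x + lat L j) ∂Measure.count = ∑' j, decay (-x + lat L j) := by
        rw [integral_countable]
        · simp [Measure.real]
        · rw [integrable_count_iff]
          simpa [abs_of_pos (decay_pos _)] using summable_decay hL (-x)
      rw [h2]
      exact hC _
    all_goals
      have osc := fun G : 𝓢₄ => differentiable_oscillatory (μ := prodCount) G
        (ContinuousLinearMap.inr ℝ Plane Plane)
        (p := fun w : Plane × Idx => (w.1, -lat L w.2)) (κ := fun w => -(inner ℝ w.1 (lat L w.2)))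
        (τ := fun _ => 0) (measurable_fst.stronglyMeasurable.prodMk measurable_lat_snd.neg)
        (measurable_fst.stronglyMeasurable.inner measurable_lat_snd).neg stronglyMeasurable_const
        (C := 0) (by simp) ((integrable_decay_prod hL 0).mono' (by
          refine StronglyMeasurable.aestronglyMeasurable ?_
          have hc : Continuous fun z : Plane × Plane => ((1 + ‖z‖) ^ 6)⁻¹ :=
            Continuous.inv₀ (by fun_prop) fun z => by positivity
          exact hc.comp_stronglyMeasurable
            (measurable_fst.stronglyMeasurable.prodMk measurable_lat_snd.neg))
          (Filter.Eventually.of_forall fun w => by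
            rw [Real.norm_of_nonneg (by positivity), zero_add, ← decay_neg (lat L w.2)]
            exact inv_one_add_norm_prod_pow_le _ _))
      have e : ∀ G : 𝓢₄, blochAFun hL G = fun x => (normConst L : ℂ) * ∫ w : Plane × Idx,
          expI (-(inner ℝ w.1 (lat L w.2)) + (0 : Plane →L[ℝ] ℝ) x) *
            G (ContinuousLinearMap.inr ℝ Plane Plane x + (w.1, -lat L w.2)) ∂prodCount := by
        intro G
        funext x
        rw [blochAFun_apply]
        simp [sub_eq_add_neg]
    · intro _ G
      rw [e G]
      exact (osc G).1.const_mul _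
    · intro _ v
      refine ⟨[((), LineDeriv.lineDerivOpCLM ℂ 𝓢₄ ((0, v) : Plane × Plane))], fun G x => ?_⟩
      simp only [List.map_cons, List.map_nil, List.sum_cons, List.sum_nil, add_zero]
      rw [e G, fderiv_const_mul ((osc G).1 x), _root_.smul_apply, (osc G).2, e]
      simp
    · clear osc
      intro _ a
      set b : Plane := (InnerProductSpace.toDual ℝ Plane).symm a with hb
      have hab : ∀ y, a y = inner ℝ b y := fun y => by
        rw [hb, InnerProductSpace.toDual_symm_apply]
      have hat : Function.HasTemperateGrowth fun z : Plane × Plane => (a z.2 : ℂ) :=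
        (Complex.ofRealCLM.comp (a.comp (ContinuousLinearMap.snd ℝ Plane Plane))).hasTemperateGrowth
      refine ⟨[((), SchwartzMap.smulLeftCLM ℂ fun z : Plane × Plane => (a z.2 : ℂ)),
        ((), -Complex.I • LineDeriv.lineDerivOpCLM ℂ 𝓢₄ ((b, 0) : Plane × Plane))], fun G x => ?_⟩
      simp only [List.map_cons, List.map_nil, List.sum_cons, List.sum_nil, add_zero]
      set G₁ := SchwartzMap.smulLeftCLM ℂ (fun z : Plane × Plane => (a z.2 : ℂ)) G with hG₁
      have hG₁a : ∀ z, G₁ z = (a z.2 : ℂ) * G z := fun z => by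
        rw [hG₁, SchwartzMap.smulLeftCLM_apply_apply hat, smul_eq_mul]
      set G₂ : 𝓢₄ := ∂_{((b, 0) : Plane × Plane)} G with hG₂
      have h2 : (-Complex.I • LineDeriv.lineDerivOpCLM ℂ 𝓢₄ ((b, 0) : Plane × Plane)) G =
          -Complex.I • G₂ := rfl
      rw [h2, map_smul]
      change (a x : ℂ) * ((normConst L : ℂ) * ∫ w : Plane × Idx,
          expI (-(inner ℝ w.1 (lat L w.2))) * G (w.1, x - lat L w.2) ∂prodCount) =
        (normConst L : ℂ) * (∫ w : Plane × Idx,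
          expI (-(inner ℝ w.1 (lat L w.2))) * G₁ (w.1, x - lat L w.2) ∂prodCount) +
        -Complex.I * ((normConst L : ℂ) * ∫ w : Plane × Idx,
          expI (-(inner ℝ w.1 (lat L w.2))) * G₂ (w.1, x - lat L w.2) ∂prodCount)
      have i0 := integrable_blochA hL G x
      have i1 := integrable_blochA hL G₁ x
      have i2 := integrable_blochA hL G₂ x
      have s0 := i0.integral_prod_right
      have s1 := i1.integral_prod_right
      have s2 := i2.integral_prod_right
      rw [integrable_count_iff] at s0 s1 s2
      rw [integral_prodCount i0, integral_prodCount i1, integral_prodCount i2]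
      -- Here a(x) = a(x - Λj) + a(Λj): the first term multiplies the test function, the second
      -- comes from its derivative in α.
      have hj : ∀ j, (a x : ℂ) * ∫ α, expI (-(inner ℝ α (lat L j))) * G (α, x - lat L j) =
          (∫ α, expI (-(inner ℝ α (lat L j))) * G₁ (α, x - lat L j)) +
          -Complex.I * ∫ α, expI (-(inner ℝ α (lat L j))) * G₂ (α, x - lat L j) := by
        intro j
        rw [hG₂, integral_expI_mul_fderiv, ← hab]
        have h4 : ∫ α, expI (-(inner ℝ α (lat L j))) * G₁ (α, x - lat L j) =
            (a (x - lat L j) : ℂ) * ∫ α, expI (-(inner ℝ α (lat L j))) * G (α, x - lat L j) := by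
          rw [← integral_const_mul]
          congr 1; funext α; rw [hG₁a]; ring
        rw [h4, map_sub]
        push_cast
        linear_combination ((a (lat L j) : ℂ) * ∫ α, expI (-(inner ℝ α (lat L j))) * G (α, x - lat L j)) * Complex.I_sq
      rw [mul_left_comm (a x : ℂ), ← tsum_mul_left]
      simp only [hj]
      rw [Summable.tsum_add s1.of_norm (s2.of_norm.mul_left _), tsum_mul_left]
      ring
  obtain ⟨S, hS⟩ := main
  refine ⟨S, fun G x => ?_⟩
  rw [hS]
  rw [blochAFun_apply, integral_prodCount (integrable_blochA hL G x)]

end BlochOperators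

/-! ### Localized Bloch transforms of Schwartz functions -/

section BlochOperators

local notation "𝓢₂" => SchwartzMap Plane ℂ
local notation "𝓢₄" => SchwartzMap (Plane × Plane) ℂ

variable {L : Matrix (Fin 2) (Fin 2) ℝ}

/-- The Bloch transform with reflected quasimomentum, as a function of a pair. -/
def jbar (L : Matrix (Fin 2) (Fin 2) ℝ) (u : Plane → ℂ) (p : Plane × Plane) : ℂ :=
  bloch L u (-p.1) p.2

theorem exists_seminorm_decay :
    ∃ q : Seminorm ℂ 𝓢₂, Continuous q ∧ ∀ u x, ‖u x‖ ≤ q u * decay x := by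
  obtain ⟨q, hqc, hq⟩ := exists_seminorm_one_add_pow (E := Plane) 3 0
  refine ⟨q, hqc, fun u x => ?_⟩
  have h := hq u x
  rw [norm_iteratedFDeriv_zero] at h
  rw [decay, ← div_eq_mul_inv, le_div_iff₀ (by positivity), mul_comm]
  exact h

theorem summable_norm_lat (hL : L.det ≠ 0) (u : 𝓢₂) (x : Plane) :
    Summable fun j => ‖u (x + lat L j)‖ := by
  obtain ⟨q, -, hq⟩ := exists_seminorm_decay
  exact Summable.of_nonneg_of_le (fun j => norm_nonneg _) (fun j => hq u _)
    ((summable_decay hL x).mul_left _)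

theorem summable_bloch (hL : L.det ≠ 0) (u : 𝓢₂) (α x : Plane) :
    Summable fun j => u (x + lat L j) * expI (-(inner ℝ α (lat L j))) := by
  refine Summable.of_norm ?_
  simpa [norm_expI] using summable_norm_lat hL u x

theorem bloch_add (hL : L.det ≠ 0) (u v : 𝓢₂) (α x : Plane) :
    bloch L (u + v : 𝓢₂) α x = bloch L u α x + bloch L v α x := by
  simp only [bloch, _root_.add_apply, add_mul]
  rw [Summable.tsum_add (summable_bloch hL u α x) (summable_bloch hL v α x), mul_add]

theorem bloch_smul (c : ℂ) (u : 𝓢₂) (α x : Plane) :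
    bloch L (c • u : 𝓢₂) α x = c * bloch L u α x := by
  simp only [bloch, _root_.smul_apply, smul_eq_mul, mul_assoc]
  rw [tsum_mul_left]
  ring

theorem exists_norm_bloch_le (hL : L.det ≠ 0) :
    ∃ q : Seminorm ℂ 𝓢₂, Continuous q ∧ ∀ (u : 𝓢₂) α x, ‖bloch L u α x‖ ≤ q u := by
  obtain ⟨q, hqc, hq⟩ := exists_seminorm_decay
  obtain ⟨C, hC0, hC⟩ := exists_tsum_decay_le_real hL
  have hn := (normConst_pos hL).le
  refine ⟨(normConst L * C).toNNReal • q, continuous_const.mul hqc, fun u α x => ?_⟩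
  change _ ≤ ((normConst L * C).toNNReal : ℝ) * q u
  rw [Real.coe_toNNReal _ (by positivity), bloch, norm_mul, Complex.norm_of_nonneg hn, mul_assoc]
  gcongr
  have h1 : ∀ j, ‖u (x + lat L j) * expI (-(inner ℝ α (lat L j)))‖ ≤ q u * decay (x + lat L j) := by
    intro j
    rw [norm_mul, norm_expI, mul_one]
    exact hq u _
  refine (tsum_of_norm_bounded ((summable_decay hL x).mul_left (q u)).hasSum h1).trans ?_
  rw [tsum_mul_left, mul_comm]
  gcongr
  exact hC x

/-- The product of a Schwartz function and the reflected Bloch transform, as a linear map. -/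
def blochBFun (hL : L.det ≠ 0) (κ : 𝓢₄) : 𝓢₂ →ₗ[ℂ] (Plane × Plane → ℂ) where
  toFun u p := κ p * jbar L u p
  map_add' u v := by
    funext p
    simp only [jbar, bloch_add hL, Pi.add_apply, mul_add]
  map_smul' c u := by
    funext p
    simp only [jbar, bloch_smul, Pi.smul_apply, smul_eq_mul, RingHom.id_apply]
    ring

theorem jbar_eq_integral (hL : L.det ≠ 0) (u : 𝓢₂) :
    jbar L u = fun p : Plane × Plane => (normConst L : ℂ) * ∫ j : Idx, expI (0 +
      ((innerSL ℝ (lat L j)).comp (ContinuousLinearMap.fst ℝ Plane Plane)) p) *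
        u (ContinuousLinearMap.snd ℝ Plane Plane p + lat L j) ∂Measure.count := by
  funext p
  rw [integral_count_eq_tsum, jbar, bloch]
  · congr 1
    refine tsum_congr fun j => ?_
    rw [mul_comm]
    simp [real_inner_comm]
  · rw [integrable_count_iff]
    simpa [norm_expI] using summable_norm_lat hL u p.2

/-- A derivative in α brings down iΛj. Written as i(x + Λj) - ix, it splits into a multiplication
acting on u and a factor that leaves the lattice sum, so that derivatives of `jbar` are again
expressed by `jbar`. -/
theorem hasFDerivAt_jbar (hL : L.det ≠ 0) (u : 𝓢₂) :
    Differentiable ℝ (jbar L u) ∧ ∀ p e, fderiv ℝ (jbar L u) p e =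
      jbar L (∂_{e.2} u : 𝓢₂) p + Complex.I *
        jbar L (SchwartzMap.smulLeftCLM ℂ (fun x : Plane => (inner ℝ e.1 x : ℂ)) u) p -
        Complex.I * (inner ℝ e.1 p.2 : ℝ) * jbar L u p := by
  obtain ⟨hd, hf⟩ := differentiable_oscillatory (μ := (Measure.count : Measure Idx)) u
    (ContinuousLinearMap.snd ℝ Plane Plane)
    (p := fun j : Idx => lat L j) (κ := fun _ => 0)
    (τ := fun j => (innerSL ℝ (lat L j)).comp (ContinuousLinearMap.fst ℝ Plane Plane))
    StronglyMeasurable.of_discrete stronglyMeasurable_const StronglyMeasurable.of_discrete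
    (C := 1) (fun j => by
      refine (ContinuousLinearMap.opNorm_comp_le _ _).trans ?_
      rw [innerSL_apply_norm]
      calc _ ≤ ‖lat L j‖ * 1 := by
            gcongr
            exact ContinuousLinearMap.norm_fst_le ..
        _ ≤ _ := by linarith)
    (by
      rw [integrable_count_iff]
      refine Summable.of_nonneg_of_le (fun j => norm_nonneg _) (fun j => ?_) (summable_decay hL 0)
      rw [Real.norm_of_nonneg (by positivity), zero_add, decay]
      gcongr
      · linarith [norm_nonneg (lat L j)]
      · norm_num)
  have hjb := jbar_eq_integral hL u
  refine ⟨hjb ▸ hd.const_mul _, fun p e => ?_⟩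
  have hfd : fderiv ℝ (jbar L u) p = _ := (congrArg (fun f => fderiv ℝ f p) hjb).trans
    (fderiv_const_mul (hd p) _)
  rw [hfd, _root_.smul_apply, hf]
  have hat : Function.HasTemperateGrowth fun x : Plane => (inner ℝ e.1 x : ℂ) :=
    (Complex.ofRealCLM.comp (innerSL ℝ e.1)).hasTemperateGrowth
  set u₁ : 𝓢₂ := ∂_{e.2} u with hu₁
  set u₂ : 𝓢₂ := SchwartzMap.smulLeftCLM ℂ (fun x : Plane => (inner ℝ e.1 x : ℂ)) u with hu₂
  have hu₂a : ∀ x, u₂ x = (inner ℝ e.1 x : ℝ) * u x := fun x => by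
    rw [hu₂, SchwartzMap.smulLeftCLM_apply_apply hat, smul_eq_mul]
  have s0 := summable_bloch hL u (-p.1) p.2
  have s1 := summable_bloch hL u₁ (-p.1) p.2
  have s2 := summable_bloch hL u₂ (-p.1) p.2
  have hj : ∀ j, expI (0 + ((innerSL ℝ (lat L j)).comp (ContinuousLinearMap.fst ℝ Plane Plane)) p) *
      ((∂_{ContinuousLinearMap.snd ℝ Plane Plane e} u : 𝓢₂) (ContinuousLinearMap.snd ℝ Plane Plane p + lat L j) +
        Complex.I * (((innerSL ℝ (lat L j)).comp (ContinuousLinearMap.fst ℝ Plane Plane)) e : ℝ) *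
          u (ContinuousLinearMap.snd ℝ Plane Plane p + lat L j)) =
      u₁ (p.2 + lat L j) * expI (-(inner ℝ (-p.1) (lat L j))) +
      Complex.I * (u₂ (p.2 + lat L j) * expI (-(inner ℝ (-p.1) (lat L j)))) -
      Complex.I * (inner ℝ e.1 p.2 : ℝ) * (u (p.2 + lat L j) * expI (-(inner ℝ (-p.1) (lat L j)))) := by
    intro j
    rw [hu₂a]
    simp only [zero_add, ContinuousLinearMap.comp_apply, ContinuousLinearMap.coe_fst',
      ContinuousLinearMap.coe_snd', innerSL_apply_apply, inner_neg_left, neg_neg, inner_add_right,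
      real_inner_comm]
    push_cast
    ring
  have ssum := (s1.hasSum.add (s2.hasSum.mul_left Complex.I)).sub
    (s0.hasSum.mul_left (Complex.I * (inner ℝ e.1 p.2 : ℝ)))
  have hint : Integrable (fun j : Idx => u₁ (p.2 + lat L j) * expI (-(inner ℝ (-p.1) (lat L j))) +
      Complex.I * (u₂ (p.2 + lat L j) * expI (-(inner ℝ (-p.1) (lat L j)))) -
      Complex.I * (inner ℝ e.1 p.2 : ℝ) * (u (p.2 + lat L j) * expI (-(inner ℝ (-p.1) (lat L j)))))
      Measure.count := by
    rw [integrable_count_iff]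
    exact ssum.summable.norm
  simp only [hj]
  rw [integral_count_eq_tsum hint, ssum.tsum_eq]
  simp only [jbar, bloch, smul_eq_mul]
  ring

/-- The Bloch transform itself does not decay, so κ supplies the decay. It is also the parameter in
`exists_clm_of_intertwining`: derivatives and coordinates that do not act on u are absorbed into κ.
-/
theorem exists_blochB (hL : L.det ≠ 0) (κ : 𝓢₄) :
    ∃ S : 𝓢₂ →L[ℂ] 𝓢₄, ∀ u p, S u p = κ p * jbar L u p := by
  refine exists_clm_of_intertwining (Ξ := 𝓢₄) (fun κ => blochBFun hL κ) ?_ ?_ ?_ ?_ κ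
  · intro κ
    obtain ⟨q, hqc, hq⟩ := exists_norm_bloch_le hL
    obtain ⟨K, hK0, hK⟩ := exists_decay_bound κ
    refine ⟨K.toNNReal • q, continuous_const.mul hqc, fun u p => ?_⟩
    change ‖κ p * jbar L u p‖ ≤ (K.toNNReal : ℝ) * q u
    rw [Real.coe_toNNReal _ hK0, norm_mul]
    have h1 : ‖κ p‖ ≤ K := (hK p).trans (mul_le_of_le_one_right hK0 (decay_le_one p))
    have h2 : ‖jbar L u p‖ ≤ q u := hq u _ _
    gcongr
  · intro κ u
    exact κ.differentiable.mul (hasFDerivAt_jbar hL u).1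
  · intro κ e
    have hat : Function.HasTemperateGrowth fun p : Plane × Plane => ((innerSL ℝ e.1 p.2 : ℝ) : ℂ) :=
      (Complex.ofRealCLM.comp ((innerSL ℝ e.1).comp
        (ContinuousLinearMap.snd ℝ Plane Plane))).hasTemperateGrowth
    set κ₁ : 𝓢₄ := ∂_{e} κ with hκ₁
    set κ₂ : 𝓢₄ := -Complex.I • SchwartzMap.smulLeftCLM ℂ
      (fun p : Plane × Plane => ((innerSL ℝ e.1 p.2 : ℝ) : ℂ)) κ with hκ₂
    have hκ₂a : ∀ p, κ₂ p = -Complex.I * ((inner ℝ e.1 p.2 : ℝ) * κ p) := fun p => by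
      rw [hκ₂, _root_.smul_apply, SchwartzMap.smulLeftCLM_apply_apply hat]
      rfl
    refine ⟨[(κ₁, ContinuousLinearMap.id ℂ 𝓢₂), (κ, LineDeriv.lineDerivOpCLM ℂ 𝓢₂ e.2),
      (κ, Complex.I • SchwartzMap.smulLeftCLM ℂ (fun x : Plane => (inner ℝ e.1 x : ℂ))),
      (κ₂, ContinuousLinearMap.id ℂ 𝓢₂)], fun u p => ?_⟩
    simp only [List.map_cons, List.map_nil, List.sum_cons, List.sum_nil, add_zero]
    have h1 : fderiv ℝ (blochBFun hL κ u) p = _ :=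
      (κ.differentiableAt.hasFDerivAt.mul ((hasFDerivAt_jbar hL u).1 p).hasFDerivAt).fderiv
    rw [h1]
    set u₂ : 𝓢₂ := SchwartzMap.smulLeftCLM ℂ (fun x : Plane => (inner ℝ e.1 x : ℂ)) u with hu₂
    have h2 : (Complex.I • SchwartzMap.smulLeftCLM ℂ (fun x : Plane => (inner ℝ e.1 x : ℂ))) u =
      Complex.I • u₂ := rfl
    rw [h2, map_smul]
    change κ p * fderiv ℝ (jbar L u) p e + jbar L u p * fderiv ℝ κ p e =
      κ₁ p * jbar L u p + (κ p * jbar L (∂_{e.2} u : 𝓢₂) p + (Complex.I * (κ p * jbar L u₂ p) +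
        κ₂ p * jbar L u p))
    rw [(hasFDerivAt_jbar hL u).2, hκ₂a, hκ₁, SchwartzMap.lineDerivOp_apply_eq_fderiv]
    ring
  · intro κ a
    have hat : Function.HasTemperateGrowth fun p : Plane × Plane => (a p : ℂ) :=
      (Complex.ofRealCLM.comp a).hasTemperateGrowth
    refine ⟨[(SchwartzMap.smulLeftCLM ℂ (fun p : Plane × Plane => (a p : ℂ)) κ,
      ContinuousLinearMap.id ℂ 𝓢₂)], fun u p => ?_⟩
    simp only [List.map_cons, List.map_nil, List.sum_cons, List.sum_nil, add_zero]
    change (a p : ℂ) * (κ p * jbar L u p) =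
      (SchwartzMap.smulLeftCLM ℂ (fun p : Plane × Plane => (a p : ℂ)) κ) p * jbar L u p
    rw [SchwartzMap.smulLeftCLM_apply_apply hat, smul_eq_mul]
    ring

/-- Near each point the function coincides with its product with a bump function, which is a
Schwartz function by `exists_blochB`. -/
theorem contDiff_jbar (hL : L.det ≠ 0) (u : 𝓢₂) : ContDiff ℝ ∞ (jbar L u) := by
  rw [contDiff_iff_contDiffAt]
  intro p
  let χ : ContDiffBump p := ⟨1, 2, by norm_num, by norm_num⟩
  have hs : ContDiff ℝ ∞ (fun x : Plane × Plane => (χ x : ℂ)) := Complex.ofRealCLM.contDiff.comp χ.contDiff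
  have hc : HasCompactSupport (fun x : Plane × Plane => (χ x : ℂ)) :=
    χ.hasCompactSupport.comp_left (g := Complex.ofReal) (by simp)
  obtain ⟨S, hS⟩ := exists_blochB hL (hc.toSchwartzMap hs)
  have h1 : ContDiffAt ℝ ∞ (fun p : Plane × Plane => S u p) p := ((S u).smooth ⊤).contDiffAt
  refine ContDiffAt.congr_of_eventuallyEq h1 ?_
  filter_upwards [Metric.ball_mem_nhds p (one_pos : (0 : ℝ) < 1)] with y hy
  have h2 : χ y = 1 := χ.one_of_mem_closedBall (Metric.ball_subset_closedBall hy)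
  rw [hS]
  change _ = (χ y : ℂ) * _
  rw [h2]; simp

theorem contDiff_bloch (hL : L.det ≠ 0) (u : 𝓢₂) :
    ContDiff ℝ ∞ fun p : Plane × Plane => bloch L u p.1 p.2 := by
  have : (fun p : Plane × Plane => bloch L u p.1 p.2) = jbar L u ∘ fun p => (-p.1, p.2) := by
    funext p; simp [jbar]
  rw [this]
  exact (contDiff_jbar hL u).comp (by fun_prop)

theorem isSmoothQP_bloch (hL : L.det ≠ 0) (u : 𝓢₂) :
    IsSmoothQP L fun p => bloch L u p.1 p.2 := by
  refine ⟨contDiff_bloch hL u, fun l α x => ?_, fun j α x => ?_⟩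
  · simp only [bloch, expI_neg, expI_inner_add_lat hL]
  · simp only [bloch]
    have h : ∑' k, u (x + lat L j + lat L k) * expI (-(inner ℝ α (lat L k))) =
        expI (inner ℝ α (lat L j)) * ∑' k, u (x + lat L k) * expI (-(inner ℝ α (lat L k))) := by
      rw [← (Equiv.subRight j).tsum_eq fun k => u (x + lat L j + lat L k) *
        expI (-(inner ℝ α (lat L k))), ← tsum_mul_left]
      refine tsum_congr fun k => ?_
      rw [Equiv.subRight_apply, lat_sub, inner_sub_right, neg_sub,
        sub_eq_add_neg (inner ℝ α (lat L j)), expI_add, add_add_sub_cancel]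
      ring
    rw [h]
    ring

end BlochOperators

/-! ### Inversion on Schwartz functions -/

section BlochPartition

local notation "𝓢₂" => SchwartzMap Plane ℂ
local notation "𝓢₄" => SchwartzMap (Plane × Plane) ℂ

variable {A L : Matrix (Fin 2) (Fin 2) ℝ}

theorem exists_schwartz_of_hasCompactSupport {E : Type*} [NormedAddCommGroup E] [NormedSpace ℝ E]
    {f : E → ℂ} (hf : ContDiff ℝ ∞ f) (hc : HasCompactSupport f) :
    ∃ g : SchwartzMap E ℂ, HasCompactSupport g ∧ ∀ x, g x = f x :=
  ⟨hc.toSchwartzMap hf, hc, fun _ => rfl⟩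

theorem IsPartition.neg {ρ : Plane → ℂ} (hρ : IsPartition A ρ) : IsPartition A (fun x => ρ (-x)) := by
  refine ⟨hρ.1.comp contDiff_neg, hρ.2.1.comp_homeomorph (Homeomorph.neg Plane), fun x => ?_⟩
  rw [← hρ.2.2 (-x), ← (Equiv.neg Idx).tsum_eq fun k => ρ (-x + lat A k)]
  refine tsum_congr fun k => ?_
  rw [Equiv.neg_apply, lat_neg, ← neg_add]

theorem IsPartition.tsum_sub {ρ : Plane → ℂ} (hρ : IsPartition A ρ) (x : Plane) :
    ∑' k, ρ (x - lat A k) = 1 := by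
  rw [← hρ.2.2 x, ← (Equiv.neg Idx).tsum_eq fun k => ρ (x + lat A k)]
  refine tsum_congr fun k => ?_
  rw [Equiv.neg_apply, lat_neg, sub_eq_add_neg]

theorem hasCompactSupport_prod_mul {ρ σ : Plane → ℂ} (hρ : HasCompactSupport ρ)
    (hσ : HasCompactSupport σ) (f : Plane × Plane → ℂ) :
    HasCompactSupport fun p : Plane × Plane => ρ p.1 * σ p.2 * f p := by
  refine HasCompactSupport.of_support_subset_isCompact (hρ.isCompact.prod hσ.isCompact) ?_
  intro p hp
  simp only [Function.mem_support, ne_eq, mul_eq_zero, not_or] at hp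
  exact ⟨subset_closure hp.1.1, subset_closure hp.1.2⟩

theorem exists_schwartz_prod_mul {ρ σ : Plane → ℂ} (hρ : IsPartition A ρ) (hσ : IsPartition L σ)
    {f : Plane × Plane → ℂ} (hf : ContDiff ℝ ∞ f) :
    ∃ G : 𝓢₄, HasCompactSupport G ∧ ∀ p, G p = ρ p.1 * σ p.2 * f p :=
  exists_schwartz_of_hasCompactSupport
    (((hρ.1.comp contDiff_fst).mul (hσ.1.comp contDiff_snd)).mul hf)
    (hasCompactSupport_prod_mul hρ.2.1 hσ.2.1 f)

/-- The operator on test functions whose transpose is the Bloch transform. -/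
def blochA (hL : L.det ≠ 0) : 𝓢₄ →L[ℂ] 𝓢₂ := (exists_blochA hL).choose

theorem blochA_apply (hL : L.det ≠ 0) (G : 𝓢₄) (x : Plane) :
    blochA hL G x = (normConst L : ℂ) * ∑' j,
      ∫ α, expI (-(inner ℝ α (lat L j))) * G (α, x - lat L j) :=
  (exists_blochA hL).choose_spec G x

theorem IsSmoothQP.sub_lat {χ : Plane × Plane → ℂ} (hχ : IsSmoothQP L χ) (j : Idx) (α x : Plane) :
    χ (α, x - lat L j) = expI (-(inner ℝ α (lat L j))) * χ (α, x) := by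
  have h := hχ.2.2 (-j) α x
  rwa [lat_neg, inner_neg_right, ← sub_eq_add_neg] at h

theorem IsSmoothQP.continuous_left {χ : Plane × Plane → ℂ} (hχ : IsSmoothQP L χ) (x : Plane) :
    Continuous fun α => χ (α, x) :=
  hχ.1.continuous.comp (by fun_prop)

/-- Quasiperiodicity cancels the phase of the j-th term, after which the translates of σ sum to one
and ρ reduces the integral to the dual cell. Thus `blochA`, applied to a cut-off smooth
quasiperiodic function with reflected α, is the inversion formula. -/
theorem blochA_partition (hL : L.det ≠ 0) {ρ σ : Plane → ℂ} (hρ : IsPartition (dualMat L) ρ)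
    (hσ : IsPartition L σ) {χ : Plane × Plane → ℂ} (hχ : IsSmoothQP L χ) {G : 𝓢₄}
    (hG : ∀ α x, G (α, x) = ρ α * σ x * χ (-α, x)) (x : Plane) :
    blochA hL G x = (normConst L : ℂ) * ∫ α, χ (α, x) ∂(cellMeasure (dualMat L)) := by
  rw [blochA_apply]
  congr 1
  have h1 : ∀ j, ∫ α, expI (-(inner ℝ α (lat L j))) * G (α, x - lat L j) =
      σ (x - lat L j) * ∫ α, ρ α * χ (-α, x) := by
    intro j
    rw [← integral_const_mul]
    refine integral_congr_ae (Filter.Eventually.of_forall fun α => ?_)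
    simp only
    rw [hG, hχ.sub_lat, inner_neg_left, neg_neg]
    linear_combination (ρ α * σ (x - lat L j) * χ (-α, x)) * expI_mul_expI_neg (inner ℝ α (lat L j))
  simp only [h1]
  rw [tsum_mul_right, hσ.tsum_sub, one_mul, ← integral_neg_eq_self]
  simp only [neg_neg]
  exact integral_partition_mul (det_dualMat_ne_zero hL) hρ.neg (hχ.continuous_left x)
    fun k α => hχ.2.1 k α x

/-- By orthogonality of the characters only the term j = 0 survives the integration over the dual
cell. -/
theorem integral_bloch_cell (hL : L.det ≠ 0) (u : 𝓢₂) (x : Plane) :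
    (normConst L : ℂ) * ∫ α, bloch L u α x ∂(cellMeasure (dualMat L)) = u x := by
  simp only [bloch]
  rw [integral_const_mul]
  have h1 : ∀ j, ∫ α, u (x + lat L j) * expI (-(inner ℝ α (lat L j))) ∂(cellMeasure (dualMat L)) =
      if j = 0 then u x * (volume.real (cell (dualMat L)) : ℂ) else 0 := by
    intro j
    rw [integral_const_mul]
    have := integral_expI_cell hL (-j)
    simp only [lat_neg, inner_neg_right, neg_eq_zero] at this
    rw [this]
    split_ifs with hj
    · simp [hj, lat_zero]
    · simp
  have hi : ∀ j, Integrable (fun α => u (x + lat L j) * expI (-(inner ℝ α (lat L j))))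
      (cellMeasure (dualMat L)) := fun j =>
    Integrable.of_bound (by
      have := continuous_expI
      exact (Continuous.aestronglyMeasurable (by fun_prop))) ‖u (x + lat L j)‖
      (Filter.Eventually.of_forall fun α => by rw [norm_mul, norm_expI, mul_one])
  have h2 := integral_tsum_of_summable_integral_norm hi (by
    simp only [norm_mul, norm_expI, mul_one, integral_const]
    exact (summable_norm_lat hL u x).mul_left _)
  rw [← h2]
  simp only [h1]
  rw [tsum_ite_eq]
  have h3 : ((normConst L : ℂ) ^ 2 * (volume.real (cell (dualMat L)) : ℂ)) = 1 := by
    exact_mod_cast normConst_sq_mul_volume hL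
  linear_combination (u x) * h3

/-- `blochA` has the localized Bloch transform as a right inverse; for the transpose this is
injectivity. -/
theorem blochA_jbar (hL : L.det ≠ 0) {ρ σ : Plane → ℂ} (hρ : IsPartition (dualMat L) ρ)
    (hσ : IsPartition L σ) (u : 𝓢₂) {G : 𝓢₄} (hG : ∀ p, G p = ρ p.1 * σ p.2 * jbar L u p) :
    blochA hL G = u := by
  ext x
  rw [blochA_partition hL hρ hσ (isSmoothQP_bloch hL u) (fun α x => hG (α, x)) x]
  exact integral_bloch_cell hL u x

theorem integral_mul_expI_cell {χ : Plane × Plane → ℂ} (hχ : IsSmoothQP L χ) (j : Idx) (x : Plane) :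
    ∫ α, χ (α, x + lat L j) ∂(cellMeasure (dualMat L)) =
      ∫ α, χ (α, x) * expI (inner ℝ α (lat L j)) ∂(cellMeasure (dualMat L)) := by
  refine integral_congr_ae (Filter.Eventually.of_forall fun α => ?_)
  simp only
  rw [hχ.2.2, mul_comm]

/-- Every smooth quasiperiodic function is the Bloch transform of a Schwartz function. -/
theorem IsSmoothQP.exists_bloch_eq (hL : L.det ≠ 0) {χ : Plane × Plane → ℂ} (hχ : IsSmoothQP L χ) :
    ∃ u : 𝓢₂, (∀ α x, bloch L u α x = χ (α, x)) ∧ ∀ x, u x =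
      (normConst L : ℂ) * ∫ α, χ (α, x) ∂(cellMeasure (dualMat L)) := by
  obtain ⟨ρ, hρ⟩ := exists_isPartition (det_dualMat_ne_zero hL)
  obtain ⟨σ, hσ⟩ := exists_isPartition hL
  have hs : ContDiff ℝ ∞ fun p : Plane × Plane => χ (-p.1, p.2) := hχ.1.comp (by fun_prop)
  obtain ⟨G, -, hG⟩ := exists_schwartz_prod_mul hρ hσ hs
  have hu := blochA_partition hL hρ hσ hχ (fun α x => hG (α, x))
  refine ⟨blochA hL G, fun α x => ?_, hu⟩
  obtain ⟨g, -, hg⟩ := exists_schwartz_of_hasCompactSupport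
    (f := fun β => ρ β * χ (β, x)) (hρ.1.mul (hχ.1.comp (by fun_prop))) hρ.2.1.mul_right
  -- The periodization of g = ρ χ(·, x) is χ(·, x), and its Fourier coefficients are, up to the
  -- factor `normConst L`, the values of u at the points x + Λj. Poisson summation therefore is the
  -- Bloch series of u.
  have hP := hasSum_poisson hL g α
  have h1 : ∑' l, g (α + lat (dualMat L) l) = χ (α, x) := by
    simp only [hg, hχ.2.1]
    rw [tsum_mul_right, hρ.2.2, one_mul]
  rw [h1] at hP
  have h2 := ((Equiv.neg Idx).hasSum_iff.2 hP).tsum_eq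
  rw [← h2, bloch, ← tsum_mul_left]
  refine tsum_congr fun j => ?_
  simp only [Function.comp_apply, Equiv.neg_apply]
  rw [hu, integral_mul_expI_cell hχ, lat_neg]
  simp only [inner_neg_right, neg_neg]
  have h3 := integral_partition_mul (det_dualMat_ne_zero hL) hρ
    (f := fun β => χ (β, x) * expI (inner ℝ β (lat L j)))
    ((hχ.continuous_left x).mul (continuous_expI.comp (by fun_prop)))
    (fun k β => by rw [hχ.2.1, expI_inner_add_lat hL])
  rw [← h3]
  have h4 : ∫ β, expI (inner ℝ β (lat L j)) * g β =
      ∫ β, ρ β * (χ (β, x) * expI (inner ℝ β (lat L j))) :=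
    integral_congr_ae (Filter.Eventually.of_forall fun β => by simp only [hg]; ring)
  rw [h4]
  ring

end BlochPartition

/-! ### The Bloch transform as a bijection on distributions -/

section BlochDist

local notation "𝓢₂" => SchwartzMap Plane ℂ
local notation "𝓢₄" => SchwartzMap (Plane × Plane) ℂ
local notation "𝓓₂" => TemperedDistribution Plane ℂ
local notation "𝓓₄" => TemperedDistribution (Plane × Plane) ℂ

variable {L : Matrix (Fin 2) (Fin 2) ℝ}

theorem blochA_mem_qpDist (hL : L.det ≠ 0) (φ : 𝓓₂) :
    PointwiseConvergenceCLM.precomp ℂ (blochA hL) φ ∈ qpDist L := by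
  refine ⟨fun l Θ Θ' h => ?_, fun k Θ Θ' h => ?_⟩
  · change φ (blochA hL Θ) = φ (blochA hL Θ')
    congr 1
    ext x
    rw [blochA_apply, blochA_apply]
    congr 1
    refine tsum_congr fun j => ?_
    rw [← integral_add_right_eq_self _ (lat (dualMat L) l)]
    refine integral_congr_ae (Filter.Eventually.of_forall fun α => ?_)
    simp only
    rw [h, expI_neg, expI_neg, expI_inner_add_lat hL]
  · change φ (blochA hL Θ) = φ (blochA hL Θ')
    congr 1
    ext x
    rw [blochA_apply, blochA_apply]
    congr 1
    rw [← (Equiv.subRight k).tsum_eq]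
    refine tsum_congr fun j => ?_
    refine integral_congr_ae (Filter.Eventually.of_forall fun α => ?_)
    simp only [Equiv.subRight_apply]
    rw [h, lat_sub, inner_sub_right, neg_sub, sub_eq_add_neg, expI_add, sub_sub_eq_add_sub,
      add_sub_right_comm]
    ring

/-- The Bloch transform of a tempered distribution. -/
def blochJ (hL : L.det ≠ 0) : 𝓓₂ →ₗ[ℂ] qpDist L :=
  LinearMap.codRestrict (qpDist L)
    (PointwiseConvergenceCLM.precomp ℂ (blochA hL) : 𝓓₂ →L[ℂ] 𝓓₄).toLinearMap
    (blochA_mem_qpDist hL)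

theorem blochJ_apply (hL : L.det ≠ 0) (φ : 𝓓₂) (Θ : 𝓢₄) :
    (blochJ hL φ : 𝓓₄) Θ = φ (blochA hL Θ) := rfl

theorem blochJ_injective (hL : L.det ≠ 0) : Function.Injective (blochJ hL) := by
  obtain ⟨ρ, hρ⟩ := exists_isPartition (det_dualMat_ne_zero hL)
  obtain ⟨σ, hσ⟩ := exists_isPartition hL
  intro φ φ' h
  ext u
  obtain ⟨G, -, hG⟩ := exists_schwartz_prod_mul hρ hσ (contDiff_jbar hL u)
  rw [← blochA_jbar hL hρ hσ u hG, ← blochJ_apply, h, blochJ_apply]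

theorem exists_finset_partition {A : Matrix (Fin 2) (Fin 2) ℝ} (hA : A.det ≠ 0) {ρ : Plane → ℂ}
    (hρ : IsPartition A ρ) (R : ℝ) :
    ∃ s : Finset Idx, (∀ α, ‖α‖ ≤ R → ∀ l ∉ s, ρ (α - lat A l) = 0) ∧
      ∀ α, ‖α‖ ≤ R → ∑ l ∈ s, ρ (α - lat A l) = 1 := by
  obtain ⟨s, hs⟩ := exists_finset_lat hA hρ.neg.2.1 R
  have h : ∀ α, ‖α‖ ≤ R → ∀ l ∉ s, ρ (α - lat A l) = 0 := fun α hα l hl => by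
    have := hs (-α) (by rwa [norm_neg]) l hl
    rwa [show -(-α + lat A l) = α - lat A l by abel] at this
  refine ⟨s, h, fun α hα => ?_⟩
  rw [← hρ.tsum_sub α]
  exact (tsum_eq_sum fun l hl => h α hα l hl).symm

/-- Poisson summation turns the Bloch series of `blochA hL Θ` into the sum of the translates of Θ
over the dual lattice in α and, with phases, over the lattice in x. The finite set `s` contains all
m that contribute at the given x. -/
theorem jbar_blochA (hL : L.det ≠ 0) {Θ : 𝓢₄} (hΘ : HasCompactSupport Θ) (α x : Plane) {s : Finset Idx}
    (hs : ∀ β, ∀ m ∉ s, Θ (β, x + lat L m) = 0) :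
    jbar L (blochA hL Θ) (α, x) = ∑' l, ∑ m ∈ s,
      expI (inner ℝ α (lat L m)) * Θ (α + lat (dualMat L) l, x + lat L m) := by
  have hcs : ∀ m, HasCompactSupport fun β => Θ (β, x + lat L m) := by
    intro m
    obtain ⟨K, hK, hKs⟩ := hasCompactSupport_def.1 hΘ |> fun h => (⟨_, h, subset_closure⟩ :
      ∃ K : Set (Plane × Plane), IsCompact K ∧ Function.support Θ ⊆ K)
    refine HasCompactSupport.of_support_subset_isCompact (hK.image continuous_fst) fun β hβ => ?_
    exact ⟨(β, x + lat L m), hKs hβ, rfl⟩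
  have hh := exists_schwartz_of_hasCompactSupport
    (f := fun β => ∑ m ∈ s, expI (inner ℝ β (lat L m)) * Θ (β, x + lat L m))
    (ContDiff.sum fun m _ => (contDiff_expI.comp (contDiff_id.inner ℝ contDiff_const)).mul
      ((Θ.smooth ⊤).comp (by fun_prop)))
    (by
      classical
      refine HasCompactSupport.of_support_subset_isCompact
        (s.isCompact_biUnion fun m _ => (hcs m).isCompact) fun β hβ => ?_
      rw [Function.mem_support] at hβ
      obtain ⟨m, hm, hne⟩ := Finset.exists_ne_zero_of_sum_ne_zero hβ
      exact Set.mem_biUnion hm (subset_closure (right_ne_zero_of_mul hne)))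
  obtain ⟨h, hhc, hh⟩ := hh
  have hP := (hasSum_poisson hL h α).tsum_eq
  have h1 : ∀ k, blochA hL Θ (x + lat L k) =
      (normConst L : ℂ) * ∫ α', expI (-(inner ℝ α' (lat L k))) * h α' := by
    intro k
    rw [blochA_apply]
    congr 1
    have hxk : ∀ m, x + lat L k - lat L (k - m) = x + lat L m := fun m => by rw [lat_sub]; abel
    have hk : ∀ m, ∫ β, expI (-(inner ℝ β (lat L (k - m)))) * Θ (β, x + lat L k - lat L (k - m)) =
        ∫ β, expI (-(inner ℝ β (lat L k))) * (expI (inner ℝ β (lat L m)) * Θ (β, x + lat L m)) := by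
      intro m
      refine integral_congr_ae (Filter.Eventually.of_forall fun β => ?_)
      simp only
      rw [hxk, lat_sub, inner_sub_right, neg_sub, sub_eq_add_neg, expI_add]
      ring
    rw [← (Equiv.subLeft k).tsum_eq]
    simp only [Equiv.subLeft_apply, hk]
    rw [tsum_eq_sum (s := s) fun m hm => by simp only [hs _ m hm, mul_zero, integral_zero],
      ← integral_finsetSum]
    · refine integral_congr_ae (Filter.Eventually.of_forall fun β => ?_)
      simp only
      rw [hh, Finset.mul_sum]
    · intro m _
      refine Continuous.integrable_of_hasCompactSupport ?_ ((hcs m).mul_left.mul_left)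
      have := continuous_expI
      have := Θ.continuous
      fun_prop
  have h2 : ∑' l, ∑ m ∈ s, expI (inner ℝ α (lat L m)) * Θ (α + lat (dualMat L) l, x + lat L m) =
      ∑' l, h (α + lat (dualMat L) l) := by
    refine tsum_congr fun l => ?_
    rw [hh]
    refine Finset.sum_congr rfl fun m _ => ?_
    rw [expI_inner_add_lat hL]
  rw [h2, ← hP, jbar, bloch, ← tsum_mul_left]
  refine tsum_congr fun k => ?_
  simp only [inner_neg_left, neg_neg]
  rw [h1]
  ring

/-- Θ and G are sums of finitely many pieces that correspond to each other under lattice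
translations, and ψ is invariant under these. So localizing the periodization of Θ to one pair of
cells does not change the value of ψ. -/
theorem qpDist_apply_eq (hL : L.det ≠ 0) {ρ σ : Plane → ℂ} (hρ : IsPartition (dualMat L) ρ)
    (hσ : IsPartition L σ) (ψ : qpDist L) {Θ : 𝓢₄} (hΘ : HasCompactSupport Θ) {G : 𝓢₄}
    (hG : ∀ p, G p = ρ p.1 * σ p.2 * jbar L (blochA hL Θ) p) :
    (ψ : 𝓓₄) G = (ψ : 𝓓₄) Θ := by
  obtain ⟨R, hR⟩ := hΘ.isBounded.exists_norm_le
  have hR' : ∀ α x, Θ (α, x) ≠ 0 → ‖α‖ ≤ R ∧ ‖x‖ ≤ R := fun α x h => by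
    have := hR (α, x) (subset_closure h)
    rw [Prod.norm_def] at this
    exact ⟨(le_max_left _ _).trans this, (le_max_right _ _).trans this⟩
  obtain ⟨s, hs0, hs1⟩ := exists_finset_partition (det_dualMat_ne_zero hL) hρ R
  obtain ⟨t, ht0, ht1⟩ := exists_finset_partition hL hσ R
  -- Ξ is the piece of Θ cut out by the translated partitions. Moving it back along the dual lattice
  -- gives Ξ', and moving that along the lattice, with the phase of the quasiperiodicity, gives Ξ''.
  have hmk : ∀ l m, ∃ Ξ Ξ' Ξ'' : 𝓢₄,
      (∀ α x, Ξ (α, x) = ρ (α - lat (dualMat L) l) * σ (x - lat L m) * Θ (α, x)) ∧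
      (∀ α x, Ξ' (α, x) = ρ α * σ (x - lat L m) * Θ (α + lat (dualMat L) l, x)) ∧
      (∀ α x, Ξ'' (α, x) = ρ α * σ x * (expI (inner ℝ α (lat L m)) *
        Θ (α + lat (dualMat L) l, x + lat L m))) := by
    intro l m
    have hρs : ContDiff ℝ ∞ ρ := hρ.1
    have hσs : ContDiff ℝ ∞ σ := hσ.1
    have hΘs : ContDiff ℝ ∞ Θ := Θ.smooth ⊤
    have he := contDiff_expI
    obtain ⟨Ξ, -, h1⟩ := exists_schwartz_of_hasCompactSupport
      (f := fun p : Plane × Plane => ρ (p.1 - lat (dualMat L) l) * σ (p.2 - lat L m) * Θ p)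
      (((hρs.comp (contDiff_fst.sub contDiff_const)).mul
        (hσs.comp (contDiff_snd.sub contDiff_const))).mul hΘs) hΘ.mul_left
    obtain ⟨Ξ', -, h2⟩ := exists_schwartz_of_hasCompactSupport
      (f := fun p : Plane × Plane => ρ p.1 * σ (p.2 - lat L m) * Θ (p.1 + lat (dualMat L) l, p.2))
      (((hρs.comp contDiff_fst).mul
        (hσs.comp (contDiff_snd.sub contDiff_const))).mul (hΘs.comp (by fun_prop)))
      (hasCompactSupport_prod_mul hρ.2.1 (hσ.translate _).2.1 _)
    obtain ⟨Ξ'', -, h3⟩ := exists_schwartz_of_hasCompactSupport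
      (f := fun p : Plane × Plane => ρ p.1 * σ p.2 * (expI (inner ℝ p.1 (lat L m)) *
        Θ (p.1 + lat (dualMat L) l, p.2 + lat L m)))
      (((hρs.comp contDiff_fst).mul (hσs.comp contDiff_snd)).mul
        ((he.comp (contDiff_fst.inner ℝ contDiff_const)).mul (hΘs.comp (by fun_prop))))
      (hasCompactSupport_prod_mul hρ.2.1 hσ.2.1 _)
    exact ⟨Ξ, Ξ', Ξ'', fun α x => h1 (α, x), fun α x => h2 (α, x), fun α x => h3 (α, x)⟩
  choose Ξ Ξ' Ξ'' h1 h2 h3 using hmk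
  have hinv : ∀ l m, (ψ : 𝓓₄) (Ξ'' l m) = (ψ : 𝓓₄) (Ξ l m) := by
    intro l m
    rw [ψ.2.1 l (Ξ l m) (Ξ' l m), ψ.2.2 m (Ξ' l m) (Ξ'' l m)]
    · intro α x
      rw [h3, h2, add_sub_cancel_right]
      ring
    · intro α x
      rw [h2, h1, add_sub_cancel_right]
  have e1 : Θ = ∑ l ∈ s, ∑ m ∈ t, Ξ l m := by
    ext ⟨α, x⟩
    simp only [_root_.sum_apply, h1]
    by_cases h0 : Θ (α, x) = 0
    · simp [h0]
    · obtain ⟨ha, hx⟩ := hR' α x h0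
      simp only [← Finset.sum_mul, ← Finset.mul_sum]
      rw [hs1 α ha, ht1 x hx, one_mul, one_mul]
  have e2 : G = ∑ l ∈ s, ∑ m ∈ t, Ξ'' l m := by
    ext ⟨α, x⟩
    simp only [_root_.sum_apply, h3, hG]
    by_cases h0 : ρ α * σ x = 0
    · simp [h0]
    · have hρ0 := left_ne_zero_of_mul h0
      have hσ0 := right_ne_zero_of_mul h0
      rw [jbar_blochA hL hΘ α x (s := t)]
      · rw [tsum_eq_sum (s := s)]
        · simp only [Finset.mul_sum]
        · intro l hl
          refine Finset.sum_eq_zero fun m _ => ?_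
          by_contra hne
          have := hs0 _ (hR' _ _ (right_ne_zero_of_mul hne)).1 l hl
          rw [add_sub_cancel_right] at this
          exact hρ0 this
      · intro β m hm
        by_contra hne
        have := ht0 _ (hR' _ _ hne).2 m hm
        rw [add_sub_cancel_right] at this
        exact hσ0 this
  rw [e2, e1, map_sum, map_sum]
  refine Finset.sum_congr rfl fun l _ => ?_
  rw [map_sum, map_sum]
  exact Finset.sum_congr rfl fun m _ => hinv l m

/-- The preimage of ψ is ψ composed with the operator of `exists_blochB`. That it maps to ψ is
`qpDist_apply_eq` for compactly supported test functions, and these are dense. -/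
theorem blochJ_surjective (hL : L.det ≠ 0) : Function.Surjective (blochJ hL) := by
  obtain ⟨ρ, hρ⟩ := exists_isPartition (det_dualMat_ne_zero hL)
  obtain ⟨σ, hσ⟩ := exists_isPartition hL
  obtain ⟨κ, -, hκ⟩ := exists_schwartz_prod_mul hρ hσ (f := fun _ => 1) contDiff_const
  obtain ⟨B, hB⟩ := exists_blochB hL κ
  intro ψ
  refine ⟨PointwiseConvergenceCLM.precomp ℂ B (ψ : 𝓓₄), Subtype.ext ?_⟩
  ext Θ
  change (ψ : 𝓓₄) (B (blochA hL Θ)) = (ψ : 𝓓₄) Θ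
  refine congrFun (Continuous.ext_on (f := fun Θ => (ψ : 𝓓₄) (B (blochA hL Θ)))
    (g := fun Θ => (ψ : 𝓓₄) Θ) dense_hasCompactSupport ?_ ?_ fun Θ hΘ => ?_) Θ
  · exact (ψ : 𝓓₄).continuous.comp (B.continuous.comp (blochA hL).continuous)
  · exact (ψ : 𝓓₄).continuous
  · refine qpDist_apply_eq hL hρ hσ ψ hΘ fun p => ?_
    rw [hB, hκ, mul_one]

/-- The Bloch transform is an isomorphism from the tempered distributions onto the quasiperiodic
distributions. -/
def blochEquiv (hL : L.det ≠ 0) : 𝓓₂ ≃ₗ[ℂ] qpDist L :=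
  LinearEquiv.ofBijective (blochJ hL) ⟨blochJ_injective hL, blochJ_surjective hL⟩

theorem blochEquiv_apply (hL : L.det ≠ 0) (φ : 𝓓₂) (Θ : 𝓢₄) :
    (blochEquiv hL φ : 𝓓₄) Θ = φ (blochA hL Θ) := rfl

end BlochDist

/-! ### Smooth quasiperiodic functions, coefficients and test functions -/

section BlochSchwartz

local notation "𝓢₂" => SchwartzMap Plane ℂ
local notation "𝓢₄" => SchwartzMap (Plane × Plane) ℂ
local notation "𝓓₂" => TemperedDistribution Plane ℂ
local notation "𝓓₄" => TemperedDistribution (Plane × Plane) ℂ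

variable {L : Matrix (Fin 2) (Fin 2) ℝ}

theorem continuous_bloch (hL : L.det ≠ 0) (u : 𝓢₂) :
    Continuous fun p : Plane × Plane => bloch L u p.1 p.2 := (contDiff_bloch hL u).continuous

theorem ofS_apply (u η : 𝓢₂) : ofS u η = ∫ x, η x * u x :=
  SchwartzMap.toTemperedDistributionCLM_apply_apply volume u η

theorem integrable_schwartz_prod (Θ : 𝓢₄) : Integrable (fun p => Θ p) := by
  have : (volume : Measure (Plane × Plane)).IsAddHaarMeasure := by
    rw [Measure.volume_eq_prod]; infer_instance
  exact Θ.integrable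

theorem integral_prod_shift {E : Type*} [NormedAddCommGroup E] [NormedSpace ℝ E]
    {F : Plane × Plane → E} (hF : Integrable F) (v : Plane) :
    Integrable (fun y => ∫ α, F (α, y - v)) ∧ ∫ p, F p = ∫ y, ∫ α, F (α, y - v) := by
  rw [Measure.volume_eq_prod] at hF ⊢
  refine ⟨hF.integral_prod_right.comp_sub_right v, ?_⟩
  rw [integral_prod_symm _ hF]
  exact (integral_sub_right_eq_self (fun y => ∫ α, F (α, y)) v).symm

theorem integrable_blochPairing (hL : L.det ≠ 0) (u : 𝓢₂) (Θ : 𝓢₄) :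
    Integrable (fun w : (Plane × Plane) × Idx =>
      expI (-(inner ℝ w.1.1 (lat L w.2))) * Θ w.1 * u (w.1.2 + lat L w.2))
      ((volume : Measure (Plane × Plane)).prod Measure.count) := by
  obtain ⟨q, -, hq⟩ := exists_seminorm_decay
  obtain ⟨C, hC0, hC⟩ := exists_tsum_decay_le_real hL
  have hm : StronglyMeasurable fun w : (Plane × Plane) × Idx => lat L w.2 :=
    (StronglyMeasurable.of_discrete (f := lat L)).comp_measurable measurable_snd
  have hms : StronglyMeasurable (fun w : (Plane × Plane) × Idx =>
      expI (-(inner ℝ w.1.1 (lat L w.2))) * Θ w.1 * u (w.1.2 + lat L w.2)) := by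
    refine ((continuous_expI.comp_stronglyMeasurable
      (measurable_fst.fst.stronglyMeasurable.inner hm).neg).mul
      (Θ.continuous.comp_stronglyMeasurable measurable_fst.stronglyMeasurable)).mul
      (u.continuous.comp_stronglyMeasurable (measurable_fst.snd.stronglyMeasurable.add hm))
  have hn : ∀ (p : Plane × Plane) j, ‖expI (-(inner ℝ p.1 (lat L j))) * Θ p * u (p.2 + lat L j)‖ =
      ‖Θ p‖ * ‖u (p.2 + lat L j)‖ := fun p j => by rw [norm_mul, norm_mul, norm_expI, one_mul]
  rw [integrable_prod_iff hms.aestronglyMeasurable]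
  refine ⟨Filter.Eventually.of_forall fun p => ?_, ?_⟩
  · rw [integrable_count_iff]
    simp only [hn]
    exact (summable_norm_lat hL u p.2).mul_left _
  · refine ((integrable_schwartz_prod Θ).norm.mul_const (q u * C)).mono'
      hms.norm.integral_prod_right.aestronglyMeasurable (Filter.Eventually.of_forall fun p => ?_)
    rw [Real.norm_of_nonneg (integral_nonneg fun _ => norm_nonneg _)]
    simp only [hn]
    rw [integral_const_mul]
    gcongr
    have hs := summable_norm_lat hL u p.2
    rw [integral_countable (by rw [integrable_count_iff]; simpa using hs)]
    simp only [Measure.real, Measure.count_singleton, ENNReal.toReal_one, one_smul]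
    calc ∑' j, ‖u (p.2 + lat L j)‖ ≤ ∑' j, q u * decay (p.2 + lat L j) :=
          hs.tsum_le_tsum (fun j => hq u _) ((summable_decay hL p.2).mul_left _)
      _ = q u * ∑' j, decay (p.2 + lat L j) := tsum_mul_left
      _ ≤ q u * C := by gcongr; exact hC _

/-- The transpose really extends the Bloch series: by Fubini the pairing is a sum over j, and in the
j-th term x is replaced by y - Λj. -/
theorem isRepr_blochEquiv_ofS (hL : L.det ≠ 0) (u : 𝓢₂) :
    IsRepr (blochEquiv hL (ofS u) : 𝓓₄) fun p => bloch L u p.1 p.2 := by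
  intro Θ
  obtain ⟨q, -, hq⟩ := exists_norm_bloch_le hL
  refine ⟨(integrable_schwartz_prod Θ).mul_bdd (c := q u)
    (continuous_bloch hL u).aestronglyMeasurable (Filter.Eventually.of_forall fun p => hq u _ _), ?_⟩
  have hI := integrable_blochPairing hL u Θ
  have h1 := integral_prod _ hI
  have h2 := integral_prod_symm _ hI
  have e1 : ∫ p : Plane × Plane, Θ p * bloch L u p.1 p.2 =
      (normConst L : ℂ) * ∫ p : Plane × Plane, ∫ j, expI (-(inner ℝ p.1 (lat L j))) * Θ p *
        u (p.2 + lat L j) ∂Measure.count := by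
    rw [← integral_const_mul]
    refine integral_congr_ae (Filter.Eventually.of_forall fun p => ?_)
    simp only
    rw [integral_count_eq_tsum, bloch, mul_left_comm, ← tsum_mul_left]
    · congr 1
      exact tsum_congr fun j => by ring
    · rw [integrable_count_iff]
      simp only [norm_mul, norm_expI, one_mul]
      exact (summable_norm_lat hL u p.2).mul_left _
  have hIj := hI.integral_prod_right
  have hIn := hI.norm.integral_prod_right
  rw [integrable_count_iff] at hIn
  rw [integral_count_eq_tsum hIj] at h2
  have hj : ∀ j, Integrable fun p : Plane × Plane =>
      expI (-(inner ℝ p.1 (lat L j))) * Θ p * u (p.2 + lat L j) := by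
    have := hI.prod_left_ae
    rw [Measure.ae_count_iff] at this
    exact this
  have e2 : ∀ j y, ∫ α, expI (-(inner ℝ α (lat L j))) * Θ (α, y - lat L j) * u (y - lat L j + lat L j) =
      (∫ α, expI (-(inner ℝ α (lat L j))) * Θ (α, y - lat L j)) * u y := by
    intro j y
    rw [integral_mul_const, sub_add_cancel]
  have e3 : ∀ j, Integrable (fun y => (∫ α, expI (-(inner ℝ α (lat L j))) * Θ (α, y - lat L j)) * u y) ∧
      ∫ p : Plane × Plane, expI (-(inner ℝ p.1 (lat L j))) * Θ p * u (p.2 + lat L j) =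
        ∫ y, (∫ α, expI (-(inner ℝ α (lat L j))) * Θ (α, y - lat L j)) * u y := by
    intro j
    have := integral_prod_shift (hj j) (lat L j)
    simpa only [e2] using this
  have e4 : ∀ j, ∫ y, ‖(∫ α, expI (-(inner ℝ α (lat L j))) * Θ (α, y - lat L j)) * u y‖ ≤
      ∫ p : Plane × Plane, ‖expI (-(inner ℝ p.1 (lat L j))) * Θ p * u (p.2 + lat L j)‖ := by
    intro j
    obtain ⟨h3, h4⟩ := integral_prod_shift (hj j).norm (lat L j)
    rw [h4]
    refine integral_mono (e3 j).1.norm h3 fun y => ?_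
    simp only
    rw [← e2]
    exact norm_integral_le_integral_norm _
  have hsum : Summable fun j =>
      ∫ y, ‖(∫ α, expI (-(inner ℝ α (lat L j))) * Θ (α, y - lat L j)) * u y‖ := by
    refine Summable.of_nonneg_of_le (fun j => integral_nonneg fun _ => norm_nonneg _)
      (fun j => (e4 j).trans (le_abs_self _)) hIn
  have e5 := integral_tsum_of_summable_integral_norm (fun j => (e3 j).1) hsum
  rw [e1, ← h1, h2, blochEquiv_apply, ofS_apply]
  simp only [e3]
  rw [e5, ← integral_const_mul]
  refine integral_congr_ae (Filter.Eventually.of_forall fun y => ?_)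
  simp only
  rw [blochA_apply, tsum_mul_right]
  ring

theorem IsRepr.unique {E : Type*} [NormedAddCommGroup E] [NormedSpace ℝ E] [MeasureSpace E]
    {u v : TemperedDistribution E ℂ} {f : E → ℂ} (hu : IsRepr u f) (hv : IsRepr v f) : u = v := by
  ext η
  rw [(hu η).2, (hv η).2]

theorem isRepr_ofS (u : 𝓢₂) : IsRepr (ofS u) u := by
  intro η
  constructor
  · have := (SchwartzMap.smulLeftCLM ℂ (η : Plane → ℂ) u).integrable (μ := volume)
    refine this.congr (Filter.Eventually.of_forall fun x => ?_)
    simp only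
    rw [SchwartzMap.smulLeftCLM_apply_apply η.hasTemperateGrowth, smul_eq_mul]
  · exact ofS_apply u η

theorem exists_eq_blochEquiv_ofS (hL : L.det ≠ 0) {ψ : qpDist L} {χ : Plane × Plane → ℂ}
    (hχ : IsSmoothQP L χ) (hψ : IsRepr (ψ : 𝓓₄) χ) :
    ∃ u : 𝓢₂, ψ = blochEquiv hL (ofS u) ∧ (χ = fun p => bloch L u p.1 p.2) ∧ ∀ x, u x =
      (normConst L : ℂ) * ∫ α, χ (α, x) ∂(cellMeasure (dualMat L)) := by
  obtain ⟨u, hu, hu'⟩ := hχ.exists_bloch_eq hL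
  have h : χ = fun p => bloch L u p.1 p.2 := funext fun p => (hu p.1 p.2).symm
  refine ⟨u, Subtype.ext ?_, h, hu'⟩
  rw [h] at hψ
  exact hψ.unique (isRepr_blochEquiv_ofS hL u)

theorem fourier_eq_integral_expI (u : 𝓢₂) (z : Plane) :
    ∫ y, u y * expI (-(inner ℝ z y)) = (𝓕 u : 𝓢₂) ((2 * Real.pi)⁻¹ • z) := by
  have := Real.pi_pos
  rw [SchwartzMap.fourier_coe, Real.fourier_eq]
  refine integral_congr_ae (Filter.Eventually.of_forall fun y => ?_)
  simp only [Circle.smul_def, smul_eq_mul, Real.fourierChar_apply, expI]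
  rw [mul_comm]
  congr 2
  rw [inner_smul_right, real_inner_comm]
  push_cast
  field_simp

/-- The kernel at x + Λk differs from that at x only by the phase of the Bloch series, because Λ*j ·
Λk is a multiple of 2π. So the lattice sum unfolds the cell integral to the plane, and the
coefficients are samples of the Fourier transform of u. -/
theorem fourierCoeff_bloch (hL : L.det ≠ 0) (u : 𝓢₂) (α : Plane) (j : Idx) :
    fourierCoeff L (fun p => bloch L u p.1 p.2) α j =
      ((2 * Real.pi)⁻¹ : ℂ) * (𝓕 u : 𝓢₂) ((2 * Real.pi)⁻¹ • (lat (dualMat L) j + α)) := by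
  have hpi := Real.pi_pos
  have hd : √|L.det| ≠ 0 := by positivity
  have hint : Integrable fun y => u y * expI (-(inner ℝ (lat (dualMat L) j + α) y)) :=
    (u.integrable (μ := volume)).mul_bdd (c := 1)
      (continuous_expI.comp (by fun_prop)).aestronglyMeasurable
      (Filter.Eventually.of_forall fun y => (norm_expI _).le)
  rw [← fourier_eq_integral_expI, ← integral_cell_tsum hL hint, ← integral_const_mul, fourierCoeff]
  refine integral_congr_ae (Filter.Eventually.of_forall fun x => ?_)
  simp only [bloch, fourierKernel]
  rw [mul_comm, ← mul_assoc, ← tsum_mul_left, ← tsum_mul_left]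
  refine tsum_congr fun k => ?_
  have h1 : expI (-(inner ℝ (lat (dualMat L) j + α) (x + lat L k))) =
      expI (-(inner ℝ (lat (dualMat L) j + α) x)) * expI (-(inner ℝ α (lat L k))) := by
    rw [inner_add_right, neg_add, expI_add, expI_neg (inner ℝ (lat (dualMat L) j + α) (lat L k)),
      add_comm (lat (dualMat L) j) α, expI_inner_add_lat hL, ← expI_neg]
  rw [h1, normConst]
  have : ((√|L.det| : ℝ) : ℂ) ≠ 0 := by exact_mod_cast hd
  push_cast
  field_simp

/-- The complex conjugate of a Schwartz function. -/
def conjS (u : 𝓢₂) : 𝓢₂ := u.postcompCLM (𝕜 := ℝ) Complex.conjCLE.toContinuousLinearMap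

theorem conjS_apply (u : 𝓢₂) (x : Plane) : conjS u x = conj (u x) := rfl

theorem conj_bloch (u : 𝓢₂) (α x : Plane) : conj (bloch L u α x) = bloch L (conjS u) (-α) x := by
  simp only [bloch, map_mul, Complex.conj_ofReal, conjS_apply]
  rw [Complex.conj_tsum]
  congr 1
  refine tsum_congr fun j => ?_
  rw [map_mul, ← expI_neg, inner_neg_left]

/-- The two smooth functions in a dual test are Bloch transforms of Schwartz functions u and u', and
by `blochA_jbar` the partitions disappear. The pairing of ψ with χ thus becomes the pairing of φ
with the conjugate of u'. -/
theorem blochA_eq_of_isDualTest (hL : L.det ≠ 0) {s : ℝ} {χ : qpDist L} {Θ : 𝓢₄}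
    (h : IsDualTest L s χ Θ) : ∃ u u' : 𝓢₂, χ = blochEquiv hL (ofS u) ∧
      (∀ ξ, (𝓕 u' : 𝓢₂) ξ = (wt s ((2 * Real.pi) • ξ) : ℂ) * (𝓕 u : 𝓢₂) ξ) ∧
      blochA hL Θ = conjS u' := by
  obtain ⟨f, f', hf, hf', hχ, hc, ρ, σ, hρ, hσ, hΘ⟩ := h
  have hpi := Real.pi_pos
  obtain ⟨u, hu, hfu, -⟩ := exists_eq_blochEquiv_ofS hL hf hχ
  obtain ⟨u', hu', -⟩ := hf'.exists_bloch_eq hL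
  have hfu' : f' = fun p => bloch L u' p.1 p.2 := funext fun p => (hu' p.1 p.2).symm
  refine ⟨u, u', hu, fun ξ => ?_, ?_⟩
  -- The index zero suffices because α ranges over the whole plane.
  · have h1 := hc ((2 * Real.pi) • ξ) 0
    rw [hfu, hfu', fourierCoeff_bloch hL, fourierCoeff_bloch hL, lat_zero, zero_add,
      smul_smul, inv_mul_cancel₀ (by positivity), one_smul] at h1
    have h2 : ((2 * Real.pi)⁻¹ : ℂ) ≠ 0 := by
      exact_mod_cast (inv_pos.2 (by positivity : 0 < 2 * Real.pi)).ne'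
    refine mul_left_cancel₀ h2 ?_
    rw [h1]; ring
  · refine blochA_jbar hL hρ hσ _ fun p => ?_
    rw [hΘ, hfu', conj_bloch]
    rfl

theorem exists_isDualTest (hL : L.det ≠ 0) {s : ℝ} {u u' : 𝓢₂}
    (h : ∀ ξ, (𝓕 u' : 𝓢₂) ξ = (wt s ((2 * Real.pi) • ξ) : ℂ) * (𝓕 u : 𝓢₂) ξ) :
    ∃ Θ, IsDualTest L s (blochEquiv hL (ofS u)) Θ ∧ blochA hL Θ = conjS u' := by
  have hpi := Real.pi_pos
  obtain ⟨ρ, hρ⟩ := exists_isPartition (det_dualMat_ne_zero hL)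
  obtain ⟨σ, hσ⟩ := exists_isPartition hL
  obtain ⟨Θ, -, hΘ⟩ := exists_schwartz_prod_mul hρ hσ (contDiff_jbar hL (conjS u'))
  refine ⟨Θ, ⟨_, _, isSmoothQP_bloch hL u, isSmoothQP_bloch hL u', isRepr_blochEquiv_ofS hL u,
    fun α j => ?_, ρ, σ, hρ, hσ, fun α x => ?_⟩, blochA_jbar hL hρ hσ _ hΘ⟩
  · rw [fourierCoeff_bloch hL, fourierCoeff_bloch hL, h, smul_smul,
      mul_inv_cancel₀ (by positivity), one_smul]
    ring
  · rw [hΘ, conj_bloch]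
    rfl

/-- Testing the j-th coefficient against η amounts to testing φ against a modulated, rescaled 𝓕 η.
In other words, the coefficient is 𝓕 φ, rescaled and translated by Λ*j. -/
theorem blochA_eq_of_isCoeffTest (hL : L.det ≠ 0) {j : Idx} {η : 𝓢₂} {Θ : 𝓢₄}
    (h : IsCoeffTest L j η Θ) (y : Plane) :
    blochA hL Θ y = ((2 * Real.pi)⁻¹ : ℂ) * (expI (-(inner ℝ (lat (dualMat L) j) y)) *
      (𝓕 η : 𝓢₂) ((2 * Real.pi)⁻¹ • y)) := by
  obtain ⟨ρ, hρ, hΘ⟩ := h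
  have hpi := Real.pi_pos
  have hd : √|L.det| ≠ 0 := by positivity
  have hd' : ((√|L.det| : ℝ) : ℂ) ≠ 0 := by exact_mod_cast hd
  rw [blochA_apply]
  have h1 : ∀ k, ∫ α, expI (-(inner ℝ α (lat L k))) * Θ (α, y - lat L k) =
      ρ (y - lat L k) * (((√|L.det|)⁻¹ : ℂ) * expI (-(inner ℝ (lat (dualMat L) j) y)) *
        ∫ α, η α * expI (-(inner ℝ y α))) := by
    intro k
    rw [← integral_const_mul, ← integral_const_mul]
    refine integral_congr_ae (Filter.Eventually.of_forall fun α => ?_)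
    simp only
    rw [hΘ, fourierKernel]
    have h2 : expI (-(inner ℝ (lat (dualMat L) j + α) (y - lat L k))) =
        expI (-(inner ℝ (lat (dualMat L) j) y)) * expI (-(inner ℝ y α)) *
          expI (inner ℝ α (lat L k)) := by
      rw [← expI_add, ← mul_one (expI (_ + _)), mul_right_comm, ← expI_add,
        ← expI_inner_lat_dualMat hL j k, ← expI_add]
      congr 1
      simp only [inner_add_left, inner_sub_right, real_inner_comm y α]
      ring
    rw [h2]
    linear_combination (η α * ρ (y - lat L k) * ((√|L.det|)⁻¹ : ℂ) *
      expI (-(inner ℝ (lat (dualMat L) j) y)) * expI (-(inner ℝ y α))) *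
      expI_mul_expI_neg (inner ℝ α (lat L k))
  simp only [h1]
  rw [tsum_mul_right, hρ.tsum_sub, fourier_eq_integral_expI, normConst]
  push_cast
  field_simp

theorem exists_isCoeffTest (hL : L.det ≠ 0) (j : Idx) {η : 𝓢₂} (hη : HasCompactSupport η) :
    ∃ Θ, IsCoeffTest L j η Θ := by
  obtain ⟨ρ, hρ⟩ := exists_isPartition hL
  have he := contDiff_expI
  have hs : ContDiff ℝ ∞ fun p : Plane × Plane => fourierKernel L j p.1 p.2 :=
    contDiff_const.mul (he.comp (((contDiff_const.add contDiff_fst).inner ℝ contDiff_snd).neg))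
  obtain ⟨Θ, -, hΘ⟩ := exists_schwartz_of_hasCompactSupport
    (f := fun p : Plane × Plane => η p.1 * ρ p.2 * fourierKernel L j p.1 p.2)
    ((((η.smooth ⊤).comp contDiff_fst).mul (hρ.1.comp contDiff_snd)).mul hs)
    (hasCompactSupport_prod_mul hη hρ.2.1 _)
  exact ⟨Θ, ρ, hρ, fun α x => hΘ (α, x)⟩

end BlochSchwartz

/-! ### Derivatives of the coefficients and multiplication by monomials -/

section CoeffDeriv

local notation "𝓢₂" => SchwartzMap Plane ℂ
local notation "𝓢₄" => SchwartzMap (Plane × Plane) ℂ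
local notation "𝓓₂" => TemperedDistribution Plane ℂ
local notation "𝓓₄" => TemperedDistribution (Plane × Plane) ℂ

variable {L : Matrix (Fin 2) (Fin 2) ℝ}

/-- The monomial `x₁^γ₁ x₂^γ₂`. -/
def mono (γ : ℕ × ℕ) (x : Plane) : ℂ := (x 0 : ℂ) ^ γ.1 * (x 1 : ℂ) ^ γ.2

theorem hasTemperateGrowth_coord (i : Fin 2) : Function.HasTemperateGrowth fun x : Plane => (x i : ℂ) :=
  (Complex.ofRealCLM.comp (EuclideanSpace.proj i : Plane →L[ℝ] ℝ)).hasTemperateGrowth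

theorem hasTemperateGrowth_mono (γ : ℕ × ℕ) : Function.HasTemperateGrowth (mono γ) := by
  have hp : ∀ (i : Fin 2) n, Function.HasTemperateGrowth fun x : Plane => (x i : ℂ) ^ n := by
    intro i n
    induction n with
    | zero => simp only [pow_zero]; exact Function.HasTemperateGrowth.const (1 : ℂ)
    | succ n ih => simp only [pow_succ]; exact ih.mul (hasTemperateGrowth_coord i)
  exact (hp 0 γ.1).mul (hp 1 γ.2)

theorem mono_smul (γ : ℕ × ℕ) (c : ℝ) (x : Plane) :
    mono γ (c • x) = (c : ℂ) ^ (γ.1 + γ.2) * mono γ x := by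
  simp only [mono, PiLp.smul_apply, smul_eq_mul, Complex.ofReal_mul, mul_pow, pow_add]
  ring

theorem fourier_lineDeriv_single (i : Fin 2) (η : 𝓢₂) (ξ : Plane) :
    (𝓕 (∂_{(EuclideanSpace.single i 1 : Plane)} η : 𝓢₂) : 𝓢₂) ξ =
      2 * Real.pi * Complex.I * (ξ i : ℂ) * (𝓕 η : 𝓢₂) ξ := by
  have hat : Function.HasTemperateGrowth fun x : Plane =>
      (inner ℝ x (EuclideanSpace.single i 1 : Plane)) :=
    ((innerSL ℝ).flip (EuclideanSpace.single i 1 : Plane)).hasTemperateGrowth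
  rw [SchwartzMap.fourier_lineDerivOp_eq, _root_.smul_apply, SchwartzMap.smulLeftCLM_apply_apply hat]
  have h : inner ℝ ξ (EuclideanSpace.single i 1 : Plane) = ξ i := by
    rw [EuclideanSpace.inner_single_right]; simp
  rw [h, smul_eq_mul, Complex.real_smul]
  ring

theorem fourier_multiDeriv (γ : ℕ × ℕ) (η : 𝓢₂) (ξ : Plane) :
    (𝓕 (multiDeriv γ η) : 𝓢₂) ξ =
      (2 * Real.pi * Complex.I) ^ (γ.1 + γ.2) * (mono γ ξ * (𝓕 η : 𝓢₂) ξ) := by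
  have hit : ∀ (i : Fin 2) (n : ℕ) (η : 𝓢₂),
      (𝓕 ((fun h : 𝓢₂ => (∂_{(EuclideanSpace.single i 1 : Plane)} h : 𝓢₂))^[n] η) : 𝓢₂) ξ =
        (2 * Real.pi * Complex.I * (ξ i : ℂ)) ^ n * (𝓕 η : 𝓢₂) ξ := by
    intro i n
    induction n with
    | zero => intro η; simp
    | succ n ih =>
      intro η
      rw [Function.iterate_succ_apply', fourier_lineDeriv_single, ih]
      ring
  obtain ⟨a, b⟩ := γ
  simp only [multiDeriv, mono]
  rw [hit, hit]
  ring

theorem hasCompactSupport_multiDeriv (γ : ℕ × ℕ) {η : 𝓢₂} (hη : HasCompactSupport η) :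
    HasCompactSupport (multiDeriv γ η) := by
  have hit : ∀ (i : Fin 2) (n : ℕ) (η : 𝓢₂), HasCompactSupport η →
      HasCompactSupport ((fun h : 𝓢₂ => (∂_{(EuclideanSpace.single i 1 : Plane)} h : 𝓢₂))^[n] η) := by
    intro i n
    induction n with
    | zero => intro η hη; exact hη
    | succ n ih =>
      intro η hη
      rw [Function.iterate_succ_apply']
      have := (ih η hη).fderiv_apply ℝ (EuclideanSpace.single i 1 : Plane)
      exact this
  exact hit 0 _ _ (hit 1 _ _ hη)

theorem fourier_comp_affine (v : Plane) {η k : 𝓢₂} (hk : ∀ ξ, k ξ = η ((2 * Real.pi) • ξ - v))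
    (y : Plane) : (𝓕 k : 𝓢₂) y = ((2 * Real.pi) ^ 2 : ℂ)⁻¹ * (expI (-(inner ℝ v y)) *
      (𝓕 η : 𝓢₂) ((2 * Real.pi)⁻¹ • y)) := by
  have hpi := Real.pi_pos
  have h1 := fourier_eq_integral_expI k ((2 * Real.pi) • y)
  rw [smul_smul, inv_mul_cancel₀ (by positivity), one_smul] at h1
  rw [← h1, ← fourier_eq_integral_expI]
  have h2 : ∀ ξ, k ξ * expI (-(inner ℝ ((2 * Real.pi) • y) ξ)) =
      (fun α => η (α - v) * expI (-(inner ℝ y α))) ((2 * Real.pi) • ξ) := by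
    intro ξ
    simp only [hk, inner_smul_left, inner_smul_right]
    simp
  simp only [h2]
  rw [Measure.integral_comp_smul volume (fun α => η (α - v) * expI (-(inner ℝ y α))),
    ← integral_add_right_eq_self (fun α => η (α - v) * expI (-(inner ℝ y α))) v,
    ← integral_const_mul]
  have hf : Module.finrank ℝ Plane = 2 := by simp
  rw [hf, abs_of_pos (by positivity), Complex.real_smul]
  push_cast
  congr 1
  refine integral_congr_ae (Filter.Eventually.of_forall fun α => ?_)
  simp only [add_sub_cancel_right]
  rw [inner_add_right, neg_add, expI_add, real_inner_comm v y]
  ring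

/-- Derivatives of η become monomials after the Fourier transform and can be moved onto φ. The
function k is η in the frequency variable ξ = (Λ*j + α)/(2π). -/
theorem blochEquiv_apply_coeffTest (hL : L.det ≠ 0) (φ : 𝓓₂) {γ : ℕ × ℕ} {j : Idx} {η k : 𝓢₂}
    {Θ : 𝓢₄} (hΘ : IsCoeffTest L j (multiDeriv γ η) Θ)
    (hk : ∀ ξ, k ξ = η ((2 * Real.pi) • ξ - lat (dualMat L) j)) :
    (blochEquiv hL φ : 𝓓₄) Θ = 2 * Real.pi * Complex.I ^ (γ.1 + γ.2) *
      (𝓕 (mulD (mono γ) φ) : 𝓓₂) k := by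
  have hpi := Real.pi_pos
  have hpi' : (Real.pi : ℂ) ≠ 0 := by exact_mod_cast hpi.ne'
  have h : blochA hL Θ = (2 * Real.pi * Complex.I ^ (γ.1 + γ.2) : ℂ) • mulF (mono γ) (𝓕 k) := by
    ext y
    rw [blochA_eq_of_isCoeffTest hL hΘ, fourier_multiDeriv, _root_.smul_apply, mulF,
      SchwartzMap.smulLeftCLM_apply_apply (hasTemperateGrowth_mono γ), fourier_comp_affine _ hk,
      mono_smul, smul_eq_mul, smul_eq_mul]
    push_cast
    rw [mul_pow _ Complex.I]
    have h3 : ((2 * Real.pi : ℂ)⁻¹) ^ (γ.1 + γ.2) * (2 * Real.pi) ^ (γ.1 + γ.2) = 1 := by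
      rw [← mul_pow, inv_mul_cancel₀ (by simp), one_pow]
    have h4 : (2 * Real.pi : ℂ) * ((2 * Real.pi) ^ 2 : ℂ)⁻¹ = (2 * Real.pi : ℂ)⁻¹ := by
      field_simp
    linear_combination ((2 * Real.pi : ℂ)⁻¹ * expI (-(inner ℝ (lat (dualMat L) j) y)) *
      Complex.I ^ (γ.1 + γ.2) * mono γ y * (𝓕 η : 𝓢₂) ((2 * Real.pi)⁻¹ • y)) * h3 -
      (expI (-(inner ℝ (lat (dualMat L) j) y)) *
      Complex.I ^ (γ.1 + γ.2) * mono γ y * (𝓕 η : 𝓢₂) ((2 * Real.pi)⁻¹ • y)) * h4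
  rw [blochEquiv_apply, h, map_smul, smul_eq_mul]
  rfl

/-- A tempered distribution is given by a locally integrable function on test functions with compact
support. -/
def IsLocRepr (u : 𝓓₂) (g : Plane → ℂ) : Prop :=
  LocallyIntegrable g ∧ ∀ k : 𝓢₂, HasCompactSupport k → u k = ∫ ξ, k ξ * g ξ

theorem IsLocRepr.ae_eq {u : 𝓓₂} {g h : Plane → ℂ} (hg : IsLocRepr u g) (hh : IsLocRepr u h) :
    g =ᵐ[volume] h := by
  refine ae_eq_of_integral_contDiff_smul_eq hg.1 hh.1 fun k hk hc => ?_
  obtain ⟨κ, hκc, hκ⟩ := exists_schwartz_of_hasCompactSupport (f := fun x => (k x : ℂ))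
    (Complex.ofRealCLM.contDiff.comp hk) (hc.comp_left (g := Complex.ofReal) (by simp))
  have h1 := (hg.2 κ hκc).symm.trans (hh.2 κ hκc)
  simpa only [hκ, Complex.real_smul] using h1

theorem LocallyIntegrable.comp_affine {g : Plane → ℂ} (hg : LocallyIntegrable g) {c : ℝ} (hc : c ≠ 0)
    (v : Plane) : LocallyIntegrable fun x => g (c • x + v) := by
  rw [locallyIntegrable_iff] at hg ⊢
  intro K hK
  have hK' : IsCompact ((fun x => c • x + v) '' K) := hK.image (by fun_prop)
  have h1 := hg _ hK'
  rw [← integrable_indicator_iff hK'.measurableSet] at h1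
  have h2 := (integrable_comp_smul_iff volume
    (fun y => Set.indicator ((fun x => c • x + v) '' K) g (y + v)) hc).2 (h1.comp_add_right v)
  rw [← integrable_indicator_iff hK.measurableSet]
  refine h2.congr (Filter.Eventually.of_forall fun x => ?_)
  have hinj : Function.Injective fun x : Plane => c • x + v := fun a b hab =>
    smul_right_injective _ hc (add_right_cancel hab)
  simp only [Set.indicator, hinj.mem_set_image (a := x)]
  by_cases hx : x ∈ K
  · rw [if_pos hx, if_pos ⟨x, hx, rfl⟩]
  · rw [if_neg hx, if_neg]
    rintro ⟨y, hy, hxy⟩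
    exact hx (hinj hxy ▸ hy)

/-- The constant relating a derivative of a coefficient and the Fourier transform. -/
def coeffConst (γ : ℕ × ℕ) : ℂ := 2 * Real.pi * Complex.I ^ (γ.1 + γ.2)

theorem norm_coeffConst (γ : ℕ × ℕ) : ‖coeffConst γ‖ = 2 * Real.pi := by
  have := Real.pi_pos
  simp [coeffConst, abs_of_pos this]

theorem coeffConst_ne_zero (γ : ℕ × ℕ) : coeffConst γ ≠ 0 := by
  have := Real.pi_pos
  rw [← norm_ne_zero_iff, norm_coeffConst]; positivity

theorem coeffConst_identity (γ : ℕ × ℕ) : (2 * Real.pi * Complex.I ^ (γ.1 + γ.2)) * coeffConst γ =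
    (-1) ^ (γ.1 + γ.2) * (2 * Real.pi) ^ 2 := by
  rw [coeffConst, ← Complex.I_sq, ← pow_mul]
  ring

theorem integral_comp_affine (f : Plane → ℂ) (v : Plane) :
    ∫ ξ, f ((2 * Real.pi) • ξ - v) = ((2 * Real.pi) ^ 2 : ℂ)⁻¹ * ∫ α, f α := by
  have hpi := Real.pi_pos
  rw [Measure.integral_comp_smul volume (fun α => f (α - v)), integral_sub_right_eq_self]
  have hf : Module.finrank ℝ Plane = 2 := by simp
  rw [hf, abs_of_pos (by positivity), Complex.real_smul]
  push_cast
  rfl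

theorem exists_comp_affine (η : 𝓢₂) (hη : HasCompactSupport η) (v : Plane) :
    ∃ k : 𝓢₂, HasCompactSupport k ∧ ∀ ξ, k ξ = η ((2 * Real.pi) • ξ - v) := by
  have hpi : 2 * Real.pi ≠ 0 := by have := Real.pi_pos; positivity
  exact exists_schwartz_of_hasCompactSupport (f := fun ξ => η ((2 * Real.pi) • ξ - v))
    ((η.smooth ⊤).comp (by fun_prop))
    (hη.comp_homeomorph ((Homeomorph.smulOfNeZero (2 * Real.pi) hpi).trans (Homeomorph.subRight v)))

theorem exists_comp_affine_inv (k : 𝓢₂) (hk : HasCompactSupport k) (v : Plane) :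
    ∃ η : 𝓢₂, HasCompactSupport η ∧ ∀ ξ, k ξ = η ((2 * Real.pi) • ξ - v) := by
  have hpi : 2 * Real.pi ≠ 0 := by have := Real.pi_pos; positivity
  obtain ⟨η, h1, h2⟩ := exists_schwartz_of_hasCompactSupport
    (f := fun ξ => k ((2 * Real.pi)⁻¹ • (ξ + v)))
    ((k.smooth ⊤).comp (by fun_prop))
    (hk.comp_homeomorph ((Homeomorph.addRight v).trans
      (Homeomorph.smulOfNeZero (2 * Real.pi)⁻¹ (inv_ne_zero hpi))))
  refine ⟨η, h1, fun ξ => ?_⟩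
  rw [h2, sub_add_cancel, smul_smul, inv_mul_cancel₀ hpi, one_smul]

/-- Up to a constant the derivatives ∂^γ of all coefficients are one and the same function, the
Fourier transform of x^γ φ, seen in coordinates shifted by Λ*j. A single j determines it. -/
theorem isLocRepr_of_isCoeffDeriv (hL : L.det ≠ 0) {φ : 𝓓₂} {γ : ℕ × ℕ} {j : Idx} {G : Plane → ℂ}
    (h : IsCoeffDeriv L (blochEquiv hL φ) γ j G) :
    IsLocRepr (𝓕 (mulD (mono γ) φ))
      fun ξ => coeffConst γ * G ((2 * Real.pi) • ξ - lat (dualMat L) j) := by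
  have hpi := Real.pi_pos
  refine ⟨?_, fun k hk => ?_⟩
  · have := (LocallyIntegrable.comp_affine h.1 (c := 2 * Real.pi) (by positivity)
      (-lat (dualMat L) j)).smul (coeffConst γ)
    simp only [sub_eq_add_neg]
    exact this
  · obtain ⟨η, hη, hkη⟩ := exists_comp_affine_inv k hk (lat (dualMat L) j)
    obtain ⟨Θ, hΘ⟩ := exists_isCoeffTest hL j (hasCompactSupport_multiDeriv γ hη)
    have h1 := h.2 η hη Θ hΘ
    rw [blochEquiv_apply_coeffTest hL φ hΘ hkη] at h1
    have h2 := integral_comp_affine (fun α => η α * (coeffConst γ * G α)) (lat (dualMat L) j)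
    simp only [← hkη] at h2
    rw [h2]
    simp only [mul_left_comm _ (coeffConst γ)]
    rw [integral_const_mul]
    have h3 := coeffConst_identity γ
    have h4 : (2 * Real.pi * Complex.I ^ (γ.1 + γ.2) : ℂ) ≠ 0 := coeffConst_ne_zero γ
    have h5 : ((2 * Real.pi) ^ 2 : ℂ) ≠ 0 := by
      exact_mod_cast (by positivity : (2 * Real.pi) ^ 2 ≠ 0)
    refine mul_left_cancel₀ h4 ?_
    rw [h1]
    have h6 := mul_inv_cancel₀ h5
    linear_combination (-(∫ α, η α * G α) * ((2 * Real.pi) ^ 2 : ℂ)⁻¹) * h3 -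
      ((-1) ^ (γ.1 + γ.2) * ∫ α, η α * G α) * h6

theorem isCoeffDeriv_of_isLocRepr (hL : L.det ≠ 0) {φ : 𝓓₂} {γ : ℕ × ℕ} (j : Idx) {g : Plane → ℂ}
    (h : IsLocRepr (𝓕 (mulD (mono γ) φ)) g) :
    IsCoeffDeriv L (blochEquiv hL φ) γ j
      fun α => (coeffConst γ)⁻¹ * g ((2 * Real.pi)⁻¹ • (lat (dualMat L) j + α)) := by
  have hpi := Real.pi_pos
  refine ⟨?_, fun η hη Θ hΘ => ?_⟩
  · have := (LocallyIntegrable.comp_affine h.1 (c := (2 * Real.pi)⁻¹) (by positivity)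
      ((2 * Real.pi)⁻¹ • lat (dualMat L) j)).smul (coeffConst γ)⁻¹
    simp only [smul_add, add_comm ((2 * Real.pi)⁻¹ • lat (dualMat L) j)]
    exact this
  · obtain ⟨k, hk, hkη⟩ := exists_comp_affine η hη (lat (dualMat L) j)
    rw [blochEquiv_apply_coeffTest hL φ hΘ hkη, h.2 k hk]
    have h2 := integral_comp_affine (fun α => η α *
      g ((2 * Real.pi)⁻¹ • (lat (dualMat L) j + α))) (lat (dualMat L) j)
    simp only [← hkη, add_sub_cancel, smul_smul] at h2
    rw [inv_mul_cancel₀ (by positivity)] at h2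
    simp only [one_smul] at h2
    rw [h2]
    simp only [mul_left_comm _ (coeffConst γ)⁻¹]
    rw [integral_const_mul]
    have h3 := coeffConst_identity γ
    have h4 := coeffConst_ne_zero γ
    have h5 : ((2 * Real.pi) ^ 2 : ℂ) ≠ 0 := by
      exact_mod_cast (by positivity : (2 * Real.pi) ^ 2 ≠ 0)
    have h6 := mul_inv_cancel₀ h5
    have h7 := mul_inv_cancel₀ h4
    generalize ∫ α, η α * g ((2 * Real.pi)⁻¹ • (lat (dualMat L) j + α)) = I
    linear_combination (I * (coeffConst γ)⁻¹ * ((2 * Real.pi) ^ 2 : ℂ)⁻¹) * h3 -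
      (2 * Real.pi * Complex.I ^ (γ.1 + γ.2) * ((2 * Real.pi) ^ 2 : ℂ)⁻¹ * I) * h7 +
      ((-1) ^ (γ.1 + γ.2) * (coeffConst γ)⁻¹ * I) * h6

end CoeffDeriv

/-! ### Norms of integer order -/

section IntNorm

local notation "𝓢₂" => SchwartzMap Plane ℂ
local notation "𝓓₂" => TemperedDistribution Plane ℂ
local notation "𝓛₂" => Lp ℂ 2 (volume : Measure Plane)

variable {A L : Matrix (Fin 2) (Fin 2) ℝ}

theorem rpow_le_of_le {a b C : ℝ} (ha : 0 < a) (hb : 0 < b) (hC : 0 < C) (h1 : a ≤ C * b)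
    (h2 : b ≤ C * a) (s : ℝ) : a ^ s ≤ C ^ |s| * b ^ s := by
  rcases le_or_gt 0 s with hs | hs
  · rw [abs_of_nonneg hs, ← Real.mul_rpow hC.le hb.le]
    exact Real.rpow_le_rpow ha.le h1 hs
  · rw [abs_of_neg hs, Real.rpow_neg hC.le, ← Real.inv_rpow hC.le, ← Real.mul_rpow (by positivity) hb.le]
    refine Real.rpow_le_rpow_of_nonpos (by positivity) ?_ hs.le
    rw [inv_mul_le_iff₀ hC]
    exact h2

theorem exists_idxWt_le_wt_lat (hA : A.det ≠ 0) (s : ℝ) :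
    ∃ C : ℝ, 0 < C ∧ ∀ j, idxWt s j ≤ C * wt s (lat A j) ∧ wt s (lat A j) ≤ C * idxWt s j := by
  let K : Plane →L[ℝ] (Fin 2 → ℝ) := LinearMap.toContinuousLinearMap
    (A⁻¹.mulVecLin ∘ₗ (WithLp.linearEquiv 2 ℝ (Fin 2 → ℝ)).toLinearMap)
  set M := ‖matVecL A‖
  set N := ‖K‖
  set C := 2 + M ^ 2 + 2 * N ^ 2 with hC
  have hCp : 0 < C := by positivity
  have hb : ∀ j : Idx, 1 + ∑ i, (j i : ℝ) ^ 2 ≤ C * (1 + ‖lat A j‖ ^ 2) ∧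
      1 + ‖lat A j‖ ^ 2 ≤ C * (1 + ∑ i, (j i : ℝ) ^ 2) := by
    intro j
    set z : Fin 2 → ℝ := fun i => (j i : ℝ) with hz
    have e1 : ‖lat A j‖ ≤ M * ‖z‖ := (matVecL A).le_opNorm z
    have e2 : ‖z‖ ≤ N * ‖lat A j‖ := by
      have h := K.le_opNorm (lat A j)
      have h' : K (lat A j) = z := coords_lat hA j
      rwa [h'] at h
    have e3 : ∑ i, (j i : ℝ) ^ 2 ≤ 2 * ‖z‖ ^ 2 := by
      rw [Fin.sum_univ_two]
      have h0 := norm_le_pi_norm z 0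
      have h1 := norm_le_pi_norm z 1
      rw [Real.norm_eq_abs] at h0 h1
      have h0' := pow_le_pow_left₀ (abs_nonneg _) h0 2
      have h1' := pow_le_pow_left₀ (abs_nonneg _) h1 2
      rw [sq_abs] at h0' h1'
      simp only [hz] at *
      linarith
    have e4 : ‖z‖ ^ 2 ≤ ∑ i, (j i : ℝ) ^ 2 := by
      have hS : 0 ≤ ∑ i, (j i : ℝ) ^ 2 := Finset.sum_nonneg fun i _ => sq_nonneg _
      have : ‖z‖ ≤ √(∑ i, (j i : ℝ) ^ 2) := by
        rw [pi_norm_le_iff_of_nonneg (Real.sqrt_nonneg _)]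
        intro i
        refine Real.le_sqrt_of_sq_le ?_
        rw [Real.norm_eq_abs, sq_abs]
        exact Finset.single_le_sum (f := fun i => (j i : ℝ) ^ 2) (fun i _ => sq_nonneg _)
          (Finset.mem_univ i)
      calc ‖z‖ ^ 2 ≤ √(∑ i, (j i : ℝ) ^ 2) ^ 2 := by gcongr
        _ = _ := Real.sq_sqrt hS
    have e1' : ‖lat A j‖ ^ 2 ≤ M ^ 2 * ‖z‖ ^ 2 := by rw [← mul_pow]; gcongr
    have e2' : ‖z‖ ^ 2 ≤ N ^ 2 * ‖lat A j‖ ^ 2 := by rw [← mul_pow]; gcongr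
    have := sq_nonneg ‖lat A j‖
    have := sq_nonneg ‖z‖
    have := sq_nonneg M
    have := sq_nonneg N
    constructor <;> rw [hC] <;> nlinarith
  have hpos : ∀ j : Idx, 0 < 1 + ∑ i, (j i : ℝ) ^ 2 := fun j => by positivity
  exact ⟨C ^ |s|, by positivity, fun j => ⟨rpow_le_of_le (hpos j) (by positivity) hCp (hb j).1 (hb j).2 s,
    rpow_le_of_le (by positivity) (hpos j) hCp (hb j).2 (hb j).1 s⟩⟩

/-- |j| and |Λ*j| are comparable because the matrix is invertible, and α is bounded on the cell. The
discrete weight may thus be replaced by a function of Λ*j + α, as is needed to assemble the cells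
into the frequency plane. -/
theorem exists_idxWt_le_wt (hA : A.det ≠ 0) (s : ℝ) :
    ∃ C : ℝ≥0, C ≠ 0 ∧ ∀ j, ∀ α ∈ cell A,
      ENNReal.ofReal (idxWt s j) ≤ C * ENNReal.ofReal (wt s (lat A j + α)) ∧
      ENNReal.ofReal (wt s (lat A j + α)) ≤ C * ENNReal.ofReal (idxWt s j) := by
  obtain ⟨C, hC, h⟩ := exists_idxWt_le_wt_lat hA s
  obtain ⟨R, hR0, hR⟩ := exists_cell_bound A
  set D := (2 * (1 + R ^ 2)) ^ |s| with hD
  have hDp : 0 < D := by positivity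
  have hle : ∀ α ∈ cell A, (2 * (1 + ‖α‖ ^ 2)) ^ |s| ≤ D := fun α hα => by
    have := hR α hα
    rw [hD]
    gcongr
  have hCD : 0 < C * D := mul_pos hC hDp
  refine ⟨(C * D).toNNReal, by simpa using hCD, fun j α hα => ?_⟩
  have e : ((C * D).toNNReal : ℝ≥0∞) = ENNReal.ofReal (C * D) := rfl
  rw [e, ← ENNReal.ofReal_mul hCD.le, ← ENNReal.ofReal_mul hCD.le]
  constructor
  · refine ENNReal.ofReal_le_ofReal ((h j).1.trans ?_)
    rw [mul_assoc]
    gcongr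
    have := wt_add_le s (-α) (lat A j + α)
    rw [neg_add_cancel_comm_assoc, norm_neg] at this
    refine this.trans ?_
    have := (wt_pos s (lat A j + α)).le
    gcongr
    exact hle α hα
  · refine ENNReal.ofReal_le_ofReal ?_
    have := wt_add_le s α (lat A j)
    rw [add_comm α] at this
    calc wt s (lat A j + α) ≤ _ := this
      _ ≤ D * (C * idxWt s j) := by
        have := (wt_pos s (lat A j)).le
        gcongr
        · exact hle α hα
        · exact (h j).2
      _ = _ := by ring

theorem lintegral_comp_smul_plane (f : Plane → ℝ≥0∞) {c : ℝ} (hc : 0 < c) :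
    ∫⁻ z, f (c⁻¹ • z) = ENNReal.ofReal (c ^ 2) * ∫⁻ ξ, f ξ := by
  have hc' : c⁻¹ ≠ 0 := (inv_pos.2 hc).ne'
  have h1 := lintegral_map_equiv (μ := (volume : Measure Plane)) f
    (Homeomorph.smulOfNeZero c⁻¹ hc').toMeasurableEquiv
  have h2 : Measure.map (Homeomorph.smulOfNeZero c⁻¹ hc').toMeasurableEquiv (volume : Measure Plane) =
      ENNReal.ofReal (c ^ 2) • volume := by
    have := Measure.map_addHaar_smul (volume : Measure Plane) hc'
    rw [show Module.finrank ℝ Plane = 2 by simp, inv_pow, inv_inv, abs_of_pos (by positivity)] at this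
    exact this
  rw [h2, lintegral_smul_measure, smul_eq_mul] at h1
  exact h1.symm

theorem IsLocRepr.mulD {u : 𝓓₂} {g : Plane → ℂ} (h : IsLocRepr u g) {a : Plane → ℂ}
    (ha : a.HasTemperateGrowth) : IsLocRepr (Bloch.mulD a u) fun x => a x * g x := by
  refine ⟨?_, fun k hk => ?_⟩
  · have hg := h.1
    rw [← locallyIntegrableOn_univ] at hg ⊢
    exact hg.continuousOn_mul ha.1.continuous.continuousOn isOpen_univ.isLocallyClosed
  · rw [Bloch.mulD, TemperedDistribution.smulLeftCLM_apply_apply, h.2]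
    · refine integral_congr_ae (Filter.Eventually.of_forall fun x => ?_)
      simp only [SchwartzMap.smulLeftCLM_apply_apply ha, smul_eq_mul]
      ring
    · have : ⇑(SchwartzMap.smulLeftCLM ℂ a k) = fun x => a x * k x := by
        funext x; rw [SchwartzMap.smulLeftCLM_apply_apply ha, smul_eq_mul]
      rw [this]
      exact hk.mul_left

theorem isLocRepr_toTemperedDistribution (g : 𝓛₂) :
    IsLocRepr (MeasureTheory.Lp.toTemperedDistribution g) g := by
  refine ⟨(Lp.memLp g).locallyIntegrable (by norm_num), fun k _ => ?_⟩
  rw [MeasureTheory.Lp.toTemperedDistribution_apply]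
  rfl

/-- The weight `(1 + |2π ξ|²)^(s/2)`. -/
abbrev freqWt (s : ℝ) (ξ : Plane) : ℝ := wt (s / 2) ((2 * Real.pi) • ξ)

theorem isWeight_freqWt (s : ℝ) : IsWeight (freqWt s) := isWeight_wt (2 * Real.pi) (s / 2)

theorem hasTemperateGrowth_freqWt (s : ℝ) : Function.HasTemperateGrowth fun ξ => (freqWt s ξ : ℂ) :=
  (isWeight_freqWt s).hasTemperateGrowth

theorem wt_half_mul_self (s : ℝ) (x : Plane) : wt (s / 2) x ^ 2 = wt s x := by
  rw [sq, ← wt_add, add_halves]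

/-- The translates of the dual cell tile the frequency plane, so the sum over j of the weighted cell
integrals is one integral. The Jacobian (2π)² of the change to the variable ξ cancels |`coeffConst
γ`|². -/
theorem l2Norm_freqWt_sq (hL : L.det ≠ 0) {s : ℝ} {u : 𝓓₂} {g : Plane → ℂ} (h : IsLocRepr u g)
    (γ : ℕ × ℕ) {G : Idx → Plane → ℂ} (hG : ∀ j, G j =ᵐ[volume] fun α =>
      (coeffConst γ)⁻¹ * g ((2 * Real.pi)⁻¹ • (lat (dualMat L) j + α))) :
    l2Norm (Bloch.mulD (fun ξ => (freqWt s ξ : ℂ)) u) ^ 2 =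
      ∑' j, ∫⁻ α, ENNReal.ofReal (wt s (lat (dualMat L) j + α)) * ‖G j α‖ₑ ^ 2
        ∂(cellMeasure (dualMat L)) := by
  have hpi := Real.pi_pos
  have hc0 : ENNReal.ofReal ((2 * Real.pi) ^ 2) ≠ 0 := by
    rw [ne_eq, ENNReal.ofReal_eq_zero, not_le]; positivity
  have hr := h.mulD (hasTemperateGrowth_freqWt s)
  rw [l2Norm_sq_eq_lintegral hr.1 hr.2]
  have h1 := lintegral_comp_smul_plane (fun ξ => ‖(freqWt s ξ : ℂ) * g ξ‖ₑ ^ 2)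
    (c := 2 * Real.pi) (by positivity)
  rw [← ENNReal.mul_right_inj hc0 ENNReal.ofReal_ne_top, ← h1,
    lintegral_eq_tsum_cell (det_dualMat_ne_zero hL), ← ENNReal.tsum_mul_left]
  refine tsum_congr fun j => ?_
  rw [← lintegral_const_mul' _ _ ENNReal.ofReal_ne_top]
  refine lintegral_congr_ae ?_
  filter_upwards [ae_restrict_of_ae (hG j)] with α hα
  rw [hα, enorm_mul, enorm_mul, mul_pow ‖((freqWt s _ : ℝ) : ℂ)‖ₑ, mul_pow ‖(coeffConst γ)⁻¹‖ₑ,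
    add_comm α, show freqWt s ((2 * Real.pi)⁻¹ • (lat (dualMat L) j + α)) =
      wt (s / 2) (lat (dualMat L) j + α) by
        rw [freqWt, smul_smul, mul_inv_cancel₀ (by positivity), one_smul]]
  have e1 : ‖((wt (s / 2) (lat (dualMat L) j + α) : ℝ) : ℂ)‖ₑ ^ 2 =
      ENNReal.ofReal (wt s (lat (dualMat L) j + α)) := by
    rw [← ofReal_norm, Complex.norm_of_nonneg (wt_pos _ _).le,
      ← ENNReal.ofReal_pow (wt_pos _ _).le, wt_half_mul_self]
  have e2 : ENNReal.ofReal ((2 * Real.pi) ^ 2) * ‖(coeffConst γ)⁻¹‖ₑ ^ 2 = 1 := by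
    rw [← ofReal_norm, norm_inv, norm_coeffConst, ← ENNReal.ofReal_pow (by positivity),
      ← ENNReal.ofReal_mul (by positivity), inv_pow, mul_inv_cancel₀ (by positivity),
      ENNReal.ofReal_one]
  rw [e1]
  calc _ = 1 * (ENNReal.ofReal (wt s (lat (dualMat L) j + α)) *
        ‖g ((2 * Real.pi)⁻¹ • (lat (dualMat L) j + α))‖ₑ ^ 2) := by rw [one_mul]
    _ = _ := by rw [← e2]; ring

theorem exists_sum_coeff_le (hL : L.det ≠ 0) (s : ℝ) : ∃ C : ℝ≥0, C ≠ 0 ∧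
    ∀ G : Idx → Plane → ℂ,
      ∑' j, ENNReal.ofReal (idxWt s j) * ∫⁻ α, ‖G j α‖ₑ ^ 2 ∂(cellMeasure (dualMat L)) ≤
        C * ∑' j, ∫⁻ α, ENNReal.ofReal (wt s (lat (dualMat L) j + α)) * ‖G j α‖ₑ ^ 2
          ∂(cellMeasure (dualMat L)) ∧
      ∑' j, ∫⁻ α, ENNReal.ofReal (wt s (lat (dualMat L) j + α)) * ‖G j α‖ₑ ^ 2
          ∂(cellMeasure (dualMat L)) ≤ C * ∑' j, ENNReal.ofReal (idxWt s j) *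
            ∫⁻ α, ‖G j α‖ₑ ^ 2 ∂(cellMeasure (dualMat L)) := by
  have hA := det_dualMat_ne_zero hL
  obtain ⟨C, hC0, hC⟩ := exists_idxWt_le_wt hA s
  refine ⟨C, hC0, fun G => ⟨?_, ?_⟩⟩
  · rw [← ENNReal.tsum_mul_left]
    refine ENNReal.tsum_le_tsum fun j => ?_
    rw [← lintegral_const_mul' _ _ ENNReal.ofReal_ne_top, ← lintegral_const_mul' _ _ ENNReal.coe_ne_top]
    refine lintegral_mono_ae ?_
    filter_upwards [ae_restrict_mem (measurableSet_cell hA)] with α hα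
    rw [← mul_assoc]
    gcongr
    exact (hC j α hα).1
  · rw [← ENNReal.tsum_mul_left]
    refine ENNReal.tsum_le_tsum fun j => ?_
    rw [← lintegral_const_mul' _ _ ENNReal.ofReal_ne_top, ← lintegral_const_mul' _ _ ENNReal.coe_ne_top]
    refine lintegral_mono_ae ?_
    filter_upwards [ae_restrict_mem (measurableSet_cell hA)] with α hα
    rw [← mul_assoc]
    gcongr
    exact (hC j α hα).2

/-- The sum of the squared norms of the products with monomials. -/
def monoSum (m : ℕ) (s : ℝ) (φ : 𝓓₂) : ℝ≥0∞ :=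
  ∑ γ ∈ multiIdx m, l2Norm (Bloch.mulD (fun ξ => (freqWt s ξ : ℂ)) (𝓕 (Bloch.mulD (mono γ) φ))) ^ 2

theorem exists_monoSum_le_intNormSq (hL : L.det ≠ 0) (m : ℕ) (s : ℝ) : ∃ C : ℝ≥0, ∀ φ : 𝓓₂,
    monoSum m s φ ≤ C * intNormSq L m s (blochEquiv hL φ) := by
  have hpi := Real.pi_pos
  obtain ⟨C, hC0, hC⟩ := exists_sum_coeff_le hL s
  refine ⟨C, fun φ => ?_⟩
  rw [intNormSq, ENNReal.mul_iInf_of_ne (by simpa using hC0) (by simp)]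
  refine le_iInf fun G => ?_
  rw [ENNReal.mul_iInf_of_ne (by simpa using hC0) (by simp)]
  refine le_iInf fun hG => ?_
  rw [monoSum, coeffSum, Finset.mul_sum]
  refine Finset.sum_le_sum fun γ hγ => ?_
  have hr := fun j => isLocRepr_of_isCoeffDeriv hL (hG γ hγ j)
  -- The coefficient with j = 0 provides the representing function; those with other j agree with it
  -- almost everywhere by uniqueness.
  rw [l2Norm_freqWt_sq hL (hr 0) γ (G := G γ)]
  · exact (hC _).2
  · intro j
    have h1 := (hr j).ae_eq (hr 0)
    have hq : Measure.QuasiMeasurePreserving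
        (fun α : Plane => (2 * Real.pi)⁻¹ • (lat (dualMat L) j + α)) volume volume := by
      have e1 : Measure.QuasiMeasurePreserving (fun α : Plane => (2 * Real.pi)⁻¹ • α) volume volume := by
        refine ⟨by fun_prop, ?_⟩
        rw [Measure.map_addHaar_smul _ (by positivity)]
        exact Measure.smul_absolutelyContinuous
      exact e1.comp (measurePreserving_add_left volume _).quasiMeasurePreserving
    filter_upwards [hq.ae h1] with α hα
    rw [← hα, smul_smul, mul_inv_cancel₀ (by positivity), one_smul, add_sub_cancel_left,
      inv_mul_cancel_left₀ (coeffConst_ne_zero γ)]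

theorem exists_intNormSq_le_monoSum (hL : L.det ≠ 0) (m : ℕ) (s : ℝ) : ∃ C : ℝ≥0, ∀ φ : 𝓓₂,
    intNormSq L m s (blochEquiv hL φ) ≤ C * monoSum m s φ := by
  obtain ⟨C, hC0, hC⟩ := exists_sum_coeff_le hL s
  refine ⟨C, fun φ => ?_⟩
  by_cases htop : monoSum m s φ = ⊤
  · rw [htop, ENNReal.mul_top (by simpa using hC0)]; exact le_top
  have hr : ∀ γ, ∃ g, γ ∈ multiIdx m → IsLocRepr (𝓕 (Bloch.mulD (mono γ) φ)) g := by
    intro γ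
    by_cases hγ : γ ∈ multiIdx m
    swap
    · exact ⟨0, fun h => absurd h hγ⟩
    have hlt : l2Norm (Bloch.mulD (fun ξ => (freqWt s ξ : ℂ)) (𝓕 (Bloch.mulD (mono γ) φ))) < ⊤ := by
      by_contra h
      refine htop ?_
      rw [monoSum, ENNReal.sum_eq_top]
      refine ⟨γ, hγ, ?_⟩
      rw [not_lt, top_le_iff] at h
      rw [h]; simp
    obtain ⟨g, hg⟩ := l2Norm_lt_top_iff.1 hlt
    -- Only the weighted transform is known to be an L² function; division by the positive weight
    -- makes the transform itself locally integrable.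
    have h1 := (isLocRepr_toTemperedDistribution g).mulD (isWeight_freqWt s).hasTemperateGrowth_inv
    rw [← hg, mulD_inv_cancel (isWeight_freqWt s).hasTemperateGrowth_inv (hasTemperateGrowth_freqWt s)
      (isWeight_freqWt s).inv_mul] at h1
    exact ⟨_, fun _ => h1⟩
  choose g hg using hr
  refine (iInf₂_le (fun γ j α => (coeffConst γ)⁻¹ *
    g γ ((2 * Real.pi)⁻¹ • (lat (dualMat L) j + α)))
    fun γ hγ j => isCoeffDeriv_of_isLocRepr hL j (hg γ hγ)).trans ?_
  rw [monoSum, coeffSum, Finset.mul_sum]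
  refine Finset.sum_le_sum fun γ hγ => ?_
  rw [l2Norm_freqWt_sq hL (hg γ hγ) γ fun j => Filter.EventuallyEq.rfl]
  exact (hC _).1

end IntNorm

/-! ### Monomials against powers of the weight; the rewritten norm -/

section FreqNorm

local notation "𝓢₂" => SchwartzMap Plane ℂ
local notation "𝓓₂" => TemperedDistribution Plane ℂ

/-- The norm of `H^s(ℝ²)`. -/
def freqNorm (s : ℝ) (φ : 𝓓₂) : ℝ≥0∞ := l2Norm (mulD (fun ξ => (freqWt s ξ : ℂ)) (𝓕 φ))

theorem besselNorm_eq_freqNorm (s r : ℝ) (φ : 𝓓₂) :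
    besselNorm s r φ = freqNorm s (mulD (fun x => (wt (r / 2) x : ℂ)) φ) := rfl

theorem freqNorm_add_le (s : ℝ) (φ φ' : 𝓓₂) : freqNorm s (φ + φ') ≤ freqNorm s φ + freqNorm s φ' := by
  rw [freqNorm, FourierTransform.fourier_add, map_add]
  exact l2Norm_add_le _ _

theorem norm_le_wt_half (x : Plane) : ‖x‖ ≤ wt (1 / 2) x := by
  refine le_of_sq_le_sq ?_ (wt_pos _ _).le
  rw [wt_half_sq]
  linarith

theorem one_le_wt {p : ℝ} (hp : 0 ≤ p) (x : Plane) : 1 ≤ wt p x :=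
  Real.one_le_rpow (by nlinarith [sq_nonneg ‖x‖]) hp

theorem isSymbol_coord (i : Fin 2) : IsSymbol (wt (1 / 2)) fun x : Plane => (x i : ℂ) := by
  let f : Plane →L[ℝ] ℂ := Complex.ofRealCLM.comp (EuclideanSpace.proj i : Plane →L[ℝ] ℝ)
  refine ⟨f.contDiff, fun n => ⟨‖f‖ , norm_nonneg _, fun x => ?_⟩⟩
  change ‖iteratedFDeriv ℝ n f x‖ ≤ _
  have h1 := one_le_wt (p := 1 / 2) (by norm_num) x
  match n with
  | 0 =>
    rw [norm_iteratedFDeriv_zero]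
    exact (f.le_opNorm x).trans (by gcongr; exact norm_le_wt_half x)
  | 1 =>
    rw [← norm_iteratedFDeriv_fderiv, norm_iteratedFDeriv_zero, f.fderiv]
    exact le_mul_of_one_le_right (norm_nonneg _) h1
  | n + 2 =>
    rw [← norm_iteratedFDeriv_fderiv]
    have : fderiv ℝ f = fun _ => f := funext fun x => f.fderiv
    rw [this, iteratedFDeriv_const_of_ne (by omega)]
    simpa using mul_nonneg (norm_nonneg f) (wt_pos _ x).le

theorem isSymbol_mono (γ : ℕ × ℕ) : IsSymbol (wt ((γ.1 + γ.2 : ℕ) / 2)) (mono γ) := by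
  have hp : ∀ (i : Fin 2) (n : ℕ), IsSymbol (wt (n / 2)) fun x : Plane => (x i : ℂ) ^ n := by
    intro i n
    induction n with
    | zero => simpa [wt_zero, funext] using isSymbol_one.mono (v := wt 0) fun x => (wt_zero x).ge
    | succ n ih =>
      simp only [pow_succ]
      refine (ih.mul (isSymbol_coord i)).mono fun x => ?_
      rw [← wt_add]
      push_cast
      rw [add_div]
  refine ((hp 0 γ.1).mul (hp 1 γ.2)).mono fun x => ?_
  rw [← wt_add]
  push_cast
  rw [add_div]

theorem freqNorm_symbol_le (s : ℝ) {a : Plane → ℂ} (ha : IsSymbol (fun _ => 1) a) :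
    ∃ C : ℝ≥0, ∀ φ : 𝓓₂, freqNorm s (mulD a φ) ≤ C * freqNorm s φ :=
  l2Norm_fourier_symbol_le (isWeight_freqWt s) ha

theorem mem_multiIdx {m : ℕ} {γ : ℕ × ℕ} : γ ∈ multiIdx m ↔ γ.1 + γ.2 ≤ m := by
  simp only [multiIdx, Finset.mem_filter, Finset.mem_product, Finset.mem_range]
  omega

/-- For |γ| ≤ m the quotient x^γ (1 + |x|²)^(-m/2) is a symbol of order zero and therefore a
multiplier of H^s. -/
theorem exists_freqNorm_mono_le (s : ℝ) {m : ℕ} {γ : ℕ × ℕ} (hγ : γ ∈ multiIdx m) :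
    ∃ C : ℝ≥0, ∀ φ : 𝓓₂, freqNorm s (mulD (mono γ) φ) ≤
      C * freqNorm s (mulD (fun x => (wt ((m : ℝ) / 2) x : ℂ)) φ) := by
  have ha : IsSymbol (fun _ => 1) fun x => mono γ x * (wt (-((m : ℝ) / 2)) x : ℂ) := by
    refine ((isSymbol_mono γ).mul (isSymbol_wt (-((m : ℝ) / 2)))).mono fun x => ?_
    rw [← wt_add]
    refine wt_le_one ?_ x
    have : ((γ.1 + γ.2 : ℕ) : ℝ) ≤ m := by exact_mod_cast mem_multiIdx.1 hγ
    linarith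
  obtain ⟨C, hC⟩ := freqNorm_symbol_le s ha
  refine ⟨C, fun φ => ?_⟩
  have h := hC (mulD (fun x => (wt ((m : ℝ) / 2) x : ℂ)) φ)
  rw [mulD_mulD (ha.hasTemperateGrowth isModerate_one) (hasTemperateGrowth_wt _)] at h
  have e : (fun x => mono γ x * (wt (-((m : ℝ) / 2)) x : ℂ) * (wt ((m : ℝ) / 2) x : ℂ)) = mono γ := by
    funext x
    rw [mul_assoc, ← Complex.ofReal_mul, ← wt_add, neg_add_cancel, wt_zero, Complex.ofReal_one, mul_one]
  rwa [e] at h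

theorem exists_monoSum_le (s : ℝ) (m : ℕ) : ∃ C : ℝ≥0, ∀ φ : 𝓓₂,
    monoSum m s φ ≤ C * freqNorm s (mulD (fun x => (wt ((m : ℝ) / 2) x : ℂ)) φ) ^ 2 := by
  choose! C hC using fun γ (hγ : γ ∈ multiIdx m) => exists_freqNorm_mono_le s hγ
  refine ⟨∑ γ ∈ multiIdx m, C γ ^ 2, fun φ => ?_⟩
  rw [monoSum]
  push_cast
  rw [Finset.sum_mul]
  refine Finset.sum_le_sum fun γ hγ => ?_
  rw [← mul_pow]
  gcongr
  exact hC γ hγ φ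

/-- Induction by the identity (1 + |x|²)^((m+1)/2) = (1 + |x|²)^(-1/2) (1 + |x|²)^(m/2) (1 + x₁² +
x₂²). The functions (1 + |x|²)^(-1/2) and x_i (1 + |x|²)^(-1/2) are symbols of order zero, and the
remaining factor 1 or x_i either keeps the monomials or raises them by one degree. -/
theorem exists_freqNorm_le_of_mono (s : ℝ) (m : ℕ) : ∃ C : ℝ≥0, ∀ (φ : 𝓓₂) (M : ℝ≥0∞),
    (∀ γ ∈ multiIdx m, freqNorm s (mulD (mono γ) φ) ≤ M) →
      freqNorm s (mulD (fun x => (wt ((m : ℝ) / 2) x : ℂ)) φ) ≤ C * M := by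
  induction m with
  | zero =>
    refine ⟨1, fun φ M h => ?_⟩
    have := h (0, 0) (mem_multiIdx.2 (by simp))
    have e : mono (0, 0) = fun _ => 1 := funext fun x => by simp [mono]
    rw [e, mulD_one] at this
    simpa [mulD_wt_zero] using this
  | succ m ih =>
    obtain ⟨C, hC⟩ := ih
    have hq0 : IsSymbol (fun _ => 1) fun x => (wt (-(1 / 2)) x : ℂ) :=
      (isSymbol_wt _).mono fun x => wt_le_one (by norm_num) x
    have hqi : ∀ i : Fin 2, IsSymbol (fun _ => 1) fun x : Plane => (x i : ℂ) * (wt (-(1 / 2)) x : ℂ) :=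
      fun i => ((isSymbol_coord i).mul (isSymbol_wt (-(1 / 2)))).mono fun x => by
        rw [← wt_add, add_neg_cancel, wt_zero]
    obtain ⟨C0, hC0⟩ := freqNorm_symbol_le s hq0
    obtain ⟨C1, hC1⟩ := freqNorm_symbol_le s (hqi 0)
    obtain ⟨C2, hC2⟩ := freqNorm_symbol_le s (hqi 1)
    have ht0 := hq0.hasTemperateGrowth isModerate_one
    have hti := fun i => (hqi i).hasTemperateGrowth isModerate_one
    have htw := hasTemperateGrowth_wt ((m : ℝ) / 2)
    have htm := hasTemperateGrowth_wt (((m + 1 : ℕ) : ℝ) / 2)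
    have htwi : ∀ i : Fin 2, Function.HasTemperateGrowth fun x : Plane =>
        (wt ((m : ℝ) / 2) x : ℂ) * (x i : ℂ) := fun i => htw.mul (hasTemperateGrowth_coord i)
    have htp : ∀ i : Fin 2, Function.HasTemperateGrowth fun x : Plane =>
        (x i : ℂ) * (wt (-(1 / 2)) x : ℂ) * ((wt ((m : ℝ) / 2) x : ℂ) * (x i : ℂ)) :=
      fun i => (hti i).mul (htwi i)
    have htz : Function.HasTemperateGrowth fun x : Plane =>
        (wt (-(1 / 2)) x : ℂ) * (wt ((m : ℝ) / 2) x : ℂ) := ht0.mul htw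
    refine ⟨(C0 + C1 + C2) * C, fun φ M h => ?_⟩
    have e : mulD (fun x => (wt (((m + 1 : ℕ) : ℝ) / 2) x : ℂ)) φ =
        mulD (fun x => (wt (-(1 / 2)) x : ℂ)) (mulD (fun x => (wt ((m : ℝ) / 2) x : ℂ)) φ) +
        mulD (fun x : Plane => (x 0 : ℂ) * (wt (-(1 / 2)) x : ℂ))
          (mulD (fun x => (wt ((m : ℝ) / 2) x : ℂ)) (mulD (fun x : Plane => (x 0 : ℂ)) φ)) +
        mulD (fun x : Plane => (x 1 : ℂ) * (wt (-(1 / 2)) x : ℂ))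
          (mulD (fun x => (wt ((m : ℝ) / 2) x : ℂ)) (mulD (fun x : Plane => (x 1 : ℂ)) φ)) := by
      rw [mulD_mulD htw (hasTemperateGrowth_coord 0), mulD_mulD htw (hasTemperateGrowth_coord 1),
        mulD_mulD ht0 htw, mulD_mulD (hti 0) (htwi 0),
        mulD_mulD (hti 1) (htwi 1)]
      ext η
      change φ (mulF _ η) = φ (mulF _ η) + φ (mulF _ η) + φ (mulF _ η)
      rw [← map_add, ← map_add]
      congr 1
      ext x
      simp only [_root_.add_apply]
      rw [SchwartzMap.smulLeftCLM_apply_apply htm, SchwartzMap.smulLeftCLM_apply_apply htz,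
        SchwartzMap.smulLeftCLM_apply_apply (htp 0),
        SchwartzMap.smulLeftCLM_apply_apply (htp 1)]
      have e1 : wt (((m + 1 : ℕ) : ℝ) / 2) x =
          wt (-(1 / 2)) x * wt ((m : ℝ) / 2) x * (1 + (x 0 ^ 2 + x 1 ^ 2)) := by
        have : 1 + (x 0 ^ 2 + x 1 ^ 2) = wt 1 x := by
          rw [wt, Real.rpow_one, EuclideanSpace.norm_sq_eq, Fin.sum_univ_two]
          simp
        rw [this, ← wt_add, ← wt_add]
        congr 1
        push_cast
        ring
      simp only [smul_eq_mul]
      rw [e1]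
      push_cast
      ring
    have hmono : ∀ γ : ℕ × ℕ, mulD (mono γ) (mulD (fun x : Plane => (x 0 : ℂ)) φ) =
        mulD (mono (γ.1 + 1, γ.2)) φ ∧ mulD (mono γ) (mulD (fun x : Plane => (x 1 : ℂ)) φ) =
        mulD (mono (γ.1, γ.2 + 1)) φ := by
      intro γ
      rw [mulD_mulD (hasTemperateGrowth_mono γ) (hasTemperateGrowth_coord 0),
        mulD_mulD (hasTemperateGrowth_mono γ) (hasTemperateGrowth_coord 1)]
      constructor
      · congr 1
        congr 1
        funext x
        simp only [mono]
        ring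
      · congr 1
        congr 1
        funext x
        simp only [mono]
        ring
    have k0 := hC φ M fun γ hγ => h γ (mem_multiIdx.2 (by have := mem_multiIdx.1 hγ; omega))
    have k1 := hC (mulD (fun x : Plane => (x 0 : ℂ)) φ) M fun γ hγ => by
      rw [(hmono γ).1]
      exact h _ (mem_multiIdx.2 (by have := mem_multiIdx.1 hγ; simp only; omega))
    have k2 := hC (mulD (fun x : Plane => (x 1 : ℂ)) φ) M fun γ hγ => by
      rw [(hmono γ).2]
      exact h _ (mem_multiIdx.2 (by have := mem_multiIdx.1 hγ; simp only; omega))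
    rw [e]
    calc _ ≤ C0 * (C * M) + C1 * (C * M) + C2 * (C * M) := by
          refine (freqNorm_add_le _ _ _).trans (add_le_add ((freqNorm_add_le _ _ _).trans
            (add_le_add ?_ ?_)) ?_)
          · exact (hC0 _).trans (by gcongr)
          · exact (hC1 _).trans (by gcongr)
          · exact (hC2 _).trans (by gcongr)
      _ = _ := by push_cast; ring

theorem exists_freqNorm_le_monoSum (s : ℝ) (m : ℕ) : ∃ C : ℝ≥0, ∀ φ : 𝓓₂,
    freqNorm s (mulD (fun x => (wt ((m : ℝ) / 2) x : ℂ)) φ) ^ 2 ≤ C * monoSum m s φ := by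
  obtain ⟨C, hC⟩ := exists_freqNorm_le_of_mono s m
  refine ⟨C ^ 2, fun φ => ?_⟩
  have hsq : ∀ x : ℝ≥0∞, (x ^ (1 / 2 : ℝ)) ^ 2 = x := fun x => by
    rw [← ENNReal.rpow_natCast, ← ENNReal.rpow_mul]; simp
  have h := hC φ (monoSum m s φ ^ (1 / 2 : ℝ)) fun γ hγ => by
    rw [← ENNReal.pow_le_pow_left_iff (n := 2) (by norm_num), hsq]
    exact Finset.single_le_sum (f := fun γ => freqNorm s (mulD (mono γ) φ) ^ 2)
      (fun _ _ => zero_le) hγ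
  calc _ ≤ (C * monoSum m s φ ^ (1 / 2 : ℝ)) ^ 2 := by gcongr
    _ = _ := by rw [mul_pow, hsq]; push_cast; rfl

/-- The distribution `F((1 + |z|²)^(s/2) F φ)`. -/
def doubleF (s : ℝ) (φ : 𝓓₂) : 𝓓₂ := 𝓕 (mulD (fun ξ => (freqWt s ξ : ℂ)) (𝓕 φ))

theorem doubleF_sub (s : ℝ) (φ φ' : 𝓓₂) : doubleF s (φ - φ') = doubleF s φ - doubleF s φ' := by
  have h : ∀ u v : 𝓓₂, 𝓕 (u - v) = 𝓕 u - 𝓕 v := fun u v => by ext; rfl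
  simp only [doubleF, h, map_sub]

theorem doubleF_surjective (s : ℝ) : Function.Surjective (doubleF s) := by
  intro v
  refine ⟨𝓕⁻ (mulD (fun ξ => ((freqWt s ξ)⁻¹ : ℂ)) (𝓕⁻ v)), ?_⟩
  rw [doubleF, FourierTransform.fourier_fourierInv_eq, mulD_inv_cancel (hasTemperateGrowth_freqWt s)
    (isWeight_freqWt s).hasTemperateGrowth_inv (isWeight_freqWt s).mul_inv,
    FourierTransform.fourier_fourierInv_eq]

/-- The norm `‖(1 + |x|²)^(r/2) F((1 + |z|²)^(s/2) F φ)‖`, equivalent to that of `H^s_r(ℝ²)`. -/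
def doubleNorm (s r : ℝ) (φ : 𝓓₂) : ℝ≥0∞ := l2Norm (mulD (fun x => (wt (r / 2) x : ℂ)) (doubleF s φ))

/-- With the weight in x applied last, H^s_r is a weighted L² space of the functions `doubleF s φ`,
for fixed s; interpolation and duality in r then concern L² weights only. -/
theorem exists_besselNorm_le (s r : ℝ) : ∃ C : ℝ≥0, ∀ φ : 𝓓₂,
    besselNorm s r φ ≤ C * doubleNorm s r φ :=
  l2Norm_swap_le (isWeight_wt_one (r / 2)) (isWeight_freqWt s)

theorem exists_le_besselNorm (s r : ℝ) : ∃ C : ℝ≥0, ∀ φ : 𝓓₂,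
    doubleNorm s r φ ≤ C * besselNorm s r φ :=
  le_l2Norm_swap (isWeight_wt_one (r / 2)) (isWeight_freqWt s)

variable {L : Matrix (Fin 2) (Fin 2) ℝ}

theorem exists_intNormSq_le (hL : L.det ≠ 0) (m : ℕ) (s : ℝ) : ∃ C : ℝ≥0, ∀ φ : 𝓓₂,
    intNormSq L m s (blochEquiv hL φ) ≤ C * doubleNorm s m φ ^ 2 := by
  obtain ⟨C1, h1⟩ := exists_intNormSq_le_monoSum hL m s
  obtain ⟨C2, h2⟩ := exists_monoSum_le s m
  obtain ⟨C3, h3⟩ := exists_besselNorm_le s m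
  refine ⟨C1 * C2 * C3 ^ 2, fun φ => ?_⟩
  calc _ ≤ C1 * (C2 * (C3 * doubleNorm s m φ) ^ 2) := by
        refine (h1 φ).trans ?_
        gcongr
        refine (h2 φ).trans ?_
        gcongr
        exact h3 φ
    _ = _ := by push_cast; ring

theorem exists_le_intNormSq (hL : L.det ≠ 0) (m : ℕ) (s : ℝ) : ∃ C : ℝ≥0, ∀ φ : 𝓓₂,
    doubleNorm s m φ ^ 2 ≤ C * intNormSq L m s (blochEquiv hL φ) := by
  obtain ⟨C1, h1⟩ := exists_monoSum_le_intNormSq hL m s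
  obtain ⟨C2, h2⟩ := exists_freqNorm_le_monoSum s m
  obtain ⟨C3, h3⟩ := exists_le_besselNorm s m
  refine ⟨C3 ^ 2 * C2 * C1, fun φ => ?_⟩
  calc doubleNorm s m φ ^ 2 ≤ (C3 * besselNorm s m φ) ^ 2 := by gcongr; exact h3 φ
    _ ≤ C3 ^ 2 * (C2 * (C1 * intNormSq L m s (blochEquiv hL φ))) := by
        rw [mul_pow]
        gcongr
        refine (h2 φ).trans ?_
        gcongr
        exact h1 φ
    _ = _ := by push_cast; ring

end FreqNorm

/-! ### Fractional and negative orders -/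

section QpNorm

local notation "𝓢₂" => SchwartzMap Plane ℂ
local notation "𝓓₂" => TemperedDistribution Plane ℂ
local notation "𝓓₄" => TemperedDistribution (Plane × Plane) ℂ

variable {L : Matrix (Fin 2) (Fin 2) ℝ}

theorem mulD_wt_surjective (p : ℝ) : Function.Surjective (mulD fun x => (wt p x : ℂ)) := fun v =>
  ⟨mulD (fun x => (wt (-p) x : ℂ)) v, by rw [mulD_wt_mulD_wt, add_neg_cancel, mulD_wt_zero]⟩

/-- Every distribution is of the form (1 + |x|²)^(m/2) `doubleF s φ₀`, so decompositions of φ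
correspond to decompositions on the weighted side. The couple of orders m and m + 1 becomes L² and
its weighted version. -/
theorem weightedKSq_doubleF (s t : ℝ) (m : ℕ) (φ : 𝓓₂) :
    weightedKSq t (mulD (fun x => (wt ((m : ℝ) / 2) x : ℂ)) (doubleF s φ)) =
      ⨅ φ₀ : 𝓓₂, doubleNorm s m φ₀ ^ 2 +
        ENNReal.ofReal t ^ 2 * doubleNorm s (m + 1 : ℕ) (φ - φ₀) ^ 2 := by
  have hsurj : Function.Surjective fun φ₀ : 𝓓₂ =>
      mulD (fun x => (wt ((m : ℝ) / 2) x : ℂ)) (doubleF s φ₀) :=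
    (mulD_wt_surjective _).comp (doubleF_surjective s)
  rw [weightedKSq, ← hsurj.iInf_comp]
  refine iInf_congr fun φ₀ => ?_
  rw [← map_sub, ← doubleF_sub, mulD_wt_mulD_wt, doubleNorm, doubleNorm]
  congr 6
  funext x
  congr 2
  push_cast
  ring

theorem exists_kSq_le (hL : L.det ≠ 0) (m : ℕ) (s : ℝ) : ∃ C : ℝ≥0, ∀ (t : ℝ) (φ : 𝓓₂),
    kSq L m s t (blochEquiv hL φ) ≤
      C * weightedKSq t (mulD (fun x => (wt ((m : ℝ) / 2) x : ℂ)) (doubleF s φ)) := by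
  obtain ⟨C1, h1⟩ := exists_intNormSq_le hL m s
  obtain ⟨C2, h2⟩ := exists_intNormSq_le hL (m + 1) s
  -- One constant has to dominate both bounds, and it has to be nonzero to be moved inside the
  -- infimum.
  refine ⟨C1 + C2 + 1, fun t φ => ?_⟩
  rw [weightedKSq_doubleF, ENNReal.mul_iInf_of_ne (by simp) (by simp)]
  refine le_iInf fun φ₀ => (iInf_le _ (blochEquiv hL φ₀)).trans ?_
  rw [← map_sub]
  calc _ ≤ C1 * doubleNorm s m φ₀ ^ 2 + ENNReal.ofReal t ^ 2 *
        (C2 * doubleNorm s (m + 1 : ℕ) (φ - φ₀) ^ 2) := by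
        gcongr
        · exact h1 _
        · exact h2 _
    _ ≤ (C1 + C2 + 1 : ℝ≥0) * doubleNorm s m φ₀ ^ 2 + ENNReal.ofReal t ^ 2 *
        ((C1 + C2 + 1 : ℝ≥0) * doubleNorm s (m + 1 : ℕ) (φ - φ₀) ^ 2) := by
        gcongr
        · exact (le_add_of_nonneg_right (zero_le (a := C2))).trans (le_add_of_nonneg_right zero_le_one)
        · exact (le_add_of_nonneg_left (zero_le (a := C1))).trans (le_add_of_nonneg_right zero_le_one)
    _ = _ := by ring

theorem exists_le_kSq (hL : L.det ≠ 0) (m : ℕ) (s : ℝ) : ∃ C : ℝ≥0, ∀ (t : ℝ) (φ : 𝓓₂),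
    weightedKSq t (mulD (fun x => (wt ((m : ℝ) / 2) x : ℂ)) (doubleF s φ)) ≤
      C * kSq L m s t (blochEquiv hL φ) := by
  obtain ⟨C1, h1⟩ := exists_le_intNormSq hL m s
  obtain ⟨C2, h2⟩ := exists_le_intNormSq hL (m + 1) s
  refine ⟨C1 + C2 + 1, fun t φ => ?_⟩
  rw [weightedKSq_doubleF, kSq, ENNReal.mul_iInf_of_ne (by simp) (by simp)]
  refine le_iInf fun ψ₀ => ?_
  obtain ⟨φ₀, rfl⟩ := (blochEquiv hL).surjective ψ₀
  refine (iInf_le _ φ₀).trans ?_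
  rw [← map_sub]
  calc _ ≤ C1 * intNormSq L m s (blochEquiv hL φ₀) + ENNReal.ofReal t ^ 2 *
        (C2 * intNormSq L (m + 1) s (blochEquiv hL (φ - φ₀))) := by
        gcongr
        · exact h1 _
        · exact h2 _
    _ ≤ (C1 + C2 + 1 : ℝ≥0) * intNormSq L m s (blochEquiv hL φ₀) + ENNReal.ofReal t ^ 2 *
        ((C1 + C2 + 1 : ℝ≥0) * intNormSq L (m + 1) s (blochEquiv hL (φ - φ₀))) := by
        gcongr
        · exact (le_add_of_nonneg_right (zero_le (a := C2))).trans (le_add_of_nonneg_right zero_le_one)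
        · exact (le_add_of_nonneg_left (zero_le (a := C1))).trans (le_add_of_nonneg_right zero_le_one)
    _ = _ := by ring

theorem lintegral_weightedKSq_doubleF {θ : ℝ} (h0 : 0 < θ) (s : ℝ) (m : ℕ) (φ : 𝓓₂) :
    ∫⁻ t in Set.Ioi (0 : ℝ), ENNReal.ofReal (t ^ (-2 * θ - 1)) *
      weightedKSq t (mulD (fun x => (wt ((m : ℝ) / 2) x : ℂ)) (doubleF s φ)) =
      interpConst θ * doubleNorm s (m + θ) φ ^ 2 := by
  rw [lintegral_weightedKSq h0, mulD_wt_mulD_wt, doubleNorm]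
  congr 6
  funext x
  congr 2
  ring

theorem exists_interpNormSq_le (hL : L.det ≠ 0) (m : ℕ) {θ : ℝ} (h0 : 0 < θ) (h1 : θ < 1) (s : ℝ) :
    ∃ C : ℝ≥0, ∀ φ : 𝓓₂,
      interpNormSq L m θ s (blochEquiv hL φ) ≤ C * doubleNorm s (m + θ) φ ^ 2 := by
  obtain ⟨C, hC⟩ := exists_kSq_le hL m s
  refine ⟨C * (interpConst θ).toNNReal, fun φ => ?_⟩
  rw [ENNReal.coe_mul, ENNReal.coe_toNNReal (interpConst_ne_top h0 h1), mul_assoc,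
    ← lintegral_weightedKSq_doubleF h0, ← lintegral_const_mul' _ _ ENNReal.coe_ne_top]
  refine lintegral_mono fun t => ?_
  rw [mul_left_comm]
  gcongr
  exact hC t φ

theorem exists_le_interpNormSq (hL : L.det ≠ 0) (m : ℕ) {θ : ℝ} (h0 : 0 < θ) (h1 : θ < 1) (s : ℝ) :
    ∃ C : ℝ≥0, ∀ φ : 𝓓₂,
      doubleNorm s (m + θ) φ ^ 2 ≤ C * interpNormSq L m θ s (blochEquiv hL φ) := by
  obtain ⟨C, hC⟩ := exists_le_kSq hL m s
  have hi0 := interpConst_ne_zero θ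
  have hinv : (interpConst θ)⁻¹ ≠ ⊤ := by simpa using hi0
  refine ⟨(interpConst θ)⁻¹.toNNReal * C, fun φ => ?_⟩
  have h := lintegral_weightedKSq_doubleF h0 s m φ
  have hle : interpConst θ * doubleNorm s (m + θ) φ ^ 2 ≤
      C * interpNormSq L m θ s (blochEquiv hL φ) := by
    rw [← h, interpNormSq, ← lintegral_const_mul' _ _ ENNReal.coe_ne_top]
    refine lintegral_mono fun t => ?_
    rw [mul_left_comm (C : ℝ≥0∞)]
    gcongr
    exact hC t φ
  rw [ENNReal.coe_mul, ENNReal.coe_toNNReal hinv, mul_assoc, mul_comm, ← div_eq_mul_inv,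
    ENNReal.le_div_iff_mul_le (Or.inl hi0) (Or.inl (interpConst_ne_top h0 h1)), mul_comm]
  exact hle

theorem natFloor_add_fract {r : ℝ} (hr : 0 ≤ r) : (⌊r⌋₊ : ℝ) + Int.fract r = r := by
  rw [natCast_floor_eq_intCast_floor hr, Int.floor_add_fract]

theorem exists_posNormSq_le (hL : L.det ≠ 0) {r : ℝ} (hr : 0 ≤ r) (s : ℝ) : ∃ C : ℝ≥0, ∀ φ : 𝓓₂,
    posNormSq L r s (blochEquiv hL φ) ≤ C * doubleNorm s r φ ^ 2 := by
  have hfl := natFloor_add_fract hr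
  unfold posNormSq
  split_ifs with h
  · obtain ⟨C, hC⟩ := exists_intNormSq_le hL ⌊r⌋₊ s
    rw [h, add_zero] at hfl
    rw [hfl] at hC
    exact ⟨C, hC⟩
  · obtain ⟨C, hC⟩ := exists_interpNormSq_le hL ⌊r⌋₊
      ((Int.fract_nonneg r).lt_of_ne' h) (Int.fract_lt_one r) s
    rw [hfl] at hC
    exact ⟨C, hC⟩

theorem exists_le_posNormSq (hL : L.det ≠ 0) {r : ℝ} (hr : 0 ≤ r) (s : ℝ) : ∃ C : ℝ≥0, ∀ φ : 𝓓₂,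
    doubleNorm s r φ ^ 2 ≤ C * posNormSq L r s (blochEquiv hL φ) := by
  have hfl := natFloor_add_fract hr
  unfold posNormSq
  split_ifs with h
  · obtain ⟨C, hC⟩ := exists_le_intNormSq hL ⌊r⌋₊ s
    rw [h, add_zero] at hfl
    rw [hfl] at hC
    exact ⟨C, hC⟩
  · obtain ⟨C, hC⟩ := exists_le_interpNormSq hL ⌊r⌋₊
      ((Int.fract_nonneg r).lt_of_ne' h) (Int.fract_lt_one r) s
    rw [hfl] at hC
    exact ⟨C, hC⟩

/-- The Schwartz function `F((1 + |z|²)^(s/2) F u)`. -/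
def doubleFS (s : ℝ) (u : 𝓢₂) : 𝓢₂ := 𝓕 (mulF (fun ξ => (freqWt s ξ : ℂ)) (𝓕 u))

theorem doubleF_ofS (s : ℝ) (u : 𝓢₂) : doubleF s (ofS u) = ofS (doubleFS s u) := by
  rw [doubleF, fourier_ofS, mulD_ofS (hasTemperateGrowth_freqWt s), fourier_ofS, doubleFS]

theorem doubleNorm_ofS (s r : ℝ) (u : 𝓢₂) : doubleNorm s r (ofS u) =
    ‖(mulF (fun x => (wt (r / 2) x : ℂ)) (doubleFS s u)).toLp 2 (volume : Measure Plane)‖ₑ := by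
  rw [doubleNorm, doubleF_ofS, mulD_ofS (hasTemperateGrowth_wt _), l2Norm_ofS]

theorem mulF_apply {a : Plane → ℂ} (ha : a.HasTemperateGrowth) (u : 𝓢₂) (x : Plane) :
    mulF a u x = a x * u x := by
  rw [mulF, SchwartzMap.smulLeftCLM_apply_apply ha, smul_eq_mul]

theorem doubleFS_surjective (s : ℝ) : Function.Surjective (doubleFS s) := by
  intro v
  refine ⟨𝓕⁻ (mulF (fun ξ => ((freqWt s ξ)⁻¹ : ℂ)) (𝓕⁻ v)), ?_⟩
  have h : mulF (fun ξ => (freqWt s ξ : ℂ)) (mulF (fun ξ => ((freqWt s ξ)⁻¹ : ℂ)) (𝓕⁻ v)) = 𝓕⁻ v := by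
    ext x
    rw [mulF_apply (hasTemperateGrowth_freqWt s),
      mulF_apply (isWeight_freqWt s).hasTemperateGrowth_inv, ← mul_assoc,
      (isWeight_freqWt s).mul_inv, one_mul]
  rw [doubleFS, FourierTransform.fourier_fourierInv_eq, h, FourierTransform.fourier_fourierInv_eq]

theorem fourier_conjS (g : 𝓢₂) : 𝓕 (conjS g) = conjS (𝓕⁻ g) := by
  ext w
  rw [conjS_apply, SchwartzMap.fourier_coe, SchwartzMap.fourierInv_coe, Real.fourier_eq,
    Real.fourierInv_eq, ← integral_conj]
  refine integral_congr_ae (Filter.Eventually.of_forall fun v => ?_)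
  simp only [Circle.smul_def, smul_eq_mul, map_mul, conjS_apply]
  rw [← Circle.coe_inv_eq_conj, AddChar.map_neg_eq_inv]

/-- The weight (1 + |z|²)^s of the inner product is divided evenly between the two factors, which
turns (ψ, χ)_s into an unweighted pairing of the doubly transformed objects. -/
theorem apply_conjS_eq (s : ℝ) (φ : 𝓓₂) {u u' : 𝓢₂}
    (h : ∀ ξ, (𝓕 u' : 𝓢₂) ξ = (wt s ((2 * Real.pi) • ξ) : ℂ) * (𝓕 u : 𝓢₂) ξ) :
    φ (conjS u') = doubleF s φ (conjS (doubleFS s u)) := by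
  have hb := hasTemperateGrowth_freqWt s
  have h1 : conjS u' = 𝓕 (conjS (𝓕 u')) := by
    rw [fourier_conjS, FourierTransform.fourierInv_fourier_eq]
  have h2 : conjS (𝓕 u') = mulF (fun ξ => (freqWt s ξ : ℂ))
      (conjS (mulF (fun ξ => (freqWt s ξ : ℂ)) (𝓕 u))) := by
    ext ξ
    rw [conjS_apply, h, mulF_apply hb, conjS_apply, mulF_apply hb, map_mul, map_mul,
      Complex.conj_ofReal, Complex.conj_ofReal, ← mul_assoc, ← Complex.ofReal_mul, ← sq,
      wt_half_mul_self]
  have h3 : 𝓕 (conjS (doubleFS s u)) = conjS (mulF (fun ξ => (freqWt s ξ : ℂ)) (𝓕 u)) := by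
    rw [fourier_conjS, doubleFS, FourierTransform.fourierInv_fourier_eq]
  rw [h1, h2]
  change mulD (fun ξ => (freqWt s ξ : ℂ)) (𝓕 φ) _ =
    mulD (fun ξ => (freqWt s ξ : ℂ)) (𝓕 φ) (𝓕 (conjS (doubleFS s u)))
  rw [h3]

theorem enorm_toLp_conjS (u : 𝓢₂) :
    ‖(conjS u).toLp 2 (volume : Measure Plane)‖ₑ = ‖u.toLp 2 (volume : Measure Plane)‖ₑ := by
  have hinj : Function.Injective fun x : ℝ≥0∞ => x ^ 2 :=
    (ENNReal.pow_right_strictMono (n := 2) (by norm_num)).injective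
  refine hinj ?_
  simp only
  rw [← lintegral_enorm_sq_eq_enorm_toLp, ← lintegral_enorm_sq_eq_enorm_toLp]
  refine lintegral_congr fun x => ?_
  rw [conjS_apply, ← ofReal_norm, RCLike.norm_conj, ofReal_norm]

theorem mulD_wt_neg_apply (r : ℝ) (v : 𝓓₂) (w : 𝓢₂) :
    mulD (fun x => (wt (-r) x : ℂ)) v (conjS (mulF (fun x => (wt r x : ℂ)) w)) = v (conjS w) := by
  change v (mulF _ _) = _
  congr 1
  ext x
  rw [mulF_apply (hasTemperateGrowth_wt _), conjS_apply, mulF_apply (hasTemperateGrowth_wt _),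
    map_mul, Complex.conj_ofReal, ← mul_assoc, ← Complex.ofReal_mul, ← wt_add, neg_add_cancel, wt_zero,
    Complex.ofReal_one, one_mul, conjS_apply]

theorem ennreal_le_of_sq_le {x y : ℝ≥0∞} {C : ℝ≥0} (h : x ^ 2 ≤ C * y) (hy : y ≤ 1) :
    x ≤ NNReal.sqrt C := by
  have := enorm_le_of_sq_le (x := x) (y := 1) (C := C)
    (h.trans (by rw [one_pow]; gcongr))
  simpa using this

/-- Cauchy–Schwarz after the weight (1 + |x|²)^(r/2) and its inverse have been distributed over the
two factors. -/
theorem exists_dualNorm_le (hL : L.det ≠ 0) {r : ℝ} (hr : 0 ≤ r) (s : ℝ) : ∃ C : ℝ≥0, ∀ φ : 𝓓₂,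
    dualNorm L r s (blochEquiv hL φ) ≤ C * doubleNorm s (-r) φ := by
  obtain ⟨C, hC⟩ := exists_le_posNormSq hL hr s
  refine ⟨NNReal.sqrt C, fun φ => ?_⟩
  refine iSup_le fun χ => iSup_le fun Θ => iSup_le fun h => iSup_le fun h' => ?_
  obtain ⟨u, u', rfl, hu, hA⟩ := blochA_eq_of_isDualTest hL h
  rw [blochEquiv_apply, hA, apply_conjS_eq s φ hu, ← mulD_wt_neg_apply (r / 2)]
  refine (enorm_apply_le_l2Norm_mul _ _).trans ?_
  rw [enorm_toLp_conjS, ← doubleNorm_ofS, mul_comm, ← neg_div, ← doubleNorm]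
  gcongr
  exact ennreal_le_of_sq_le (hC _) h'

/-- The weights and the double transform are invertible on Schwartz functions, so every Schwartz
function is, up to scaling, the weighted transform of an admissible χ. The dual norm therefore
bounds all pairings of the weighted transform of φ, which is an L² function by
`l2Norm_le_of_forall_enorm_le`. -/
theorem exists_le_dualNorm (hL : L.det ≠ 0) {r : ℝ} (hr : 0 ≤ r) (s : ℝ) : ∃ C : ℝ≥0, ∀ φ : 𝓓₂,
    doubleNorm s (-r) φ ≤ C * dualNorm L r s (blochEquiv hL φ) := by
  obtain ⟨C, hC⟩ := exists_posNormSq_le hL hr s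
  set K : ℝ≥0 := NNReal.sqrt C + 1 with hK
  have hK0 : K ≠ 0 := by positivity
  have hCK : C ≤ K ^ 2 := by
    calc C = NNReal.sqrt C ^ 2 := (NNReal.sq_sqrt C).symm
      _ ≤ K ^ 2 := by gcongr; exact le_add_of_nonneg_right zero_le_one
  refine ⟨K, fun φ => ?_⟩
  by_cases htop : dualNorm L r s (blochEquiv hL φ) = ⊤
  · rw [htop, ENNReal.mul_top (by simpa using hK0)]; exact le_top
  obtain ⟨D, hD⟩ := WithTop.ne_top_iff_exists.1 htop
  change (D : ℝ≥0∞) = _ at hD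
  rw [← hD, ← ENNReal.coe_mul, doubleNorm, neg_div]
  refine l2Norm_le_of_forall_enorm_le fun η => ?_
  by_cases hη : η = 0
  · rw [hη, map_zero]; simp
  have hN0 : ‖η.toLp 2 (volume : Measure Plane)‖ ≠ 0 := by
    rw [norm_ne_zero_iff]
    intro h0
    refine hη (SchwartzMap.injective_toLp (F := ℂ) 2 (volume : Measure Plane) ?_)
    exact h0.trans (map_zero (SchwartzMap.toLpCLM ℂ ℂ 2 (volume : Measure Plane))).symm
  -- The scaling gives χ the double norm 1/K. Since C ≤ K², the norm of χ is then at most one, as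
  -- the supremum requires.
  set c : ℝ := (K * ‖η.toLp 2 (volume : Measure Plane)‖)⁻¹ with hc
  have hKr : (0 : ℝ) < K := by exact_mod_cast pos_iff_ne_zero.2 hK0
  have hNp : 0 < ‖η.toLp 2 (volume : Measure Plane)‖ := (norm_nonneg _).lt_of_ne' hN0
  have hcp : 0 < c := by positivity
  obtain ⟨w, hw⟩ : ∃ w : 𝓢₂, mulF (fun x => (wt (r / 2) x : ℂ)) w = (c : ℂ) • conjS η := by
    refine ⟨mulF (fun x => (wt (-(r / 2)) x : ℂ)) ((c : ℂ) • conjS η), ?_⟩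
    ext x
    rw [mulF_apply (hasTemperateGrowth_wt _), mulF_apply (hasTemperateGrowth_wt _), ← mul_assoc,
      ← Complex.ofReal_mul, ← wt_add, add_neg_cancel, wt_zero, Complex.ofReal_one, one_mul]
  obtain ⟨u, hu⟩ := doubleFS_surjective s w
  have hu' : ∃ u' : 𝓢₂, ∀ ξ, (𝓕 u' : 𝓢₂) ξ = (wt s ((2 * Real.pi) • ξ) : ℂ) * (𝓕 u : 𝓢₂) ξ := by
    have ht : Function.HasTemperateGrowth fun ξ : Plane => (wt s ((2 * Real.pi) • ξ) : ℂ) :=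
      (isWeight_wt (2 * Real.pi) s).hasTemperateGrowth
    refine ⟨𝓕⁻ (mulF (fun ξ => (wt s ((2 * Real.pi) • ξ) : ℂ)) (𝓕 u)), fun ξ => ?_⟩
    rw [FourierTransform.fourier_fourierInv_eq, mulF_apply ht]
  obtain ⟨u', hu'⟩ := hu'
  obtain ⟨Θ, hΘ, hA⟩ := exists_isDualTest hL hu'
  have hn : doubleNorm s r (ofS u) = (K : ℝ≥0∞)⁻¹ := by
    rw [doubleNorm_ofS, hu, hw]
    have e : ((c : ℂ) • conjS η).toLp 2 (volume : Measure Plane) =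
        (c : ℂ) • (conjS η).toLp 2 (volume : Measure Plane) :=
      map_smul (SchwartzMap.toLpCLM ℂ ℂ 2 (volume : Measure Plane)) (c : ℂ) (conjS η)
    rw [e, enorm_smul, enorm_toLp_conjS, ← ofReal_norm, ← ofReal_norm,
      Complex.norm_of_nonneg hcp.le, ← ENNReal.ofReal_mul hcp.le, hc, mul_inv, mul_assoc,
      inv_mul_cancel₀ hN0, mul_one, ENNReal.ofReal_inv_of_pos hKr, ENNReal.ofReal_coe_nnreal]
  have hpos : posNormSq L r s (blochEquiv hL (ofS u)) ≤ 1 := by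
    refine (hC _).trans ?_
    rw [hn]
    calc (C : ℝ≥0∞) * (K : ℝ≥0∞)⁻¹ ^ 2 ≤ (K ^ 2 : ℝ≥0) * (K : ℝ≥0∞)⁻¹ ^ 2 := by gcongr
      _ = 1 := by
        rw [ENNReal.coe_pow, ← mul_pow, ENNReal.mul_inv_cancel (by simpa using hK0) (by simp), one_pow]
  have hle : ‖(blochEquiv hL φ : 𝓓₄) Θ‖ₑ ≤ D := by
    rw [hD]
    exact le_iSup_of_le _ (le_iSup_of_le Θ (le_iSup_of_le hΘ (le_iSup_of_le hpos le_rfl)))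
  rw [blochEquiv_apply, hA, apply_conjS_eq s φ hu', ← mulD_wt_neg_apply (r / 2), hu, hw] at hle
  have e2 : conjS ((c : ℂ) • conjS η) = (c : ℂ) • η := by
    ext x
    simp [conjS_apply]
  rw [e2, map_smul, enorm_smul] at hle
  have e3 : ‖(c : ℂ)‖ₑ = (K * ‖η.toLp 2 (volume : Measure Plane)‖ₑ)⁻¹ := by
    rw [← ofReal_norm, ← ofReal_norm, Complex.norm_of_nonneg hcp.le, hc,
      ENNReal.ofReal_inv_of_pos (by positivity), ENNReal.ofReal_mul hKr.le, ENNReal.ofReal_coe_nnreal]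
  have hX0 : (K : ℝ≥0∞) * ‖η.toLp 2 (volume : Measure Plane)‖ₑ ≠ 0 :=
    mul_ne_zero (by simpa using hK0) (by rwa [ne_eq, enorm_eq_zero, ← norm_eq_zero])
  have hXt : (K : ℝ≥0∞) * ‖η.toLp 2 (volume : Measure Plane)‖ₑ ≠ ⊤ :=
    ENNReal.mul_ne_top (by simp) (by simp)
  rw [e3, ENNReal.inv_mul_le_iff hX0 hXt] at hle
  calc _ ≤ _ := hle
    _ = _ := by push_cast; ring

theorem exists_qpNorm_le (hL : L.det ≠ 0) (r s : ℝ) : ∃ C : ℝ≥0, ∀ φ : 𝓓₂,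
    qpNorm L r s (blochEquiv hL φ) ≤ C * besselNorm s r φ := by
  obtain ⟨C2, h2⟩ := exists_le_besselNorm s r
  unfold qpNorm
  split_ifs with hr
  · obtain ⟨C1, h1⟩ := exists_posNormSq_le hL hr s
    refine ⟨NNReal.sqrt C1 * C2, fun φ => ?_⟩
    have e : (posNormSq L r s (blochEquiv hL φ) ^ (1 / 2 : ℝ)) ^ 2 =
        posNormSq L r s (blochEquiv hL φ) := by
      rw [← ENNReal.rpow_natCast, ← ENNReal.rpow_mul]; simp
    have := enorm_le_of_sq_le (e.le.trans (h1 φ))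
    refine this.trans ?_
    rw [ENNReal.coe_mul, mul_assoc]
    gcongr
    exact h2 φ
  · obtain ⟨C1, h1⟩ := exists_dualNorm_le hL (r := -r) (by linarith) s
    refine ⟨C1 * C2, fun φ => (h1 φ).trans ?_⟩
    rw [neg_neg, ENNReal.coe_mul, mul_assoc]
    gcongr
    exact h2 φ

theorem exists_le_qpNorm (hL : L.det ≠ 0) (r s : ℝ) : ∃ C : ℝ≥0, ∀ φ : 𝓓₂,
    besselNorm s r φ ≤ C * qpNorm L r s (blochEquiv hL φ) := by
  obtain ⟨C2, h2⟩ := exists_besselNorm_le s r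
  unfold qpNorm
  split_ifs with hr
  · obtain ⟨C1, h1⟩ := exists_le_posNormSq hL hr s
    refine ⟨C2 * NNReal.sqrt C1, fun φ => (h2 φ).trans ?_⟩
    have e : (posNormSq L r s (blochEquiv hL φ) ^ (1 / 2 : ℝ)) ^ 2 =
        posNormSq L r s (blochEquiv hL φ) := by
      rw [← ENNReal.rpow_natCast, ← ENNReal.rpow_mul]; simp
    rw [ENNReal.coe_mul, mul_assoc]
    gcongr
    refine enorm_le_of_sq_le ?_
    rw [e]
    exact h1 φ
  · obtain ⟨C1, h1⟩ := exists_le_dualNorm hL (r := -r) (by linarith) s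
    refine ⟨C2 * C1, fun φ => (h2 φ).trans ?_⟩
    rw [ENNReal.coe_mul, mul_assoc]
    gcongr
    have := h1 φ
    rwa [neg_neg] at this

end QpNorm

/-! ### The isomorphism of part (b) -/

section BesselIso

local notation "𝓢₂" => SchwartzMap Plane ℂ
local notation "𝓓₂" => TemperedDistribution Plane ℂ
local notation "𝓓₄" => TemperedDistribution (Plane × Plane) ℂ

variable {L : Matrix (Fin 2) (Fin 2) ℝ}

theorem besselNorm_ofS_lt_top (s r : ℝ) (u : 𝓢₂) : besselNorm s r (ofS u) < ⊤ := by
  rw [besselNorm_eq_freqNorm, mulD_ofS (hasTemperateGrowth_wt _), freqNorm, fourier_ofS,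
    mulD_ofS (hasTemperateGrowth_freqWt s), l2Norm_ofS]
  simp

/-- Schwartz functions are dense in L², and the weights and the Fourier transform are invertible on
them; an approximation of the weighted transform is pulled back to one of φ. -/
theorem exists_besselNorm_sub_ofS_lt (s r : ℝ) {φ : 𝓓₂} (hφ : besselNorm s r φ < ⊤) {ε : ℝ≥0∞}
    (hε : 0 < ε) : ∃ u : 𝓢₂, besselNorm s r (φ - ofS u) < ε := by
  obtain ⟨g, hg⟩ := besselNorm_lt_top_iff.1 hφ
  obtain ⟨w, hw⟩ := denseRange_toLp.exists_mem_open
    (s := {y | ‖g - y‖ₑ < ε}) (isOpen_lt (by fun_prop) continuous_const)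
    ⟨g, by simpa using hε⟩
  change ‖g - w.toLp 2 volume‖ₑ < ε at hw
  have hb := isWeight_freqWt s
  have ha := isWeight_wt_one (r / 2)
  refine ⟨mulF (fun x => ((wt (r / 2) x)⁻¹ : ℂ)) (𝓕⁻ (mulF (fun ξ => ((freqWt s ξ)⁻¹ : ℂ)) w)), ?_⟩
  set u := mulF (fun x => ((wt (r / 2) x)⁻¹ : ℂ)) (𝓕⁻ (mulF (fun ξ => ((freqWt s ξ)⁻¹ : ℂ)) w)) with hu
  have h1 : besselSymbol s r (ofS u) = ofS w := by
    change mulD (fun ξ => (freqWt s ξ : ℂ)) (𝓕 (mulD (fun x => (wt (r / 2) x : ℂ)) (ofS u))) = _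
    rw [hu, ← mulD_ofS ha.hasTemperateGrowth_inv, mulD_inv_cancel ha.hasTemperateGrowth
      ha.hasTemperateGrowth_inv ha.mul_inv, fourier_ofS, FourierTransform.fourier_fourierInv_eq,
      ← mulD_ofS hb.hasTemperateGrowth_inv, mulD_inv_cancel hb.hasTemperateGrowth
      hb.hasTemperateGrowth_inv hb.mul_inv]
  have h2 : besselSymbol s r (φ - ofS u) = besselSymbol s r φ - besselSymbol s r (ofS u) := by
    have h : ∀ u v : 𝓓₂, 𝓕 (u - v) = 𝓕 u - 𝓕 v := fun u v => by ext; rfl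
    simp only [besselSymbol, map_sub, h]
  have h3 : besselSymbol s r (φ - ofS u) =
      MeasureTheory.Lp.toTemperedDistribution (g - w.toLp 2 volume) := by
    rw [h2, h1, hg, ofS, ← MeasureTheory.Lp.toTemperedDistribution_toLp_eq (p := 2),
      ← MeasureTheory.Lp.toTemperedDistributionCLM_apply, ← MeasureTheory.Lp.toTemperedDistributionCLM_apply,
      ← MeasureTheory.Lp.toTemperedDistributionCLM_apply, map_sub]
  change l2Norm (besselSymbol s r (φ - ofS u)) < ε
  rw [h3, l2Norm_toTemperedDistribution]
  exact hw

theorem map_besselSpace (hL : L.det ≠ 0) (s r : ℝ) :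
    (besselSpace s r).map (blochEquiv hL : 𝓓₂ →ₗ[ℂ] qpDist L) = qpSpace L r s := by
  obtain ⟨C1, h1⟩ := exists_qpNorm_le hL r s
  obtain ⟨C2, h2⟩ := exists_le_qpNorm hL r s
  ext ψ
  obtain ⟨φ, rfl⟩ := (blochEquiv hL).surjective ψ
  rw [Submodule.mem_map]
  constructor
  · rintro ⟨φ', hφ', he⟩
    obtain rfl : φ' = φ := (blochEquiv hL).injective he
    exact (h1 φ').trans_lt (ENNReal.mul_lt_top ENNReal.coe_lt_top hφ')
  · intro h
    exact ⟨φ, (h2 φ).trans_lt (ENNReal.mul_lt_top ENNReal.coe_lt_top h), rfl⟩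

/-- The Bloch transform between the weighted Bessel potential space and the space of quasiperiodic
distributions. -/
def blochIso (hL : L.det ≠ 0) (s r : ℝ) : besselSpace s r ≃ₗ[ℂ] qpSpace L r s :=
  (blochEquiv hL).ofSubmodules (besselSpace s r) (qpSpace L r s) (map_besselSpace hL s r)

theorem coe_blochIso (hL : L.det ≠ 0) (s r : ℝ) (φ : besselSpace s r) :
    (blochIso hL s r φ : qpDist L) = blochEquiv hL φ := rfl

theorem blochEquiv_blochIso_symm (hL : L.det ≠ 0) (s r : ℝ) (ψ : qpSpace L r s) :
    blochEquiv hL ((blochIso hL s r).symm ψ : 𝓓₂) = ψ := by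
  rw [← coe_blochIso, LinearEquiv.apply_symm_apply]

theorem exists_blochIso_sub_lt (hL : L.det ≠ 0) (s r : ℝ) (f : besselSpace s r) {ε : ℝ≥0∞} (hε : 0 < ε) :
    ∃ (f' : besselSpace s r) (u : 𝓢₂), (f' : 𝓓₂) = ofS u ∧
      qpNorm L r s (blochIso hL s r (f - f')) < ε ∧
      besselNorm s r (f - f' : besselSpace s r) < ε := by
  obtain ⟨C, hC⟩ := exists_qpNorm_le hL r s
  -- The first bound serves the norm on the plane, the second the norm of the image; C + 1 avoids
  -- division by zero.
  obtain ⟨δ, hδ⟩ : ∃ δ : ℝ≥0∞, δ = min ε (ε / ((C : ℝ≥0∞) + 1)) := ⟨_, rfl⟩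
  have hδ0 : 0 < δ := hδ ▸ lt_min hε (ENNReal.div_pos hε.ne' (by simp))
  obtain ⟨u, hu⟩ := exists_besselNorm_sub_ofS_lt s r f.2 hδ0
  refine ⟨⟨ofS u, besselNorm_ofS_lt_top s r u⟩, u, rfl, (hC _).trans_lt ?_,
    hu.trans_le (hδ.le.trans (min_le_left _ _))⟩
  have hlt := hu.trans_le (hδ.le.trans (min_le_right _ _))
  rw [ENNReal.lt_div_iff_mul_lt (Or.inl (by simp)) (Or.inl (by simp)), mul_comm] at hlt
  refine lt_of_le_of_lt ?_ hlt
  gcongr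
  · exact le_self_add
  · exact le_of_eq rfl

theorem exists_blochIso_bound (hL : L.det ≠ 0) (s r : ℝ) :
    ∃ C : ℝ≥0, ∀ f : besselSpace s r, qpNorm L r s (blochIso hL s r f) ≤ C * besselNorm s r f ∧
      besselNorm s r f ≤ C * qpNorm L r s (blochIso hL s r f) := by
  obtain ⟨C1, h1⟩ := exists_qpNorm_le hL r s
  obtain ⟨C2, h2⟩ := exists_le_qpNorm hL r s
  refine ⟨C1 + C2, fun f => ⟨(h1 f).trans ?_, (h2 f).trans ?_⟩⟩
  · gcongr
    exact le_add_of_nonneg_right zero_le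
  · rw [coe_blochIso]
    gcongr
    exact le_add_of_nonneg_left zero_le

theorem exists_isRepr_blochIso_symm (hL : L.det ≠ 0) (s r : ℝ) (ψ : qpSpace L r s)
    (χ : Plane × Plane → ℂ) (hχ : IsSmoothQP L χ) (hψ : IsRepr (ψ : 𝓓₄) χ) :
    ∃ f : Plane → ℂ, IsRepr ((blochIso hL s r).symm ψ : 𝓓₂) f ∧ ∀ x ∈ cell L, ∀ j : Idx,
      f (x + lat L j) = (normConst L : ℂ) *
        ∫ α, χ (α, x) * expI (inner ℝ α (lat L j)) ∂(cellMeasure (dualMat L)) := by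
  obtain ⟨u, hu, -, hux⟩ := exists_eq_blochEquiv_ofS hL hχ hψ
  have he : ((blochIso hL s r).symm ψ : 𝓓₂) = ofS u :=
    (blochEquiv hL).injective ((blochEquiv_blochIso_symm hL s r ψ).trans hu)
  refine ⟨u, he ▸ isRepr_ofS u, fun x _ j => ?_⟩
  rw [hux, integral_mul_expI_cell hχ]

theorem exists_isSmoothQP_approx (hL : L.det ≠ 0) (s r : ℝ) (ψ : qpSpace L r s) (ε : ℝ≥0∞) (hε : 0 < ε) :
    ∃ (ψ' : qpSpace L r s) (χ : Plane × Plane → ℂ), IsSmoothQP L χ ∧ IsRepr (ψ' : 𝓓₄) χ ∧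
      qpNorm L r s (ψ - ψ' : qpSpace L r s) < ε ∧
      besselNorm s r ((blochIso hL s r).symm ψ - (blochIso hL s r).symm ψ' : besselSpace s r) < ε := by
  obtain ⟨f', u, hf', hq, hb⟩ := exists_blochIso_sub_lt hL s r ((blochIso hL s r).symm ψ) hε
  rw [map_sub, LinearEquiv.apply_symm_apply] at hq
  refine ⟨blochIso hL s r f', fun p => bloch L u p.1 p.2, isSmoothQP_bloch hL u, ?_, hq, ?_⟩
  · rw [coe_blochIso, hf']
    exact isRepr_blochEquiv_ofS hL u
  · rw [LinearEquiv.symm_apply_apply]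
    exact hb

theorem exists_bessel_iso (hL : L.det ≠ 0) (s r : ℝ) :
    ∃ T : besselSpace s r ≃ₗ[ℂ] qpSpace L r s,
      (∀ φ : 𝓢₂, HasCompactSupport φ →
        ∃ h : SchwartzMap.toTemperedDistributionCLM Plane ℂ volume φ ∈ besselSpace s r,
          IsRepr (T ⟨_, h⟩ : 𝓓₄) (fun p => bloch L φ p.1 p.2)) ∧
      (∃ C : ℝ≥0, ∀ f : besselSpace s r, qpNorm L r s (T f) ≤ C * besselNorm s r f ∧
        besselNorm s r f ≤ C * qpNorm L r s (T f)) ∧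
      (∀ (ψ : qpSpace L r s) (χ : Plane × Plane → ℂ), IsSmoothQP L χ → IsRepr (ψ : 𝓓₄) χ →
        ∃ f : Plane → ℂ, IsRepr (T.symm ψ : 𝓓₂) f ∧ ∀ x ∈ cell L, ∀ j : Idx,
          f (x + lat L j) = (normConst L : ℂ) *
            ∫ α, χ (α, x) * expI (inner ℝ α (lat L j)) ∂(cellMeasure (dualMat L))) ∧
      (∀ (ψ : qpSpace L r s) (ε : ℝ≥0∞), 0 < ε →
        ∃ (ψ' : qpSpace L r s) (χ : Plane × Plane → ℂ), IsSmoothQP L χ ∧ IsRepr (ψ' : 𝓓₄) χ ∧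
          qpNorm L r s (ψ - ψ' : qpSpace L r s) < ε ∧
          besselNorm s r (T.symm ψ - T.symm ψ' : besselSpace s r) < ε) := by
  exact ⟨blochIso hL s r, fun φ _ => ⟨besselNorm_ofS_lt_top s r φ, isRepr_blochEquiv_ofS hL φ⟩,
    exists_blochIso_bound hL s r, exists_isRepr_blochIso_symm hL s r,
    exists_isSmoothQP_approx hL s r⟩

end BesselIso

/-! ### Hilbert spaces with matching orthogonal decompositions -/

section HilbertSum

variable {ι H X Y : Type*} [DecidableEq ι] [NormedAddCommGroup H] [InnerProductSpace ℂ H]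
  [NormedAddCommGroup X] [InnerProductSpace ℂ X] [NormedAddCommGroup Y] [InnerProductSpace ℂ Y]

/-- The maps `S i` embed `H` as orthogonal summands with dense sum, and `P i` are their adjoints. -/
structure IsSummandFamily (S : ι → H →ₗ[ℂ] X) (P : ι → X → H) : Prop where
  inner_eq : ∀ i h f, inner ℂ (S i h) f = inner ℂ h (P i f)
  proj_apply : ∀ i j h, P i (S j h) = if i = j then h else 0
  eq_zero : ∀ f, (∀ i, P i f = 0) → f = 0

variable {S : ι → H →ₗ[ℂ] X} {P : ι → X → H} {S' : ι → H →ₗ[ℂ] Y} {P' : ι → Y → H}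

theorem IsSummandFamily.inner_apply (hS : IsSummandFamily S P) (i : ι) (x y : H) :
    inner ℂ (S i x) (S i y) = inner ℂ x y := by
  rw [hS.inner_eq, hS.proj_apply, if_pos rfl]

/-- The isometries of a summand family. -/
def IsSummandFamily.isometry (hS : IsSummandFamily S P) (i : ι) : H →ₗᵢ[ℂ] X :=
  (S i).isometryOfInner (hS.inner_apply i)

variable [CompleteSpace H] [CompleteSpace X]

theorem IsSummandFamily.isHilbertSum (hS : IsSummandFamily S P) :
    IsHilbertSum ℂ (fun _ : ι => H) hS.isometry := by
  refine IsHilbertSum.mk (fun i j hij x y => ?_) ?_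
  · change inner ℂ (S i x) (S j y) = 0
    rw [hS.inner_eq, hS.proj_apply, if_neg hij, inner_zero_right]
  · rw [top_le_iff, Submodule.topologicalClosure_eq_top_iff, eq_bot_iff]
    intro f hf
    rw [← Submodule.iInf_orthogonal, Submodule.mem_iInf] at hf
    refine hS.eq_zero f fun i => ext_inner_left ℂ fun h => ?_
    rw [← hS.inner_eq, inner_zero_right]
    exact (Submodule.mem_orthogonal _ _).1 (hf i) (S i h) ⟨h, rfl⟩

variable [CompleteSpace Y]

/-- Both spaces are isometric to the Hilbert sum of copies of H indexed by ι. The composed isometry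
matches the embeddings, and taking adjoints gives the relation between the projections. -/
theorem IsSummandFamily.exists_linearIsometryEquiv (hS : IsSummandFamily S P)
    (hS' : IsSummandFamily S' P') :
    ∃ T : X ≃ₗᵢ[ℂ] Y, (∀ i h, T (S i h) = S' i h) ∧ ∀ i y, P i (T.symm y) = P' i y := by
  refine ⟨hS.isHilbertSum.linearIsometryEquiv.trans hS'.isHilbertSum.linearIsometryEquiv.symm, ?_⟩
  obtain ⟨T, hT⟩ : ∃ T, T = hS.isHilbertSum.linearIsometryEquiv.trans
    hS'.isHilbertSum.linearIsometryEquiv.symm := ⟨_, rfl⟩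
  rw [← hT]
  have h1 : ∀ i h, T (S i h) = S' i h := by
    intro i h
    have e : S i h = hS.isHilbertSum.linearIsometryEquiv.symm (lp.single 2 i h) :=
      (hS.isHilbertSum.linearIsometryEquiv_symm_apply_single h).symm
    rw [e, hT, LinearIsometryEquiv.trans_apply, LinearIsometryEquiv.apply_symm_apply]
    exact hS'.isHilbertSum.linearIsometryEquiv_symm_apply_single h
  refine ⟨h1, fun i y => ext_inner_left ℂ fun h => ?_⟩
  rw [← hS.inner_eq, ← hS'.inner_eq, ← h1, ← T.inner_map_map, LinearIsometryEquiv.apply_symm_apply]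

end HilbertSum

/-! ### L²(ℝ²) as a Hilbert sum over the cells -/

section CellRestriction

variable {A : Matrix (Fin 2) (Fin 2) ℝ}

theorem ae_of_forall_ae_cell (hA : A.det ≠ 0) {p : Plane → Prop}
    (h : ∀ j, ∀ᵐ x ∂(cellMeasure A), p (x + lat A j)) : ∀ᵐ x, p x := by
  have h1 : ∀ j, ∀ᵐ x ∂(volume.restrict (cellAt A j)), p x := by
    intro j
    rw [← (map_add_cellMeasure hA j).map_eq, (measurableEmbedding_addRight _).ae_map_iff]
    exact h j
  rw [← Measure.restrict_univ (μ := (volume : Measure Plane)), ← iUnion_cellAt hA]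
  exact (ae_restrict_iUnion_iff _ _).2 h1

theorem ae_cell_of_ae (hA : A.det ≠ 0) {p : Plane → Prop} (h : ∀ᵐ x, p x) (j : Idx) :
    ∀ᵐ x ∂(cellMeasure A), p (x + lat A j) :=
  (map_add_cellMeasure hA j).quasiMeasurePreserving.ae (ae_restrict_of_ae h)

/-- The restriction of a function to the cell at `A j`, translated to the cell at the origin. -/
def cellRestr (hA : A.det ≠ 0) (j : Idx) :
    Lp ℂ 2 (volume : Measure Plane) →ₗ[ℂ] Lp ℂ 2 (cellMeasure A) :=
  (Lp.compMeasurePreservingₗ ℂ _ (map_add_cellMeasure hA j)).comp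
    (LpToLpRestrictCLM Plane ℂ ℂ volume 2 (cellAt A j)).toLinearMap

theorem coeFn_cellRestr (hA : A.det ≠ 0) (j : Idx) (f : Lp ℂ 2 (volume : Measure Plane)) :
    cellRestr hA j f =ᵐ[cellMeasure A] fun x => f (x + lat A j) := by
  have h1 := Lp.coeFn_compMeasurePreserving (LpToLpRestrictCLM Plane ℂ ℂ volume 2 (cellAt A j) f)
    (map_add_cellMeasure hA j)
  have h2 := (map_add_cellMeasure hA j).quasiMeasurePreserving.ae
    (LpToLpRestrictCLM_coeFn ℂ (cellAt A j) f)
  filter_upwards [h1, h2] with x hx1 hx2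
  rw [← hx2]
  exact hx1

theorem eq_of_cellRestr_eq (hA : A.det ≠ 0) {f g : Lp ℂ 2 (volume : Measure Plane)}
    (h : ∀ j, cellRestr hA j f = cellRestr hA j g) : f = g := by
  refine Lp.ext (ae_of_forall_ae_cell hA fun j => ?_)
  filter_upwards [coeFn_cellRestr hA j f, coeFn_cellRestr hA j g] with x h1 h2
  rw [← h1, ← h2, h j]

theorem memLp_indicator_cellAt (hA : A.det ≠ 0) (j : Idx) (h : Lp ℂ 2 (cellMeasure A)) :
    MemLp ((cellAt A j).indicator fun x => h (x - lat A j)) 2 (volume : Measure Plane) := by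
  rw [memLp_indicator_iff_restrict (measurableSet_cellAt hA j)]
  exact (Lp.memLp h).comp_measurePreserving
    ((measurePreserving_sub_right (volume : Measure Plane) (lat A j)).restrict_preimage
      (measurableSet_cell hA))

/-- A function on the cell, translated to the cell at `A j` and extended by zero. -/
def cellExtFun (hA : A.det ≠ 0) (j : Idx) (h : Lp ℂ 2 (cellMeasure A)) :
    Lp ℂ 2 (volume : Measure Plane) :=
  (memLp_indicator_cellAt hA j h).toLp _

theorem cellRestr_cellExtFun (hA : A.det ≠ 0) (k j : Idx) (h : Lp ℂ 2 (cellMeasure A)) :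
    cellRestr hA k (cellExtFun hA j h) = if k = j then h else 0 := by
  have h1 := ae_cell_of_ae hA (memLp_indicator_cellAt hA j h).coeFn_toLp k
  refine Lp.ext ?_
  filter_upwards [coeFn_cellRestr hA k (cellExtFun hA j h), h1,
    ae_restrict_mem (measurableSet_cell hA), Lp.coeFn_zero ℂ 2 (cellMeasure A)] with x hx1 hx2 hx h0
  rw [hx1, cellExtFun, hx2]
  split_ifs with hkj
  · subst hkj
    rw [Set.indicator_of_mem (show x + lat A k ∈ cellAt A k by simpa [cellAt] using hx),
      add_sub_cancel_right]
  · rw [h0, Set.indicator_of_notMem, Pi.zero_apply]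
    intro hm
    have : x + lat A (k - j) ∈ cell A := by
      rw [lat_sub, ← add_sub_assoc]
      exact hm
    exact hkj (sub_eq_zero.1 (eq_zero_of_mem_cell hA hx this))

/-- Translation to the cell at `A j` and extension by zero, as a linear map. -/
def cellExt (hA : A.det ≠ 0) (j : Idx) :
    Lp ℂ 2 (cellMeasure A) →ₗ[ℂ] Lp ℂ 2 (volume : Measure Plane) where
  toFun := cellExtFun hA j
  map_add' x y := eq_of_cellRestr_eq hA fun k => by
    simp only [map_add, cellRestr_cellExtFun]
    split_ifs <;> simp
  map_smul' c x := eq_of_cellRestr_eq hA fun k => by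
    simp only [map_smul, cellRestr_cellExtFun, RingHom.id_apply]
    split_ifs <;> simp

/-- The translates of the cell are disjoint and cover the plane: disjointness gives the
orthogonality, and covering shows that a function with vanishing restrictions is zero. -/
theorem isSummandFamily_cellExt (hA : A.det ≠ 0) :
    IsSummandFamily (cellExt hA) fun j => cellRestr hA j where
  inner_eq j h f := by
    have h1 : ∀ᵐ x, inner ℂ (cellExt hA j h x) (f x) =
        (cellAt A j).indicator (fun x => inner ℂ (h (x - lat A j)) (f x)) x := by
      filter_upwards [(memLp_indicator_cellAt hA j h).coeFn_toLp] with x hx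
      change inner ℂ (((memLp_indicator_cellAt hA j h).toLp _ : Lp ℂ 2 volume) x) (f x) = _
      rw [hx]
      by_cases hm : x ∈ cellAt A j
      · simp [hm]
      · simp [hm]
    rw [L2.inner_def, L2.inner_def, integral_congr_ae h1,
      integral_indicator (measurableSet_cellAt hA j), setIntegral_cellAt hA]
    refine integral_congr_ae ?_
    filter_upwards [coeFn_cellRestr hA j f] with x hx
    rw [hx, add_sub_cancel_right]
  proj_apply i j h := cellRestr_cellExtFun hA i j h
  eq_zero f hf := eq_of_cellRestr_eq hA fun j => by rw [hf j, map_zero]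

end CellRestriction

/-! ### L²(W*; L²(W)) as a Hilbert sum of plane waves; part (a) -/

section BlochIsometry

variable {L : Matrix (Fin 2) (Fin 2) ℝ}

theorem convex_cell (A : Matrix (Fin 2) (Fin 2) ℝ) : Convex ℝ (cell A) := by
  have : cell A = matVecL A '' Set.univ.pi (fun _ => Set.Ioc (-(1 / 2)) (1 / 2)) := by
    ext x
    constructor
    · rintro ⟨z, hz, rfl⟩
      exact ⟨z, fun i _ => hz i, rfl⟩
    · rintro ⟨z, hz, rfl⟩
      exact ⟨z, fun i => hz i (Set.mem_univ i), rfl⟩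
  rw [this]
  exact (convex_pi fun i _ => convex_Ioc _ _).linear_image (matVecL A).toLinearMap

/-- The boundary of a convex set is a null set. This allows testing with functions supported in the
open interior. -/
theorem ae_mem_interior_cell {A : Matrix (Fin 2) (Fin 2) ℝ} (hA : A.det ≠ 0) :
    ∀ᵐ x ∂(cellMeasure A), x ∈ interior (cell A) := by
  have h0 : ∀ᵐ x, x ∉ frontier (cell A) :=
    measure_eq_zero_iff_ae_notMem.1 ((convex_cell A).addHaar_frontier volume)
  filter_upwards [ae_restrict_of_ae h0, ae_restrict_mem (measurableSet_cell hA)] with x hx hm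
  by_contra hi
  exact hx ⟨subset_closure hm, hi⟩

theorem continuous_expI_inner (v : Plane) : Continuous fun α : Plane => expI (inner ℝ α v) :=
  continuous_expI.comp (continuous_id.inner continuous_const)

section Coefficients

variable {E : Type*} [NormedAddCommGroup E] [NormedSpace ℂ E]

theorem integrable_expI_smul {μ : Measure Plane} {f : Plane → E} (hf : Integrable f μ) (v : Plane) :
    Integrable (fun α => expI (inner ℝ α v) • f α) μ :=
  hf.bdd_smul 1 (continuous_expI_inner v).aestronglyMeasurable
    (Filter.Eventually.of_forall fun _ => (norm_expI _).le)

theorem tsum_lat_eq_self {A : Matrix (Fin 2) (Fin 2) ℝ} (hA : A.det ≠ 0) {g : Plane → ℂ}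
    (hg : Function.support g ⊆ cell A) {x : Plane} (hx : x ∈ cell A) :
    ∑' l, g (x + lat A l) = g x := by
  rw [tsum_eq_single 0, lat_zero, add_zero]
  intro l hl
  by_contra h
  exact hl (eq_zero_of_mem_cell hA hx (hg h))

/-- A function on the dual cell all of whose Fourier coefficients vanish is orthogonal to the
Schwartz functions supported in the dual cell. -/
theorem integral_smul_eq_zero_of_coeff [CompleteSpace E] (hL : L.det ≠ 0) {f : Plane → E}
    (hf : Integrable f (cellMeasure (dualMat L)))
    (h : ∀ k, ∫ α, expI (inner ℝ α (lat L k)) • f α ∂(cellMeasure (dualMat L)) = 0)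
    (g : SchwartzMap Plane ℂ) (hg : Function.support g ⊆ cell (dualMat L)) :
    ∫ α, g α • f α ∂(cellMeasure (dualMat L)) = 0 := by
  have hA := det_dualMat_ne_zero hL
  -- Poisson summation expands g on the cell into an absolutely convergent series of characters,
  -- which may be integrated against f term by term.
  obtain ⟨c, hc⟩ : ∃ c : Idx → ℂ, ∀ k, c k = (normConst L : ℂ) ^ 2 *
    ∫ α', expI (-(inner ℝ α' (lat L k))) * g α' := ⟨_, fun _ => rfl⟩
  have hP : ∀ α, HasSum (fun k => c k * expI (inner ℝ α (lat L k)))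
      (∑' l, g (α + lat (dualMat L) l)) := fun α => by
    refine (hasSum_poisson hL g α).congr_fun fun k => ?_
    rw [hc]
    ring
  have hcs : Summable fun k => ‖c k‖ := by
    refine (hP 0).summable.norm.congr fun k => ?_
    rw [norm_mul, norm_expI, mul_one]
  have hint : ∀ k, Integrable (fun α => c k • expI (inner ℝ α (lat L k)) • f α)
      (cellMeasure (dualMat L)) := fun k => (integrable_expI_smul hf _).smul (c k)
  have hs := hasSum_integral_of_summable_integral_norm hint (by
    simp only [norm_smul, norm_expI, one_mul, integral_const_mul]
    exact hcs.mul_right _)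
  have e1 : ∀ k, ∫ α, c k • expI (inner ℝ α (lat L k)) • f α ∂(cellMeasure (dualMat L)) = 0 :=
    fun k => by rw [integral_smul, h k, smul_zero]
  simp only [e1] at hs
  rw [hasSum_zero.unique hs]
  refine integral_congr_ae ?_
  filter_upwards [ae_restrict_mem (measurableSet_cell hA)] with α hα
  have := (hP α).smul_const (f α)
  simp only [← smul_smul] at this
  rw [this.tsum_eq, tsum_lat_eq_self hA hg hα]

/-- Completeness of the characters for vector-valued functions: f is annihilated by all test
functions supported in the interior of the dual cell and hence vanishes there. -/
theorem ae_eq_zero_of_coeff [CompleteSpace E] (hL : L.det ≠ 0) {f : Plane → E}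
    (hf : Integrable f (cellMeasure (dualMat L)))
    (h : ∀ k, ∫ α, expI (inner ℝ α (lat L k)) • f α ∂(cellMeasure (dualMat L)) = 0) :
    f =ᵐ[cellMeasure (dualMat L)] 0 := by
  have h0 := isOpen_interior.ae_eq_zero_of_integral_contDiff_smul_eq_zero
    (U := interior (cell (dualMat L))) (f := f) (μ := cellMeasure (dualMat L))
    (hf.locallyIntegrable.locallyIntegrableOn _) (fun g hg hc hsupp => by
      obtain ⟨G, -, hG⟩ := exists_schwartz_of_hasCompactSupport
        (f := fun x => (g x : ℂ)) (Complex.ofRealCLM.contDiff.comp hg)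
        (hc.comp_left (g := Complex.ofReal) Complex.ofReal_zero)
      have := integral_smul_eq_zero_of_coeff hL hf h G (fun x hx => by
        refine interior_subset (hsupp (subset_tsupport g ?_))
        intro h0
        exact hx (by rw [hG, h0, Complex.ofReal_zero]))
      simpa only [hG, Complex.coe_smul] using this)
  filter_upwards [h0, ae_mem_interior_cell (det_dualMat_ne_zero hL)] with x hx hm
  exact hx hm

end Coefficients

theorem integrable_coe_Lp {H : Type*} [NormedAddCommGroup H]
    (ψ : Lp H 2 (cellMeasure (dualMat L))) : Integrable ψ (cellMeasure (dualMat L)) :=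
  (Lp.memLp ψ).integrable (by norm_num)

section Waves

variable {H : Type*} [NormedAddCommGroup H] [InnerProductSpace ℂ H]

theorem memLp_wave (L : Matrix (Fin 2) (Fin 2) ℝ) (j : Idx) (h : H) :
    MemLp (fun α => ((normConst L : ℂ) * expI (-(inner ℝ α (lat L j)))) • h) 2
      (cellMeasure (dualMat L)) := by
  refine MemLp.of_bound (Continuous.aestronglyMeasurable ?_) (|normConst L| * ‖h‖)
    (Filter.Eventually.of_forall fun α => ?_)
  · exact (continuous_const.mul (continuous_expI.comp
      (continuous_id.inner continuous_const).neg)).smul continuous_const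
  · rw [norm_smul, norm_mul, norm_expI, mul_one, Complex.norm_real, Real.norm_eq_abs]

/-- The plane wave `|det Λ|^(1/2) / (2π) exp(-i α · Λ j) h` on the dual cell. -/
def wave (L : Matrix (Fin 2) (Fin 2) ℝ) (j : Idx) : H →ₗ[ℂ] Lp H 2 (cellMeasure (dualMat L)) where
  toFun h := (memLp_wave L j h).toLp _
  map_add' x y := by
    rw [← MemLp.toLp_add]
    congr 1
    funext α
    exact smul_add _ _ _
  map_smul' c x := by
    rw [RingHom.id_apply, ← MemLp.toLp_const_smul]
    congr 1
    funext α
    exact smul_comm _ _ _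

theorem coeFn_wave (L : Matrix (Fin 2) (Fin 2) ℝ) (j : Idx) (h : H) :
    wave L j h =ᵐ[cellMeasure (dualMat L)]
      fun α => ((normConst L : ℂ) * expI (-(inner ℝ α (lat L j)))) • h :=
  (memLp_wave L j h).coeFn_toLp

/-- The Fourier coefficients on the dual cell. -/
def waveCoeff (L : Matrix (Fin 2) (Fin 2) ℝ) (j : Idx) (ψ : Lp H 2 (cellMeasure (dualMat L))) : H :=
  (normConst L : ℂ) • ∫ α, expI (inner ℝ α (lat L j)) • ψ α ∂(cellMeasure (dualMat L))

theorem waveCoeff_wave [CompleteSpace H] (hL : L.det ≠ 0) (i j : Idx) (h : H) :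
    waveCoeff L i (wave L j h) = if i = j then h else 0 := by
  have h1 : ∫ α, expI (inner ℝ α (lat L i)) • wave L j h α ∂(cellMeasure (dualMat L)) =
      ∫ α, expI (inner ℝ α (lat L (i - j))) • (normConst L : ℂ) • h ∂(cellMeasure (dualMat L)) := by
    refine integral_congr_ae ?_
    filter_upwards [coeFn_wave L j h] with α hα
    rw [hα, smul_smul, smul_smul, lat_sub, inner_sub_right, sub_eq_add_neg, expI_add]
    congr 1
    ring
  rw [waveCoeff, h1, integral_smul_const, integral_expI_cell hL]
  simp only [sub_eq_zero]
  split_ifs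
  · have := normConst_sq_mul_volume hL
    rw [smul_smul, smul_smul]
    convert one_smul ℂ h using 2
    rw [← Complex.ofReal_one, ← this]
    push_cast
    ring
  · simp

/-- Fourier series on the dual cell with values in H. The coefficient map is the adjoint of the
plane wave, the orthogonality relations make the waves orthonormal, and completeness is
`ae_eq_zero_of_coeff`. -/
theorem isSummandFamily_wave [CompleteSpace H] (hL : L.det ≠ 0) :
    IsSummandFamily (wave L) (waveCoeff (H := H) L) where
  inner_eq j h ψ := by
    have hi : Integrable (fun α => (normConst L : ℂ) • expI (inner ℝ α (lat L j)) • ψ α)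
        (cellMeasure (dualMat L)) := (integrable_expI_smul (integrable_coe_Lp ψ) _).smul _
    rw [L2.inner_def, waveCoeff, ← integral_smul, ← integral_inner hi]
    refine integral_congr_ae ?_
    filter_upwards [coeFn_wave L j h] with α hα
    rw [hα, inner_smul_left, inner_smul_right, inner_smul_right, map_mul, Complex.conj_ofReal,
      expI_neg, Complex.conj_conj, mul_assoc]
  proj_apply := waveCoeff_wave hL
  eq_zero ψ hψ := by
    refine (Lp.eq_zero_iff_ae_eq_zero).2 (ae_eq_zero_of_coeff hL (integrable_coe_Lp ψ) fun k => ?_)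
    exact (smul_eq_zero.1 (hψ k)).resolve_left
      (Complex.ofReal_ne_zero.2 (normConst_pos hL).ne')

end Waves

theorem coeFn_finset_sum_smul {μ : Measure Plane} (s : Finset Idx) (c : Idx → ℂ)
    (f : Idx → Lp ℂ 2 μ) :
    ((∑ j ∈ s, c j • f j : Lp ℂ 2 μ) : Plane → ℂ) =ᵐ[μ] fun x => ∑ j ∈ s, c j * f j x := by
  classical
  induction s using Finset.induction_on with
  | empty =>
    filter_upwards [Lp.coeFn_zero ℂ 2 μ] with x hx
    simpa only [Finset.sum_empty, Pi.zero_apply] using hx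
  | insert a s ha ih =>
    filter_upwards [ih, Lp.coeFn_add (c a • f a) (∑ j ∈ s, c j • f j),
      Lp.coeFn_smul (c a) (f a)] with x h1 h2 h3
    rw [Finset.sum_insert ha, Finset.sum_insert ha, h2, Pi.add_apply, h1, h3]
    rfl

theorem coeFn_finset_sum_Lp {H : Type*} [NormedAddCommGroup H] {μ : Measure Plane}
    (s : Finset Idx) (f : Idx → Lp H 2 μ) :
    ((∑ j ∈ s, f j : Lp H 2 μ) : Plane → H) =ᵐ[μ] fun x => ∑ j ∈ s, f j x := by
  classical
  induction s using Finset.induction_on with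
  | empty =>
    filter_upwards [Lp.coeFn_zero H 2 μ] with x hx
    simpa only [Finset.sum_empty, Pi.zero_apply] using hx
  | insert a s ha ih =>
    filter_upwards [ih, Lp.coeFn_add (f a) (∑ j ∈ s, f j)] with x h1 h2
    rw [Finset.sum_insert ha, Finset.sum_insert ha, h2, Pi.add_apply, h1]

/-- A compactly supported function is the finite sum of its restrictions to the cells. -/
theorem toLp_eq_sum_cellExt (hL : L.det ≠ 0) (φ : SchwartzMap Plane ℂ) {s : Finset Idx}
    (hs : ∀ x ∈ cell L, ∀ j ∉ s, φ (x + lat L j) = 0) :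
    φ.toLp 2 volume = ∑ j ∈ s, cellExt hL j (cellRestr hL j (φ.toLp 2 volume)) := by
  refine eq_of_cellRestr_eq hL fun k => ?_
  have e : ∀ j h, cellRestr hL k (cellExt hL j h) = if k = j then h else 0 :=
    (isSummandFamily_cellExt hL).proj_apply k
  rw [map_sum]
  simp only [e, Finset.sum_ite_eq]
  split_ifs with hk
  · rfl
  · refine Lp.ext ?_
    filter_upwards [coeFn_cellRestr hL k (φ.toLp 2 volume), Lp.coeFn_zero ℂ 2 (cellMeasure L),
      ae_cell_of_ae hL (φ.coeFn_toLp 2 volume) k, ae_restrict_mem (measurableSet_cell hL)]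
      with x h1 h2 h3 hx
    rw [h1, h2, h3, hs x hx k hk, Pi.zero_apply]

theorem ae_sum_wave_eq_bloch (hL : L.det ≠ 0) (φ : SchwartzMap Plane ℂ) {s : Finset Idx}
    (hs : ∀ x ∈ cell L, ∀ j ∉ s, φ (x + lat L j) = 0) :
    ∀ᵐ α ∂(cellMeasure (dualMat L)), ∀ᵐ x ∂(cellMeasure L),
      ((∑ j ∈ s, wave L j (cellRestr hL j (φ.toLp 2 volume)) :
        Lp (Lp ℂ 2 (cellMeasure L)) 2 (cellMeasure (dualMat L))) α) x = bloch L φ α x := by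
  have h1 : ∀ᵐ α ∂(cellMeasure (dualMat L)), ∀ j,
      wave L j (cellRestr hL j (φ.toLp 2 volume)) α =
        ((normConst L : ℂ) * expI (-(inner ℝ α (lat L j)))) • cellRestr hL j (φ.toLp 2 volume) :=
    ae_all_iff.2 fun j => coeFn_wave L j _
  have h2 : ∀ᵐ x ∂(cellMeasure L), ∀ j,
      cellRestr hL j (φ.toLp 2 volume) x = φ (x + lat L j) := by
    refine ae_all_iff.2 fun j => ?_
    filter_upwards [coeFn_cellRestr hL j (φ.toLp 2 volume),
      ae_cell_of_ae hL (φ.coeFn_toLp 2 volume) j] with x hx1 hx2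
    rw [hx1, hx2]
  filter_upwards [h1, coeFn_finset_sum_Lp s fun j => wave L j (cellRestr hL j (φ.toLp 2 volume))]
    with α hα hα'
  rw [hα']
  simp only [hα]
  filter_upwards [coeFn_finset_sum_smul s
    (fun j => (normConst L : ℂ) * expI (-(inner ℝ α (lat L j))))
    (fun j => cellRestr hL j (φ.toLp 2 volume)), h2, ae_restrict_mem (measurableSet_cell hL)]
    with x hx1 hx2 hx
  rw [hx1, bloch, tsum_eq_sum (s := s) fun j hj => by rw [hs x hx j hj, zero_mul], Finset.mul_sum]
  refine Finset.sum_congr rfl fun j _ => ?_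
  rw [hx2]
  ring

/-- The Bloch transform is an isometric isomorphism of the `L²` spaces. -/
theorem exists_l2_iso (hL : L.det ≠ 0) :
    ∃ T : Lp ℂ 2 (volume : Measure Plane) ≃ₗᵢ[ℂ]
        Lp (Lp ℂ 2 (cellMeasure L)) 2 (cellMeasure (dualMat L)),
      (∀ φ : SchwartzMap Plane ℂ, HasCompactSupport φ →
        ∀ᵐ α ∂(cellMeasure (dualMat L)), ∀ᵐ x ∂(cellMeasure L),
          (T (φ.toLp 2 volume) α) x = bloch L φ α x) ∧
      (∀ (ψ : Lp (Lp ℂ 2 (cellMeasure L)) 2 (cellMeasure (dualMat L))) (j : Idx),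
        Integrable (fun α => expI (inner ℝ α (lat L j)) • ψ α) (cellMeasure (dualMat L)) ∧
        ∀ᵐ x ∂(cellMeasure L),
          (T.symm ψ) (x + lat L j) = (normConst L : ℂ) *
            (∫ α, expI (inner ℝ α (lat L j)) • ψ α ∂(cellMeasure (dualMat L))) x) := by
  obtain ⟨T, hT, hT'⟩ :=
    (isSummandFamily_cellExt hL).exists_linearIsometryEquiv (isSummandFamily_wave hL)
  refine ⟨T, fun φ hφ => ?_, fun ψ j => ⟨integrable_expI_smul (integrable_coe_Lp ψ) _, ?_⟩⟩
  · obtain ⟨R, -, hR⟩ := exists_cell_bound L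
    obtain ⟨s, hs⟩ := exists_finset_lat hL hφ R
    have hs' : ∀ x ∈ cell L, ∀ j ∉ s, φ (x + lat L j) = 0 := fun x hx => hs x (hR x hx)
    -- A compactly supported φ meets only finitely many cells, so its image is a finite sum of
    -- waves, which is the Bloch series.
    have e : T (φ.toLp 2 volume) = ∑ j ∈ s, wave L j (cellRestr hL j (φ.toLp 2 volume)) := by
      conv_lhs => rw [toLp_eq_sum_cellExt hL φ hs', map_sum]
      exact Finset.sum_congr rfl fun j _ => hT j _
    rw [e]
    exact ae_sum_wave_eq_bloch hL φ hs'
  · have h1 := coeFn_cellRestr hL j (T.symm ψ)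
    -- The restriction of the preimage to the j-th cell is the j-th Fourier coefficient of ψ, an
    -- integral with values in L²(W); this is formula (1).
    rw [hT' j ψ, waveCoeff] at h1
    filter_upwards [h1, Lp.coeFn_smul (normConst L : ℂ)
      (∫ α, expI (inner ℝ α (lat L j)) • ψ α ∂(cellMeasure (dualMat L)))] with x hx1 hx2
    exact hx1.symm.trans hx2

end BlochIsometry

end Bloch

end

theorem mainTheorem2 (L : Matrix (Fin 2) (Fin 2) ℝ) (hL : L.det ≠ 0) :
    -- part (a)
    (∃ T : Lp ℂ 2 (volume : Measure Bloch.Plane) ≃ₗᵢ[ℂ]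
        Lp (Lp ℂ 2 (Bloch.cellMeasure L)) 2 (Bloch.cellMeasure (Bloch.dualMat L)),
      (∀ φ : SchwartzMap Bloch.Plane ℂ, HasCompactSupport φ →
        ∀ᵐ α ∂(Bloch.cellMeasure (Bloch.dualMat L)), ∀ᵐ x ∂(Bloch.cellMeasure L),
          (T (φ.toLp 2 volume) α) x = Bloch.bloch L φ α x) ∧
      (∀ (ψ : Lp (Lp ℂ 2 (Bloch.cellMeasure L)) 2 (Bloch.cellMeasure (Bloch.dualMat L)))
          (j : Bloch.Idx),
        Integrable (fun α => Bloch.expI (inner ℝ α (Bloch.lat L j)) • ψ α)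
          (Bloch.cellMeasure (Bloch.dualMat L)) ∧
        ∀ᵐ x ∂(Bloch.cellMeasure L),
          (T.symm ψ) (x + Bloch.lat L j) = (Bloch.normConst L : ℂ) *
            (∫ α, Bloch.expI (inner ℝ α (Bloch.lat L j)) • ψ α
              ∂(Bloch.cellMeasure (Bloch.dualMat L))) x)) ∧
    -- part (b)
    (∀ s r : ℝ, ∃ T : Bloch.besselSpace s r ≃ₗ[ℂ] Bloch.qpSpace L r s,
      -- `T` extends the Bloch transform
      (∀ φ : SchwartzMap Bloch.Plane ℂ, HasCompactSupport φ →
        ∃ h : SchwartzMap.toTemperedDistributionCLM Bloch.Plane ℂ volume φ ∈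
            Bloch.besselSpace s r,
          Bloch.IsRepr (T ⟨_, h⟩ : TemperedDistribution (Bloch.Plane × Bloch.Plane) ℂ)
            (fun p => Bloch.bloch L φ p.1 p.2)) ∧
      -- `T` and its inverse are bounded
      (∃ C : ℝ≥0, ∀ f : Bloch.besselSpace s r,
        Bloch.qpNorm L r s (T f) ≤ C * Bloch.besselNorm s r f ∧
        Bloch.besselNorm s r f ≤ C * Bloch.qpNorm L r s (T f)) ∧
      -- the inverse is given by the inversion formula on smooth functions ...
      (∀ (ψ : Bloch.qpSpace L r s) (χ : Bloch.Plane × Bloch.Plane → ℂ), Bloch.IsSmoothQP L χ →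
        Bloch.IsRepr (ψ : TemperedDistribution (Bloch.Plane × Bloch.Plane) ℂ) χ →
        ∃ f : Bloch.Plane → ℂ,
          Bloch.IsRepr (T.symm ψ : TemperedDistribution Bloch.Plane ℂ) f ∧
          ∀ x ∈ Bloch.cell L, ∀ j : Bloch.Idx,
            f (x + Bloch.lat L j) = (Bloch.normConst L : ℂ) *
              ∫ α, χ (α, x) * Bloch.expI (inner ℝ α (Bloch.lat L j))
                ∂(Bloch.cellMeasure (Bloch.dualMat L))) ∧
      -- ... and in the general case as a limit in norm of these
      (∀ (ψ : Bloch.qpSpace L r s) (ε : ℝ≥0∞), 0 < ε →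
        ∃ (ψ' : Bloch.qpSpace L r s) (χ : Bloch.Plane × Bloch.Plane → ℂ), Bloch.IsSmoothQP L χ ∧
          Bloch.IsRepr (ψ' : TemperedDistribution (Bloch.Plane × Bloch.Plane) ℂ) χ ∧
          Bloch.qpNorm L r s (ψ - ψ' : Bloch.qpSpace L r s) < ε ∧
          Bloch.besselNorm s r (T.symm ψ - T.symm ψ' : Bloch.besselSpace s r) < ε)) :=
  ⟨Bloch.exists_l2_iso hL, fun s r => Bloch.exists_bessel_iso hL s r⟩
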